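/- **Model Riemann–Hilbert problem.** Fix real parameters $\alpha>-1$ and $\gamma\in[-1,1]$, and call $(\rho,\sigma,\tau)\in\mathbb R^3$ admissible if either $\rho<0$, or $\rho=0$ and $\sigma>0$. Let $\omega=e^{2\pi i/3}$, let all powers be principal, and let $\Gamma$ be the union of $\{0\}$ and the six rays $\arg\xi\in\{0,\pi,\pm\frac\pi4,\pm\frac{3\pi}4\}$, oriented outward from $0$ (the $+$ side of a ray is its counterclockwise side). For every admissible $(\rho,\sigma,\tau)$ let $\Phi=\Phi^{(\gamma,\alpha,\rho,\sigma,\tau)}$ be a $3\times3$ matrix function that is analytic on $\mathbb C\setminus\Gamma$, has continuous boundary values on $\Gamma\setminus\{0\}$, and satisfies: 1. $\Phi_+=\Phi_-J$ on $\Gamma\setminus\{0\}$, where $J=I\pm e^{\mp\frac{2\alpha}3\pi i}E_{12}$ for $\arg\xi=\pm\frac\pi4$, $J=I\mp\gamma e^{\mp\frac\alpha3\pi i}E_{32}$ for $\arg\xi=\pm\frac{3\pi}4$ ($E_{jk}$ being the matrix units), $J$ is the permutation matrix exchanging $1,2$ on $\mathbb R_+$, and the one exchanging $2,3$ on $\mathbb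 R_-$. 2. $\Phi(\xi)=(I+\mathcal O(\xi^{-1}))\Upsilon(\xi)\Omega_\pm e^{-\Theta(\xi)}$ as $\xi\to\infty$ in $\mathbb C_\pm\setminus\Gamma$, where $\Upsilon=\operatorname{diag}(1,\omega\xi^{1/3},\omega^2\xi^{2/3})$, $$\Omega_+=\begin{pmatrix}1&1&1\\1&\omega&\omega^2\\1&\omega^2&\omega\end{pmatrix},\qquad \Omega_-=\begin{pmatrix}1&1&1\\\omega&1&\omega^2\\\omega^2&1&\omega\end{pmatrix},$$ and, with $\theta_a=\rho a\xi^{4/3}+\sigma a^2\xi^{2/3}+\tau a\xi^{1/3}$, $\Theta=\operatorname{diag}(\theta_\omega,\theta_{\omega^2},\theta_1)$ in $\mathbb C_+$ and $\Theta=\operatorname{diag}(\theta_{\omega^2},\theta_\omega,\theta_1)$ in $\mathbb C_-$. 3. There is a matrix function $N$, analytic in a neighbourhood of $0$, such that $\Phi(\xi)=N(\xi)\operatorname{diag}(\xi^{\frac12-\frac\alpha3},\xi^{\frac12+\frac\alpha6},\xi^{\frac\alpha6})E$ for $\xi$ near $0$ in the sector $\frac\pi4<\arg\xi<\frac{3\pi}4$,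 where $$E=\begin{pmatrix}1&0&0\\ \frac{e^{\frac{2\alpha}3\pi i}}{1-e^{\alpha\pi i}}(1-\gamma)&1-\gamma&-e^{\frac\alpha3\pi i}\\ \frac{e^{\frac{2\alpha}3\pi i}}{1+e^{\alpha\pi i}}(1+\gamma)&1+\gamma&e^{\frac\alpha3\pi i}\end{pmatrix},$$ except that the $(3,1)$ entry is $-\frac{1}{2\pi i}e^{\frac{2\alpha}3\pi i}(1+\gamma)\log\xi$ if $\alpha$ is an odd integer, and the $(2,1)$ entry is $-\frac1{2\pi i}e^{\frac{2\alpha}3\pi i}(1-\gamma)\log\xi$ if $\alpha$ is an even integer. **Theorem.** Then $$\Phi(\xi)=\Bigl(I+\frac M\xi+\mathcal O(\xi^{-2})\Bigr)\Upsilon(\xi)\Omega_\pm e^{-\Theta(\xi)},\qquad \xi\to\infty,\quad M=(m_{jk}(\rho,\sigma,\tau))_{j,k=1}^3,$$ with $m_{jk}$ of class $C^\infty$ on the set of admissible parameters. Throughout, $\partial_\rho$ is one-sided at $\rho=0$. Put $\hat\Phi=P\Phi$ and $$P=\begin{pmatrix}1&0&0\\m_{13}&1&0\\2m_{13}^2+2m_{23}-m_{12}&m_{13}&1\end{pmatrix},$$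 $$u=-3(m_{13}^2+m_{23}-m_{12}),\qquad v=3(m_{13}^3-m_{12}m_{13}+2m_{13}m_{23}-m_{22}+m_{33}).$$ (a) *Lax system.* For all admissible parameters and $\xi\in\mathbb C\setminus\Gamma$, $$-\xi\hat\Phi_\xi=\hat L\hat\Phi,\quad-\hat\Phi_\tau=\hat A\hat\Phi,\quad-\hat\Phi_\sigma=\hat B\hat\Phi,\quad-\hat\Phi_\rho=\hat C\hat\Phi,\qquad \hat L=-\tfrac13\operatorname{diag}(0,1,2)+\tfrac\tau3\hat A+\tfrac{2\sigma}3\hat B+\tfrac{4\rho}3\hat C,$$ $$\hat A=\begin{pmatrix}0&1&0\\0&0&1\\\xi+v&-u&0\end{pmatrix},\qquad \hat B=\begin{pmatrix}\frac23u&0&1\\\xi+v-\frac23u_\tau&-\frac13u&0\\-v_\tau+\frac23u_{\tau\tau}&\xi+v-\frac13u_\tau&-\frac13u\end{pmatrix},$$ $$\hat C=\xi^2\begin{pmatrix}0&0&0\\0&0&0\\1&0&0\end{pmatrix}+\xi\begin{pmatrix}0&1&0\\\frac13u&0&1\\-\frac13u_\tau+\frac23v&-\frac23u&0\end{pmatrix}+\begin{pmatrix}c_{11}&-\frac13(v-u_\tau)&\frac13u\\c_{21}&c_{22}&-\frac13v\\c_{31}&c_{32}&c_{33}\end{pmatrix},$$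 where $$\begin{aligned}9c_{11}&=2u_{\tau\tau}-3v_\tau+2u^2,\quad 9c_{22}=-u_{\tau\tau}-u^2,\quad 9c_{33}=-u_{\tau\tau}+3v_\tau-u^2,\\ 9c_{21}&=-2u_{\tau\tau\tau}+3v_{\tau\tau}-2(u^2)_\tau+3uv,\\ 9c_{31}&=2u_{\tau\tau\tau\tau}-3v_{\tau\tau\tau}+2(u^2)_{\tau\tau}-3(uv)_\tau-3v^2,\\ 9c_{32}&=-u_{\tau\tau\tau}-(u^2)_\tau+3v_{\tau\tau}+6uv.\end{aligned}$$ (b) *Boussinesq hierarchy.* For all admissible parameters $u,v$ satisfy the first flow $$u_\sigma=u_{\tau\tau}-2v_\tau,\qquad v_\sigma=-v_{\tau\tau}+\tfrac23u_{\tau\tau\tau}+\tfrac23uu_\tau,\tag{1}$$ hence the Boussinesq equation $u_{\sigma\sigma}=-\frac13u_{\tau\tau\tau\tau}-\frac43(uu_\tau)_\tau$, the second flow $$\begin{aligned}u_\rho&=\tfrac13\bigl(u_{\tau\tau\tau\tau}-2v_{\tau\tau\tau}+(u^2)_{\tau\tau}-4(uv)_\tau\bigr),\\ v_\rho&=\tfrac19\bigl(2u_{\tau\tau\tau\tau\tau}-3v_{\tau\tau\tau\tau}+2(u^2)_{\tau\tau\tau}+2uu_{\tau\tau\tau}-6(uv_\tau)_\tau-6(v^2)_\tau+4u^2u_\tau\bigr),\end{aligned}\tag{2}$$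 and the self-similar reduction $$\begin{aligned}&\tfrac43\rho\bigl(-u_{\tau\tau\tau\tau}+2v_{\tau\tau\tau}-(u^2)_{\tau\tau}+4(uv)_\tau\bigr)+2\sigma(2v_\tau-u_{\tau\tau})-\tau u_\tau-2u=0,\\ &\tfrac49\rho\bigl(-2u_{\tau\tau\tau\tau\tau}+3v_{\tau\tau\tau\tau}-2(u^2)_{\tau\tau\tau}-2uu_{\tau\tau\tau}+6(uv_\tau)_\tau+6(v^2)_\tau-4u^2u_\tau\bigr)\\&\qquad+2\sigma\bigl(v_{\tau\tau}-\tfrac23u_{\tau\tau\tau}-\tfrac13(u^2)_\tau\bigr)-\tau v_\tau-3v=0.\end{aligned}\tag{3}$$ These equations express the compatibility of the Lax system: for arbitrary complex-valued $C^\infty$ functions $u,v$ on the set of admissible parameters, at every admissible point, $\hat A_\sigma-\hat B_\tau=[\hat A,\hat B]$ for all $\xi$ if and only if (1) holds, $\hat A_\rho-\hat C_\tau=[\hat A,\hat C]$ for all $\xi$ if and only if (2) holds, and $\hat L_\tau-\xi\hat A_\xi=[\hat L,\hat A]$ for all $\xi$ if and only if (3) holds; and if (1) holds at every admissible point, then so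 does the Boussinesq equation. (c) *The case $\rho=0$.* For $\sigma>0$, $u(0,\sigma,\cdot)$ satisfies $$4\sigma^2\bigl(-u_{\tau\tau\tau\tau}-2(u^2)_{\tau\tau}\bigr)-3\tau^2u_{\tau\tau}-21\tau u_\tau-24u=0.\tag{4}$$ More generally, for $\rho=0$, $\sigma>0$ and a $C^\infty$ function $u:\mathbb R\to\mathbb C$, there is a $C^\infty$ function $v:\mathbb R\to\mathbb C$ such that (3) holds on $\mathbb R$ if and only if (4) holds on $\mathbb R$. (d) *Chazy equations.* Let $f(\tau)=m_{13}(0,\frac32,\tau)$. Then $y(\tau)=f(\tau)+\frac{\tau^3}{108}$ and $\tilde y(\tau)=\sqrt2f(\sqrt2\tau)+\frac4{27}\tau^3$ satisfy, for all $\tau\in\mathbb R$, $$y_{\tau\tau\tau}+6y_\tau^2+\tau y-\tfrac1{72}\tau^4+\tfrac16(\alpha-\alpha^2)=0,$$ $$\tilde y_{\tau\tau}^2+4\tilde y_\tau^3-4(\tau\tilde y_\tau-\tilde y)^2-\tfrac43(\alpha^2-\alpha+1)\tilde y_\tau+\tfrac4{27}(\alpha+1)(2\alpha-1)(\alpha-2)=0.\tag{5}$$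 (e) *Painlevé IV.* Equation (5) is equivalent to the Painlevé IV equation $$w''=\frac{w'^2}{2w}+\frac32w^3+4\tau w^2+2(\tau^2-A)w+\frac Bw,\qquad A=\frac{1-\alpha}2,\quad B=-\frac{(1-\alpha)^2}2,\tag{6}$$ through $$w=\frac{\tilde y''-2\tau\tilde y'+2\tilde y}{2(\tilde y'-\frac{\alpha+1}3)},\qquad \tilde y=\frac{1-2\alpha}3\tau-\frac\alpha2w+\frac{w'^2-(w^2+2\tau w+1-\alpha)^2}{8w},$$ in the following sense. Let $S\subseteq\mathbb R$ be open. If $\tilde y$ is a complex-valued $C^3$ solution of (5) on $S$ such that $\tilde y''\ne0$, $\tilde y'\neq\frac{\alpha+1}3$ and $w\ne0$ on $S$ ($w$ being defined by the first formula), then $w$ is a $C^2$ solution of (6) on $S$ and the second formula returns $\tilde y$. Conversely, if $w$ is a nowhere vanishing complex-valued $C^2$ solution of (6) on $S$, then the second formula defines a $C^3$ solution $\tilde y$ of (5) on $S$, and the first formula returns $w$ wherever $\tilde y'\ne\frac{\alpha+1}3$. -/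

import Mathlib

open Filter Topology Asymptotics
open scoped ContDiff

noncomputable section

namespace BoussinesqRHP

/-! ## The model Riemann-Hilbert problem -/

abbrev Mat3 := Matrix (Fin 3) (Fin 3) ℂ

/-- `e^{iθ}` for a real angle `θ`. -/
def expI (θ : ℝ) : ℂ := Complex.exp (θ * Complex.I)

/-- The primitive cube root of unity `e^{2πi/3}`. -/
def omega : ℂ := expI (2 * Real.pi / 3)

/-- The six rays `arg ξ ∈ {0, π, ±π/4, ±3π/4}` together with the origin (`Complex.arg 0 = 0`). -/
def contour : Set ℂ :=
  {ξ | ξ.arg = 0 ∨ ξ.arg = Real.pi ∨ ξ.arg = Real.pi / 4 ∨ ξ.arg = -(Real.pi / 4) ∨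
    ξ.arg = 3 * Real.pi / 4 ∨ ξ.arg = -(3 * Real.pi / 4)}

/-- The open sector `a < arg ξ < b`, with `arg ξ ∈ (-π, π]`. -/
def sector (a b : ℝ) : Set ℂ := {ξ | a < ξ.arg ∧ ξ.arg < b}

/-- Along the open ray `arg ξ = θ`, the function `Φ` has continuous boundary values from the
sectors `Sm` and `Sp`, and they satisfy `Φ₊ = Φ₋ J`. A ray is oriented outward, so its `+` side is
its counterclockwise side. -/
def HasJump (Φ : ℂ → Mat3) (θ : ℝ) (Sm Sp : Set ℂ) (J : Mat3) : Prop :=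
  ∀ r : ℝ, 0 < r → ∃ Fm Fp : Mat3,
    Tendsto Φ (𝓝[Sm] ((r : ℂ) * expI θ)) (𝓝 Fm) ∧
    Tendsto Φ (𝓝[Sp] ((r : ℂ) * expI θ)) (𝓝 Fp) ∧ Fp = Fm * J

/-- The scalar `ρ a ξ^{4/3} + σ a² ξ^{2/3} + τ a ξ^{1/3}` (principal powers). -/
def phase (a : ℂ) (ρ σ τ : ℝ) (ξ : ℂ) : ℂ :=
  ρ * a * ξ ^ (4 / 3 : ℂ) + σ * a ^ 2 * ξ ^ (2 / 3 : ℂ) + τ * a * ξ ^ (1 / 3 : ℂ)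

/-- The diagonal of `Θ(ξ)`. In the upper half-plane the three entries use `a = ω, ω², 1`
(so that `a² = ω², ω, 1`), in the lower one `a = ω², ω, 1`. -/
def Theta (ρ σ τ : ℝ) (ξ : ℂ) : Fin 3 → ℂ :=
  if 0 < ξ.im then
    ![phase omega ρ σ τ ξ, phase (omega ^ 2) ρ σ τ ξ, phase 1 ρ σ τ ξ]
  else
    ![phase (omega ^ 2) ρ σ τ ξ, phase omega ρ σ τ ξ, phase 1 ρ σ τ ξ]

def Upsilon (ξ : ℂ) : Mat3 :=
  Matrix.diagonal ![1, omega * ξ ^ (1 / 3 : ℂ), omega ^ 2 * ξ ^ (2 / 3 : ℂ)]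

def OmegaPlus : Mat3 :=
  !![1, 1, 1;
     1, omega, omega ^ 2;
     1, omega ^ 2, omega]

def OmegaMinus : Mat3 :=
  !![1, 1, 1;
     omega, 1, omega ^ 2;
     omega ^ 2, 1, omega]

/-- The leading behaviour `Υ(ξ) Ω_± e^{-Θ(ξ)}` at infinity. -/
def modelAtInfinity (ρ σ τ : ℝ) (ξ : ℂ) : Mat3 :=
  Upsilon ξ * (if 0 < ξ.im then OmegaPlus else OmegaMinus) *
    Matrix.diagonal (fun j => Complex.exp (-Theta ρ σ τ ξ j))

open Classical in
/-- The matrix `E` in the sector `π/4 < arg ξ < 3π/4`: it is constant unless `α` is an integer, in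
which case one entry is a multiple of `log ξ`. -/
def connectionMatrix (γ α : ℝ) (ξ : ℂ) : Mat3 :=
  if ∃ k : ℤ, α = 2 * k + 1 then
    !![1, 0, 0;
       expI (2 * α / 3 * Real.pi) / (1 - expI (α * Real.pi)) * (1 - γ), 1 - γ,
         -expI (α / 3 * Real.pi);
       -(expI (2 * α / 3 * Real.pi) / (2 * Real.pi * Complex.I)) * (1 + γ) * Complex.log ξ, 1 + γ,
         expI (α / 3 * Real.pi)]
  else if ∃ k : ℤ, α = 2 * k then
    !![1, 0, 0;
       -(expI (2 * α / 3 * Real.pi) / (2 * Real.pi * Complex.I)) * (1 - γ) * Complex.log ξ, 1 - γ,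
         -expI (α / 3 * Real.pi);
       expI (2 * α / 3 * Real.pi) / (1 + expI (α * Real.pi)) * (1 + γ), 1 + γ,
         expI (α / 3 * Real.pi)]
  else
    !![1, 0, 0;
       expI (2 * α / 3 * Real.pi) / (1 - expI (α * Real.pi)) * (1 - γ), 1 - γ,
         -expI (α / 3 * Real.pi);
       expI (2 * α / 3 * Real.pi) / (1 + expI (α * Real.pi)) * (1 + γ), 1 + γ,
         expI (α / 3 * Real.pi)]

/-- `diag(ξ^{1/2 - α/3}, ξ^{1/2 + α/6}, ξ^{α/6})` (principal powers). -/
def originPowers (α : ℝ) (ξ : ℂ) : Mat3 :=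
  Matrix.diagonal ![ξ ^ ((1 / 2 - α / 3 : ℝ) : ℂ), ξ ^ ((1 / 2 + α / 6 : ℝ) : ℂ),
    ξ ^ ((α / 6 : ℝ) : ℂ)]

/-- `Φ` solves the model Riemann-Hilbert problem with parameters `γ, α, ρ, σ, τ`. Only the values of
`Φ` off the contour matter. The behaviour at the origin is stated in the sector
`π/4 < arg ξ < 3π/4`; in the other sectors it is determined by the jump relations. -/
structure IsModelSolution (γ α ρ σ τ : ℝ) (Φ : ℂ → Mat3) : Prop where
  analytic : ∀ i j, DifferentiableOn ℂ (fun ξ => Φ ξ i j) contourᶜ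
  jump_pos : HasJump Φ 0 (sector (-(Real.pi / 4)) 0) (sector 0 (Real.pi / 4))
    !![0, 1, 0; 1, 0, 0; 0, 0, 1]
  jump_neg : HasJump Φ Real.pi (sector (3 * Real.pi / 4) Real.pi)
    (sector (-Real.pi) (-(3 * Real.pi / 4)))
    !![1, 0, 0; 0, 0, 1; 0, 1, 0]
  jump_quarter : HasJump Φ (Real.pi / 4) (sector 0 (Real.pi / 4))
    (sector (Real.pi / 4) (3 * Real.pi / 4))
    !![1, expI (-(2 * α / 3 * Real.pi)), 0; 0, 1, 0; 0, 0, 1]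
  jump_neg_quarter : HasJump Φ (-(Real.pi / 4)) (sector (-(3 * Real.pi / 4)) (-(Real.pi / 4)))
    (sector (-(Real.pi / 4)) 0)
    !![1, -expI (2 * α / 3 * Real.pi), 0; 0, 1, 0; 0, 0, 1]
  jump_three_quarter : HasJump Φ (3 * Real.pi / 4) (sector (Real.pi / 4) (3 * Real.pi / 4))
    (sector (3 * Real.pi / 4) Real.pi)
    !![1, 0, 0; 0, 1, 0; 0, -(γ * expI (-(α / 3 * Real.pi))), 1]
  jump_neg_three_quarter : HasJump Φ (-(3 * Real.pi / 4))
    (sector (-Real.pi) (-(3 * Real.pi / 4))) (sector (-(3 * Real.pi / 4)) (-(Real.pi / 4)))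
    !![1, 0, 0; 0, 1, 0; 0, γ * expI (α / 3 * Real.pi), 1]
  at_infinity : ∃ R : ℂ → Mat3,
    (∀ ξ ∈ contourᶜ, Φ ξ = (1 + R ξ) * modelAtInfinity ρ σ τ ξ) ∧
    ∀ i j, (fun ξ => R ξ i j) =O[Bornology.cobounded ℂ ⊓ 𝓟 contourᶜ] fun ξ => ξ⁻¹
  at_zero : ∃ N : ℂ → Mat3, (∀ i j, AnalyticAt ℂ (fun ξ => N ξ i j) 0) ∧
    ∀ᶠ ξ in 𝓝[sector (Real.pi / 4) (3 * Real.pi / 4)] 0,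
      Φ ξ = N ξ * originPowers α ξ * connectionMatrix γ α ξ

/-- The expansion `Φ(ξ) = (I + M/ξ + O(ξ⁻²)) Υ(ξ) Ω_± e^{-Θ(ξ)}` as `ξ → ∞`. -/
def HasExpansion (ρ σ τ : ℝ) (Φ : ℂ → Mat3) (M : Mat3) : Prop :=
  ∃ R : ℂ → Mat3,
    (∀ ξ ∈ contourᶜ, Φ ξ = (1 + ξ⁻¹ • M + R ξ) * modelAtInfinity ρ σ τ ξ) ∧
    ∀ i j, (fun ξ => R ξ i j) =O[Bornology.cobounded ℂ ⊓ 𝓟 contourᶜ] fun ξ => (ξ ^ 2)⁻¹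

/-! ## Parameters and parameter derivatives -/

/-- The admissible parameters: `ρ < 0`, or `ρ = 0` and `σ > 0` (and `τ` is any real number). -/
def Admissible (ρ σ : ℝ) : Prop := ρ < 0 ∨ (ρ = 0 ∧ 0 < σ)

/-- `F` is `C^∞` in `(ρ, σ, τ)` on the set of admissible parameters (one-sided in `ρ` at `ρ = 0`). -/
def SmoothOnParams (F : ℝ → ℝ → ℝ → ℂ) : Prop :=
  ContDiffOn ℝ ∞ (fun p : ℝ × ℝ × ℝ => F p.1 p.2.1 p.2.2) {p | Admissible p.1 p.2.1}

/-- The `k`-th derivative of a function of `τ`. -/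
abbrev D (k : ℕ) (f : ℝ → ℂ) (τ : ℝ) : ℂ := iteratedDeriv k f τ

def dSigma (F : ℝ → ℝ → ℝ → ℂ) (ρ σ τ : ℝ) : ℂ := deriv (fun s => F ρ s τ) σ

/-- The derivative in `ρ`, which is one-sided at `ρ = 0`. -/
def dRho (F : ℝ → ℝ → ℝ → ℂ) (ρ σ τ : ℝ) : ℂ := derivWithin (fun r => F r σ τ) (Set.Iic 0) ρ

/-! ## The gauge transformation and the functions `u`, `v`. The entry `m_{ij}` is `M (i-1) (j-1)`. -/

def gaugeMatrix (M : Mat3) : Mat3 :=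
  !![1, 0, 0;
     M 0 2, 1, 0;
     2 * M 0 2 ^ 2 + 2 * M 1 2 - M 0 1, M 0 2, 1]

def uOf (M : Mat3) : ℂ := -3 * (M 0 2 ^ 2 + M 1 2 - M 0 1)

def vOf (M : Mat3) : ℂ :=
  3 * (M 0 2 ^ 3 - M 0 1 * M 0 2 + 2 * M 0 2 * M 1 2 - M 1 1 + M 2 2)

/-! ## The Lax matrices. Here `U`, `V` are functions of `τ`, the parameters `ρ`, `σ` being fixed. -/

def Ahat (U V : ℝ → ℂ) (τ : ℝ) (ξ : ℂ) : Mat3 :=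
  !![0, 1, 0;
     0, 0, 1;
     ξ + V τ, -U τ, 0]

def Bhat (U V : ℝ → ℂ) (τ : ℝ) (ξ : ℂ) : Mat3 :=
  !![0, 0, 1;
     ξ, 0, 0;
     0, ξ, 0] +
  !![2 / 3 * U τ, 0, 0;
     V τ - 2 / 3 * D 1 U τ, -(1 / 3) * U τ, 0;
     -D 1 V τ + 2 / 3 * D 2 U τ, V τ - 1 / 3 * D 1 U τ, -(1 / 3) * U τ]

def c11 (U V : ℝ → ℂ) (τ : ℝ) : ℂ := 1 / 9 * (2 * D 2 U τ - 3 * D 1 V τ + 2 * U τ ^ 2)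

def c22 (U : ℝ → ℂ) (τ : ℝ) : ℂ := 1 / 9 * (-D 2 U τ - U τ ^ 2)

def c33 (U V : ℝ → ℂ) (τ : ℝ) : ℂ := 1 / 9 * (-D 2 U τ + 3 * D 1 V τ - U τ ^ 2)

def c21 (U V : ℝ → ℂ) (τ : ℝ) : ℂ :=
  1 / 9 * (-2 * D 3 U τ + 3 * D 2 V τ - 2 * D 1 (U ^ 2) τ + 3 * U τ * V τ)

def c31 (U V : ℝ → ℂ) (τ : ℝ) : ℂ :=
  1 / 9 * (2 * D 4 U τ - 3 * D 3 V τ + 2 * D 2 (U ^ 2) τ - 3 * D 1 (U * V) τ - 3 * V τ ^ 2)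

def c32 (U V : ℝ → ℂ) (τ : ℝ) : ℂ :=
  1 / 9 * (-D 3 U τ - D 1 (U ^ 2) τ + 3 * D 2 V τ + 6 * U τ * V τ)

def Chat (U V : ℝ → ℂ) (τ : ℝ) (ξ : ℂ) : Mat3 :=
  ξ ^ 2 •
  !![0, 0, 0;
     0, 0, 0;
     1, 0, 0] +
  ξ •
  !![0, 1, 0;
     1 / 3 * U τ, 0, 1;
     -(1 / 3) * D 1 U τ + 2 / 3 * V τ, -(2 / 3) * U τ, 0] +
  !![c11 U V τ, -(1 / 3) * (V τ - D 1 U τ), 1 / 3 * U τ;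
     c21 U V τ, c22 U τ, -(1 / 3) * V τ;
     c31 U V τ, c32 U V τ, c33 U V τ]

def Lhat (ρ σ : ℝ) (U V : ℝ → ℂ) (τ : ℝ) (ξ : ℂ) : Mat3 :=
  -(1 / 3 : ℂ) • Matrix.diagonal ![0, 1, 2] + (τ / 3 : ℂ) • Ahat U V τ ξ +
    (2 * σ / 3 : ℂ) • Bhat U V τ ξ + (4 * ρ / 3 : ℂ) • Chat U V τ ξ

/-- The Lax system `-ξ Φ̂_ξ = L̂ Φ̂`, `-Φ̂_τ = Â Φ̂`, `-Φ̂_σ = B̂ Φ̂`, `-Φ̂_ρ = Ĉ Φ̂` at one point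
(with existence of all these derivatives, entry by entry). -/
def LaxSystemAt (u v : ℝ → ℝ → ℝ → ℂ) (Ψ : ℝ → ℝ → ℝ → ℂ → Mat3) (ρ σ τ : ℝ) (ξ : ℂ) : Prop :=
  (∃ X : Mat3, (∀ i j, HasDerivAt (fun z => Ψ ρ σ τ z i j) (X i j) ξ) ∧
    -ξ • X = Lhat ρ σ (u ρ σ) (v ρ σ) τ ξ * Ψ ρ σ τ ξ) ∧
  (∃ X : Mat3, (∀ i j, HasDerivAt (fun t => Ψ ρ σ t ξ i j) (X i j) τ) ∧
    -X = Ahat (u ρ σ) (v ρ σ) τ ξ * Ψ ρ σ τ ξ) ∧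
  (∃ X : Mat3, (∀ i j, HasDerivAt (fun s => Ψ ρ s τ ξ i j) (X i j) σ) ∧
    -X = Bhat (u ρ σ) (v ρ σ) τ ξ * Ψ ρ σ τ ξ) ∧
  (∃ X : Mat3, (∀ i j, HasDerivWithinAt (fun r => Ψ r σ τ ξ i j) (X i j) (Set.Iic 0) ρ) ∧
    -X = Chat (u ρ σ) (v ρ σ) τ ξ * Ψ ρ σ τ ξ)

/-! ## Compatibility (zero-curvature) conditions of the Lax system -/

/-- `∂_σ Â - ∂_τ B̂ = [Â, B̂]` for all `ξ`. -/
def CompatibleTauSigma (u v : ℝ → ℝ → ℝ → ℂ) (ρ σ τ : ℝ) : Prop :=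
  ∀ ξ : ℂ,
    Matrix.of (fun i j => dSigma (fun r s t => Ahat (u r s) (v r s) t ξ i j) ρ σ τ) -
      Matrix.of (fun i j => deriv (fun t => Bhat (u ρ σ) (v ρ σ) t ξ i j) τ) =
    Ahat (u ρ σ) (v ρ σ) τ ξ * Bhat (u ρ σ) (v ρ σ) τ ξ -
      Bhat (u ρ σ) (v ρ σ) τ ξ * Ahat (u ρ σ) (v ρ σ) τ ξ

/-- `∂_ρ Â - ∂_τ Ĉ = [Â, Ĉ]` for all `ξ`. -/
def CompatibleTauRho (u v : ℝ → ℝ → ℝ → ℂ) (ρ σ τ : ℝ) : Prop :=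
  ∀ ξ : ℂ,
    Matrix.of (fun i j => dRho (fun r s t => Ahat (u r s) (v r s) t ξ i j) ρ σ τ) -
      Matrix.of (fun i j => deriv (fun t => Chat (u ρ σ) (v ρ σ) t ξ i j) τ) =
    Ahat (u ρ σ) (v ρ σ) τ ξ * Chat (u ρ σ) (v ρ σ) τ ξ -
      Chat (u ρ σ) (v ρ σ) τ ξ * Ahat (u ρ σ) (v ρ σ) τ ξ

/-- `∂_τ L̂ - ξ ∂_ξ Â = [L̂, Â]` for all `ξ`. -/
def CompatibleXiTau (u v : ℝ → ℝ → ℝ → ℂ) (ρ σ τ : ℝ) : Prop :=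
  ∀ ξ : ℂ,
    Matrix.of (fun i j => deriv (fun t => Lhat ρ σ (u ρ σ) (v ρ σ) t ξ i j) τ) -
      ξ • Matrix.of (fun i j => deriv (fun z => Ahat (u ρ σ) (v ρ σ) τ z i j) ξ) =
    Lhat ρ σ (u ρ σ) (v ρ σ) τ ξ * Ahat (u ρ σ) (v ρ σ) τ ξ -
      Ahat (u ρ σ) (v ρ σ) τ ξ * Lhat ρ σ (u ρ σ) (v ρ σ) τ ξ

/-! ## The Boussinesq hierarchy and its self-similar reduction -/

/-- The first flow. -/
def FirstFlowAt (u v : ℝ → ℝ → ℝ → ℂ) (ρ σ τ : ℝ) : Prop :=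
  dSigma u ρ σ τ = D 2 (u ρ σ) τ - 2 * D 1 (v ρ σ) τ ∧
  dSigma v ρ σ τ =
    -D 2 (v ρ σ) τ + 2 / 3 * D 3 (u ρ σ) τ + 2 / 3 * u ρ σ τ * D 1 (u ρ σ) τ

/-- The classical Boussinesq equation `u_σσ = -u_ττττ/3 - (4/3)(u u_τ)_τ`. -/
def BoussinesqAt (u : ℝ → ℝ → ℝ → ℂ) (ρ σ τ : ℝ) : Prop :=
  dSigma (dSigma u) ρ σ τ =
    -(1 / 3) * D 4 (u ρ σ) τ - 4 / 3 * D 1 (fun t => u ρ σ t * D 1 (u ρ σ) t) τ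

/-- The second flow. -/
def SecondFlowAt (u v : ℝ → ℝ → ℝ → ℂ) (ρ σ τ : ℝ) : Prop :=
  dRho u ρ σ τ =
    1 / 3 * (D 4 (u ρ σ) τ - 2 * D 3 (v ρ σ) τ + D 2 (u ρ σ ^ 2) τ
      - 4 * D 1 (u ρ σ * v ρ σ) τ) ∧
  dRho v ρ σ τ =
    1 / 9 * (2 * D 5 (u ρ σ) τ - 3 * D 4 (v ρ σ) τ + 2 * D 3 (u ρ σ ^ 2) τ
      + 2 * u ρ σ τ * D 3 (u ρ σ) τ - 6 * D 1 (fun t => u ρ σ t * D 1 (v ρ σ) t) τ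
      - 6 * D 1 (v ρ σ ^ 2) τ + 4 * u ρ σ τ ^ 2 * D 1 (u ρ σ) τ)

/-- The self-similar reduction, for functions `U`, `V` of `τ`. -/
def SelfSimilarAt (ρ σ : ℝ) (U V : ℝ → ℂ) (τ : ℝ) : Prop :=
  4 / 3 * ρ * (-D 4 U τ + 2 * D 3 V τ - D 2 (U ^ 2) τ + 4 * D 1 (U * V) τ)
    + 2 * σ * (2 * D 1 V τ - D 2 U τ) - τ * D 1 U τ - 2 * U τ = 0 ∧
  4 / 9 * ρ * (-2 * D 5 U τ + 3 * D 4 V τ - 2 * D 3 (U ^ 2) τ - 2 * U τ * D 3 U τ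
      + 6 * D 1 (fun t => U t * D 1 V t) τ + 6 * D 1 (V ^ 2) τ - 4 * U τ ^ 2 * D 1 U τ)
    + 2 * σ * (D 2 V τ - 2 / 3 * D 3 U τ - 1 / 3 * D 1 (U ^ 2) τ)
    - τ * D 1 V τ - 3 * V τ = 0

/-- The single equation to which the self-similar reduction with `ρ = 0` amounts. -/
def ReducedAt (σ : ℝ) (U : ℝ → ℂ) (τ : ℝ) : Prop :=
  4 * (σ : ℂ) ^ 2 * (-D 4 U τ - 2 * D 2 (U ^ 2) τ) - 3 * (τ : ℂ) ^ 2 * D 2 U τ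
    - 21 * τ * D 1 U τ - 24 * U τ = 0

/-! ## Chazy-type equations and Painlevé IV -/

def ChazyThirdAt (α : ℝ) (y : ℝ → ℂ) (τ : ℝ) : Prop :=
  D 3 y τ + 6 * D 1 y τ ^ 2 + τ * y τ - 1 / 72 * (τ : ℂ) ^ 4 + 1 / 6 * ((α : ℂ) - (α : ℂ) ^ 2) = 0

def ChazySecondAt (α : ℝ) (y : ℝ → ℂ) (τ : ℝ) : Prop :=
  D 2 y τ ^ 2 + 4 * D 1 y τ ^ 3 - 4 * (τ * D 1 y τ - y τ) ^ 2
    - 4 / 3 * ((α : ℂ) ^ 2 - α + 1) * D 1 y τ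
    + 4 / 27 * ((α : ℂ) + 1) * (2 * α - 1) * (α - 2) = 0

/-- `w` is a nowhere vanishing `C²` solution on `S` of the Painlevé IV equation
`w'' = w'²/(2w) + (3/2) w³ + 4 τ w² + 2 (τ² - A) w + B/w`. -/
def IsPainleveIV (A B : ℝ) (S : Set ℝ) (w : ℝ → ℂ) : Prop :=
  ContDiffOn ℝ 2 w S ∧ ∀ τ ∈ S, w τ ≠ 0 ∧
    D 2 w τ = D 1 w τ ^ 2 / (2 * w τ) + 3 / 2 * w τ ^ 3 + 4 * τ * w τ ^ 2
      + 2 * ((τ : ℂ) ^ 2 - A) * w τ + B / w τ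

/-- `y` is a `C³` solution on `S` of the second-order Chazy equation. -/
def IsChazySecond (α : ℝ) (S : Set ℝ) (y : ℝ → ℂ) : Prop :=
  ContDiffOn ℝ 3 y S ∧ ∀ τ ∈ S, ChazySecondAt α y τ

/-- `w = (y'' - 2τy' + 2y) / (2 (y' - (α+1)/3))`. -/
def chazyToPainleve (α : ℝ) (y : ℝ → ℂ) (τ : ℝ) : ℂ :=
  (D 2 y τ - 2 * τ * D 1 y τ + 2 * y τ) / (2 * (D 1 y τ - ((α : ℂ) + 1) / 3))

/-- `y = ((1-2α)/3) τ - (α/2) w + (w'² - (w² + 2τw + 1 - α)²) / (8w)`. -/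
def painleveToChazy (α : ℝ) (w : ℝ → ℂ) (τ : ℝ) : ℂ :=
  (1 - 2 * (α : ℂ)) / 3 * τ - α / 2 * w τ
    + (D 1 w τ ^ 2 - (w τ ^ 2 + 2 * τ * w τ + 1 - α) ^ 2) / (8 * w τ)

/-- Equivalence of the second-order Chazy equation with Painlevé IV with parameters
`A = (1-α)/2`, `B = -(1-α)²/2`, through two mutually inverse explicit transformations, on every open
set on which the denominators do not vanish and `y` is not a singular solution (`y'' ≠ 0`). -/
def ChazyPainleveEquivalence (α : ℝ) : Prop :=
  ∀ S : Set ℝ, IsOpen S →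
    (∀ y : ℝ → ℂ, IsChazySecond α S y →
      (∀ τ ∈ S, D 2 y τ ≠ 0 ∧ D 1 y τ ≠ ((α : ℂ) + 1) / 3 ∧ chazyToPainleve α y τ ≠ 0) →
      IsPainleveIV ((1 - α) / 2) (-((1 - α) ^ 2 / 2)) S (chazyToPainleve α y) ∧
      Set.EqOn (painleveToChazy α (chazyToPainleve α y)) y S) ∧
    (∀ w : ℝ → ℂ, IsPainleveIV ((1 - α) / 2) (-((1 - α) ^ 2 / 2)) S w →
      IsChazySecond α S (painleveToChazy α w) ∧
      ∀ τ ∈ S, D 1 (painleveToChazy α w) τ ≠ ((α : ℂ) + 1) / 3 →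
        chazyToPainleve α (painleveToChazy α w) τ = w τ)

end BoussinesqRHP

end

open BoussinesqRHP
open scoped ContDiff

open scoped Real Interval BoundedContinuousFunction Matrix.Norms.Operator

noncomputable section

namespace BoussinesqRHP

open Complex Set MeasureTheory Metric Bornology

section
variable {E : Type*} [NormedAddCommGroup E] [NormedSpace ℂ E] [CompleteSpace E]

/-- Painlevé's theorem for the real axis: a continuous function on a ball that is holomorphic off
the real axis is holomorphic. -/
lemma differentiableOn_ball_of_off_real {f : ℂ → E} {c : ℂ} {r : ℝ} (hc : ContinuousOn f (ball c r))
    (hd : ∀ z ∈ ball c r, z.im ≠ 0 → DifferentiableAt ℂ f z) :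
    DifferentiableOn ℂ f (ball c r) := by
  refine (IsConservativeOn.isExactOn_ball hc ?_).differentiableOn isOpen_ball
  intro z w hzw
  rw [← add_eq_zero_iff_eq_neg, wedgeIntegral_add_wedgeIntegral_eq]
  -- rectangles that do not meet the axis in their interior
  have key : ∀ y₁ y₂ : ℝ, [[y₁, y₂]] ⊆ [[z.im, w.im]] → (0 ∉ Ioo (min y₁ y₂) (max y₁ y₂)) →
      (∫ x : ℝ in z.re..w.re, f (x + y₁ * I)) - (∫ x : ℝ in z.re..w.re, f (x + y₂ * I)) +
      I • (∫ y : ℝ in y₁..y₂, f (w.re + y * I)) -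
      I • (∫ y : ℝ in y₁..y₂, f (z.re + y * I)) = 0 := by
    intro y₁ y₂ hsub h0
    have := integral_boundary_rect_eq_zero_of_differentiable_on_off_countable f
      (⟨z.re, y₁⟩ : ℂ) ⟨w.re, y₂⟩ ∅ countable_empty
      (hc.mono ?_) ?_
    · simpa using this
    · refine subset_trans ?_ hzw
      intro t ht
      rw [mem_reProdIm] at ht
      simp only [Rectangle, mem_reProdIm]
      exact ⟨ht.1, hsub ht.2⟩
    · intro x hx
      have hx1 := hx.1
      rw [mem_reProdIm] at hx1
      refine hd x (hzw ?_) ?_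
      · simp only [Rectangle, mem_reProdIm]
        refine ⟨?_, hsub ?_⟩
        · exact Ioo_subset_Icc_self hx1.1
        · exact Ioo_subset_Icc_self hx1.2
      · intro h; rw [h] at hx1; exact h0 hx1.2
  by_cases h0 : 0 ∈ Ioo (min z.im w.im) (max z.im w.im)
  · have h0' : (0 : ℝ) ∈ [[z.im, w.im]] := Ioo_subset_Icc_self h0
    have k1 := key z.im 0 (uIcc_subset_uIcc left_mem_uIcc h0') (by
      rintro ⟨h1, h2⟩; rcases le_total z.im 0 with h | h
      · rw [max_eq_right h] at h2; exact lt_irrefl _ h2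
      · rw [min_eq_right h] at h1; exact lt_irrefl _ h1)
    have k2 := key 0 w.im (uIcc_subset_uIcc h0' right_mem_uIcc) (by
      rintro ⟨h1, h2⟩; rcases le_total 0 w.im with h | h
      · rw [min_eq_left h] at h1; exact lt_irrefl _ h1
      · rw [max_eq_left h] at h2; exact lt_irrefl _ h2)
    have hint : ∀ u : ℂ, u.re ∈ [[z.re, w.re]] → ∀ a b : ℝ, [[a, b]] ⊆ [[z.im, w.im]] →
        IntervalIntegrable (fun y : ℝ => f (u.re + y * I)) volume a b := by
      intro u hu a b hab
      apply ContinuousOn.intervalIntegrable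
      refine hc.comp (by fun_prop) ?_
      intro y hy
      apply hzw
      simp only [Rectangle, mem_reProdIm]
      simpa using ⟨hu, hab hy⟩
    rw [← intervalIntegral.integral_add_adjacent_intervals
        (hint w right_mem_uIcc z.im 0 (uIcc_subset_uIcc left_mem_uIcc h0'))
        (hint w right_mem_uIcc 0 w.im (uIcc_subset_uIcc h0' right_mem_uIcc)),
      ← intervalIntegral.integral_add_adjacent_intervals
        (hint z left_mem_uIcc z.im 0 (uIcc_subset_uIcc left_mem_uIcc h0'))
        (hint z left_mem_uIcc 0 w.im (uIcc_subset_uIcc h0' right_mem_uIcc))]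
    rw [smul_add, smul_add]
    have := congrArg₂ (· + ·) k1 k2
    simp only [add_zero] at this
    rw [← this]
    abel
  · exact key z.im w.im subset_rfl h0

/-- Painlevé's theorem for a line through the origin. -/
lemma differentiableAt_of_off_line {f : ℂ → E} {U : Set ℂ} (hU : IsOpen U) {a : ℂ} (ha : a ≠ 0)
    (hc : ContinuousOn f U) (hd : ∀ z ∈ U, (z / a).im ≠ 0 → DifferentiableAt ℂ f z) :
    DifferentiableOn ℂ f U := by
  intro z hz
  apply DifferentiableAt.differentiableWithinAt
  set g : ℂ → E := fun w => f (a * w) with hg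
  have hV : IsOpen ((fun w => a * w) ⁻¹' U) := hU.preimage (by fun_prop)
  have hzV : z / a ∈ (fun w => a * w) ⁻¹' U := by simpa [mul_div_cancel₀ _ ha] using hz
  obtain ⟨r, hr, hrU⟩ := Metric.isOpen_iff.1 hV _ hzV
  have hgd : DifferentiableOn ℂ g (ball (z / a) r) := by
    apply differentiableOn_ball_of_off_real
    · exact hc.comp (by fun_prop) (fun w hw => hrU hw)
    · intro w hw him
      have : DifferentiableAt ℂ f (a * w) := hd _ (hrU hw) (by rwa [mul_div_cancel_left₀ _ ha])
      exact this.comp w (by fun_prop)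
  have h1 : DifferentiableAt ℂ g (z / a) := hgd.differentiableAt (ball_mem_nhds _ hr)
  have h2 : f = fun w => g (w / a) := by funext w; simp [hg, mul_div_cancel₀ _ ha]
  rw [h2]
  exact DifferentiableAt.comp (f := fun w => w / a) z h1 (by fun_prop)

/-- The holomorphic extension across a line of a function with limits at the points of the line. -/
lemma differentiableOn_extendFrom {f : ℂ → E} {S U : Set ℂ} (hU : IsOpen U) {a : ℂ} (ha : a ≠ 0)
    (hS : IsOpen S) (hd : DifferentiableOn ℂ f S) (hcl : U ⊆ closure S)
    (hline : ∀ z ∈ U, z ∉ S → (z / a).im = 0)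
    (hlim : ∀ z ∈ U, z ∉ S → ∃ l, Tendsto f (𝓝[S] z) (𝓝 l)) :
    DifferentiableOn ℂ (extendFrom S f) U := by
  have heq : ∀ z ∈ S, extendFrom S f z = f z := fun z hz =>
    extendFrom_eq (subset_closure hz) ((hd.continuousOn z hz))
  refine differentiableAt_of_off_line hU ha ?_ ?_
  · refine continuousOn_extendFrom hcl ?_
    intro z hz
    by_cases h : z ∈ S
    · exact ⟨_, hd.continuousOn z h⟩
    · exact hlim z hz h
  · intro z hz him
    have hzS : z ∈ S := by by_contra h; exact him (hline z hz h)
    refine (hd.differentiableAt (hS.mem_nhds hzS)).congr_of_eventuallyEq ?_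
    filter_upwards [hS.mem_nhds hzS] with w hw using heq w hw

/-- An entire function that tends to zero at infinity vanishes. -/
lemma eq_zero_of_entire_of_tendsto {F : Type*} [NormedAddCommGroup F] [NormedSpace ℂ F]
    {f : ℂ → F} (hf : Differentiable ℂ f)
    (h : Tendsto f (cobounded ℂ) (𝓝 0)) (z : ℂ) : f z = 0 := by
  have : Tendsto f (cocompact ℂ) (𝓝 0) := by rwa [← Metric.cobounded_eq_cocompact]
  exact hf.apply_eq_of_tendsto_cocompact z this

lemma tendsto_cobounded_of_dense {F : Type*} [TopologicalSpace F] [RegularSpace F] {f : ℂ → F}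
    {S : Set ℂ} {l : F} (hS : Dense S) {K : Set ℂ} (hK : Kᶜ ∈ cobounded ℂ)
    (hKc : IsClosed K)
    (hf : ContinuousOn f Kᶜ) (h : Tendsto f (cobounded ℂ ⊓ 𝓟 S) (𝓝 l)) :
    Tendsto f (cobounded ℂ) (𝓝 l) := by
  rw [(closed_nhds_basis l).tendsto_right_iff]
  rintro V ⟨hV, hVc⟩
  have := h hV
  rw [mem_map, mem_inf_principal] at this
  have h2 := inter_mem this hK
  rw [← Bornology.isBounded_def] at hK
  rw [Metric.hasBasis_cobounded_compl_closedBall 0 |>.mem_iff] at h2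
  obtain ⟨R, -, hR⟩ := h2
  rw [(Metric.hasBasis_cobounded_compl_closedBall (0:ℂ)).eventually_iff]
  refine ⟨R, trivial, fun z hz => ?_⟩
  have hzo : IsOpen (closedBall (0:ℂ) R)ᶜ := isClosed_closedBall.isOpen_compl
  have hcz : ContinuousAt f z := hf.continuousAt (hKc.isOpen_compl.mem_nhds (hR hz).2)
  have hne : (𝓝[S] z).NeBot := mem_closure_iff_nhdsWithin_neBot.1 (hS z)
  refine hVc.mem_of_tendsto (hcz.tendsto.mono_left nhdsWithin_le_nhds : Tendsto f (𝓝[S] z) _) ?_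
  filter_upwards [self_mem_nhdsWithin, mem_nhdsWithin_of_mem_nhds (hzo.mem_nhds hz)] with w hw1 hw2
  exact (hR hw2).1 hw1
end

section
/-! ## The Cauchy transform on the plane -/

/-- The weight `(1 + |s|²)⁻²`. -/
def weight (s : ℂ) : ℝ := ((1 + ‖s‖ ^ 2) ^ 2)⁻¹

lemma weight_pos (s : ℂ) : 0 < weight s := by unfold weight; positivity

lemma weight_le_one (s : ℂ) : weight s ≤ 1 := by
  unfold weight
  apply inv_le_one_of_one_le₀
  nlinarith [sq_nonneg ‖s‖]

lemma continuous_weight : Continuous weight := by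
  unfold weight
  refine Continuous.inv₀ (by fun_prop) (fun s => by positivity)

lemma integrable_weight : Integrable weight := by
  have := integrable_rpow_neg_one_add_norm_sq (E := ℂ) (μ := volume) (r := 4)
    (by rw [Complex.finrank_real_complex]; norm_num)
  refine this.congr (ae_of_all _ fun s => ?_)
  simp only [weight]
  rw [show (-4 / 2 : ℝ) = -((2 : ℕ) : ℝ) by norm_num, Real.rpow_neg (by positivity),
    Real.rpow_natCast]

lemma weight_add_le (K : ℝ) (x h : ℂ) (hh : ‖h‖ ≤ K) :
    weight (x + h) ≤ (2 + 2 * K ^ 2) ^ 2 * weight x := by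
  unfold weight
  have h1 : ‖x‖ ≤ ‖x + h‖ + K := by
    have := norm_sub_le (x + h) h
    simp only [add_sub_cancel_right] at this
    linarith
  have h2 : 1 + ‖x‖ ^ 2 ≤ (2 + 2 * K ^ 2) * (1 + ‖x + h‖ ^ 2) := by
    have : ‖x‖ ^ 2 ≤ (‖x + h‖ + K) ^ 2 := by gcongr
    nlinarith [sq_nonneg (‖x + h‖ - K), sq_nonneg (K * ‖x + h‖), norm_nonneg (x + h)]
  have h3 : (1 + ‖x‖ ^ 2) ^ 2 ≤ ((2 + 2 * K ^ 2) * (1 + ‖x + h‖ ^ 2)) ^ 2 := by gcongr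
  rw [mul_pow] at h3
  rw [← div_eq_mul_inv, inv_eq_one_div, div_le_div_iff₀ (by positivity) (by positivity)]
  linarith

lemma integrableOn_norm_inv : IntegrableOn (fun s : ℂ => ‖s‖⁻¹) (ball 0 1) := by
  refine integrableOn_ball_of_norm_le_rpow (C := 1) (α := 1) ?_ ?_ ?_ ?_
  · rw [Complex.finrank_real_complex]; norm_num
  · rw [Complex.finrank_real_complex]; norm_num
  · refine ae_of_all _ fun s => ?_
    rw [Real.rpow_neg_one]; simp
  · exact (measurable_norm.inv).aestronglyMeasurable

/-- The integral of `1/|s|` over the unit disc plus the integral of the weight. -/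
def kernelBound : ℝ := (∫ s in ball (0 : ℂ) 1, ‖s‖⁻¹) + ∫ s, weight s

lemma norm_inv_mul_weight_le (ξ s : ℂ) :
    ‖s‖⁻¹ * weight (ξ + s) ≤ (ball (0:ℂ) 1).indicator (fun s => ‖s‖⁻¹) s + weight (ξ + s) := by
  by_cases h : s ∈ ball (0:ℂ) 1
  · rw [indicator_of_mem h]
    have := mul_le_of_le_one_right (inv_nonneg.2 (norm_nonneg s)) (weight_le_one (ξ + s))
    linarith [weight_pos (ξ + s)]
  · rw [indicator_of_notMem h, zero_add]
    have h1 : 1 ≤ ‖s‖ := by simpa using h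
    exact mul_le_of_le_one_left (weight_pos _).le (inv_le_one_of_one_le₀ h1)

lemma integrable_majorant (ξ : ℂ) : Integrable (fun s : ℂ =>
    (ball (0:ℂ) 1).indicator (fun s => ‖s‖⁻¹) s + weight (ξ + s)) := by
  refine Integrable.add ?_ (integrable_weight.comp_add_left ξ)
  exact integrableOn_norm_inv.integrable_indicator measurableSet_ball

lemma integrable_kernel_weight (ξ : ℂ) : Integrable (fun s : ℂ => ‖s‖⁻¹ * weight (ξ + s)) := by
  refine (integrable_majorant ξ).mono' ?_ (ae_of_all _ fun s => ?_)
  · exact ((measurable_norm.inv).mul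
      ((continuous_weight.measurable).comp (measurable_const_add ξ))).aestronglyMeasurable
  · rw [Real.norm_of_nonneg (mul_nonneg (by positivity) (weight_pos _).le)]
    exact norm_inv_mul_weight_le ξ s

lemma integral_kernel_weight_le (ξ : ℂ) : ∫ s : ℂ, ‖s‖⁻¹ * weight (ξ + s) ≤ kernelBound := by
  refine (integral_mono (integrable_kernel_weight ξ) (integrable_majorant ξ)
    (norm_inv_mul_weight_le ξ)).trans ?_
  rw [integral_add (integrableOn_norm_inv.integrable_indicator measurableSet_ball)
    (integrable_weight.comp_add_left ξ), integral_indicator measurableSet_ball,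
    integral_add_left_eq_self weight ξ]
  rfl

variable {E : Type*} [NormedAddCommGroup E] [NormedSpace ℂ E]

/-- The Cauchy transform `-(1/π) ∫ g(s)/(s-ξ) dA(s)`. -/
def cauchyTransform (g : ℂ → E) (ξ : ℂ) : E := -((π : ℂ)⁻¹ • ∫ s, (s - ξ)⁻¹ • g s)

lemma integral_cauchy_eq (g : ℂ → E) (ξ : ℂ) : ∫ s, (s - ξ)⁻¹ • g s = ∫ s, s⁻¹ • g (ξ + s) := by
  rw [← integral_add_left_eq_self (fun s => (s - ξ)⁻¹ • g s) ξ]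
  simp

lemma norm_inv_smul_le {g : ℂ → E} {C : ℝ} (hC : ∀ s, ‖g s‖ ≤ C * weight s) (ξ s : ℂ) :
    ‖s⁻¹ • g (ξ + s)‖ ≤ C * (‖s‖⁻¹ * weight (ξ + s)) := by
  rw [norm_smul, norm_inv]
  have := mul_le_mul_of_nonneg_left (hC (ξ + s)) (inv_nonneg.2 (norm_nonneg s))
  linarith

lemma aestronglyMeasurable_inv_smul {g : ℂ → E} (hg : Continuous g) (ξ : ℂ) :
    AEStronglyMeasurable (fun s : ℂ => s⁻¹ • g (ξ + s)) :=
  (measurable_inv.aestronglyMeasurable).smul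
    ((hg.comp (continuous_const_add ξ)).aestronglyMeasurable)

lemma integrable_inv_smul {g : ℂ → E} (hg : Continuous g) {C : ℝ}
    (hC : ∀ s, ‖g s‖ ≤ C * weight s) (ξ : ℂ) : Integrable (fun s : ℂ => s⁻¹ • g (ξ + s)) :=
  ((integrable_kernel_weight ξ).const_mul C).mono' (aestronglyMeasurable_inv_smul hg ξ)
    (ae_of_all _ (norm_inv_smul_le hC ξ))

lemma integrable_sub_inv_smul {g : ℂ → E} (hg : Continuous g) {C : ℝ}
    (hC : ∀ s, ‖g s‖ ≤ C * weight s) (ξ : ℂ) : Integrable (fun s : ℂ => (s - ξ)⁻¹ • g s) := by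
  have := (integrable_inv_smul hg hC ξ).comp_sub_right ξ
  simpa using this

lemma norm_cauchyTransform_le {g : ℂ → E} {C : ℝ} (hC : ∀ s, ‖g s‖ ≤ C * weight s) (ξ : ℂ) :
    ‖cauchyTransform g ξ‖ ≤ π⁻¹ * kernelBound * C := by
  have hC0 : 0 ≤ C := by
    have h := (norm_nonneg _).trans (hC 0)
    exact nonneg_of_mul_nonneg_left h (weight_pos 0)
  unfold cauchyTransform
  rw [norm_neg, norm_smul, norm_inv, Complex.norm_real, Real.norm_of_nonneg Real.pi_pos.le,
    integral_cauchy_eq, mul_assoc]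
  gcongr
  refine (norm_integral_le_of_norm_le ((integrable_kernel_weight ξ).const_mul C)
    (ae_of_all _ (norm_inv_smul_le hC ξ))).trans ?_
  rw [integral_const_mul, mul_comm]
  gcongr
  exact integral_kernel_weight_le ξ

lemma continuous_cauchyTransform {g : ℂ → E} (hg : Continuous g) {C : ℝ}
    (hC : ∀ s, ‖g s‖ ≤ C * weight s) : Continuous (cauchyTransform g) := by
  have hC0 : 0 ≤ C := by
    have h := (norm_nonneg _).trans (hC 0)
    exact nonneg_of_mul_nonneg_left h (weight_pos 0)
  unfold cauchyTransform
  simp_rw [integral_cauchy_eq]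
  refine (Continuous.const_smul ?_ _).neg
  rw [continuous_iff_continuousAt]
  intro ξ₀
  refine continuousAt_of_dominated (bound := fun s =>
    C * ((2 + 2 * 1 ^ 2) ^ 2) * (‖s‖⁻¹ * weight (ξ₀ + s))) ?_ ?_ ?_ ?_
  · exact Eventually.of_forall fun ξ => aestronglyMeasurable_inv_smul hg ξ
  · filter_upwards [closedBall_mem_nhds ξ₀ one_pos] with ξ hξ
    refine ae_of_all _ fun s => ?_
    refine (norm_inv_smul_le hC ξ s).trans ?_
    have h1 := weight_add_le 1 (ξ₀ + s) (ξ - ξ₀) (by rwa [← dist_eq_norm])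
    rw [show ξ₀ + s + (ξ - ξ₀) = ξ + s by ring] at h1
    calc C * (‖s‖⁻¹ * weight (ξ + s))
        ≤ C * (‖s‖⁻¹ * ((2 + 2 * 1 ^ 2) ^ 2 * weight (ξ₀ + s))) := by gcongr
      _ = _ := by ring
  · exact (integrable_kernel_weight ξ₀).const_mul _
  · refine ae_of_all _ fun s => ?_
    exact (continuous_const.smul (hg.comp (continuous_add_const s))).continuousAt

/-! ## The Cauchy–Pompeiu formula -/

/-- The Cauchy–Riemann operator `∂/∂ξ̄`. -/
def dbar (f : ℂ → E) (z : ℂ) : E := (1 / 2 : ℂ) • (fderiv ℝ f z 1 + I • fderiv ℝ f z I)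

lemma fderiv_expI (f : ℂ → E) (z : ℂ) (θ : ℝ) : fderiv ℝ f z (exp (θ * I)) =
      (2 * exp (-(θ * I))) • dbar f z - I • fderiv ℝ f z (I * exp (θ * I)) := by
  have h1 : exp (θ * I) = (Real.cos θ) • (1 : ℂ) + (Real.sin θ) • I := by rw [exp_mul_I]; simp
  have h2 : I * exp (θ * I) = (-Real.sin θ) • (1 : ℂ) + (Real.cos θ) • I := by
    rw [h1]; simp only [real_smul]; push_cast; ring_nf; rw [I_sq]; ring
  have h3 : exp (-(θ * I)) = Real.cos θ - Real.sin θ * I := by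
    rw [← neg_mul, ← ofReal_neg, exp_mul_I, ← ofReal_cos, ← ofReal_sin]
    simp [sub_eq_add_neg]
  rw [h2, h1, h3, dbar]
  simp only [map_add, map_smul, smul_add, smul_smul]
  simp only [← Complex.coe_smul, smul_smul]
  set a := fderiv ℝ f z 1
  set b := fderiv ℝ f z I
  have e1 : (2 * (((Real.cos θ : ℝ) : ℂ) - ((Real.sin θ : ℝ) : ℂ) * I) * (1 / 2 * I)) =
     ((Real.cos θ : ℝ) : ℂ) * I + ((Real.sin θ : ℝ) : ℂ) := by
    ring_nf; rw [I_sq]; ring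
  rw [e1, ofReal_neg]
  module

variable [CompleteSpace E]

/-- The Cauchy–Pompeiu formula on the whole plane. -/
lemma eq_add_cauchyTransform_dbar {f : ℂ → E} (hf : ContDiff ℝ 1 f) {l : E}
    (hl : Tendsto f (cobounded ℂ) (𝓝 l)) {C : ℝ}
    (hC : ∀ s, ‖dbar f s‖ ≤ C * weight s) (ξ : ℂ) :
    f ξ = l + cauchyTransform (dbar f) ξ := by
  have hfc := hf.continuous
  have hf' : Continuous (fderiv ℝ f) := hf.continuous_fderiv (by norm_num)
  have hg : Continuous (dbar f) := by
    unfold dbar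
    fun_prop
  set γ : ℝ → ℝ → ℂ := fun r θ => ξ + r * exp (θ * I) with hγ
  have hγc : Continuous (fun p : ℝ × ℝ => γ p.1 p.2) := by simp only [hγ]; fun_prop
  have hγr : ∀ r, Continuous (γ r) := fun r => by simp only [hγ]; fun_prop
  set A : ℝ → E := fun r => ∫ θ in (-π)..π, f (γ r θ) with hA
  have hderiv : ∀ r, HasDerivAt A (∫ θ in (-π)..π, fderiv ℝ f (γ r θ) (exp (θ * I))) r := by
    intro r
    have hcont : Continuous (fun p : ℝ × ℝ => fderiv ℝ f (γ p.1 p.2) (exp (p.2 * I))) := by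
      apply Continuous.clm_apply (hf'.comp hγc); fun_prop
    have hcpt : IsCompact (closedBall r 1 ×ˢ Icc (-π) π) :=
      (isCompact_closedBall r 1).prod isCompact_Icc
    obtain ⟨B, hB⟩ := hcpt.exists_bound_of_continuousOn hcont.continuousOn
    refine (intervalIntegral.hasDerivAt_integral_of_dominated_loc_of_deriv_le
      (F := fun r θ => f (γ r θ)) (F' := fun r θ => fderiv ℝ f (γ r θ) (exp (θ * I)))
      (bound := fun _ => B) (ball_mem_nhds r one_pos) ?_ ?_ ?_ ?_ ?_ ?_).2
    · refine Eventually.of_forall fun x => ?_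
      exact (hfc.comp (hγr x)).aestronglyMeasurable
    · exact (hfc.comp (hγr r)).intervalIntegrable _ _
    · exact (hcont.comp (by fun_prop : Continuous fun θ : ℝ => (r, θ))).aestronglyMeasurable
    · refine ae_of_all _ fun θ hθ x hx => hB (x, θ) ⟨ball_subset_closedBall hx, ?_⟩
      rw [uIoc_of_le (by linarith [Real.pi_pos])] at hθ
      exact Ioc_subset_Icc_self hθ
    · simp
    · refine ae_of_all _ fun θ hθ x hx => ?_
      have h1 : HasDerivAt (fun x : ℝ => γ x θ) (exp (θ * I)) x := by
        simp only [hγ]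
        have := ((hasDerivAt_id x).ofReal_comp.mul_const (exp (θ * I))).const_add ξ
        simpa using this
      exact ((hf.differentiable (by norm_num) _).hasFDerivAt).comp_hasDerivAt x h1
  have hperiod : ∀ r : ℝ, r • ∫ θ in (-π)..π, fderiv ℝ f (γ r θ) (I * exp (θ * I)) = 0 := by
    intro r
    have h1 : ∀ θ : ℝ, HasDerivAt (fun θ : ℝ => f (γ r θ))
        (r • fderiv ℝ f (γ r θ) (I * exp (θ * I))) θ := by
      intro θ
      have h0 : HasDerivAt (fun θ : ℝ => γ r θ) (r • (I * exp (θ * I))) θ := by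
        simp only [hγ]
        have := ((((hasDerivAt_id θ).ofReal_comp.mul_const I).cexp).const_mul (r : ℂ)).const_add ξ
        refine this.congr_deriv ?_
        rw [real_smul, id, ofReal_one, one_mul]
        ring
      have h2 := ((hf.differentiable (by norm_num) (γ r θ)).hasFDerivAt).comp_hasDerivAt θ h0
      rw [map_smul] at h2
      exact h2
    rw [← intervalIntegral.integral_smul, intervalIntegral.integral_eq_sub_of_hasDerivAt
      (fun θ _ => h1 θ)]
    · have : γ r π = γ r (-π) := by
        simp only [hγ]; rw [ofReal_neg, neg_mul, exp_neg, exp_pi_mul_I]; norm_num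
      rw [this, sub_self]
    · exact (((hf'.comp (hγr r)).clm_apply (by fun_prop)).const_smul _).intervalIntegrable _ _
  have hderiv' : ∀ r ∈ Ioi (0:ℝ), HasDerivAt A ((2:ℂ) • ∫ θ in (-π)..π,
      exp (-(θ * I)) • dbar f (γ r θ)) r := by
    intro r hr
    convert hderiv r using 1
    have hr0 : r ≠ 0 := ne_of_gt hr
    have h0 : ∫ θ in (-π)..π, fderiv ℝ f (γ r θ) (I * exp (θ * I)) = 0 := by
      have := hperiod r
      rwa [smul_eq_zero_iff_right hr0] at this
    simp_rw [fderiv_expI]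
    rw [intervalIntegral.integral_sub, intervalIntegral.integral_smul, h0, smul_zero, sub_zero,
      ← intervalIntegral.integral_smul]
    · simp_rw [smul_smul]
    · exact (Continuous.smul (by fun_prop) (hg.comp (hγr r))).intervalIntegrable _ _
    · exact (((hf'.comp (hγr r)).clm_apply (by fun_prop)).const_smul _).intervalIntegrable _ _
  -- integrability of the polar integrand
  set P : ℝ × ℝ → E := fun p => exp (-(p.2 * I)) • dbar f (γ p.1 p.2) with hP
  have hPint : Integrable P ((volume.restrict (Ioi (0:ℝ))).prod
      (volume.restrict (Ioo (-π) π))) := by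
    have h1 : Integrable (fun r : ℝ => (1 + r ^ 2)⁻¹) (volume.restrict (Ioi (0:ℝ))) :=
      integrable_inv_one_add_sq.integrableOn
    have h2 := (h1.comp_fst (volume.restrict (Ioo (-π) π))).const_mul (|C| * (2 + 2 * ‖ξ‖ ^ 2) ^ 2)
    refine h2.mono' ?_ (ae_of_all _ fun p => ?_)
    · refine Continuous.aestronglyMeasurable ?_
      simp only [hP]
      refine Continuous.smul (by fun_prop) (hg.comp hγc)
    · simp only [hP]
      rw [norm_smul, ← neg_mul, ← ofReal_neg, norm_exp_ofReal_mul_I, one_mul]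
      refine (hC _).trans ?_
      have hw := weight_add_le ‖ξ‖ (p.1 * exp (p.2 * I)) ξ le_rfl
      rw [add_comm] at hw
      have hn : ‖(p.1 : ℂ) * exp (p.2 * I)‖ ^ 2 = p.1 ^ 2 := by
        rw [norm_mul, norm_exp_ofReal_mul_I, mul_one, norm_real, Real.norm_eq_abs, sq_abs]
      have hle : weight (p.1 * exp (p.2 * I)) ≤ (1 + p.1 ^ 2)⁻¹ := by
        unfold weight
        rw [hn]
        gcongr
        nlinarith [sq_nonneg p.1]
      calc C * weight (γ p.1 p.2) ≤ |C| * weight (γ p.1 p.2) := by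
            gcongr
            · exact (weight_pos _).le
            · exact le_abs_self C
        _ ≤ |C| * ((2 + 2 * ‖ξ‖ ^ 2) ^ 2 * (1 + p.1 ^ 2)⁻¹) := by
            gcongr
            exact hw.trans (by gcongr)
        _ = _ := by ring
  have hinner : ∀ r : ℝ, ∫ θ in (-π)..π, exp (-(θ * I)) • dbar f (γ r θ) =
      ∫ θ in Ioo (-π) π, P (r, θ) := by
    intro r
    rw [intervalIntegral.integral_of_le (by linarith [Real.pi_pos]), integral_Ioc_eq_integral_Ioo]
  have hA'int : IntegrableOn (fun r => (2:ℂ) • ∫ θ in (-π)..π,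
      exp (-(θ * I)) • dbar f (γ r θ)) (Ioi 0) := by
    simp_rw [hinner]
    exact (hPint.integral_prod_left).smul (2:ℂ)
  -- boundedness and limit
  have hlim : Tendsto A atTop (𝓝 (∫ _ in (-π)..π, l)) := by
    have hbd : ∃ B, ∀ z, ‖f z‖ ≤ B := by
      have h1 := hl.norm.eventually (gt_mem_nhds (lt_add_one ‖l‖))
      rw [(Metric.hasBasis_cobounded_compl_closedBall (0:ℂ)).eventually_iff] at h1
      obtain ⟨R, -, hR⟩ := h1
      obtain ⟨B, hB⟩ := (isCompact_closedBall (0:ℂ) R).exists_bound_of_continuousOn hfc.continuousOn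
      refine ⟨max B (‖l‖ + 1), fun z => ?_⟩
      by_cases hz : z ∈ closedBall (0:ℂ) R
      · exact (hB z hz).trans (le_max_left _ _)
      · exact (hR hz).le.trans (le_max_right _ _)
    obtain ⟨B, hB⟩ := hbd
    refine intervalIntegral.tendsto_integral_filter_of_dominated_convergence (fun _ => B) ?_ ?_ ?_ ?_
    · refine Eventually.of_forall fun r => ?_
      exact (hfc.comp (hγr r)).aestronglyMeasurable
    · exact Eventually.of_forall fun r => ae_of_all _ fun θ _ => hB _
    · simp
    · refine ae_of_all _ fun θ _ => hl.comp ?_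
      rw [← tendsto_norm_atTop_iff_cobounded]
      have : Tendsto (fun r : ℝ => r - ‖ξ‖) atTop atTop := tendsto_atTop_add_const_right _ _ tendsto_id
      refine tendsto_atTop_mono' _ ?_ this
      filter_upwards [eventually_ge_atTop 0] with r hr
      have h1 : ‖(r:ℂ) * exp (θ * I)‖ = r := by
        rw [norm_mul, norm_exp_ofReal_mul_I, mul_one, norm_real, Real.norm_of_nonneg hr]
      have h2 := norm_sub_le (γ r θ) ξ
      simp only [hγ, add_sub_cancel_left] at h2
      rw [h1] at h2
      simp only [hγ]; linarith
  have hFTC := integral_Ioi_of_hasDerivAt_of_tendsto (hderiv 0).continuousAt.continuousWithinAt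
    hderiv' hA'int hlim
  have hA0 : A 0 = (2 * π) • f ξ := by
    simp only [hA, hγ, ofReal_zero, zero_mul, add_zero, intervalIntegral.integral_const]
    congr 1; ring
  rw [hA0, intervalIntegral.integral_const, integral_smul] at hFTC
  simp_rw [hinner] at hFTC
  have hpol : ∫ s, s⁻¹ • dbar f (ξ + s) = ∫ r in Ioi (0:ℝ), ∫ θ in Ioo (-π) π, P (r, θ) := by
    rw [← Complex.integral_comp_polarCoord_symm]
    rw [polarCoord_target, Measure.volume_eq_prod, ← Measure.prod_restrict,
      ← integral_prod _ hPint, Measure.prod_restrict]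
    refine setIntegral_congr_fun (measurableSet_Ioi.prod measurableSet_Ioo) fun p hp => ?_
    have hr : 0 < p.1 := hp.1
    have hs : Complex.polarCoord.symm p = p.1 * exp (p.2 * I) := by
      rw [Complex.polarCoord_symm_apply, exp_mul_I]; simp
    simp only [hs, hP, hγ]
    rw [← Complex.coe_smul, smul_smul, mul_inv, ← mul_assoc, mul_inv_cancel₀ (by exact_mod_cast hr.ne'),
      one_mul, exp_neg]
  unfold cauchyTransform
  rw [integral_cauchy_eq, hpol]
  have hpi : (π : ℂ) ≠ 0 := by exact_mod_cast Real.pi_ne_zero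
  have h3 : ∫ r in Ioi (0:ℝ), ∫ θ in Ioo (-π) π, P (r, θ) = (π : ℂ) • l - (π : ℂ) • f ξ := by
    have := congrArg (fun x => (1/2 : ℂ) • x) hFTC
    simp only [smul_smul, smul_sub] at this
    rw [show (1/2 : ℂ) * 2 = 1 by norm_num, one_smul] at this
    rw [this, ← Complex.coe_smul, ← Complex.coe_smul, smul_smul, smul_smul]
    push_cast
    congr 2 <;> ring
  rw [h3, smul_sub, smul_smul, smul_smul, inv_mul_cancel₀ hpi, one_smul, one_smul]
  abel
end

/-- The weight `(1 + |s|²)⁻³`. -/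
def heavyWeight (s : ℂ) : ℝ := ((1 + ‖s‖ ^ 2) ^ 3)⁻¹

lemma heavyWeight_pos (s : ℂ) : 0 < heavyWeight s := by unfold heavyWeight; positivity

lemma continuous_heavyWeight : Continuous heavyWeight := by
  unfold heavyWeight
  refine Continuous.inv₀ (by fun_prop) (fun s => by positivity)

lemma heavyWeight_mul_le (s : ℂ) : (1 + ‖s‖ ^ 2) * heavyWeight s = weight s := by
  unfold heavyWeight weight
  have : (1 + ‖s‖ ^ 2) ≠ 0 := by positivity
  field_simp

lemma heavyWeight_le (s : ℂ) : heavyWeight s ≤ weight s := by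
  rw [← heavyWeight_mul_le]
  nlinarith [mul_nonneg (sq_nonneg ‖s‖) (heavyWeight_pos s).le]

lemma norm_mul_heavyWeight_le (s : ℂ) : ‖s‖ * heavyWeight s ≤ weight s := by
  rw [← heavyWeight_mul_le]
  have := heavyWeight_pos s
  gcongr
  nlinarith [sq_nonneg (‖s‖ - 1), norm_nonneg s]

lemma norm_sq_mul_heavyWeight_le (s : ℂ) : ‖s‖ ^ 2 * heavyWeight s ≤ weight s := by
  rw [← heavyWeight_mul_le]
  have := heavyWeight_pos s
  gcongr
  linarith

section Transform
variable {E : Type*} [NormedAddCommGroup E] [NormedSpace ℂ E]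

omit [NormedSpace ℂ E] in
lemma integrable_of_le_weight {g : ℂ → E} (hg : Continuous g) {C : ℝ}
    (hC : ∀ s, ‖g s‖ ≤ C * weight s) : Integrable g :=
  (integrable_weight.const_mul C).mono' hg.aestronglyMeasurable (ae_of_all _ hC)

/-- The remainder of the two-term expansion of a Cauchy transform at infinity. -/
def cauchyRemainder (g : ℂ → E) (ξ : ℂ) : E :=
  (π : ℂ)⁻¹ • (∫ s, s • g s) + cauchyTransform (fun s => s ^ 2 • g s) ξ

lemma cauchyTransform_eq_expansion {g : ℂ → E} (hg : Continuous g) {C : ℝ}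
    (hC : ∀ s, ‖g s‖ ≤ C * heavyWeight s) {ξ : ℂ} (hξ : ξ ≠ 0) :
    cauchyTransform g ξ = ξ⁻¹ • ((π : ℂ)⁻¹ • ∫ s, g s) + (ξ ^ 2)⁻¹ • cauchyRemainder g ξ := by
  have hC0 : 0 ≤ C := nonneg_of_mul_nonneg_left ((norm_nonneg _).trans (hC 0)) (heavyWeight_pos 0)
  have h0 : ∀ s, ‖g s‖ ≤ C * weight s := fun s => (hC s).trans (by gcongr; exact heavyWeight_le s)
  have h1 : ∀ s, ‖s • g s‖ ≤ C * weight s := fun s => by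
    rw [norm_smul]
    calc ‖s‖ * ‖g s‖ ≤ ‖s‖ * (C * heavyWeight s) := by gcongr; exact hC s
      _ = C * (‖s‖ * heavyWeight s) := by ring
      _ ≤ _ := by gcongr; exact norm_mul_heavyWeight_le s
  have h2 : ∀ s, ‖s ^ 2 • g s‖ ≤ C * weight s := fun s => by
    rw [norm_smul, norm_pow]
    calc ‖s‖ ^ 2 * ‖g s‖ ≤ ‖s‖ ^ 2 * (C * heavyWeight s) := by gcongr; exact hC s
      _ = C * (‖s‖ ^ 2 * heavyWeight s) := by ring
      _ ≤ _ := by gcongr; exact norm_sq_mul_heavyWeight_le s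
  have i0 := integrable_of_le_weight hg h0
  have i1 := integrable_of_le_weight (g := fun s => s • g s) (by fun_prop) h1
  have i2 := integrable_sub_inv_smul (g := fun s => s ^ 2 • g s) (by fun_prop) h2 ξ
  have key : ∀ᵐ s, (s - ξ)⁻¹ • g s =
      (ξ ^ 2)⁻¹ • ((s - ξ)⁻¹ • s ^ 2 • g s) - (ξ⁻¹ • g s + (ξ ^ 2)⁻¹ • s • g s) := by
    have : ∀ᵐ s : ℂ, s ≠ ξ := by simp [ae_iff, measure_singleton]
    filter_upwards [this] with s hs
    have hs' : s - ξ ≠ 0 := sub_ne_zero.2 hs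
    simp only [smul_smul, ← add_smul, ← sub_smul]
    congr 1
    field_simp
    ring
  unfold cauchyTransform cauchyRemainder cauchyTransform
  have e1 : Integrable (fun s => ξ⁻¹ • g s) := i0.smul (ξ⁻¹)
  have e2 : Integrable (fun s => (ξ ^ 2)⁻¹ • s • g s) := i1.smul ((ξ ^ 2)⁻¹)
  have e3 : Integrable (fun s => (ξ ^ 2)⁻¹ • ((s - ξ)⁻¹ • s ^ 2 • g s)) := i2.smul ((ξ ^ 2)⁻¹)
  have e4 : Integrable (fun s => ξ⁻¹ • g s + (ξ ^ 2)⁻¹ • s • g s) := e1.add e2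
  rw [integral_congr_ae key, integral_sub e3 e4, integral_add e1 e2, integral_smul, integral_smul,
    integral_smul]
  module

lemma norm_cauchyRemainder_le {g : ℂ → E} {C : ℝ} (hC : ∀ s, ‖g s‖ ≤ C * heavyWeight s) (ξ : ℂ) :
    ‖cauchyRemainder g ξ‖ ≤ π⁻¹ * (C * ∫ s, weight s) + π⁻¹ * kernelBound * C := by
  have hC0 : 0 ≤ C := nonneg_of_mul_nonneg_left ((norm_nonneg _).trans (hC 0)) (heavyWeight_pos 0)
  refine (norm_add_le _ _).trans (add_le_add ?_ (norm_cauchyTransform_le (fun s => ?_) ξ))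
  · rw [norm_smul, norm_inv, Complex.norm_real, Real.norm_of_nonneg Real.pi_pos.le]
    gcongr
    rw [← integral_const_mul]
    refine norm_integral_le_of_norm_le (integrable_weight.const_mul C) (ae_of_all _ fun s => ?_)
    rw [norm_smul]
    calc ‖s‖ * ‖g s‖ ≤ ‖s‖ * (C * heavyWeight s) := by gcongr; exact hC s
      _ = C * (‖s‖ * heavyWeight s) := by ring
      _ ≤ _ := by gcongr; exact norm_mul_heavyWeight_le s
  · rw [norm_smul, norm_pow]
    calc ‖s‖ ^ 2 * ‖g s‖ ≤ ‖s‖ ^ 2 * (C * heavyWeight s) := by gcongr; exact hC s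
      _ = C * (‖s‖ ^ 2 * heavyWeight s) := by ring
      _ ≤ _ := by gcongr; exact norm_sq_mul_heavyWeight_le s

lemma norm_weight_smul_le (z : ℂ →ᵇ E) (s : ℂ) :
    ‖((heavyWeight s : ℝ) : ℂ) • z s‖ ≤ ‖z‖ * heavyWeight s := by
  rw [norm_smul, norm_real, Real.norm_of_nonneg (heavyWeight_pos s).le, mul_comm]
  have := heavyWeight_pos s
  gcongr
  exact z.norm_coe_le_norm s

lemma continuous_weight_smul (z : ℂ →ᵇ E) : Continuous fun s => ((heavyWeight s : ℝ) : ℂ) • z s :=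
  (continuous_ofReal.comp continuous_heavyWeight).smul z.continuous

lemma norm_weight_smul_le' (z : ℂ →ᵇ E) (s : ℂ) :
    ‖((heavyWeight s : ℝ) : ℂ) • z s‖ ≤ ‖z‖ * weight s :=
  (norm_weight_smul_le z s).trans (by gcongr; exact heavyWeight_le s)

lemma integrable_weight_smul (z : ℂ →ᵇ E) : Integrable fun s => ((heavyWeight s : ℝ) : ℂ) • z s :=
  integrable_of_le_weight (continuous_weight_smul z) (norm_weight_smul_le' z)

/-- The Cauchy transform of `heavyWeight • z` as a bounded operator on bounded continuous
functions. -/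
def cauchyOp : (ℂ →ᵇ E) →L[ℝ] (ℂ →ᵇ E) := LinearMap.mkContinuous
    { toFun := fun z => BoundedContinuousFunction.ofNormedAddCommGroup
        (cauchyTransform fun s => ((heavyWeight s : ℝ) : ℂ) • z s)
        (continuous_cauchyTransform (continuous_weight_smul z) (norm_weight_smul_le' z)) _
        (norm_cauchyTransform_le (norm_weight_smul_le' z))
      map_add' := fun z z' => by
        ext ξ
        simp only [cauchyTransform, BoundedContinuousFunction.coe_ofNormedAddCommGroup,
          BoundedContinuousFunction.coe_add, Pi.add_apply, smul_add]
        rw [integral_add (integrable_sub_inv_smul (continuous_weight_smul z) (norm_weight_smul_le' z) ξ)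
          (integrable_sub_inv_smul (continuous_weight_smul z') (norm_weight_smul_le' z') ξ)]
        module
      map_smul' := fun c z => by
        ext ξ
        simp only [cauchyTransform, BoundedContinuousFunction.coe_ofNormedAddCommGroup,
          BoundedContinuousFunction.coe_smul, RingHom.id_apply]
        simp_rw [← Complex.coe_smul c, smul_comm _ (c : ℂ)]
        rw [integral_smul, smul_neg, smul_comm] }
    (π⁻¹ * kernelBound) fun z => by
      refine (BoundedContinuousFunction.norm_le ?_).2 fun ξ => ?_
      · have := norm_cauchyTransform_le (norm_weight_smul_le' z) 0
        exact (norm_nonneg _).trans this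
      · exact norm_cauchyTransform_le (norm_weight_smul_le' z) ξ

lemma cauchyOp_apply (z : ℂ →ᵇ E) (ξ : ℂ) :
    cauchyOp z ξ = cauchyTransform (fun s => ((heavyWeight s : ℝ) : ℂ) • z s) ξ := rfl

/-- The coefficient of `1/ξ` in the Cauchy transform of `heavyWeight • z`. -/
def momentOp : (ℂ →ᵇ E) →L[ℝ] E := LinearMap.mkContinuous
    { toFun := fun z => (π : ℂ)⁻¹ • ∫ s, ((heavyWeight s : ℝ) : ℂ) • z s
      map_add' := fun z z' => by
        simp only [BoundedContinuousFunction.coe_add, Pi.add_apply, smul_add]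
        rw [integral_add (integrable_weight_smul z) (integrable_weight_smul z'), smul_add]
      map_smul' := fun c z => by
        simp only [BoundedContinuousFunction.coe_smul, RingHom.id_apply]
        simp_rw [← Complex.coe_smul c, smul_comm _ (c : ℂ)]
        rw [integral_smul, smul_comm] }
    (π⁻¹ * ∫ s, weight s) fun z => by
      simp only [LinearMap.coe_mk, AddHom.coe_mk]
      rw [norm_smul, norm_inv, Complex.norm_real, Real.norm_of_nonneg Real.pi_pos.le, mul_assoc]
      gcongr
      rw [mul_comm, ← integral_const_mul]
      exact norm_integral_le_of_norm_le (integrable_weight.const_mul _)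
        (ae_of_all _ (norm_weight_smul_le' z))

/-- `f` has the expansion `l + m/ξ + O(ξ⁻²)` at infinity. -/
def ExpandsTo (f : ℂ → E) (l m : E) : Prop :=
  (fun ξ => f ξ - l - ξ⁻¹ • m) =O[cobounded ℂ] fun ξ => (ξ ^ 2)⁻¹

lemma eventually_ne_zero_cobounded : ∀ᶠ ξ in cobounded ℂ, ξ ≠ (0:ℂ) := by
  rw [(Metric.hasBasis_cobounded_compl_closedBall (0:ℂ)).eventually_iff]
  exact ⟨0, trivial, fun z hz => by simpa using hz⟩

lemma expandsTo_of_eq_cauchyTransform {f g : ℂ → E} {l : E} (hg : Continuous g) {C : ℝ}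
    (hC : ∀ s, ‖g s‖ ≤ C * heavyWeight s) (hf : ∀ ξ, f ξ = l + cauchyTransform g ξ) :
    ExpandsTo f l ((π : ℂ)⁻¹ • ∫ s, g s) := by
  refine IsBigO.of_bound (π⁻¹ * (C * ∫ s, weight s) + π⁻¹ * kernelBound * C) ?_
  filter_upwards [eventually_ne_zero_cobounded] with ξ hξ
  rw [hf, cauchyTransform_eq_expansion hg hC hξ]
  rw [add_sub_cancel_left, add_sub_cancel_left, norm_smul, mul_comm]
  gcongr
  exact norm_cauchyRemainder_le hC ξ

lemma expandsTo_cauchyOp (z : ℂ →ᵇ E) : ExpandsTo (cauchyOp z) 0 (momentOp z) :=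
  expandsTo_of_eq_cauchyTransform (continuous_weight_smul z) (norm_weight_smul_le z)
    (fun ξ => by rw [zero_add]; rfl)

end Transform

/-! ## Resolvents of small operators -/

section SmallNorm
variable {A : Type*} [NormedRing A] [NormedAlgebra ℝ A] [CompleteSpace A]
  {P : Type*} [NormedAddCommGroup P] [NormedSpace ℝ P]

/-- A solution of `W = 1 + T (W b)` with small `b` depends smoothly on `b`. -/
lemma contDiffWithinAt_of_fixedPoint (T : A →L[ℝ] A) {s : Set P} {p₀ : P} (hp₀ : p₀ ∈ s)
    {b W : P → A}
    (hb : ContDiffWithinAt ℝ ∞ b s p₀) (hb0 : b p₀ = 0)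
    (hW : ∀ᶠ p in 𝓝[s] p₀, W p = 1 + T (W p * b p)) :
    ContDiffWithinAt ℝ ∞ W s p₀ := by
  set L : A →L[ℝ] (A →L[ℝ] A) :=
    (ContinuousLinearMap.compL ℝ A A A T).comp (ContinuousLinearMap.mul ℝ A).flip with hL
  have hLa : ∀ x y, L x y = T (y * x) := fun x y => rfl
  have hs : ContDiffWithinAt ℝ ∞ (fun p => Ring.inverse (1 - L (b p)) (1 : A)) s p₀ := by
    have h1 : ContDiffWithinAt ℝ ∞ (fun p => 1 - L (b p)) s p₀ :=
      contDiffWithinAt_const.sub (L.contDiff.contDiffAt.comp_contDiffWithinAt p₀ hb)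
    have h2 : ContDiffAt ℝ ∞ (Ring.inverse : (A →L[ℝ] A) → _) (1 - L (b p₀)) := by
      rw [hb0, map_zero, sub_zero]
      exact contDiffAt_ringInverse ℝ (1 : (A →L[ℝ] A)ˣ)
    exact (h2.comp_contDiffWithinAt p₀ h1).clm_apply contDiffWithinAt_const
  have hev : ∀ᶠ p in 𝓝[s] p₀, W p = Ring.inverse (1 - L (b p)) (1 : A) := by
    have hc : Tendsto (fun p => ‖L (b p)‖) (𝓝[s] p₀) (𝓝 0) := by
      have := ((L.continuous.tendsto _).comp hb.continuousWithinAt.tendsto).norm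
      simpa [hb0] using this
    filter_upwards [hW, hc.eventually (gt_mem_nhds one_pos)] with p hp hlt
    have hu : IsUnit (1 - L (b p)) := isUnit_one_sub_of_norm_lt_one hlt
    have h1 : (1 - L (b p)) (W p) = 1 := by
      change W p - L (b p) (W p) = 1
      rw [hLa]
      nth_rewrite 1 [hp]
      abel
    have h2 := congrArg (fun F : A →L[ℝ] A => F (W p)) (Ring.inverse_mul_cancel _ hu)
    simp only [mul_apply_eq_comp, h1] at h2
    exact h2.symm
  exact hs.congr_of_eventuallyEq hev (hev.self_of_nhdsWithin hp₀)

end SmallNorm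

/-! ## Smooth families of exponentials -/

lemma norm_exp_sub_one_le (d : ℂ) : ‖exp d - 1‖ ≤ ‖d‖ * max 1 (Real.exp d.re) := by
  have := norm_image_sub_le_of_norm_deriv_le_segment_01' (f := fun t : ℝ => exp (t * d))
    (f' := fun t : ℝ => d * exp (t * d)) (C := ‖d‖ * max 1 (Real.exp d.re)) ?_ ?_
  · simpa using this
  · intro t _
    have h := (((hasDerivAt_id t).ofReal_comp.mul_const d).cexp)
    refine (h.congr_deriv ?_).hasDerivWithinAt
    simp; ring
  · intro t ht
    rw [norm_mul, norm_exp]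
    gcongr
    simp only [re_ofReal_mul]
    rcases le_total d.re 0 with h | h
    · exact le_max_of_le_left (by rw [Real.exp_le_one_iff]; nlinarith [ht.1])
    · exact le_max_of_le_right (by gcongr; nlinarith [ht.2])

lemma norm_exp_sub_one_sub_le (d : ℂ) : ‖exp d - 1 - d‖ ≤ ‖d‖ ^ 2 * max 1 (Real.exp d.re) := by
  have := norm_image_sub_le_of_norm_deriv_le_segment_01' (f := fun t : ℝ => exp (t * d) - t * d)
    (f' := fun t : ℝ => d * (exp (t * d) - 1)) (C := ‖d‖ ^ 2 * max 1 (Real.exp d.re)) ?_ ?_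
  · have h2 : exp d - 1 - d = (fun t : ℝ => exp (t * d) - t * d) 1 -
      (fun t : ℝ => exp (t * d) - t * d) 0 := by simp; ring
    rw [h2]; exact this
  · intro t _
    have h := (((hasDerivAt_id t).ofReal_comp.mul_const d).cexp).sub
      ((hasDerivAt_id t).ofReal_comp.mul_const d)
    refine (h.congr_deriv ?_).hasDerivWithinAt
    simp; ring
  · intro t ht
    rw [norm_mul, sq, mul_assoc]
    gcongr
    refine (norm_exp_sub_one_le _).trans ?_
    rw [norm_mul, norm_real, Real.norm_of_nonneg ht.1]
    have h1 : t * ‖d‖ ≤ ‖d‖ := mul_le_of_le_one_left (norm_nonneg _) ht.2.le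
    gcongr ?_ * ?_
    simp only [re_ofReal_mul]
    rcases le_total d.re 0 with h | h
    · exact max_le (le_max_left _ _)
        (le_max_of_le_left (by rw [Real.exp_le_one_iff]; nlinarith [ht.1]))
    · exact max_le (le_max_left _ _) (le_max_of_le_right (by gcongr; nlinarith [ht.2]))

lemma norm_exp_taylor_le (x y : ℂ) : ‖exp y - exp x - (y - x) * exp x‖ ≤
      ‖y - x‖ ^ 2 * (Real.exp x.re + Real.exp y.re) := by
  have h : exp y - exp x - (y - x) * exp x = exp x * (exp (y - x) - 1 - (y - x)) := by
    rw [exp_sub]; field_simp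
  rw [h, norm_mul, norm_exp]
  calc Real.exp x.re * ‖exp (y - x) - 1 - (y - x)‖
      ≤ Real.exp x.re * (‖y - x‖ ^ 2 * max 1 (Real.exp (y - x).re)) := by
        gcongr; exact norm_exp_sub_one_sub_le _
    _ = ‖y - x‖ ^ 2 * (Real.exp x.re * max 1 (Real.exp (y - x).re)) := by ring
    _ ≤ _ := by
        gcongr
        rw [mul_max_of_nonneg _ _ (Real.exp_pos _).le, mul_one, ← Real.exp_add]
        refine max_le ?_ ?_
        · linarith [Real.exp_pos y.re]
        · simp; positivity

section ExpFamily
variable {E : Type*} [NormedAddCommGroup E] [NormedSpace ℂ E]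

abbrev Param := ℝ × ℝ × ℝ

/-- Amplitude `a` and phase `ℓ` for which `p ↦ exp (ℓ p) • a` is a bounded family of bounded
continuous functions together with all its parameter derivatives. -/
structure IsExpFamily (s : Set Param) (ℓ : ℂ → Param →L[ℝ] ℂ) (a : ℂ → E) : Prop where
  cont : ∀ ξ, (∀ᶠ z in 𝓝 ξ, a z = 0) ∨ (ContinuousAt a ξ ∧ ContinuousAt ℓ ξ)
  bound : ∀ n : ℕ, ∃ C, ∀ ξ, ∀ p ∈ s, ‖ℓ ξ‖ ^ n * (Real.exp (ℓ ξ p).re * ‖a ξ‖) ≤ C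

variable {s : Set Param} {ℓ : ℂ → Param →L[ℝ] ℂ} {a : ℂ → E}

lemma IsExpFamily.smul (h : IsExpFamily s ℓ a) (v : Param) :
    IsExpFamily s ℓ (fun ξ => ℓ ξ v • a ξ) where
  cont ξ := by
    rcases h.cont ξ with h1 | ⟨h1, h2⟩
    · left; filter_upwards [h1] with z hz; rw [hz, smul_zero]
    · right; exact ⟨(h2.clm_apply continuousAt_const).smul h1, h2⟩
  bound n := by
    obtain ⟨C, hC⟩ := h.bound (n + 1)
    refine ⟨C * ‖v‖, fun ξ p hp => ?_⟩
    rw [norm_smul]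
    have h1 := hC ξ p hp
    calc ‖ℓ ξ‖ ^ n * (Real.exp (ℓ ξ p).re * (‖ℓ ξ v‖ * ‖a ξ‖))
        ≤ ‖ℓ ξ‖ ^ n * (Real.exp (ℓ ξ p).re * ((‖ℓ ξ‖ * ‖v‖) * ‖a ξ‖)) := by
          gcongr; exact (ℓ ξ).le_opNorm v
      _ = ‖ℓ ξ‖ ^ (n + 1) * (Real.exp (ℓ ξ p).re * ‖a ξ‖) * ‖v‖ := by ring
      _ ≤ _ := by gcongr

lemma IsExpFamily.continuous (h : IsExpFamily s ℓ a) (p : Param) :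
    Continuous fun ξ => exp (ℓ ξ p) • a ξ := by
  rw [continuous_iff_continuousAt]
  intro ξ
  rcases h.cont ξ with h1 | ⟨h1, h2⟩
  · have : (fun ξ => exp (ℓ ξ p) • a ξ) =ᶠ[𝓝 ξ] fun _ => 0 := by
      filter_upwards [h1] with z hz; rw [hz, smul_zero]
    exact continuousAt_const.congr this.symm
  · exact ((h2.clm_apply continuousAt_const).cexp).smul h1

open Classical in
/-- The family `p ↦ exp (ℓ p) • a` of bounded continuous functions. -/
def expFamily (h : IsExpFamily s ℓ a) (p : Param) : ℂ →ᵇ E := if hp : p ∈ s then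
    BoundedContinuousFunction.ofNormedAddCommGroup (fun ξ => exp (ℓ ξ p) • a ξ) (h.continuous p)
      (h.bound 0).choose (fun ξ => by
        have := (h.bound 0).choose_spec ξ p hp
        rw [norm_smul, norm_exp]; simpa using this)
  else 0

lemma expFamily_apply (h : IsExpFamily s ℓ a) {p : Param} (hp : p ∈ s) (ξ : ℂ) :
    expFamily h p ξ = exp (ℓ ξ p) • a ξ := by
  simp [expFamily, hp]

/-- The derivative of an exponential family. -/
def expFamilyDeriv (h : IsExpFamily s ℓ a) (p : Param) : Param →L[ℝ] (ℂ →ᵇ E) :=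
  (ContinuousLinearMap.fst ℝ ℝ (ℝ × ℝ)).smulRight (expFamily (h.smul (1, 0, 0)) p) +
  ((ContinuousLinearMap.fst ℝ ℝ ℝ).comp (ContinuousLinearMap.snd ℝ ℝ (ℝ × ℝ))).smulRight
    (expFamily (h.smul (0, 1, 0)) p) +
  ((ContinuousLinearMap.snd ℝ ℝ ℝ).comp (ContinuousLinearMap.snd ℝ ℝ (ℝ × ℝ))).smulRight
    (expFamily (h.smul (0, 0, 1)) p)

lemma expFamilyDeriv_apply (h : IsExpFamily s ℓ a) {p : Param} (hp : p ∈ s) (v : Param) (ξ : ℂ) :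
    expFamilyDeriv h p v ξ = (ℓ ξ v * exp (ℓ ξ p)) • a ξ := by
  have hv : ℓ ξ v = v.1 * ℓ ξ (1, 0, 0) + v.2.1 * ℓ ξ (0, 1, 0) + v.2.2 * ℓ ξ (0, 0, 1) := by
    have : v = v.1 • ((1, 0, 0) : Param) + v.2.1 • ((0, 1, 0) : Param) +
      v.2.2 • ((0, 0, 1) : Param) := by ext <;> simp
    conv_lhs => rw [this]
    simp only [map_add, map_smul, real_smul]
  simp only [expFamilyDeriv, _root_.add_apply, ContinuousLinearMap.smulRight_apply,
    BoundedContinuousFunction.coe_add, Pi.add_apply, BoundedContinuousFunction.coe_smul,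
    expFamily_apply _ hp, ContinuousLinearMap.coe_fst', ContinuousLinearMap.coe_snd',
    ContinuousLinearMap.comp_apply]
  rw [hv]
  simp only [← Complex.coe_smul, smul_smul, ← add_smul]
  congr 1
  ring

lemma hasFDerivWithinAt_expFamily (h : IsExpFamily s ℓ a) {p : Param} (hp : p ∈ s) :
    HasFDerivWithinAt (expFamily h) (expFamilyDeriv h p) s p := by
  obtain ⟨C, hC⟩ := h.bound 2
  rw [hasFDerivWithinAt_iff_isLittleO]
  have hO : (fun q => expFamily h q - expFamily h p - expFamilyDeriv h p (q - p)) =O[𝓝[s] p]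
      fun q => ‖q - p‖ ^ 2 := by
    refine IsBigO.of_bound (2 * |C|) ?_
    filter_upwards [self_mem_nhdsWithin] with q hq
    refine (BoundedContinuousFunction.norm_le (by positivity)).2 fun ξ => ?_
    simp only [BoundedContinuousFunction.coe_sub, Pi.sub_apply, expFamily_apply h hp,
      expFamily_apply h hq, expFamilyDeriv_apply h hp, ← sub_smul]
    rw [norm_smul]
    have h1 := norm_exp_taylor_le (ℓ ξ p) (ℓ ξ q)
    rw [← map_sub] at h1
    calc _ ≤ ‖ℓ ξ (q - p)‖ ^ 2 * (Real.exp (ℓ ξ p).re + Real.exp (ℓ ξ q).re) * ‖a ξ‖ := by gcongr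
      _ ≤ (‖ℓ ξ‖ * ‖q - p‖) ^ 2 * (Real.exp (ℓ ξ p).re + Real.exp (ℓ ξ q).re) * ‖a ξ‖ := by
          gcongr; exact (ℓ ξ).le_opNorm _
      _ = (‖ℓ ξ‖ ^ 2 * (Real.exp (ℓ ξ p).re * ‖a ξ‖) +
            ‖ℓ ξ‖ ^ 2 * (Real.exp (ℓ ξ q).re * ‖a ξ‖)) * ‖q - p‖ ^ 2 := by ring
      _ ≤ (|C| + |C|) * ‖q - p‖ ^ 2 := by
          gcongr
          · exact (hC ξ p hp).trans (le_abs_self C)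
          · exact (hC ξ q hq).trans (le_abs_self C)
      _ = _ := by rw [Real.norm_of_nonneg (by positivity)]; ring
  refine hO.trans_isLittleO ?_
  have h3 : (fun q : Param => ‖q - p‖ ^ 2) =o[𝓝 p] fun q => q - p :=
    isLittleO_pow_sub_sub p one_lt_two
  exact h3.mono nhdsWithin_le_nhds

lemma contDiffOn_expFamily_nat (n : ℕ) : ∀ {a : ℂ → E} (h : IsExpFamily s ℓ a),
    ContDiffOn ℝ n (expFamily h) s := by
  induction n with
  | zero =>
    intro a h
    refine contDiffOn_zero.2 fun p hp => (hasFDerivWithinAt_expFamily h hp).continuousWithinAt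
  | succ n ih =>
    intro a h
    rw [Nat.cast_succ, contDiffOn_succ_iff_hasFDerivWithinAt (by simp)]
    intro p hp
    refine ⟨s, ?_, by simp, expFamilyDeriv h, fun q hq => hasFDerivWithinAt_expFamily h hq, ?_⟩
    · rw [insert_eq_of_mem hp]; exact self_mem_nhdsWithin
    · unfold expFamilyDeriv
      refine ((?_ : ContDiffOn ℝ n _ s).add ?_).add ?_
      · exact contDiffOn_const.smulRight (ih _)
      · exact contDiffOn_const.smulRight (ih _)
      · exact contDiffOn_const.smulRight (ih _)

lemma contDiffOn_expFamily (h : IsExpFamily s ℓ a) : ContDiffOn ℝ ∞ (expFamily h) s :=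
  contDiffOn_infty.2 fun n => contDiffOn_expFamily_nat n h

end ExpFamily

/-! ## Matrix-valued functions -/

section MatrixFunctions

lemma mat_eq_sum (A : Mat3) : A = ∑ i, ∑ j, A i j • Matrix.single i j (1 : ℂ) := by
  conv_lhs => rw [Matrix.matrix_eq_sum_single A]
  simp [Matrix.smul_single]

/-- The entry of a matrix as a continuous linear map. -/
def entryCLM (i j : Fin 3) : Mat3 →L[ℂ] ℂ :=
  LinearMap.toContinuousLinearMap (Matrix.entryLinearMap ℂ ℂ i j)

lemma differentiableWithinAt_mat {f : ℂ → Mat3} {s : Set ℂ} {z : ℂ}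
    (h : ∀ i j, DifferentiableWithinAt ℂ (fun z => f z i j) s z) : DifferentiableWithinAt ℂ f s z := by
  rw [show f = fun z => ∑ i, ∑ j, f z i j • Matrix.single i j (1 : ℂ) from
    funext fun z => mat_eq_sum _]
  exact .fun_sum fun i _ => .fun_sum fun j _ => (h i j).smul_const _

lemma differentiableOn_mat {f : ℂ → Mat3} {s : Set ℂ}
    (h : ∀ i j, DifferentiableOn ℂ (fun z => f z i j) s) : DifferentiableOn ℂ f s :=
  fun z hz => differentiableWithinAt_mat fun i j => h i j z hz

lemma differentiableAt_mat {f : ℂ → Mat3} {z : ℂ}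
    (h : ∀ i j, DifferentiableAt ℂ (fun z => f z i j) z) : DifferentiableAt ℂ f z :=
  differentiableWithinAt_univ.1 (differentiableWithinAt_mat fun i j =>
    (h i j).differentiableWithinAt)

lemma analyticAt_mat {f : ℂ → Mat3} {z : ℂ}
    (h : ∀ i j, AnalyticAt ℂ (fun z => f z i j) z) : AnalyticAt ℂ f z := by
  rw [show f = fun z => ∑ i, ∑ j, f z i j • Matrix.single i j (1 : ℂ) from
    funext fun z => mat_eq_sum _]
  refine Finset.analyticAt_fun_sum _ fun i _ => Finset.analyticAt_fun_sum _ fun j _ => ?_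
  exact (h i j).smul analyticAt_const

lemma norm_entry_le (A : Mat3) (i j : Fin 3) : ‖A i j‖ ≤ ‖A‖ := by
  rw [Matrix.linfty_opNorm_def]
  have h1 : ‖A i j‖₊ ≤ ∑ k, ‖A i k‖₊ :=
    Finset.single_le_sum (f := fun k => ‖A i k‖₊) (fun _ _ => zero_le) (Finset.mem_univ j)
  have h2 := Finset.le_sup (f := fun i => ∑ k, ‖A i k‖₊) (Finset.mem_univ i)
  exact_mod_cast h1.trans h2

lemma norm_le_sum_entries (A : Mat3) : ‖A‖ ≤ ∑ i, ∑ j, ‖A i j‖ := by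
  conv_lhs => rw [mat_eq_sum A]
  refine (norm_sum_le _ _).trans (Finset.sum_le_sum fun i _ => (norm_sum_le _ _).trans
    (Finset.sum_le_sum fun j _ => ?_))
  rw [norm_smul]
  refine mul_le_of_le_one_right (norm_nonneg _) ?_
  rw [Matrix.linfty_opNorm_def]
  norm_cast
  refine Finset.sup_le fun k _ => ?_
  rw [Finset.sum_eq_single j]
  · by_cases h : i = k
    · subst h; simp
    · simp [h]
  · intro b _ hb; simp [hb.symm]
  · simp

lemma isBigO_mat {l : Filter ℂ} {f : ℂ → Mat3} {g : ℂ → ℂ}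
    (h : ∀ i j, (fun z => f z i j) =O[l] g) : f =O[l] g := by
  have h1 : f =O[l] fun z => ∑ i, ∑ j, ‖f z i j‖ :=
    IsBigO.of_bound 1 (Eventually.of_forall fun z => by
      rw [one_mul]; exact (norm_le_sum_entries _).trans (le_abs_self _))
  refine h1.trans ?_
  exact IsBigO.fun_sum fun i _ => IsBigO.fun_sum fun j _ => (h i j).norm_left

lemma isBigO_entry {l : Filter ℂ} {f : ℂ → Mat3} {g : ℂ → ℂ} (h : f =O[l] g) (i j : Fin 3) :
    (fun z => f z i j) =O[l] g :=
  (IsBigO.of_bound 1 (Eventually.of_forall fun z => by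
    rw [one_mul]; exact norm_entry_le _ i j)).trans h

lemma isUnit_of_det_ne_zero {A : Mat3} (h : A.det ≠ 0) : IsUnit A :=
  (Matrix.isUnit_iff_isUnit_det A).2 (isUnit_iff_ne_zero.2 h)

lemma tendsto_mat_inv {ι : Type*} {l : Filter ι} {f : ι → Mat3} {A : Mat3} (hA : A.det ≠ 0)
    (h : Tendsto f l (𝓝 A)) : Tendsto (fun x => (f x)⁻¹) l (𝓝 A⁻¹) := by
  obtain ⟨u, rfl⟩ := isUnit_of_det_ne_zero hA
  simp_rw [Matrix.nonsing_inv_eq_ringInverse]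
  exact (NormedRing.inverse_continuousAt u).tendsto.comp h

lemma differentiableAt_mat_inv {f : ℂ → Mat3} {z : ℂ} (hA : (f z).det ≠ 0)
    (h : DifferentiableAt ℂ f z) : DifferentiableAt ℂ (fun x => (f x)⁻¹) z := by
  obtain ⟨u, hu⟩ := isUnit_of_det_ne_zero hA
  simp_rw [Matrix.nonsing_inv_eq_ringInverse]
  have h2 : DifferentiableAt ℂ (Ring.inverse : Mat3 → Mat3) (f z) := by
    exact differentiableAt_inverse (hu ▸ u.isUnit)
  exact h2.comp z h

lemma continuous_det : Continuous (fun A : Mat3 => A.det) := by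
  exact Continuous.matrix_det continuous_id

lemma differentiableAt_det {f : ℂ → Mat3} {z : ℂ} (h : DifferentiableAt ℂ f z) :
    DifferentiableAt ℂ (fun x => (f x).det) z := by
  have he : ∀ i j, DifferentiableAt ℂ (fun x => f x i j) z := fun i j =>
    (entryCLM i j).differentiableAt.comp z h
  simp only [Matrix.det_fin_three]
  fun_prop (disch := exact he _ _)

end MatrixFunctions

/-! ## Geometry of the contour -/

lemma expI_re (θ : ℝ) : (expI θ).re = Real.cos θ := by
  unfold expI; rw [exp_mul_I]; simp [← ofReal_cos, ← ofReal_sin]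

lemma expI_im (θ : ℝ) : (expI θ).im = Real.sin θ := by
  unfold expI; rw [exp_mul_I]; simp [← ofReal_cos, ← ofReal_sin]

lemma norm_expI (θ : ℝ) : ‖expI θ‖ = 1 := norm_exp_ofReal_mul_I θ

lemma expI_ne_zero (θ : ℝ) : expI θ ≠ 0 := exp_ne_zero _

lemma re_sub_im_eq (z : ℂ) : z.re - z.im = ‖z‖ * √2 * Real.sin (π / 4 - z.arg) := by
  have h1 := norm_mul_cos_arg z
  have h2 := norm_mul_sin_arg z
  rw [Real.sin_sub, Real.sin_pi_div_four, Real.cos_pi_div_four, ← h1, ← h2]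
  have h3 : √2 * √2 = 2 := Real.mul_self_sqrt (by norm_num)
  linear_combination (-‖z‖ * Real.cos z.arg / 2 + ‖z‖ * Real.sin z.arg / 2) * h3

lemma im_pos_iff (z : ℂ) : 0 < z.im ↔ 0 < z.arg ∧ z.arg < π := by
  rw [lt_iff_le_and_ne, ← arg_nonneg_iff, arg_lt_pi_iff]
  have := arg_eq_zero_iff (z := z)
  have := arg_eq_pi_iff (z := z)
  have := arg_le_pi z
  grind [Real.pi_pos]

lemma im_neg_iff (z : ℂ) : z.im < 0 ↔ z.arg < 0 := arg_neg_iff.symm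

lemma im_lt_re_iff {z : ℂ} (hz : z ≠ 0) : z.im < z.re ↔ -(3 * π / 4) < z.arg ∧ z.arg < π / 4 := by
  have hp := Real.pi_pos
  have hn : 0 < ‖z‖ * √2 := by positivity
  rw [← sub_pos, re_sub_im_eq, mul_pos_iff_of_pos_left hn]
  constructor
  · intro h
    by_contra hcon
    rw [not_and_or, not_lt, not_lt] at hcon
    rcases hcon with h1 | h1
    · have h3 : Real.sin (π / 4 - z.arg) = -Real.sin (π / 4 - z.arg - π) := by
        rw [Real.sin_sub_pi]; ring
      have := Real.sin_nonneg_of_nonneg_of_le_pi (x := π / 4 - z.arg - π) (by linarith)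
        (by linarith [neg_pi_lt_arg z])
      linarith
    · have := Real.sin_nonpos_of_nonpos_of_neg_pi_le (x := π / 4 - z.arg) (by linarith)
        (by linarith [arg_le_pi z])
      linarith
  · rintro ⟨h1, h2⟩
    exact Real.sin_pos_of_pos_of_lt_pi (by linarith) (by linarith)

lemma neg_im_lt_re_iff {z : ℂ} (hz : z ≠ 0) :
    -z.im < z.re ↔ -(π / 4) < z.arg ∧ z.arg < 3 * π / 4 := by
  have h := im_lt_re_iff ((map_ne_zero (starRingEnd ℂ)).2 hz)
  rw [conj_im, conj_re, arg_conj] at h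
  grind [Real.pi_pos]

lemma re_lt_im_iff {z : ℂ} (hz : z ≠ 0) : z.re < z.im ↔ z.arg < -(3 * π / 4) ∨ π / 4 < z.arg := by
  have h := im_lt_re_iff (neg_ne_zero.2 hz)
  rw [neg_im, neg_re, neg_lt_neg_iff] at h
  have h1 := arg_neg_eq_arg_sub_pi_iff (x := z)
  have h2 := arg_neg_eq_arg_add_pi_iff (x := z)
  have := im_pos_iff z
  have := arg_eq_pi_iff (z := z)
  have := arg_eq_zero_iff (z := z)
  grind [Real.pi_pos, arg_le_pi z, neg_pi_lt_arg z, im_neg_iff z, Complex.ext_iff]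

lemma re_lt_neg_im_iff {z : ℂ} (hz : z ≠ 0) :
    z.re < -z.im ↔ z.arg < -(π / 4) ∨ 3 * π / 4 < z.arg := by
  have h := re_lt_im_iff ((map_ne_zero (starRingEnd ℂ)).2 hz)
  rw [conj_im, conj_re, arg_conj] at h
  grind [Real.pi_pos]

lemma mem_contour_iff {z : ℂ} : z ∈ contour ↔ z.im = 0 ∨ z.re = z.im ∨ z.re = -z.im := by
  by_cases hz : z = 0
  · subst hz; simp [contour]
  simp only [contour, mem_ofPred_eq]
  grind [Real.pi_pos, im_lt_re_iff hz, re_lt_im_iff hz, neg_im_lt_re_iff hz, re_lt_neg_im_iff hz,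
    im_pos_iff z, im_neg_iff z, neg_pi_lt_arg z, arg_le_pi z]

lemma isClosed_contour : IsClosed contour := by
  have : contour = {z | z.im = 0} ∪ ({z | z.re = z.im} ∪ {z | z.re = -z.im}) := by
    ext z; rw [mem_contour_iff]; rfl
  rw [this]
  exact (isClosed_eq continuous_im continuous_const).union
    ((isClosed_eq continuous_re continuous_im).union (isClosed_eq continuous_re continuous_im.neg))

lemma isOpen_compl_contour : IsOpen contourᶜ := isClosed_contour.isOpen_compl

lemma zero_mem_contour : (0 : ℂ) ∈ contour := by rw [mem_contour_iff]; simp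

lemma ne_zero_of_notMem_contour {z : ℂ} (hz : z ∈ contourᶜ) : z ≠ 0 := by
  rintro rfl; exact hz zero_mem_contour

lemma dense_compl_contour : Dense contourᶜ := by
  intro z
  -- approach along a direction which is transversal to all rays
  have hev : ∀ᶠ t : ℝ in 𝓝[>] 0, z + t * (1 + 2 * I) ∈ contourᶜ := by
    have h1 : ∀ a b : ℝ, b ≠ 0 → ∀ᶠ t : ℝ in 𝓝[>] 0, a + t * b ≠ 0 := by
      intro a b hb
      by_cases ha : a = 0
      · filter_upwards [self_mem_nhdsWithin] with t ht
        rw [ha, zero_add]; exact mul_ne_zero (ne_of_gt ht) hb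
      · have : Tendsto (fun t : ℝ => a + t * b) (𝓝 0) (𝓝 (a + 0 * b)) := by
          apply Continuous.tendsto; fun_prop
        rw [zero_mul, add_zero] at this
        exact (this.mono_left nhdsWithin_le_nhds).eventually_ne ha
    filter_upwards [h1 z.im 2 (by norm_num), h1 (z.re - z.im) (-1) (by norm_num),
      h1 (z.re + z.im) 3 (by norm_num)] with t h1 h2 h3
    rw [mem_compl_iff, mem_contour_iff]
    simp only [add_im, add_re, mul_re, mul_im, ofReal_re, ofReal_im, one_re, one_im, I_re, I_im,
      re_ofNat, im_ofNat]
    push Not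
    refine ⟨fun h => h1 (by linarith), fun h => h2 (by linarith), fun h => h3 (by linarith)⟩
  have hlim : Tendsto (fun t : ℝ => z + t * (1 + 2 * I)) (𝓝[>] 0) (𝓝 z) := by
    have : Tendsto (fun t : ℝ => z + t * (1 + 2 * I)) (𝓝 0) (𝓝 (z + (0:ℝ) * (1 + 2 * I))) := by
      apply Continuous.tendsto; fun_prop
    rw [ofReal_zero, zero_mul, add_zero] at this
    exact this.mono_left nhdsWithin_le_nhds
  exact mem_closure_of_tendsto hlim hev

lemma mem_sector_0_quarter {z : ℂ} : z ∈ sector 0 (π / 4) ↔ 0 < z.im ∧ z.im < z.re := by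
  by_cases hz : z = 0
  · subst hz; simp [sector]
  rw [im_pos_iff, im_lt_re_iff hz, sector, mem_ofPred_eq]
  grind [Real.pi_pos, neg_pi_lt_arg z]

lemma mem_sector_quarter_three {z : ℂ} : z ∈ sector (π / 4) (3 * π / 4) ↔
    z.re < z.im ∧ -z.im < z.re := by
  by_cases hz : z = 0
  · subst hz; simp [sector]; grind [Real.pi_pos]
  rw [re_lt_im_iff hz, neg_im_lt_re_iff hz, sector, mem_ofPred_eq]
  grind [Real.pi_pos, neg_pi_lt_arg z]

lemma mem_sector_three_pi {z : ℂ} : z ∈ sector (3 * π / 4) π ↔ 0 < z.im ∧ z.re < -z.im := by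
  by_cases hz : z = 0
  · subst hz; simp [sector]; grind [Real.pi_pos]
  rw [im_pos_iff, re_lt_neg_im_iff hz, sector, mem_ofPred_eq]
  grind [Real.pi_pos, neg_pi_lt_arg z]

lemma mem_sector_neg_quarter_0 {z : ℂ} : z ∈ sector (-(π / 4)) 0 ↔ z.im < 0 ∧ -z.im < z.re := by
  by_cases hz : z = 0
  · subst hz; simp [sector]
  rw [im_neg_iff, neg_im_lt_re_iff hz, sector, mem_ofPred_eq]
  grind [Real.pi_pos, neg_pi_lt_arg z]

lemma mem_sector_neg_three_quarter {z : ℂ} :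
    z ∈ sector (-(3 * π / 4)) (-(π / 4)) ↔ z.im < z.re ∧ z.re < -z.im := by
  by_cases hz : z = 0
  · subst hz; simp [sector]; grind [Real.pi_pos]
  rw [im_lt_re_iff hz, re_lt_neg_im_iff hz, sector, mem_ofPred_eq]
  grind [Real.pi_pos, neg_pi_lt_arg z]

lemma mem_sector_neg_pi_three {z : ℂ} : z ∈ sector (-π) (-(3 * π / 4)) ↔
    z.im < 0 ∧ z.re < z.im := by
  by_cases hz : z = 0
  · subst hz; simp [sector]; grind [Real.pi_pos]
  rw [im_neg_iff, re_lt_im_iff hz, sector, mem_ofPred_eq]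
  grind [Real.pi_pos, neg_pi_lt_arg z]

/-! ## Removing the contour -/

section Extension
variable {E : Type*} [NormedAddCommGroup E] [NormedSpace ℂ E] [CompleteSpace E]

/-- A narrow cone around the ray through `a`. -/
def cone (a : ℂ) : Set ℂ := {z | 2 * |(z / a).im| < (z / a).re}

lemma isOpen_cone {a : ℂ} : IsOpen (cone a) := by
  have h : Continuous fun z : ℂ => z / a := by fun_prop
  exact isOpen_lt (continuous_const.mul (continuous_im.comp h).abs) (continuous_re.comp h)

lemma mem_cone_self {a : ℂ} (ha : a ≠ 0) : a ∈ cone a := by simp [cone, ha]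

lemma im_div_eq_zero_of_mem_cone {a z : ℂ} (ha0 : a ≠ 0) (ha : a ∈ contour) (hz : z ∈ cone a)
    (hzc : z ∈ contour) : (z / a).im = 0 := by
  have h : z = a * (z / a) := by field_simp
  set w := z / a
  have hw : 2 * |w.im| < w.re := hz
  have h1 := le_abs_self w.im
  have h2 := neg_abs_le w.im
  have h3 := abs_nonneg w.im
  have hre : z.re = a.re * w.re - a.im * w.im := by rw [h, mul_re]
  have him : z.im = a.re * w.im + a.im * w.re := by rw [h, mul_im]
  rw [mem_contour_iff] at ha hzc
  rw [hre, him] at hzc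
  have hne : a.re ≠ 0 ∨ a.im ≠ 0 := by
    by_contra hcon; push Not at hcon
    exact ha0 (Complex.ext hcon.1 hcon.2)
  have hp1 : w.re ≠ 0 := by intro h; linarith
  have hp2 : w.re - w.im ≠ 0 := by intro h; linarith
  have hp3 : w.re + w.im ≠ 0 := by intro h; linarith
  rcases ha with ha | ha | ha
  · have hr : a.re ≠ 0 := by rcases hne with h | h; exacts [h, absurd ha h]
    rw [ha] at hzc
    rcases hzc with h | h | h
    · exact (mul_eq_zero.1 (by linarith : a.re * w.im = 0)).resolve_left hr
    · exact absurd ((mul_eq_zero.1 (by linarith : a.re * (w.re - w.im) = 0)).resolve_left hr) hp2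
    · exact absurd ((mul_eq_zero.1 (by linarith : a.re * (w.re + w.im) = 0)).resolve_left hr) hp3
  · have hr : a.im ≠ 0 := by rcases hne with h | h; exacts [fun h' => h (ha.trans h'), h]
    rw [ha] at hzc
    rcases hzc with h | h | h
    · exact absurd ((mul_eq_zero.1 (by linarith : a.im * (w.re + w.im) = 0)).resolve_left hr) hp3
    · exact (mul_eq_zero.1 (by linarith : a.im * w.im = 0)).resolve_left hr
    · exact absurd ((mul_eq_zero.1 (by linarith : a.im * w.re = 0)).resolve_left hr) hp1
  · have hr : a.im ≠ 0 := by rcases hne with h | h; exacts [fun h' => h (by rw [ha, h', neg_zero]), h]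
    rw [ha] at hzc
    rcases hzc with h | h | h
    · exact absurd ((mul_eq_zero.1 (by linarith : a.im * (w.re - w.im) = 0)).resolve_left hr) hp2
    · exact absurd ((mul_eq_zero.1 (by linarith : a.im * w.re = 0)).resolve_left hr) hp1
    · exact (mul_eq_zero.1 (by linarith : a.im * w.im = 0)).resolve_left hr

omit [CompleteSpace E] in
lemma extendFrom_eq_of_mem {g : ℂ → E} (hg : DifferentiableOn ℂ g contourᶜ) {z : ℂ}
    (hz : z ∈ contourᶜ) : extendFrom contourᶜ g z = g z :=
  extendFrom_eq (subset_closure hz) (hg.continuousOn z hz)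

/-- A holomorphic function off the contour extends holomorphically across the parts of the contour
on which it has limits. -/
lemma differentiableOn_extend_contour {g : ℂ → E} (hg : DifferentiableOn ℂ g contourᶜ)
    {V : Set ℂ} (hV : IsOpen V) (h0 : (0 : ℂ) ∉ V)
    (hlim : ∀ z ∈ V, z ∈ contour → ∃ l, Tendsto g (𝓝[contourᶜ] z) (𝓝 l)) :
    DifferentiableOn ℂ (extendFrom contourᶜ g) V := by
  intro z hz
  apply DifferentiableAt.differentiableWithinAt
  have hz0 : z ≠ 0 := fun h => h0 (h ▸ hz)
  by_cases hzc : z ∈ contour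
  · have := differentiableOn_extendFrom (U := V ∩ cone z) (hV.inter isOpen_cone) hz0
      isOpen_compl_contour hg (fun w _ => dense_compl_contour w)
      (fun w hw hwc => im_div_eq_zero_of_mem_cone hz0 hzc hw.2 (not_not.1 hwc))
      (fun w hw hwc => hlim w hw.1 (not_not.1 hwc))
    exact this.differentiableAt ((hV.inter isOpen_cone).mem_nhds ⟨hz, mem_cone_self hz0⟩)
  · refine (hg.differentiableAt (isOpen_compl_contour.mem_nhds hzc)).congr_of_eventuallyEq ?_
    filter_upwards [isOpen_compl_contour.mem_nhds hzc] with w hw using extendFrom_eq_of_mem hg hw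

/-- A function holomorphic off the origin that agrees near the origin, in a sector, with a function
holomorphic at the origin, extends to an entire function. -/
lemma exists_entire_of_sector {g h : ℂ → E} (hg : DifferentiableOn ℂ g {0}ᶜ) (hh : AnalyticAt ℂ h 0)
    (heq : ∀ᶠ z in 𝓝[sector (π / 4) (3 * π / 4)] 0, g z = h z) :
    ∃ G : ℂ → E, Differentiable ℂ G ∧ (∀ z, z ≠ 0 → G z = g z) ∧ G 0 = h 0 := by
  obtain ⟨ε, hε, hhε⟩ := Metric.eventually_nhds_iff_ball.1 hh.eventually_analyticAt
  have hpunct : ∀ z ∈ ball (0:ℂ) ε, z ≠ 0 → g z = h z := by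
    set H : Set ℂ := {z | z.re < Real.log ε} with hH
    have hHo : IsOpen H := isOpen_lt continuous_re continuous_const
    have hmem : ∀ z ∈ H, exp z ∈ ball (0:ℂ) ε := by
      intro z hz
      rw [mem_ball_zero_iff, norm_exp]
      exact (Real.lt_log_iff_exp_lt hε).1 hz
    have hgo : AnalyticOnNhd ℂ (fun z => g (exp z)) H := by
      apply DifferentiableOn.analyticOnNhd _ hHo
      refine hg.comp differentiable_exp.differentiableOn ?_
      intro z _; exact exp_ne_zero z
    have hho : AnalyticOnNhd ℂ (fun z => h (exp z)) H := by
      intro z hz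
      exact (hhε _ (hmem z hz)).comp (f := exp) analyticAt_cexp
    have hconv : IsPreconnected H := (convex_halfSpace_re_lt _).isPreconnected
    rw [eventually_nhdsWithin_iff, Metric.eventually_nhds_iff_ball] at heq
    obtain ⟨δ, hδ, heq⟩ := heq
    set z₀ : ℂ := (min (Real.log ε) (Real.log δ) - 1 : ℝ) + (π / 2 : ℝ) * I with hz₀
    have hz₀re : z₀.re = min (Real.log ε) (Real.log δ) - 1 := by simp [hz₀]
    have hz₀im : z₀.im = π / 2 := by simp [hz₀]
    have hz₀H : z₀ ∈ H := by
      show z₀.re < _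
      rw [hz₀re]; linarith [min_le_left (Real.log ε) (Real.log δ)]
    have hev : (fun z => g (exp z)) =ᶠ[𝓝 z₀] fun z => h (exp z) := by
      have h1 : ∀ᶠ z : ℂ in 𝓝 z₀, z.re < Real.log δ :=
        (continuous_re.tendsto z₀).eventually (gt_mem_nhds (by
          rw [hz₀re]; linarith [min_le_right (Real.log ε) (Real.log δ)]))
      have h2 : ∀ᶠ z : ℂ in 𝓝 z₀, z.im < 3 * π / 4 :=
        (continuous_im.tendsto z₀).eventually (gt_mem_nhds (by rw [hz₀im]; linarith [Real.pi_pos]))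
      have h3 : ∀ᶠ z : ℂ in 𝓝 z₀, π / 4 < z.im :=
        (continuous_im.tendsto z₀).eventually (lt_mem_nhds (by rw [hz₀im]; linarith [Real.pi_pos]))
      filter_upwards [h1, h2, h3] with z h1 h2 h3
      refine heq _ ?_ ?_
      · rw [mem_ball_zero_iff, norm_exp]
        exact (Real.lt_log_iff_exp_lt hδ).1 h1
      · have hp := Real.pi_pos
        have : (exp z).arg = z.im := by rw [← log_im, log_exp (by linarith) (by linarith)]
        show _ < _ ∧ _ < _
        rw [this]; exact ⟨h3, h2⟩
    have := hgo.eqOn_of_preconnected_of_eventuallyEq hho hconv hz₀H hev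
    intro z hz hz0
    have h1 : log z ∈ H := by
      show (log z).re < _
      rw [log_re]
      exact Real.log_lt_log (norm_pos_iff.2 hz0) (mem_ball_zero_iff.1 hz)
    have := this h1
    simpa only [exp_log hz0] using this
  classical
  refine ⟨Function.update g 0 (h 0), fun z => ?_, fun z hz => by simp [hz], by simp⟩
  by_cases hz : z = 0
  · subst hz
    refine hh.differentiableAt.congr_of_eventuallyEq ?_
    filter_upwards [ball_mem_nhds 0 hε] with w hw
    by_cases hw0 : w = 0
    · subst hw0; simp
    · simp [hw0, hpunct w hw hw0]
  · refine (hg.differentiableAt (isOpen_compl_singleton.mem_nhds hz)).congr_of_eventuallyEq ?_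
    filter_upwards [isOpen_compl_singleton.mem_nhds hz] with w hw
    simp [show w ≠ 0 from hw]

end Extension

/-! ## Limits at the points of the contour -/

lemma nhdsWithin_compl_contour_le {z : ℂ} {S T : Set ℂ} {f g f' g' : ℂ → ℝ} (hf : Continuous f)
    (hg : Continuous g) (hf' : Continuous f') (hg' : Continuous g') (h1 : f z < g z)
    (h2 : f' z < g' z) (h : ∀ w, f w < g w → f' w < g' w → w ∈ contourᶜ → w ∈ S ∨ w ∈ T) :
    𝓝[contourᶜ] z ≤ 𝓝[S] z ⊔ 𝓝[T] z := by
  rw [← nhdsWithin_union]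
  refine le_inf inf_le_left (le_principal_iff.2 ?_)
  filter_upwards [self_mem_nhdsWithin, mem_nhdsWithin_of_mem_nhds
    ((hf.tendsto z).eventually_lt (hg.tendsto z) h1), mem_nhdsWithin_of_mem_nhds
    ((hf'.tendsto z).eventually_lt (hg'.tendsto z) h2)] with w hw hw1 hw2 using h w hw1 hw2 hw

/-- The two sectors adjacent to the ray through `z`. -/
inductive Adjacent (z : ℂ) : ℝ → Set ℂ → Set ℂ → Prop
  | pos : 0 < z.re → z.im = 0 → Adjacent z 0 (sector (-(π / 4)) 0) (sector 0 (π / 4))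
  | neg : z.re < 0 → z.im = 0 → Adjacent z π (sector (3 * π / 4) π) (sector (-π) (-(3 * π / 4)))
  | quarter : 0 < z.im → z.re = z.im →
      Adjacent z (π / 4) (sector 0 (π / 4)) (sector (π / 4) (3 * π / 4))
  | neg_quarter : z.im < 0 → z.re = -z.im → Adjacent z (-(π / 4)) (sector (-(3 * π / 4)) (-(π / 4)))
        (sector (-(π / 4)) 0)
  | three_quarter : 0 < z.im → z.re = -z.im → Adjacent z (3 * π / 4) (sector (π / 4) (3 * π / 4))
        (sector (3 * π / 4) π)
  | neg_three_quarter : z.im < 0 → z.re = z.im →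
      Adjacent z (-(3 * π / 4)) (sector (-π) (-(3 * π / 4))) (sector (-(3 * π / 4)) (-(π / 4)))

lemma exists_adjacent {z : ℂ} (hz : z ∈ contour) (hz0 : z ≠ 0) : ∃ θ S T, Adjacent z θ S T := by
  rw [mem_contour_iff] at hz
  have hne : z.re ≠ 0 ∨ z.im ≠ 0 := by
    by_contra hcon; push Not at hcon
    exact hz0 (Complex.ext hcon.1 hcon.2)
  rcases hz with h | h | h
  · rcases lt_trichotomy z.re 0 with h1 | h1 | h1
    · exact ⟨_, _, _, .neg h1 h⟩
    · rcases hne with h2 | h2 <;> contradiction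
    · exact ⟨_, _, _, .pos h1 h⟩
  · rcases lt_trichotomy z.im 0 with h1 | h1 | h1
    · exact ⟨_, _, _, .neg_three_quarter h1 h⟩
    · rw [h1] at h; rcases hne with h2 | h2 <;> contradiction
    · exact ⟨_, _, _, .quarter h1 h⟩
  · rcases lt_trichotomy z.im 0 with h1 | h1 | h1
    · exact ⟨_, _, _, .neg_quarter h1 h⟩
    · rw [h1, neg_zero] at h; rcases hne with h2 | h2 <;> contradiction
    · exact ⟨_, _, _, .three_quarter h1 h⟩

lemma mul_expI_re (r θ : ℝ) : ((r : ℂ) * expI θ).re = r * Real.cos θ := by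
  rw [re_ofReal_mul, expI_re]

lemma mul_expI_im (r θ : ℝ) : ((r : ℂ) * expI θ).im = r * Real.sin θ := by
  rw [im_ofReal_mul, expI_im]

lemma sin_three_quarter : Real.sin (3 * π / 4) = √2 / 2 := by
  rw [show 3 * π / 4 = π - π / 4 by ring, Real.sin_pi_sub, Real.sin_pi_div_four]

lemma cos_three_quarter : Real.cos (3 * π / 4) = -(√2 / 2) := by
  rw [show 3 * π / 4 = π - π / 4 by ring, Real.cos_pi_sub, Real.cos_pi_div_four]

lemma Adjacent.eq_mul_expI {z : ℂ} {θ : ℝ} {S T : Set ℂ} (h : Adjacent z θ S T) :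
    ∃ r : ℝ, 0 < r ∧ z = r * expI θ := by
  have h2 : √2 * √2 = 2 := Real.mul_self_sqrt (by norm_num)
  have h2p : 0 < √2 := by positivity
  cases h with
  | pos h1 h2 => exact ⟨z.re, h1, Complex.ext (by rw [mul_expI_re]; simp)
      (by rw [mul_expI_im]; simp [h2])⟩
  | neg h1 h2 =>
    exact ⟨-z.re, by linarith, Complex.ext (by rw [mul_expI_re]; simp)
      (by rw [mul_expI_im]; simp [h2])⟩
  | quarter h1 h3 =>
    refine ⟨z.im * √2, by positivity, Complex.ext ?_ ?_⟩
    · rw [mul_expI_re, Real.cos_pi_div_four, h3]; linear_combination (-z.im / 2) * h2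
    · rw [mul_expI_im, Real.sin_pi_div_four]; linear_combination (-z.im / 2) * h2
  | neg_quarter h1 h3 =>
    refine ⟨-z.im * √2, mul_pos (by linarith) h2p, Complex.ext ?_ ?_⟩
    · rw [mul_expI_re, Real.cos_neg, Real.cos_pi_div_four, h3]; linear_combination (z.im / 2) * h2
    · rw [mul_expI_im, Real.sin_neg, Real.sin_pi_div_four]; linear_combination (-z.im / 2) * h2
  | three_quarter h1 h3 =>
    refine ⟨z.im * √2, by positivity, Complex.ext ?_ ?_⟩
    · rw [mul_expI_re, cos_three_quarter, h3]; linear_combination (z.im / 2) * h2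
    · rw [mul_expI_im, sin_three_quarter]; linear_combination (-z.im / 2) * h2
  | neg_three_quarter h1 h3 =>
    refine ⟨-z.im * √2, mul_pos (by linarith) h2p, Complex.ext ?_ ?_⟩
    · rw [mul_expI_re, Real.cos_neg, cos_three_quarter, h3]; linear_combination (-z.im / 2) * h2
    · rw [mul_expI_im, Real.sin_neg, sin_three_quarter]; linear_combination (-z.im / 2) * h2

lemma lt_of_notMem_contour {w : ℂ} (hw : w ∈ contourᶜ) :
    (w.im < 0 ∨ 0 < w.im) ∧ (w.re < w.im ∨ w.im < w.re) ∧ (w.re < -w.im ∨ -w.im < w.re) := by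
  rw [mem_compl_iff, mem_contour_iff] at hw
  push Not at hw
  exact ⟨lt_or_gt_of_ne hw.1, lt_or_gt_of_ne hw.2.1, lt_or_gt_of_ne hw.2.2⟩

lemma Adjacent.nhdsWithin_le {z : ℂ} {θ : ℝ} {S T : Set ℂ} (h : Adjacent z θ S T) :
    𝓝[contourᶜ] z ≤ 𝓝[S] z ⊔ 𝓝[T] z := by
  have cre := continuous_re
  have cim := continuous_im
  have cn : Continuous fun w : ℂ => -w.im := cim.neg
  have c0 : Continuous fun _ : ℂ => (0:ℝ) := continuous_const
  cases h with
  | pos h1 h2 =>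
    exact nhdsWithin_compl_contour_le cim cre cn cre (by linarith) (by linarith) fun w p1 p2 hw => by
      grind [mem_sector_neg_quarter_0, mem_sector_0_quarter, lt_of_notMem_contour hw]
  | neg h1 h2 =>
    exact nhdsWithin_compl_contour_le cre cim cre cn (by linarith) (by linarith) fun w p1 p2 hw => by
      grind [mem_sector_three_pi, mem_sector_neg_pi_three, lt_of_notMem_contour hw]
  | quarter h1 h2 =>
    exact nhdsWithin_compl_contour_le c0 cim cn cre h1 (by linarith) fun w p1 p2 hw => by
      grind [mem_sector_0_quarter, mem_sector_quarter_three, lt_of_notMem_contour hw]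
  | neg_quarter h1 h2 =>
    exact nhdsWithin_compl_contour_le cim c0 cim cre h1 (by linarith) fun w p1 p2 hw => by
      grind [mem_sector_neg_three_quarter, mem_sector_neg_quarter_0, lt_of_notMem_contour hw]
  | three_quarter h1 h2 =>
    exact nhdsWithin_compl_contour_le c0 cim cre cim h1 (by linarith) fun w p1 p2 hw => by
      grind [mem_sector_three_pi, mem_sector_quarter_three, lt_of_notMem_contour hw]
  | neg_three_quarter h1 h2 =>
    exact nhdsWithin_compl_contour_le cim c0 cre cn h1 (by linarith) fun w p1 p2 hw => by
      grind [mem_sector_neg_pi_three, mem_sector_neg_three_quarter, lt_of_notMem_contour hw]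

/-- The jump matrix on the ray adjacent to the given sectors. -/
lemma exists_modelJump (γ α : ℝ) {z : ℂ} {θ : ℝ} {S T : Set ℂ} (h : Adjacent z θ S T) :
    ∃ J : Mat3, ((θ = 0 ∨ θ = π) ∧ J.det = -1 ∨ z.im ≠ 0 ∧ J.det = 1) ∧
      ∀ ρ σ τ Φ, IsModelSolution γ α ρ σ τ Φ → ∃ Fm : Mat3,
        Tendsto Φ (𝓝[S] z) (𝓝 Fm) ∧ Tendsto Φ (𝓝[T] z) (𝓝 (Fm * J)) := by
  obtain ⟨r, hr, hz⟩ := h.eq_mul_expI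
  have key : ∀ {Φ : ℂ → Mat3} {J : Mat3}, HasJump Φ θ S T J → ∃ Fm : Mat3,
      Tendsto Φ (𝓝[S] z) (𝓝 Fm) ∧ Tendsto Φ (𝓝[T] z) (𝓝 (Fm * J)) := by
    intro Φ J hJ
    obtain ⟨Fm, Fp, h1, h2, h3⟩ := hJ r hr
    rw [← hz] at h1 h2
    exact ⟨Fm, h1, h3 ▸ h2⟩
  cases h with
  | pos h1 => refine ⟨_, Or.inl ⟨Or.inl rfl, ?_⟩, fun _ _ _ _ hΦ => key hΦ.jump_pos⟩; simp [Matrix.det_fin_three]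
  | neg h1 => refine ⟨_, Or.inl ⟨Or.inr rfl, ?_⟩, fun _ _ _ _ hΦ => key hΦ.jump_neg⟩; simp [Matrix.det_fin_three]
  | quarter h1 => refine ⟨_, Or.inr ⟨h1.ne', ?_⟩, fun _ _ _ _ hΦ => key hΦ.jump_quarter⟩; simp [Matrix.det_fin_three]
  | neg_quarter h1 => refine ⟨_, Or.inr ⟨h1.ne, ?_⟩, fun _ _ _ _ hΦ => key hΦ.jump_neg_quarter⟩; simp [Matrix.det_fin_three]
  | three_quarter h1 => refine ⟨_, Or.inr ⟨h1.ne', ?_⟩, fun _ _ _ _ hΦ => key hΦ.jump_three_quarter⟩; simp [Matrix.det_fin_three]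
  | neg_three_quarter h1 => refine ⟨_, Or.inr ⟨h1.ne, ?_⟩, fun _ _ _ _ hΦ => key hΦ.jump_neg_three_quarter⟩; simp [Matrix.det_fin_three]

/-! ## The model at infinity as a Vandermonde matrix -/

lemma omega_pow_three : omega ^ 3 = 1 := by
  unfold omega expI
  rw [← exp_nat_mul, show ((3 : ℕ) : ℂ) * (((2 * π / 3 : ℝ) : ℂ) * I) = 2 * π * I by
    push_cast; ring]
  exact exp_two_pi_mul_I

lemma omega_im_pos : 0 < omega.im := by
  unfold omega
  rw [expI_im]
  exact Real.sin_pos_of_pos_of_lt_pi (by positivity) (by linarith [Real.pi_pos])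

lemma omega_ne_one : omega ≠ 1 := by intro h; have := omega_im_pos; rw [h] at this; simp at this

lemma omega_sq : omega ^ 2 = -1 - omega := by
  have h : (omega - 1) * (omega ^ 2 + omega + 1) = 0 := by linear_combination omega_pow_three
  have := (mul_eq_zero.1 h).resolve_left (sub_ne_zero.2 omega_ne_one)
  linear_combination this

/-- The principal cube root. -/
def cbrt (ξ : ℂ) : ℂ := ξ ^ (1 / 3 : ℂ)

lemma cbrt_pow_three (ξ : ℂ) : cbrt ξ ^ 3 = ξ := by
  unfold cbrt
  rw [← cpow_nat_mul]; norm_num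

lemma cpow_two_thirds (ξ : ℂ) : ξ ^ (2 / 3 : ℂ) = cbrt ξ ^ 2 := by
  unfold cbrt
  rw [← cpow_nat_mul]; norm_num

lemma cpow_four_thirds (ξ : ℂ) : ξ ^ (4 / 3 : ℂ) = cbrt ξ ^ 4 := by
  unfold cbrt
  rw [← cpow_nat_mul]; norm_num

lemma cbrt_ne_zero {ξ : ℂ} (h : ξ ≠ 0) : cbrt ξ ≠ 0 := by
  intro h0; apply h; rw [← cbrt_pow_three ξ, h0]; ring

/-- The three cube roots of `ξ` in the order in which they enter the model. -/
def kap (ξ : ℂ) : Fin 3 → ℂ := if 0 < ξ.im then ![omega * cbrt ξ, omega ^ 2 * cbrt ξ, cbrt ξ]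
  else ![omega ^ 2 * cbrt ξ, omega * cbrt ξ, cbrt ξ]

lemma kap_pow_three (ξ : ℂ) (j : Fin 3) : kap ξ j ^ 3 = ξ := by
  have h := cbrt_pow_three ξ
  have h2 := omega_pow_three
  have e1 : (omega * cbrt ξ) ^ 3 = ξ := by rw [mul_pow, h, h2, one_mul]
  have e2 : (omega ^ 2 * cbrt ξ) ^ 3 = ξ := by
    rw [mul_pow, h, ← pow_mul, mul_comm 2 3, pow_mul, h2]; ring
  unfold kap
  split_ifs <;> fin_cases j <;> simp [e1, e2, h]

/-- The Vandermonde matrix of three numbers. -/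
def vander (k : Fin 3 → ℂ) : Mat3 := !![1, 1, 1; k 0, k 1, k 2; k 0 ^ 2, k 1 ^ 2, k 2 ^ 2]

/-- The phase polynomial `ρ κ⁴ + σ κ² + τ κ`. -/
def phasePoly (p : Param) (κ : ℂ) : ℂ := p.1 * κ ^ 4 + p.2.1 * κ ^ 2 + p.2.2 * κ

lemma model_eq (ρ σ τ : ℝ) (ξ : ℂ) : modelAtInfinity ρ σ τ ξ =
      vander (kap ξ) * Matrix.diagonal fun j => exp (-phasePoly (ρ, σ, τ) (kap ξ j)) := by
  have hT : Theta ρ σ τ ξ = fun j => phasePoly (ρ, σ, τ) (kap ξ j) := by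
    have h3 := omega_pow_three
    have h4 : omega ^ 4 = omega := by linear_combination omega * h3
    have h8 : omega ^ 8 = omega ^ 2 := by linear_combination omega ^ 2 * (omega ^ 3 + 1) * h3
    have hc : ξ ^ (3⁻¹ : ℂ) = cbrt ξ := by unfold cbrt; norm_num
    unfold Theta kap phasePoly
    funext j
    simp only [phase, cpow_two_thirds, cpow_four_thirds]
    split_ifs <;> fin_cases j <;> simp [hc] <;> first
        | linear_combination (-ρ * cbrt ξ ^ 4 : ℂ) * h4
        | linear_combination (-ρ * cbrt ξ ^ 4 : ℂ) * h8 + (σ * cbrt ξ ^ 2 : ℂ) * (h4 - h4)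
  have hV : Upsilon ξ * (if 0 < ξ.im then OmegaPlus else OmegaMinus) = vander (kap ξ) := by
    have h3 := omega_pow_three
    have hc : ξ ^ (1 / 3 : ℂ) = cbrt ξ := rfl
    unfold Upsilon kap vander
    rw [cpow_two_thirds, hc]
    split_ifs <;> ext i j <;> fin_cases i <;> fin_cases j <;>
      simp [OmegaPlus, OmegaMinus, Matrix.diagonal_mul] <;>
      first
        | ring1
        | linear_combination (cbrt ξ) * h3
        | linear_combination (cbrt ξ ^ 2) * h3
  unfold modelAtInfinity
  rw [hV, hT]

/-- The sign of the half plane. -/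
def halfSign (ξ : ℂ) : ℂ := if 0 < ξ.im then 1 else -1

lemma halfSign_mul_self (ξ : ℂ) : halfSign ξ * halfSign ξ = 1 := by
  unfold halfSign; split_ifs <;> norm_num

/-- The determinant of the constant matrix in the upper half plane. -/
def detOmega : ℂ := (omega ^ 2 - omega) * (1 - omega) * (1 - omega ^ 2)

lemma detOmega_ne_zero : detOmega ≠ 0 := by
  have h := omega_sq
  have h3 := omega_pow_three
  have : detOmega ^ 2 = -27 := by
    unfold detOmega
    have e1 : (1 - omega) * (1 - omega ^ 2) = 3 := by linear_combination (-1 : ℂ) * h + h3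
    have e2 : (omega ^ 2 - omega) ^ 2 = -3 := by linear_combination (omega - 2) * h3 + h
    rw [mul_assoc, e1, mul_pow, e2]; norm_num
  intro h0; rw [h0] at this; norm_num at this

lemma det_vander (k : Fin 3 → ℂ) : (vander k).det = (k 1 - k 0) * (k 2 - k 0) * (k 2 - k 1) := by
  unfold vander
  rw [Matrix.det_fin_three]
  simp
  ring

lemma det_vander_kap (ξ : ℂ) : (vander (kap ξ)).det = halfSign ξ * detOmega * ξ := by
  rw [det_vander]
  have h := cbrt_pow_three ξ
  unfold halfSign detOmega kap
  split_ifs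
  · simp; linear_combination ((omega ^ 2 - omega) * (1 - omega) * (1 - omega ^ 2)) * h
  · simp; linear_combination (-(omega ^ 2 - omega) * (1 - omega) * (1 - omega ^ 2)) * h

lemma sum_phasePoly_kap (p : Param) (ξ : ℂ) :
    phasePoly p (kap ξ 0) + phasePoly p (kap ξ 1) + phasePoly p (kap ξ 2) = 0 := by
  have h := omega_sq
  have h3 := omega_pow_three
  unfold phasePoly kap
  split_ifs <;> simp <;>
    linear_combination (p.1 * cbrt ξ ^ 4 * (omega + omega ^ 2 * (omega ^ 3 + 1)) +
      p.2.1 * cbrt ξ ^ 2 * omega) * h3 + (p.1 * cbrt ξ ^ 4 + p.2.1 * cbrt ξ ^ 2 + p.2.2 * cbrt ξ) * h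

lemma det_model (ρ σ τ : ℝ) (ξ : ℂ) :
    (modelAtInfinity ρ σ τ ξ).det = halfSign ξ * detOmega * ξ := by
  rw [model_eq, Matrix.det_mul, det_vander_kap, Matrix.det_diagonal, Fin.prod_univ_three,
    ← exp_add, ← exp_add, ← neg_add, ← neg_add, sum_phasePoly_kap, neg_zero, exp_zero, mul_one]

/-! ## The determinant of a solution -/

section Solutions
variable {γ α ρ σ τ : ℝ} {Φ : ℂ → Mat3}

lemma IsModelSolution.differentiableOn (h : IsModelSolution γ α ρ σ τ Φ) :
    DifferentiableOn ℂ Φ contourᶜ := differentiableOn_mat h.analytic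

lemma Adjacent.halfSign_real {z : ℂ} {θ : ℝ} {S T : Set ℂ} (h : Adjacent z θ S T)
    (hθ : θ = 0 ∨ θ = π) :
    ∃ s : ℂ, (∀ w ∈ S, halfSign w = s) ∧ ∀ w ∈ T, halfSign w = -s := by
  have hp := Real.pi_pos
  cases h with
  | pos h1 h2 =>
    refine ⟨-1, fun w hw => ?_, fun w hw => ?_⟩
    · rw [mem_sector_neg_quarter_0] at hw; simp [halfSign, hw.1.le]
    · rw [mem_sector_0_quarter] at hw; simp [halfSign, hw.1]
  | neg h1 h2 =>
    refine ⟨1, fun w hw => ?_, fun w hw => ?_⟩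
    · rw [mem_sector_three_pi] at hw; simp [halfSign, hw.1]
    · rw [mem_sector_neg_pi_three] at hw; simp [halfSign, hw.1.le]
  | quarter h1 h2 => rcases hθ with h | h <;> linarith
  | neg_quarter h1 h2 => rcases hθ with h | h <;> linarith
  | three_quarter h1 h2 => rcases hθ with h | h <;> linarith
  | neg_three_quarter h1 h2 => rcases hθ with h | h <;> linarith

lemma halfSign_eventually {z : ℂ} (hz : z.im ≠ 0) : ∀ᶠ w in 𝓝 z, halfSign w = halfSign z := by
  rcases lt_or_gt_of_ne hz with h | h
  · filter_upwards [(continuous_im.tendsto z).eventually (gt_mem_nhds h)] with w hw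
    unfold halfSign
    rw [if_neg (not_lt.2 hw.le), if_neg (not_lt.2 h.le)]
  · filter_upwards [(continuous_im.tendsto z).eventually (lt_mem_nhds h)] with w hw
    unfold halfSign
    rw [if_pos hw, if_pos h]

lemma differentiableOn_halfSign : DifferentiableOn ℂ halfSign contourᶜ := by
  intro z hz
  have hz' : z.im ≠ 0 := by intro h; apply hz; rw [mem_contour_iff]; exact Or.inl h
  have : halfSign =ᶠ[𝓝 z] fun _ => halfSign z := halfSign_eventually hz'
  exact ((differentiableAt_const _).congr_of_eventuallyEq this).differentiableWithinAt

lemma sector_subset_compl_contour : sector (π / 4) (3 * π / 4) ⊆ contourᶜ := by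
  intro z hz
  rw [mem_sector_quarter_three] at hz
  rw [mem_compl_iff, mem_contour_iff]
  push Not
  refine ⟨fun h => ?_, fun h => ?_, fun h => ?_⟩ <;> linarith [hz.1, hz.2]

lemma det_connectionMatrix (γ α : ℝ) (ξ : ℂ) :
    (connectionMatrix γ α ξ).det = 2 * expI (α / 3 * π) := by
  unfold connectionMatrix
  split_ifs <;> rw [Matrix.det_fin_three] <;> simp <;> ring

lemma det_originPowers (α : ℝ) {ξ : ℂ} (hξ : ξ ≠ 0) : (originPowers α ξ).det = ξ := by
  unfold originPowers
  rw [Matrix.det_diagonal, Fin.prod_univ_three]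
  simp only [Matrix.cons_val_zero, Matrix.cons_val_one, Matrix.cons_val]
  rw [← cpow_add _ _ hξ, ← cpow_add _ _ hξ]
  conv_rhs => rw [← cpow_one ξ]
  congr 1
  push_cast; ring

lemma expansion_tendsto_zero {R : ℂ → Mat3}
    (hO : ∀ i j, (fun ξ => R ξ i j) =O[cobounded ℂ ⊓ 𝓟 contourᶜ] fun ξ => ξ⁻¹) :
    Tendsto R (cobounded ℂ ⊓ 𝓟 contourᶜ) (𝓝 0) := by
  have h2 : Tendsto (fun ξ : ℂ => ξ⁻¹) (cobounded ℂ ⊓ 𝓟 contourᶜ) (𝓝 0) :=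
    (tendsto_inv₀_cobounded (α := ℂ)).mono_left inf_le_left
  exact (isBigO_mat hO).trans_tendsto h2

lemma IsModelSolution.det_eq (h : IsModelSolution γ α ρ σ τ Φ) {ξ : ℂ} (hξ : ξ ∈ contourᶜ) :
    (Φ ξ).det = halfSign ξ * detOmega * ξ := by
  set d : ℂ → ℂ := fun ξ => halfSign ξ * (Φ ξ).det * ξ⁻¹ with hd
  have hdd : DifferentiableOn ℂ d contourᶜ := by
    refine (differentiableOn_halfSign.mul fun z hz => ?_).mul fun z hz => ?_
    · exact (differentiableAt_det (h.differentiableOn.differentiableAt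
        (isOpen_compl_contour.mem_nhds hz))).differentiableWithinAt
    · exact (differentiableAt_inv (ne_zero_of_notMem_contour hz)).differentiableWithinAt
  have hlim : ∀ z ∈ ({0}ᶜ : Set ℂ), z ∈ contour → ∃ l, Tendsto d (𝓝[contourᶜ] z) (𝓝 l) := by
    intro z hz hzc
    obtain ⟨θ, S, T, hadj⟩ := exists_adjacent hzc hz
    obtain ⟨J, hJ, hlim⟩ := exists_modelJump γ α hadj
    obtain ⟨Fm, h1, h2⟩ := hlim _ _ _ _ h
    have hinv : Tendsto (fun w : ℂ => w⁻¹) (𝓝 z) (𝓝 z⁻¹) := tendsto_inv₀ hz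
    have t1 := (continuous_det.tendsto _).comp h1
    have t2 := (continuous_det.tendsto _).comp h2
    rcases hJ with ⟨hθ, hJ⟩ | ⟨hθ, hJ⟩
    · obtain ⟨s, hs1, hs2⟩ := hadj.halfSign_real hθ
      refine ⟨s * Fm.det * z⁻¹, Tendsto.mono_left ?_ hadj.nhdsWithin_le⟩
      rw [tendsto_sup]
      constructor
      · refine Tendsto.congr' ?_ ((t1.const_mul s).mul (hinv.mono_left nhdsWithin_le_nhds))
        filter_upwards [self_mem_nhdsWithin] with w hw
        simp [hd, hs1 w hw]
      · have := (t2.const_mul (-s)).mul (hinv.mono_left (nhdsWithin_le_nhds (s := T)))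
        rw [Matrix.det_mul, hJ, show -s * (Fm.det * -1) = s * Fm.det by ring] at this
        refine Tendsto.congr' ?_ this
        filter_upwards [self_mem_nhdsWithin] with w hw
        simp [hd, hs2 w hw]
    · have hs := halfSign_eventually hθ
      refine ⟨halfSign z * Fm.det * z⁻¹, Tendsto.mono_left ?_ hadj.nhdsWithin_le⟩
      rw [tendsto_sup]
      constructor
      · refine Tendsto.congr' ?_ ((t1.const_mul (halfSign z)).mul
          (hinv.mono_left nhdsWithin_le_nhds))
        filter_upwards [mem_nhdsWithin_of_mem_nhds hs] with w hw
        simp [hd, hw]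
      · have := (t2.const_mul (halfSign z)).mul (hinv.mono_left (nhdsWithin_le_nhds (s := T)))
        rw [Matrix.det_mul, hJ, mul_one] at this
        refine Tendsto.congr' ?_ this
        filter_upwards [mem_nhdsWithin_of_mem_nhds hs] with w hw
        simp [hd, hw]
  have hext := differentiableOn_extend_contour hdd isOpen_compl_singleton (by simp) hlim
  obtain ⟨N, hN, hNeq⟩ := h.at_zero
  have hNa : AnalyticAt ℂ (fun ξ => (N ξ).det * (2 * expI (α / 3 * π))) 0 := by
    simp only [Matrix.det_fin_three]
    fun_prop (disch := exact hN _ _)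
  obtain ⟨G, hG, hGd, -⟩ := exists_entire_of_sector hext hNa (by
    filter_upwards [hNeq, self_mem_nhdsWithin] with z hz hzs
    have hzc := sector_subset_compl_contour hzs
    have hz0 := ne_zero_of_notMem_contour hzc
    rw [extendFrom_eq_of_mem hdd hzc]
    simp only [hd]
    rw [hz, Matrix.det_mul, Matrix.det_mul, det_connectionMatrix, det_originPowers α hz0]
    have : halfSign z = 1 := by
      rw [mem_sector_quarter_three] at hzs
      have him : 0 < z.im := by linarith [hzs.1, hzs.2]
      simp [halfSign, him]
    rw [this]; field_simp)
  have hGS : ∀ z ∈ contourᶜ, G z = d z := fun z hz => by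
    rw [hGd z (ne_zero_of_notMem_contour hz), extendFrom_eq_of_mem hdd hz]
  obtain ⟨R, hR, hO⟩ := h.at_infinity
  have hR0 := expansion_tendsto_zero hO
  have hGlim : Tendsto G (cobounded ℂ) (𝓝 detOmega) := by
    refine tendsto_cobounded_of_dense dense_compl_contour (K := ∅) (by simp) isClosed_empty
      hG.continuous.continuousOn ?_
    have h1 : Tendsto (fun ξ => (1 + R ξ).det * detOmega)
        (cobounded ℂ ⊓ 𝓟 contourᶜ) (𝓝 ((1 + (0 : Mat3)).det * detOmega)) :=
      ((continuous_det.tendsto _).comp (hR0.const_add 1)).mul_const _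
    rw [add_zero, Matrix.det_one, one_mul] at h1
    refine h1.congr' ?_
    filter_upwards [mem_inf_of_right (mem_principal_self _)] with z hz
    rw [hGS z hz]
    simp only [hd]
    rw [hR z hz, Matrix.det_mul, det_model]
    have hz0 := ne_zero_of_notMem_contour hz
    field_simp
    linear_combination (-(1 + R z).det * detOmega) * halfSign_mul_self z
  have hGc : G ξ - detOmega = 0 := eq_zero_of_entire_of_tendsto (f := fun z => G z - detOmega)
    (hG.sub_const _) (by simpa using hGlim.sub_const detOmega) ξ
  have h1 : d ξ = detOmega := by rw [← hGS ξ hξ]; linear_combination hGc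
  simp only [hd] at h1
  have hz0 := ne_zero_of_notMem_contour hξ
  rw [← h1]
  field_simp
  linear_combination (-(Φ ξ).det) * halfSign_mul_self ξ

lemma halfSign_ne_zero (ξ : ℂ) : halfSign ξ ≠ 0 := by
  intro h; have := halfSign_mul_self ξ; rw [h] at this; simp at this

lemma IsModelSolution.det_ne_zero (h : IsModelSolution γ α ρ σ τ Φ) {ξ : ℂ}
    (hξ : ξ ∈ contourᶜ) : (Φ ξ).det ≠ 0 := by
  rw [h.det_eq hξ]
  exact mul_ne_zero (mul_ne_zero (halfSign_ne_zero _) detOmega_ne_zero)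
    (ne_zero_of_notMem_contour hξ)

lemma IsModelSolution.isUnit (h : IsModelSolution γ α ρ σ τ Φ) {ξ : ℂ}
    (hξ : ξ ∈ contourᶜ) : IsUnit (Φ ξ) := isUnit_of_det_ne_zero (h.det_ne_zero hξ)

lemma det_model_ne_zero (ρ σ τ : ℝ) {ξ : ℂ} (hξ : ξ ≠ 0) : (modelAtInfinity ρ σ τ ξ).det ≠ 0 := by
  rw [det_model]
  exact mul_ne_zero (mul_ne_zero (halfSign_ne_zero _) detOmega_ne_zero) hξ

lemma neBot_sector : (𝓝[sector (π / 4) (3 * π / 4)] (0:ℂ)).NeBot := by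
  have h1 : Tendsto (fun t : ℝ => (t : ℂ) * I) (𝓝[>] 0) (𝓝[sector (π / 4) (3 * π / 4)] (0:ℂ)) := by
    refine tendsto_nhdsWithin_iff.2 ⟨?_, ?_⟩
    · have : Tendsto (fun t : ℝ => (t : ℂ) * I) (𝓝 0) (𝓝 ((0:ℝ) * I)) := by
        apply Continuous.tendsto; fun_prop
      rw [ofReal_zero, zero_mul] at this
      exact this.mono_left nhdsWithin_le_nhds
    · filter_upwards [self_mem_nhdsWithin] with t ht
      rw [mem_sector_quarter_three]
      simpa using ht
  exact h1.neBot

lemma IsModelSolution.det_N_ne_zero (h : IsModelSolution γ α ρ σ τ Φ) {N : ℂ → Mat3}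
    (hN : ∀ i j, AnalyticAt ℂ (fun ξ => N ξ i j) 0)
    (hNeq : ∀ᶠ ξ in 𝓝[sector (π / 4) (3 * π / 4)] 0,
      Φ ξ = N ξ * originPowers α ξ * connectionMatrix γ α ξ) :
    (N 0).det ≠ 0 := by
  have hc : ContinuousAt N 0 := (analyticAt_mat hN).continuousAt
  have hne := neBot_sector
  have t1 : Tendsto (fun ξ => (N ξ).det * (2 * expI (α / 3 * π))) (𝓝[sector (π / 4) (3 * π / 4)] 0)
      (𝓝 ((N 0).det * (2 * expI (α / 3 * π)))) :=
    (((continuous_det.tendsto _).comp hc.tendsto).mul_const _).mono_left nhdsWithin_le_nhds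
  have t2 : (fun ξ => (N ξ).det * (2 * expI (α / 3 * π)))
      =ᶠ[𝓝[sector (π / 4) (3 * π / 4)] 0] fun _ => detOmega := by
    filter_upwards [hNeq, self_mem_nhdsWithin] with z hz hzs
    have hzc := sector_subset_compl_contour hzs
    have hz0 := ne_zero_of_notMem_contour hzc
    have hs : halfSign z = 1 := by
      rw [mem_sector_quarter_three] at hzs
      have him : 0 < z.im := by linarith [hzs.1, hzs.2]
      simp [halfSign, him]
    have := h.det_eq hzc
    rw [hz, Matrix.det_mul, Matrix.det_mul, det_connectionMatrix, det_originPowers α hz0, hs] at this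
    apply mul_right_cancel₀ hz0
    linear_combination this
  have := tendsto_nhds_unique t1 (tendsto_const_nhds.congr' t2.symm)
  intro h0
  rw [h0, zero_mul] at this
  exact detOmega_ne_zero this.symm

end Solutions

/-! ## The ratio of two solutions -/

section Ratio
variable {γ α ρ σ τ ρ' σ' τ' : ℝ} {Φ Φ' : ℂ → Mat3}

/-- The boundary values of a solution are invertible. -/
lemma IsModelSolution.det_limit_ne_zero (h : IsModelSolution γ α ρ σ τ Φ) {z : ℂ} (hz : z ≠ 0)
    {θ : ℝ} {S T : Set ℂ} (hadj : Adjacent z θ S T) {F J : Mat3} (hJ : ‖J.det‖ = 1)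
    (h1 : Tendsto Φ (𝓝[S] z) (𝓝 F)) (h2 : Tendsto Φ (𝓝[T] z) (𝓝 (F * J))) : F.det ≠ 0 := by
  have t1 := ((continuous_det.tendsto _).comp h1).norm
  have t2 := ((continuous_det.tendsto _).comp h2).norm
  rw [Matrix.det_mul, norm_mul, hJ, mul_one] at t2
  have t3 : Tendsto (fun w => ‖(Φ w).det‖) (𝓝[contourᶜ] z) (𝓝 ‖F.det‖) :=
    (tendsto_sup.2 ⟨t1, t2⟩).mono_left hadj.nhdsWithin_le
  have t4 : Tendsto (fun w => ‖detOmega * w‖) (𝓝[contourᶜ] z) (𝓝 ‖detOmega * z‖) := by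
    refine Tendsto.mono_left (Continuous.tendsto ?_ _) nhdsWithin_le_nhds
    fun_prop
  have t5 : Tendsto (fun w => ‖detOmega * w‖) (𝓝[contourᶜ] z) (𝓝 ‖F.det‖) := by
    refine t3.congr' ?_
    filter_upwards [self_mem_nhdsWithin] with w hw
    have hs : ‖halfSign w‖ = 1 := by unfold halfSign; split_ifs <;> simp
    simp only [h.det_eq hw, norm_mul, hs, one_mul]
  have hne : (𝓝[contourᶜ] z).NeBot := mem_closure_iff_nhdsWithin_neBot.1 (dense_compl_contour z)
  have := tendsto_nhds_unique t4 t5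
  intro h0
  rw [h0, norm_zero, norm_eq_zero] at this
  exact mul_ne_zero detOmega_ne_zero hz this

lemma IsModelSolution.mul_inv_self (h : IsModelSolution γ α ρ σ τ Φ) {ξ : ℂ}
    (hξ : ξ ∈ contourᶜ) : Φ ξ * (Φ ξ)⁻¹ = 1 :=
  Matrix.mul_nonsing_inv _ (h.det_ne_zero hξ).isUnit

lemma IsModelSolution.inv_mul_self (h : IsModelSolution γ α ρ σ τ Φ) {ξ : ℂ}
    (hξ : ξ ∈ contourᶜ) : (Φ ξ)⁻¹ * Φ ξ = 1 :=
  Matrix.nonsing_inv_mul _ (h.det_ne_zero hξ).isUnit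

/-- Two solutions with the same jumps differ by an entire unimodular left factor. -/
lemma IsModelSolution.exists_ratio (h : IsModelSolution γ α ρ σ τ Φ)
    (h' : IsModelSolution γ α ρ' σ' τ' Φ') :
    ∃ X : ℂ → Mat3, Differentiable ℂ X ∧ (∀ ξ ∈ contourᶜ, Φ' ξ = X ξ * Φ ξ) ∧
      ∀ ξ, (X ξ).det = 1 := by
  set g : ℂ → Mat3 := fun ξ => Φ' ξ * (Φ ξ)⁻¹ with hg
  have hgd : DifferentiableOn ℂ g contourᶜ := by
    intro z hz
    exact ((h'.differentiableOn.differentiableAt (isOpen_compl_contour.mem_nhds hz)).mul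
      (differentiableAt_mat_inv (h.det_ne_zero hz) (h.differentiableOn.differentiableAt
        (isOpen_compl_contour.mem_nhds hz)))).differentiableWithinAt
  have hlim : ∀ z ∈ ({0}ᶜ : Set ℂ), z ∈ contour → ∃ l, Tendsto g (𝓝[contourᶜ] z) (𝓝 l) := by
    intro z hz hzc
    obtain ⟨θ, S, T, hadj⟩ := exists_adjacent hzc hz
    obtain ⟨J, hJ, hlim⟩ := exists_modelJump γ α hadj
    obtain ⟨F, h1, h2⟩ := hlim _ _ _ _ h
    obtain ⟨F', h1', h2'⟩ := hlim _ _ _ _ h'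
    have hJn : ‖J.det‖ = 1 := by rcases hJ with ⟨-, hJ⟩ | ⟨-, hJ⟩ <;> simp [hJ]
    have hF := h.det_limit_ne_zero hz hadj hJn h1 h2
    have hJ0 : J.det ≠ 0 := by intro h0; rw [h0] at hJn; simp at hJn
    refine ⟨F' * F⁻¹, Tendsto.mono_left (tendsto_sup.2 ⟨?_, ?_⟩) hadj.nhdsWithin_le⟩
    · exact h1'.mul (tendsto_mat_inv hF h1)
    · have h3 : (F * J).det ≠ 0 := by rw [Matrix.det_mul]; exact mul_ne_zero hF hJ0
      have := h2'.mul (tendsto_mat_inv h3 h2)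
      rwa [Matrix.mul_inv_rev, mul_assoc, ← mul_assoc J,
        Matrix.mul_nonsing_inv _ hJ0.isUnit, one_mul] at this
  have hext := differentiableOn_extend_contour hgd isOpen_compl_singleton (by simp) hlim
  obtain ⟨N, hN, hNeq⟩ := h.at_zero
  obtain ⟨N', hN', hNeq'⟩ := h'.at_zero
  have hdet := h.det_N_ne_zero hN hNeq
  have hNa : AnalyticAt ℂ (fun ξ => N' ξ * (N ξ)⁻¹) 0 := by
    apply (analyticAt_mat hN').mul
    have hNa := analyticAt_mat hN
    rw [analyticAt_iff_eventually_differentiableAt] 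
    have hc : ∀ᶠ z in 𝓝 (0:ℂ), (N z).det ≠ 0 :=
      ((continuous_det.tendsto _).comp hNa.continuousAt.tendsto).eventually_ne hdet
    filter_upwards [hc, hNa.eventually_analyticAt] with z hz hza
    exact differentiableAt_mat_inv hz hza.differentiableAt
  have hdet' : ∀ᶠ z in 𝓝 (0:ℂ), (N z).det ≠ 0 :=
    ((continuous_det.tendsto _).comp (analyticAt_mat hN).continuousAt.tendsto).eventually_ne hdet
  obtain ⟨X, hX, hXe, -⟩ := exists_entire_of_sector hext hNa (by
    filter_upwards [hNeq, hNeq', self_mem_nhdsWithin, mem_nhdsWithin_of_mem_nhds hdet']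
      with z hz hz' hzs hzd
    have hzc := sector_subset_compl_contour hzs
    have hz0 := ne_zero_of_notMem_contour hzc
    rw [extendFrom_eq_of_mem hgd hzc]
    simp only [hg]
    have hinv : IsUnit (originPowers α z * connectionMatrix γ α z).det := by
      rw [Matrix.det_mul, det_originPowers α hz0, det_connectionMatrix]
      exact (mul_ne_zero hz0 (mul_ne_zero two_ne_zero (expI_ne_zero _))).isUnit
    rw [hz, hz', mul_assoc (N' z), mul_assoc (N z), Matrix.mul_inv_rev, mul_assoc (N' z),
      ← mul_assoc (originPowers α z * connectionMatrix γ α z), Matrix.mul_nonsing_inv _ hinv,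
      one_mul])
  have hXg : ∀ ξ ∈ contourᶜ, X ξ = g ξ := fun ξ hξ => by
    rw [hXe ξ (ne_zero_of_notMem_contour hξ), extendFrom_eq_of_mem hgd hξ]
  have heq : ∀ ξ ∈ contourᶜ, Φ' ξ = X ξ * Φ ξ := fun ξ hξ => by
    rw [hXg ξ hξ]; simp only [hg]
    rw [mul_assoc, h.inv_mul_self hξ, mul_one]
  refine ⟨X, hX, heq, fun ξ => ?_⟩
  have hc : Continuous fun ξ => (X ξ).det := continuous_det.comp hX.continuous
  refine congrFun (hc.ext_on dense_compl_contour continuous_const fun z hz => ?_) ξ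
  have h1 := h'.det_eq hz
  rw [heq z hz, Matrix.det_mul, h.det_eq hz] at h1
  have h2 := h.det_ne_zero hz
  rw [h.det_eq hz] at h2
  exact mul_right_cancel₀ h2 (by rw [h1, one_mul])

lemma IsModelSolution.eqOn (h : IsModelSolution γ α ρ σ τ Φ)
    (h' : IsModelSolution γ α ρ σ τ Φ') : EqOn Φ' Φ contourᶜ := by
  obtain ⟨X, hX, hXe, -⟩ := h.exists_ratio h'
  obtain ⟨R, hR, hO⟩ := h.at_infinity
  obtain ⟨R', hR', hO'⟩ := h'.at_infinity
  have t := expansion_tendsto_zero hO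
  have t' := expansion_tendsto_zero hO'
  have h1 : Tendsto (fun ξ => (1 + R' ξ) * (1 + R ξ)⁻¹) (cobounded ℂ ⊓ 𝓟 contourᶜ)
      (𝓝 ((1 + 0) * (1 + 0)⁻¹)) :=
    (t'.const_add 1).mul (tendsto_mat_inv (by simp) (t.const_add 1))
  rw [add_zero, inv_one, mul_one] at h1
  have h2 : Tendsto X (cobounded ℂ) (𝓝 1) := by
    refine tendsto_cobounded_of_dense dense_compl_contour (K := ∅) (by simp) isClosed_empty
      hX.continuous.continuousOn (h1.congr' ?_)
    filter_upwards [mem_inf_of_right (mem_principal_self _)] with z hz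
    have hz0 := ne_zero_of_notMem_contour hz
    have e1 := hXe z hz
    have hm := det_model_ne_zero ρ σ τ hz0
    have hd := h.det_ne_zero hz
    rw [hR z hz, Matrix.det_mul] at hd
    have hd1 : IsUnit (1 + R z).det := (left_ne_zero_of_mul hd).isUnit
    rw [hR' z hz, hR z hz, ← mul_assoc] at e1
    have e2 : 1 + R' z = X z * (1 + R z) := by
      have := congrArg (· * (modelAtInfinity ρ σ τ z)⁻¹) e1
      simpa only [mul_assoc, Matrix.mul_nonsing_inv _ hm.isUnit, mul_one] using this
    rw [e2, mul_assoc, Matrix.mul_nonsing_inv _ hd1, mul_one]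
  intro ξ hξ
  have h3 : X ξ - 1 = 0 := eq_zero_of_entire_of_tendsto (f := fun z => X z - 1)
    (hX.sub_const _) (sub_self (1 : Mat3) ▸ h2.sub_const 1) ξ
  rw [hXe ξ hξ, sub_eq_zero.1 h3, one_mul]

end Ratio

/-! ## Calculus of the Cauchy–Riemann operator -/

section Dbar
variable {E : Type*} [NormedAddCommGroup E] [NormedSpace ℂ E]

lemma dbar_congr {f g : ℂ → E} {z : ℂ} (h : f =ᶠ[𝓝 z] g) : dbar f z = dbar g z := by
  unfold dbar; rw [h.fderiv_eq]

lemma dbar_const (c : E) (z : ℂ) : dbar (fun _ => c) z = 0 := by simp [dbar]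

lemma dbar_add {f g : ℂ → E} {z : ℂ} (hf : DifferentiableAt ℝ f z)
    (hg : DifferentiableAt ℝ g z) : dbar (fun w => f w + g w) z = dbar f z + dbar g z := by
  unfold dbar
  rw [fderiv_fun_add hf hg]
  simp [smul_add]
  abel

lemma dbar_eq_zero {f : ℂ → E} {z : ℂ} (hf : DifferentiableAt ℂ f z) : dbar f z = 0 := by
  unfold dbar
  rw [hf.fderiv_restrictScalars ℝ]
  have h : fderiv ℂ f z I = I • fderiv ℂ f z 1 := by rw [← map_smul, smul_eq_mul, mul_one]
  simp only [ContinuousLinearMap.coe_restrictScalars']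
  rw [h, smul_smul, I_mul_I]
  simp

lemma dbar_smul {f : ℂ → ℂ} {g : ℂ → E} {z : ℂ} (hf : DifferentiableAt ℝ f z)
    (hg : DifferentiableAt ℝ g z) :
    dbar (fun w => f w • g w) z = dbar f z • g z + f z • dbar g z := by
  unfold dbar
  rw [fderiv_fun_smul hf hg]
  simp only [_root_.add_apply, _root_.smul_apply, ContinuousLinearMap.smulRight_apply]
  simp only [smul_add, smul_smul, smul_eq_mul]
  module

lemma continuousAt_dbar {f : ℂ → E} {z : ℂ} (hf : ContDiffAt ℝ 1 f z) :
    ContinuousAt (dbar f) z := by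
  have h := (hf.fderiv_right (m := 0) (by norm_num)).continuousAt
  unfold dbar
  exact ((h.clm_apply continuousAt_const).add
    ((h.clm_apply continuousAt_const).const_smul I)).const_smul _

variable {A : Type*} [NormedRing A] [NormedAlgebra ℂ A]

lemma dbar_mul {f g : ℂ → A} {z : ℂ} (hf : DifferentiableAt ℝ f z) (hg : DifferentiableAt ℝ g z) :
    dbar (fun w => f w * g w) z = dbar f z * g z + f z * dbar g z := by
  unfold dbar
  rw [fderiv_fun_mul' hf hg]
  simp [mul_add, add_mul, smul_add]
  abel

end Dbar

/-! ## The two wedges along which jumps are smoothed out -/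

/-- The column which is added to, or subtracted from, in the wedge. -/
def sideRow (b : Bool) : Fin 3 := if b then 0 else 2

def sideSign (b : Bool) : ℝ := if b then 1 else -1

/-- `|cot (arg ξ)|`, with a sign. -/
def slope (b : Bool) (ξ : ℂ) : ℝ := sideSign b * ξ.re / |ξ.im|

/-- The cutoff: `1` near the real half line, `0` beyond the diagonal. -/
def cut (b : Bool) (ξ : ℂ) : ℝ := Real.smoothTransition (slope b ξ - 1)

def wedge (b : Bool) : Set ℂ := {ξ | ξ.im ≠ 0 ∧ 1 ≤ slope b ξ ∧ slope b ξ ≤ 2}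

lemma abs_sideSign (b : Bool) : |sideSign b| = 1 := by cases b <;> simp [sideSign]

lemma contDiffAt_slope (b : Bool) {ξ : ℂ} (h : ξ.im ≠ 0) : ContDiffAt ℝ ∞ (slope b) ξ := by
  unfold slope
  have hre : ContDiffAt ℝ ∞ (fun z : ℂ => z.re) ξ := reCLM.contDiff.contDiffAt
  have him : ContDiffAt ℝ ∞ (fun z : ℂ => z.im) ξ := imCLM.contDiff.contDiffAt
  exact (contDiffAt_const.mul hre).div (him.abs h) (abs_ne_zero.2 h)

lemma contDiffAt_cut (b : Bool) {ξ : ℂ} (h : ξ.im ≠ 0) :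
    ContDiffAt ℝ ∞ (fun ξ => (cut b ξ : ℂ)) ξ := by
  have h1 : ContDiffAt ℝ ∞ (cut b) ξ := (Real.smoothTransition.contDiff (n := ⊤)).contDiffAt.comp ξ
      ((contDiffAt_slope b h).sub contDiffAt_const)
  exact ofRealCLM.contDiff.contDiffAt.comp ξ h1

lemma cut_eventually {b : Bool} {ξ : ℂ} (h : ξ.im ≠ 0) (hw : ξ ∉ wedge b) :
    (∀ᶠ z in 𝓝 ξ, cut b z = 0) ∨ (∀ᶠ z in 𝓝 ξ, cut b z = 1) := by
  have hc := (contDiffAt_slope b h).continuousAt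
  by_cases h1 : slope b ξ < 1
  · left
    filter_upwards [hc.eventually (gt_mem_nhds h1)] with z hz
    exact Real.smoothTransition.zero_of_nonpos (by linarith)
  · right
    have h2 : 2 < slope b ξ := by
      by_contra h2
      exact hw ⟨h, not_lt.1 h1, not_lt.1 h2⟩
    filter_upwards [hc.eventually (lt_mem_nhds h2)] with z hz
    exact Real.smoothTransition.one_of_one_le (by linarith)

/-- `∂/∂ξ̄` of the cutoff, set to `0` on the real line. -/
def dbarCut (b : Bool) (ξ : ℂ) : ℂ := if ξ.im = 0 then 0 else dbar (fun z => (cut b z : ℂ)) ξ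

lemma dbarCut_of_notMem {b : Bool} {ξ : ℂ} (hw : ξ ∉ wedge b) : dbarCut b ξ = 0 := by
  unfold dbarCut
  split_ifs with h
  · rfl
  · rcases cut_eventually h hw with h1 | h1
    · rw [dbar_congr (g := fun _ => 0) (by filter_upwards [h1] with z hz; simp [hz]), dbar_const]
    · rw [dbar_congr (g := fun _ => 1) (by filter_upwards [h1] with z hz; simp [hz]), dbar_const]

lemma norm_le_of_mem_wedge {b : Bool} {ξ : ℂ} (h : ξ ∈ wedge b) : ‖ξ‖ ≤ 3 * |ξ.im| := by
  obtain ⟨h0, h3, h2⟩ := h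
  have hp : 0 < |ξ.im| := abs_pos.2 h0
  have h1 : |ξ.re| ≤ 2 * |ξ.im| := by
    unfold slope at *
    have e : |sideSign b * ξ.re| = |ξ.re| := by rw [abs_mul, abs_sideSign, one_mul]
    rw [div_le_iff₀ hp] at h2
    rw [one_le_div hp] at h3
    rw [← e, abs_of_nonneg (by linarith)]
    exact h2
  linarith [norm_le_abs_re_add_abs_im ξ]

/-- The wedges are closed in `ℂ \ {0}`. -/
lemma eventually_notMem_wedge {b : Bool} {ξ : ℂ} (h0 : ξ ≠ 0) (h : ξ ∉ wedge b) :
    ∀ᶠ z in 𝓝 ξ, z ∉ wedge b := by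
  by_cases him : ξ.im = 0
  · have h1 : 3 * |ξ.im| < ‖ξ‖ := by rw [him]; simpa using h0
    have hc : Continuous fun z : ℂ => 3 * |z.im| := by fun_prop
    filter_upwards [(hc.tendsto ξ).eventually_lt (continuous_norm.tendsto ξ) h1] with z hz hzw
    linarith [norm_le_of_mem_wedge hzw]
  · have hc := (contDiffAt_slope b him).continuousAt
    have h1 : slope b ξ < 1 ∨ 2 < slope b ξ := by
      by_contra hcon
      push Not at hcon
      exact h ⟨him, hcon.1, hcon.2⟩
    rcases h1 with h1 | h1
    · filter_upwards [hc.eventually (gt_mem_nhds h1)] with z hz hzw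
      linarith [hzw.2.1]
    · filter_upwards [hc.eventually (lt_mem_nhds h1)] with z hz hzw
      linarith [hzw.2.2]

lemma exists_bound_deriv_smoothTransition : ∃ C, ∀ x, |deriv Real.smoothTransition x| ≤ C := by
  have hc : Continuous (deriv Real.smoothTransition) :=
    (Real.smoothTransition.contDiff (n := 1)).continuous_deriv (by norm_num)
  obtain ⟨C, hC⟩ := isCompact_Icc.exists_bound_of_continuousOn (hc.continuousOn (s := Icc 0 1))
  refine ⟨C, fun x => ?_⟩
  by_cases hx : x ∈ Icc (0:ℝ) 1
  · exact hC x hx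
  · have h0 : 0 ≤ C := (norm_nonneg _).trans (hC 0 (by simp))
    have : deriv Real.smoothTransition x = 0 := by
      have hx' : x < 0 ∨ 1 < x := by by_contra hcon; push Not at hcon; exact hx ⟨hcon.1, hcon.2⟩
      rcases hx' with hx | hx
      · have : Real.smoothTransition =ᶠ[𝓝 x] fun _ => 0 := by
          filter_upwards [gt_mem_nhds hx] with y hy
          exact Real.smoothTransition.zero_of_nonpos hy.le
        rw [this.deriv_eq]; simp
      · have : Real.smoothTransition =ᶠ[𝓝 x] fun _ => 1 := by
          filter_upwards [lt_mem_nhds hx] with y hy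
          exact Real.smoothTransition.one_of_one_le hy.le
        rw [this.deriv_eq]; simp
    rw [this, abs_zero]; exact h0

lemma norm_dbar_ofReal_le {f : ℂ → ℝ} {z : ℂ} (hf : DifferentiableAt ℝ f z) :
    ‖dbar (fun w => (f w : ℂ)) z‖ ≤ ‖fderiv ℝ f z‖ := by
  have h : HasFDerivAt (fun w => (f w : ℂ)) (ofRealCLM.comp (fderiv ℝ f z)) z :=
    ofRealCLM.hasFDerivAt.comp z hf.hasFDerivAt
  unfold dbar
  rw [h.fderiv]
  simp only [ContinuousLinearMap.comp_apply, ofRealCLM_apply]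
  have h1 := (fderiv ℝ f z).le_opNorm 1
  have h2 := (fderiv ℝ f z).le_opNorm I
  rw [norm_one, mul_one] at h1
  rw [norm_I, mul_one] at h2
  rw [norm_smul]
  have h3 : ‖((fderiv ℝ f z 1 : ℝ) : ℂ) + I • ((fderiv ℝ f z I : ℝ) : ℂ)‖ ≤ 2 * ‖fderiv ℝ f z‖ := by
    refine (norm_add_le _ _).trans ?_
    rw [norm_smul, norm_I, one_mul, Complex.norm_real, Complex.norm_real]
    linarith
  rw [show ‖(1 / 2 : ℂ)‖ = 1 / 2 by norm_num]
  linarith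

lemma exists_bound_dbarCut : ∃ C, ∀ b ξ, ‖dbarCut b ξ‖ * ‖ξ‖ ≤ C := by
  obtain ⟨C, hC⟩ := exists_bound_deriv_smoothTransition
  have hC0 : 0 ≤ C := (abs_nonneg _).trans (hC 0)
  refine ⟨12 * C, fun b ξ => ?_⟩
  by_cases hw : ξ ∈ wedge b
  swap
  · rw [dbarCut_of_notMem hw]; simp; positivity
  have him := hw.1
  have hn := norm_le_of_mem_wedge hw
  obtain ⟨ε, hε1, hε⟩ : ∃ ε : ℝ, |ε| = 1 ∧ slope b =ᶠ[𝓝 ξ] fun z => ε * (z.re * (z.im)⁻¹) := by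
    rcases lt_or_gt_of_ne him with h | h
    · refine ⟨-sideSign b, by rw [abs_neg, abs_sideSign], ?_⟩
      filter_upwards [(continuous_im.tendsto ξ).eventually (gt_mem_nhds h)] with z hz
      unfold slope
      rw [abs_of_neg hz, div_neg, mul_div_assoc, div_eq_mul_inv]; ring
    · refine ⟨sideSign b, abs_sideSign b, ?_⟩
      filter_upwards [(continuous_im.tendsto ξ).eventually (lt_mem_nhds h)] with z hz
      unfold slope
      rw [abs_of_pos hz, mul_div_assoc, div_eq_mul_inv]
  have hs : HasFDerivAt (slope b) (ε • (ξ.re • ((-(ξ.im ^ 2)⁻¹) • imCLM) + (ξ.im)⁻¹ • reCLM)) ξ := by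
    refine HasFDerivAt.congr_of_eventuallyEq ?_ hε
    have h1 : HasFDerivAt (fun z : ℂ => z.im) imCLM ξ := imCLM.hasFDerivAt
    have h2 : HasFDerivAt (fun z : ℂ => z.re) reCLM ξ := reCLM.hasFDerivAt
    exact ((h2.mul (((hasDerivAt_inv him).comp_hasFDerivAt ξ h1))).const_mul ε)
  have hcut : HasFDerivAt (cut b) (deriv Real.smoothTransition (slope b ξ - 1) •
      (ε • (ξ.re • ((-(ξ.im ^ 2)⁻¹) • imCLM) + (ξ.im)⁻¹ • reCLM))) ξ := by
    have h1 : HasDerivAt Real.smoothTransition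
        (deriv Real.smoothTransition (slope b ξ - 1)) (slope b ξ - 1) :=
      ((Real.smoothTransition.contDiff (n := 1)).differentiable (by norm_num) _).hasDerivAt
    exact h1.comp_hasFDerivAt ξ (hs.sub_const 1)
  have hre : |ξ.re| ≤ 3 * |ξ.im| := (abs_re_le_norm ξ).trans hn
  have hbound : ‖fderiv ℝ (cut b) ξ‖ * |ξ.im| ≤ 3 * C + C := by
    rw [hcut.fderiv, norm_smul, norm_smul, Real.norm_eq_abs, Real.norm_eq_abs, hε1, one_mul]
    have h1 : ‖ξ.re • ((-(ξ.im ^ 2)⁻¹) • imCLM) + (ξ.im)⁻¹ • reCLM‖ ≤ 4 * |ξ.im|⁻¹ := by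
      refine (norm_add_le _ _).trans ?_
      rw [norm_smul, norm_smul, norm_smul, imCLM_norm, reCLM_norm, mul_one, mul_one, norm_neg,
        norm_inv, norm_pow, norm_inv, Real.norm_eq_abs, Real.norm_eq_abs]
      have : |ξ.re| * (|ξ.im| ^ 2)⁻¹ ≤ 3 * |ξ.im| * (|ξ.im| ^ 2)⁻¹ := by gcongr
      have e : 3 * |ξ.im| * (|ξ.im| ^ 2)⁻¹ = 3 * |ξ.im|⁻¹ := by field_simp
      linarith
    calc _ ≤ C * (4 * |ξ.im|⁻¹) * |ξ.im| := by gcongr; exact hC _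
      _ = 3 * C + C := by field_simp; ring
  have h3 : ‖dbarCut b ξ‖ ≤ ‖fderiv ℝ (cut b) ξ‖ := by
    unfold dbarCut
    rw [if_neg him]
    exact norm_dbar_ofReal_le hcut.differentiableAt
  calc ‖dbarCut b ξ‖ * ‖ξ‖ ≤ ‖fderiv ℝ (cut b) ξ‖ * (3 * |ξ.im|) := by gcongr
    _ ≤ 12 * C := by linarith

lemma continuousAt_dbarCut {b : Bool} {ξ : ℂ} (h : ξ.im ≠ 0) : ContinuousAt (dbarCut b) ξ := by
  have h1 := continuousAt_dbar ((contDiffAt_cut b h).of_le (m := 1) (by norm_num))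
  refine h1.congr ?_
  filter_upwards [(continuous_im.tendsto ξ).eventually_ne h] with z hz
  rw [dbarCut, if_neg hz]

/-! ## The cube roots and the exponents -/

lemma norm_cbrt_pow_three (ξ : ℂ) : ‖cbrt ξ‖ ^ 3 = ‖ξ‖ := by rw [← norm_pow, cbrt_pow_three]

lemma cbrt_eq {ξ : ℂ} (hξ : ξ ≠ 0) : cbrt ξ = ‖cbrt ξ‖ * expI (ξ.arg / 3) := by
  have h : cbrt ξ = exp ((Real.log ‖ξ‖ / 3 : ℝ) : ℂ) * expI (ξ.arg / 3) := by
    unfold cbrt expI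
    rw [cpow_def_of_ne_zero hξ, ← exp_add, log]
    congr 1; push_cast; ring
  have hn : ‖cbrt ξ‖ = Real.exp (Real.log ‖ξ‖ / 3) := by
    rw [h, norm_mul, norm_expI, mul_one, norm_exp, ofReal_re]
  rw [hn, ofReal_exp]; exact h

lemma expI_add (x y : ℝ) : expI (x + y) = expI x * expI y := by
  unfold expI; rw [← exp_add]; congr 1; push_cast; ring

lemma expI_pow (x : ℝ) (n : ℕ) : expI x ^ n = expI (n * x) := by
  unfold expI; rw [← exp_nat_mul]; congr 1; push_cast; ring

/-- The arguments of the three cube roots in the upper half plane. -/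
def kapAngle (ξ : ℂ) : Fin 3 → ℝ := ![|ξ.arg| / 3 + 2 * π / 3, |ξ.arg| / 3 + 4 * π / 3, |ξ.arg| / 3]

lemma expI_two_pi_mul (n : ℤ) : expI (n * (2 * π)) = 1 := by
  unfold expI
  rw [show (((n * (2 * π) : ℝ) : ℂ) * I) = n * (2 * π * I) by push_cast; ring]
  exact exp_int_mul_two_pi_mul_I n

lemma kap_eq {ξ : ℂ} (h : ξ.im ≠ 0) (j : Fin 3) :
    kap ξ j = ‖cbrt ξ‖ * expI (kapAngle ξ j) ∨ kap ξ j = ‖cbrt ξ‖ * expI (-kapAngle ξ j) := by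
  have hξ : ξ ≠ 0 := by rintro rfl; simp at h
  have hc := cbrt_eq hξ
  have h2 : omega ^ 2 = expI (4 * π / 3) := by unfold omega; rw [expI_pow]; congr 1; push_cast; ring
  rcases lt_or_gt_of_ne h with him | him
  · right
    have ha : |ξ.arg| = -ξ.arg := abs_of_neg ((im_neg_iff ξ).1 him)
    unfold kap kapAngle
    rw [if_neg (not_lt.2 him.le), ha, hc]
    have n1 : ‖((‖cbrt ξ‖ : ℝ) : ℂ) * expI (ξ.arg / 3)‖ = ‖cbrt ξ‖ := by rw [← hc]
    fin_cases j
    · simp only [Fin.zero_eta, Matrix.cons_val_zero]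
      rw [n1, mul_left_comm, h2, ← expI_add]
      rw [show -(-ξ.arg / 3 + 2 * π / 3) =
        4 * π / 3 + ξ.arg / 3 + ((-1 : ℤ) : ℝ) * (2 * π) by push_cast; ring,
        expI_add _ (((-1 : ℤ) : ℝ) * (2 * π)), expI_two_pi_mul, mul_one]
    · simp only [Fin.mk_one, Matrix.cons_val_one, Matrix.cons_val_zero]
      rw [n1, mul_left_comm, omega, ← expI_add]
      rw [show -(-ξ.arg / 3 + 4 * π / 3) =
        2 * π / 3 + ξ.arg / 3 + ((-1 : ℤ) : ℝ) * (2 * π) by push_cast; ring,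
        expI_add _ (((-1 : ℤ) : ℝ) * (2 * π)), expI_two_pi_mul, mul_one]
    · simp only [Fin.reduceFinMk, Matrix.cons_val]
      rw [n1, neg_div, neg_neg]
  · left
    have ha : |ξ.arg| = ξ.arg := abs_of_pos ((im_pos_iff ξ).1 him).1
    unfold kap kapAngle
    rw [if_pos him, ha, hc]
    have n1 : ‖((‖cbrt ξ‖ : ℝ) : ℂ) * expI (ξ.arg / 3)‖ = ‖cbrt ξ‖ := by rw [← hc]
    fin_cases j
    · simp only [Fin.zero_eta, Matrix.cons_val_zero]
      rw [n1, mul_left_comm, omega, ← expI_add, add_comm]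
    · simp only [Fin.mk_one, Matrix.cons_val_one, Matrix.cons_val_zero]
      rw [n1, mul_left_comm, h2, ← expI_add, add_comm]
    · simp only [Fin.reduceFinMk, Matrix.cons_val]
      rw [n1]

lemma re_kap_pow {ξ : ℂ} (h : ξ.im ≠ 0) (j : Fin 3) (n : ℕ) :
    (kap ξ j ^ n).re = ‖cbrt ξ‖ ^ n * Real.cos (n * kapAngle ξ j) := by
  rcases kap_eq h j with e | e
  · rw [e, mul_pow, expI_pow, ← ofReal_pow, re_ofReal_mul, expI_re]
  · rw [e, mul_pow, expI_pow, ← ofReal_pow, re_ofReal_mul, expI_re, mul_neg, Real.cos_neg]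

lemma norm_kap (ξ : ℂ) (j : Fin 3) : ‖kap ξ j‖ = ‖cbrt ξ‖ := by
  have h1 : ‖kap ξ j‖ ^ 3 = ‖cbrt ξ‖ ^ 3 := by rw [← norm_pow, kap_pow_three, norm_cbrt_pow_three]
  exact (pow_left_inj₀ (norm_nonneg _) (norm_nonneg _) (by norm_num)).1 h1

lemma differentiableAt_cbrt {ξ : ℂ} (h : ξ ∈ slitPlane) : DifferentiableAt ℂ cbrt ξ :=
  (differentiableAt_id).cpow (differentiableAt_const _) h

lemma kap_eventually {ξ : ℂ} (h : ξ.im ≠ 0) : ∃ c : Fin 3 → ℂ, ∀ j,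
    (fun z => kap z j) =ᶠ[𝓝 ξ] fun z => c j * cbrt z := by
  rcases lt_or_gt_of_ne h with him | him
  · refine ⟨![omega ^ 2, omega, 1], fun j => ?_⟩
    filter_upwards [(continuous_im.tendsto ξ).eventually (gt_mem_nhds him)] with z hz
    unfold kap
    rw [if_neg (not_lt.2 hz.le)]
    fin_cases j <;> simp
  · refine ⟨![omega, omega ^ 2, 1], fun j => ?_⟩
    filter_upwards [(continuous_im.tendsto ξ).eventually (lt_mem_nhds him)] with z hz
    unfold kap
    rw [if_pos hz]
    fin_cases j <;> simp

lemma differentiableAt_kap {ξ : ℂ} (h : ξ.im ≠ 0) (j : Fin 3) :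
    DifferentiableAt ℂ (fun z => kap z j) ξ := by
  obtain ⟨c, hc⟩ := kap_eventually h
  exact ((differentiableAt_cbrt (Or.inr h)).const_mul (c j)).congr_of_eventuallyEq (hc j)

/-- The exponent `θ_j - θ_2` which governs the jump in a wedge. -/
def expo (b : Bool) (p : Param) (ξ : ℂ) : ℂ :=
  phasePoly p (kap ξ (sideRow b)) - phasePoly p (kap ξ 1)

lemma differentiableAt_phasePoly_kap {ξ : ℂ} (h : ξ.im ≠ 0) (p : Param) (j : Fin 3) :
    DifferentiableAt ℂ (fun z => phasePoly p (kap z j)) ξ := by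
  have := differentiableAt_kap h j
  unfold phasePoly
  fun_prop

lemma differentiableAt_expo {ξ : ℂ} (h : ξ.im ≠ 0) (b : Bool) (p : Param) :
    DifferentiableAt ℂ (expo b p) ξ :=
  (differentiableAt_phasePoly_kap h p _).sub (differentiableAt_phasePoly_kap h p _)

/-- The angle between `ξ` and the real half line of the wedge. -/
def sideAngle (b : Bool) (ξ : ℂ) : ℝ := if b then |ξ.arg| else π - |ξ.arg|

lemma re_expo_eq {ξ : ℂ} (h : ξ.im ≠ 0) (b : Bool) : ∃ s : ℝ, |s| ≤ 2 ∧ ∀ p : Param,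
    (expo b p ξ).re = -p.1 * (‖cbrt ξ‖ ^ 4 * (√3 * Real.sin (4 * sideAngle b ξ / 3))) +
      p.2.1 * (‖cbrt ξ‖ ^ 2 * (√3 * Real.sin (2 * sideAngle b ξ / 3))) +
      p.2.2 * (‖cbrt ξ‖ * s) := by
  refine ⟨Real.cos (kapAngle ξ (sideRow b)) - Real.cos (kapAngle ξ 1), ?_, fun p => ?_⟩
  · have h1 := Real.abs_cos_le_one (kapAngle ξ (sideRow b))
    have h2 := Real.abs_cos_le_one (kapAngle ξ 1)
    rw [abs_le] at *
    constructor <;> linarith [h1.1, h1.2, h2.1, h2.2]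
  have key : ∀ j, (phasePoly p (kap ξ j)).re = p.1 * (‖cbrt ξ‖ ^ 4 * Real.cos (4 * kapAngle ξ j)) +
      p.2.1 * (‖cbrt ξ‖ ^ 2 * Real.cos (2 * kapAngle ξ j)) +
      p.2.2 * (‖cbrt ξ‖ * Real.cos (kapAngle ξ j)) := by
    intro j
    have h1 := re_kap_pow h j 1
    have h2 := re_kap_pow h j 2
    have h4 := re_kap_pow h j 4
    simp only [pow_one, Nat.cast_one, one_mul] at h1
    push_cast at h2 h4
    unfold phasePoly
    rw [add_re, add_re, re_ofReal_mul, re_ofReal_mul, re_ofReal_mul, h1, h2, h4]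
  have e3 : Real.sin (π / 3) = √3 / 2 := Real.sin_pi_div_three
  have e4 : Real.cos (4 * kapAngle ξ (sideRow b)) - Real.cos (4 * kapAngle ξ 1) =
      -(√3 * Real.sin (4 * sideAngle b ξ / 3)) := by
    rw [Real.cos_sub_cos]
    cases b
    · simp only [sideRow, kapAngle, sideAngle, Bool.false_eq_true, if_false, Matrix.cons_val,
        Matrix.cons_val_one, Matrix.cons_val_zero]
      rw [show (4 * (|ξ.arg| / 3) + 4 * (|ξ.arg| / 3 + 4 * π / 3)) / 2 =
          -(4 * (π - |ξ.arg|) / 3) + 2 * π + 2 * π by ring,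
        show (4 * (|ξ.arg| / 3) - 4 * (|ξ.arg| / 3 + 4 * π / 3)) / 2 =
          π / 3 - π - 2 * π by ring, Real.sin_sub_two_pi, Real.sin_sub_pi,
        Real.sin_add_two_pi, Real.sin_add_two_pi, Real.sin_neg, e3]
      ring
    · simp only [sideRow, kapAngle, sideAngle, if_true, Matrix.cons_val_one, Matrix.cons_val_zero]
      rw [show (4 * (|ξ.arg| / 3 + 2 * π / 3) + 4 * (|ξ.arg| / 3 + 4 * π / 3)) / 2 =
          4 * |ξ.arg| / 3 + 2 * π + 2 * π by ring,
        show (4 * (|ξ.arg| / 3 + 2 * π / 3) - 4 * (|ξ.arg| / 3 + 4 * π / 3)) / 2 =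
          -(π / 3 + π) by ring, Real.sin_neg, Real.sin_add_pi,
        Real.sin_add_two_pi, Real.sin_add_two_pi, e3]
      ring
  have e2 : Real.cos (2 * kapAngle ξ (sideRow b)) - Real.cos (2 * kapAngle ξ 1) =
      √3 * Real.sin (2 * sideAngle b ξ / 3) := by
    rw [Real.cos_sub_cos]
    cases b
    · simp only [sideRow, kapAngle, sideAngle, Bool.false_eq_true, if_false, Matrix.cons_val,
        Matrix.cons_val_one, Matrix.cons_val_zero]
      rw [show (2 * (|ξ.arg| / 3) + 2 * (|ξ.arg| / 3 + 4 * π / 3)) / 2 =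
          -(2 * (π - |ξ.arg|) / 3) + 2 * π by ring,
        show (2 * (|ξ.arg| / 3) - 2 * (|ξ.arg| / 3 + 4 * π / 3)) / 2 =
          -(π / 3 + π) by ring, Real.sin_neg, Real.sin_add_pi,
        Real.sin_add_two_pi, Real.sin_neg, e3]
      ring
    · simp only [sideRow, kapAngle, sideAngle, if_true, Matrix.cons_val_one, Matrix.cons_val_zero]
      rw [show (2 * (|ξ.arg| / 3 + 2 * π / 3) + 2 * (|ξ.arg| / 3 + 4 * π / 3)) / 2 =
          2 * |ξ.arg| / 3 + 2 * π by ring,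
        show (2 * (|ξ.arg| / 3 + 2 * π / 3) - 2 * (|ξ.arg| / 3 + 4 * π / 3)) / 2 =
          π / 3 - π by ring, Real.sin_sub_pi, Real.sin_add_two_pi, e3]
      ring
  unfold expo
  rw [sub_re, key, key]
  linear_combination (p.1 * ‖cbrt ξ‖ ^ 4) * e4 + (p.2.1 * ‖cbrt ξ‖ ^ 2) * e2

lemma sideAngle_bounds {b : Bool} {ξ : ℂ} (h : ξ ∈ wedge b) :
    1 / 3 ≤ sideAngle b ξ ∧ sideAngle b ξ ≤ π / 2 := by
  have hξ : ξ ≠ 0 := by rintro rfl; exact h.1 (by simp)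
  have hn : 0 < ‖ξ‖ := norm_pos_iff.2 hξ
  have ha := abs_arg_le_pi ξ
  have hs : Real.sin (sideAngle b ξ) = |ξ.im| / ‖ξ‖ := by
    have h1 : Real.sin |ξ.arg| = |ξ.im| / ‖ξ‖ := by
      rw [← abs_of_pos hn, ← abs_div, ← sin_arg]
      rcases le_total 0 ξ.arg with h0 | h0
      · rw [abs_of_nonneg h0, abs_of_nonneg (Real.sin_nonneg_of_nonneg_of_le_pi h0 (arg_le_pi ξ))]
      · rw [abs_of_nonpos h0, Real.sin_neg,
          abs_of_nonpos (Real.sin_nonpos_of_nonpos_of_neg_pi_le h0 (neg_pi_lt_arg ξ).le)]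
    cases b <;> simp [sideAngle, h1]
  have hc : Real.cos (sideAngle b ξ) = sideSign b * ξ.re / ‖ξ‖ := by
    cases b <;> simp [sideAngle, sideSign, Real.cos_pi_sub, cos_arg hξ, neg_div]
  have h0 : 0 ≤ sideAngle b ξ := by
    cases b <;> simp [sideAngle, ha]
  have hle : sideAngle b ξ ≤ π := by
    cases b <;> simp [sideAngle, ha]
  have him : 0 < |ξ.im| := abs_pos.2 h.1
  constructor
  · refine le_trans ?_ (Real.sin_le h0)
    rw [hs, div_le_div_iff₀ (by norm_num) hn]
    linarith [norm_le_of_mem_wedge h]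
  · by_contra hcon
    push Not at hcon
    have h1 := Real.cos_nonpos_of_pi_div_two_le_of_le hcon.le (by linarith [Real.pi_pos])
    have h2 := h.2.1
    rw [slope, one_le_div him] at h2
    rw [hc] at h1
    have : 0 < sideSign b * ξ.re / ‖ξ‖ := div_pos (by linarith) hn
    linarith

lemma one_eighth_le_sin {x : ℝ} (h1 : 2 / 9 ≤ x) (h2 : x ≤ 2 * π / 3) : 1 / 8 ≤ Real.sin x := by
  have hp := Real.pi_pos
  have hp4 := Real.pi_lt_d2
  rcases le_total x (π / 2) with h | h
  · have := Real.mul_le_sin (by linarith) h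
    refine le_trans ?_ this
    rw [div_mul_eq_mul_div, div_le_div_iff₀ (by norm_num) hp]
    linarith
  · have := Real.mul_le_sin (x := π - x) (by linarith) (by linarith)
    rw [Real.sin_pi_sub] at this
    refine le_trans ?_ this
    rw [div_mul_eq_mul_div, div_le_div_iff₀ (by norm_num) hp]
    linarith

/-- Near an admissible parameter the exponents in the wedges are uniformly large. -/
lemma exists_le_re_expo {p₀ : Param} (h : Admissible p₀.1 p₀.2.1) :
    ∃ ε > 0, ∃ c > 0, ∃ C, ∀ p : Param, Admissible p.1 p.2.1 → p ∈ ball p₀ ε →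
      ∀ b, ∀ ξ ∈ wedge b, c * ‖cbrt ξ‖ ^ 2 - C ≤ (expo b p ξ).re := by
  have low : ∀ b, ∀ ξ ∈ wedge b, ∃ s : ℝ, |s| ≤ 2 ∧ ∃ k4 k2 : ℝ, 1 / 8 ≤ k4 ∧ 1 / 8 ≤ k2 ∧ k4 ≤ 2 ∧
      k2 ≤ 2 ∧ ∀ p : Param, (expo b p ξ).re = -p.1 * (‖cbrt ξ‖ ^ 4 * k4) +
      p.2.1 * (‖cbrt ξ‖ ^ 2 * k2) + p.2.2 * (‖cbrt ξ‖ * s) := by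
    intro b ξ hξ
    obtain ⟨s, hs, hp⟩ := re_expo_eq hξ.1 b
    obtain ⟨h1, h2⟩ := sideAngle_bounds hξ
    have h3 : (1:ℝ) ≤ √3 := by rw [Real.one_le_sqrt]; norm_num
    have h3' : √3 ≤ (2:ℝ) := by rw [Real.sqrt_le_left (by norm_num)]; norm_num
    have hpi := Real.pi_pos
    have s4 := one_eighth_le_sin (x := 4 * sideAngle b ξ / 3) (by linarith) (by linarith)
    have s2 := one_eighth_le_sin (x := 2 * sideAngle b ξ / 3) (by linarith) (by linarith)
    have s4' := Real.sin_le_one (4 * sideAngle b ξ / 3)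
    have s2' := Real.sin_le_one (2 * sideAngle b ξ / 3)
    exact ⟨s, hs, _, _, by nlinarith, by nlinarith, by nlinarith, by nlinarith, hp⟩
  have coord : ∀ {ε : ℝ} {p : Param}, p ∈ ball p₀ ε →
      |p.1 - p₀.1| < ε ∧ |p.2.1 - p₀.2.1| < ε ∧ |p.2.2 - p₀.2.2| < ε := by
    intro ε p hp
    rw [mem_ball, Prod.dist_eq, Prod.dist_eq, max_lt_iff, max_lt_iff] at hp
    simpa [Real.dist_eq] using hp
  have lin : ∀ {t s τ T : ℝ}, 0 ≤ t → |s| ≤ 2 → |τ| ≤ T → -(2 * T * t) ≤ τ * (t * s) := by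
    intro t s τ T ht hs hτ
    have h1 : |τ * (t * s)| ≤ T * (t * 2) := by
      rw [abs_mul, abs_mul, abs_of_nonneg ht]
      have := (abs_nonneg τ).trans hτ
      gcongr
    linarith [neg_abs_le (τ * (t * s))]
  have amgm : ∀ {k : ℝ} (B x : ℝ), 0 < k → B * x ≤ k * x ^ 2 + B ^ 2 / (4 * k) := by
    intro k B x hk
    have : 0 ≤ k * (x - B / (2 * k)) ^ 2 := by positivity
    have e : k * (x - B / (2 * k)) ^ 2 = k * x ^ 2 - B * x + B ^ 2 / (4 * k) := by field_simp; ring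
    linarith
  rcases h with h | ⟨h, h'⟩
  · set r := -p₀.1 / 2 with hr
    have hr0 : 0 < r := by rw [hr]; linarith
    set S := |p₀.2.1| + r
    set T := |p₀.2.2| + r
    refine ⟨r, hr0, 1, one_pos, (2 * S + 2) ^ 2 / (4 * (r / 8)) + T ^ 2, fun p hp hpb b ξ hξ => ?_⟩
    obtain ⟨s, hs, k4, k2, h4, h2, -, h2', he⟩ := low b ξ hξ
    obtain ⟨c1, c2, c3⟩ := coord hpb
    rw [he]
    set t := ‖cbrt ξ‖
    have ht : 0 ≤ t := norm_nonneg _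
    have hτ : |p.2.2| ≤ T := by
      have := abs_sub_abs_le_abs_sub p.2.2 p₀.2.2
      linarith
    have hσ : |p.2.1| ≤ S := by
      have := abs_sub_abs_le_abs_sub p.2.1 p₀.2.1
      linarith
    have hρ : r ≤ -p.1 := by linarith [(abs_lt.1 c1).2]
    have e1 := lin ht hs hτ
    have e2 : -(2 * S * t ^ 2) ≤ p.2.1 * (t ^ 2 * k2) := by
      have h1 : |p.2.1 * (t ^ 2 * k2)| ≤ S * (t ^ 2 * 2) := by
        rw [abs_mul, abs_of_nonneg (show 0 ≤ t ^ 2 * k2 by positivity)]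
        gcongr
      linarith [neg_abs_le (p.2.1 * (t ^ 2 * k2))]
    have e3 : r * (t ^ 4 * (1 / 8)) ≤ -p.1 * (t ^ 4 * k4) := by
      have : 0 ≤ -p.1 := hr0.le.trans hρ
      gcongr
    have e4 := amgm (2 * S + 2) (t ^ 2) (show 0 < r / 8 by positivity)
    have e5 : 2 * T * t ≤ t ^ 2 + T ^ 2 := by nlinarith [sq_nonneg (t - T)]
    nlinarith
  · set r := p₀.2.1 / 2 with hr
    have hr0 : 0 < r := by rw [hr]; linarith
    set T := |p₀.2.2| + r
    refine ⟨r, hr0, r / 16, by positivity, (2 * T) ^ 2 / (4 * (r / 16)), fun p hp hpb b ξ hξ => ?_⟩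
    obtain ⟨s, hs, k4, k2, h4, h2, -, h2', he⟩ := low b ξ hξ
    obtain ⟨c1, c2, c3⟩ := coord hpb
    rw [he]
    set t := ‖cbrt ξ‖
    have ht : 0 ≤ t := norm_nonneg _
    have hτ : |p.2.2| ≤ T := by
      have := abs_sub_abs_le_abs_sub p.2.2 p₀.2.2
      linarith
    have hσ : r ≤ p.2.1 := by linarith [(abs_lt.1 c2).1]
    have hρ : 0 ≤ -p.1 := by rcases hp with hp | ⟨hp, -⟩ <;> linarith
    have e1 := lin ht hs hτ
    have e2 : r * (t ^ 2 * (1 / 8)) ≤ p.2.1 * (t ^ 2 * k2) := by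
      have : 0 ≤ p.2.1 := hr0.le.trans hσ
      gcongr
    have e3 : 0 ≤ -p.1 * (t ^ 4 * k4) := by positivity
    have e5 := amgm (2 * T) t (show 0 < r / 16 by positivity)
    linarith

/-- Exponentials `exp (C - c |ξ|^{2/3})` decay faster than any power. -/
lemma exists_pow_mul_exp_le {c : ℝ} (hc : 0 < c) (C : ℝ) (n : ℕ) :
    ∃ B, ∀ (ξ : ℂ) (x : ℝ), x ≤ C - c * ‖cbrt ξ‖ ^ 2 → (1 + ‖ξ‖) ^ n * Real.exp x ≤ B := by
  refine ⟨Real.exp (C + c) * ((2 * n).factorial / c ^ (2 * n)), fun ξ x hx => ?_⟩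
  set t := ‖cbrt ξ‖ with ht
  have ht0 : 0 ≤ t := norm_nonneg _
  have h1 : 1 + ‖ξ‖ ≤ (1 + t ^ 2) ^ 2 := by
    rw [← norm_cbrt_pow_three ξ, ← ht]
    nlinarith [sq_nonneg (t - 1), sq_nonneg (t * (t - 1)), mul_nonneg ht0 ht0]
  have h2 := Real.pow_div_factorial_le_exp (c * (1 + t ^ 2)) (by positivity) (2 * n)
  have h3 : (1 + ‖ξ‖) ^ n ≤ (1 + t ^ 2) ^ (2 * n) := by rw [pow_mul]; gcongr
  have h4 : (1 + t ^ 2) ^ (2 * n) ≤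
      ((2 * n).factorial / c ^ (2 * n)) * Real.exp (c * (1 + t ^ 2)) := by
    rw [mul_pow] at h2
    rw [div_mul_eq_mul_div, le_div_iff₀ (by positivity)]
    rw [div_le_iff₀ (by positivity)] at h2
    linarith
  calc (1 + ‖ξ‖) ^ n * Real.exp x ≤ ((2 * n).factorial / c ^ (2 * n)) * Real.exp (c * (1 + t ^ 2)) *
        Real.exp (C - c * t ^ 2) := by
        gcongr
        exact h3.trans h4
    _ = _ := by
        rw [mul_assoc, ← Real.exp_add, mul_comm]
        congr 2; ring

/-! ## The solution relative to the model, with smoothed jumps -/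

/-- `Φ` solves the model problem with the parameter triple `p`. -/
abbrev Solves (γ α : ℝ) (p : Param) (Φ : ℂ → Mat3) : Prop := IsModelSolution γ α p.1 p.2.1 p.2.2 Φ

/-- The model at infinity, as a function of the parameter triple. -/
def model (p : Param) (ξ : ℂ) : Mat3 := modelAtInfinity p.1 p.2.1 p.2.2 ξ

/-- The model built from an arbitrary triple of cube roots. -/
def modelOf (p : Param) (k : Fin 3 → ℂ) : Mat3 :=
  vander k * Matrix.diagonal fun j => exp (-phasePoly p (k j))

lemma model_eq_modelOf (p : Param) (ξ : ℂ) : model p ξ = modelOf p (kap ξ) := model_eq _ _ _ _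

lemma det_model' (p : Param) {ξ : ℂ} (hξ : ξ ≠ 0) : (model p ξ).det ≠ 0 :=
  det_model_ne_zero _ _ _ hξ

lemma det_vander_kap_ne_zero {ξ : ℂ} (hξ : ξ ≠ 0) : (vander (kap ξ)).det ≠ 0 := by
  rw [det_vander_kap]
  exact mul_ne_zero (mul_ne_zero (halfSign_ne_zero _) detOmega_ne_zero) hξ

def nil (b : Bool) : Mat3 := Matrix.single (sideRow b) 1 1

lemma nil_mul_nil (b b' : Bool) : nil b * nil b' = 0 := by
  cases b <;> cases b' <;> simp [nil, sideRow]

lemma diagonal_mul_nil (d : Fin 3 → ℂ) (b : Bool) :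
    Matrix.diagonal d * nil b = d (sideRow b) • nil b := by
  cases b <;> ext i j <;> fin_cases i <;> fin_cases j <;> simp [nil, sideRow]

lemma nil_mul_diagonal (d : Fin 3 → ℂ) (b : Bool) : nil b * Matrix.diagonal d = d 1 • nil b := by
  cases b <;> ext i j <;> fin_cases i <;> fin_cases j <;> simp [nil, sideRow]

/-- The rank one matrix carried by a wedge, conjugated by the Vandermonde matrix. -/
def wedgeMat (b : Bool) (ξ : ℂ) : Mat3 := vander (kap ξ) * nil b * (vander (kap ξ))⁻¹

lemma model_conj_nil (b : Bool) (p : Param) {ξ : ℂ} (hξ : ξ ≠ 0) :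
    model p ξ * nil b * (model p ξ)⁻¹ = exp (-expo b p ξ) • wedgeMat b ξ := by
  have hV := (det_vander_kap_ne_zero hξ).isUnit
  have hm := (det_model' p hξ).isUnit
  have h : model p ξ * nil b = exp (-expo b p ξ) • wedgeMat b ξ * model p ξ := by
    rw [model_eq_modelOf]
    unfold modelOf wedgeMat
    rw [mul_assoc (vander (kap ξ)), diagonal_mul_nil, Matrix.smul_mul, mul_assoc _ _
      (vander (kap ξ) * _), ← mul_assoc (vander (kap ξ))⁻¹, Matrix.nonsing_inv_mul _ hV, one_mul,
      mul_assoc, nil_mul_diagonal, Matrix.mul_smul, Matrix.mul_smul, smul_smul]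
    congr 1
    rw [← exp_add]
    congr 1
    unfold expo; ring
  rw [h, mul_assoc, Matrix.mul_nonsing_inv _ hm, mul_one]

/-- The off-diagonal entry of the jump which is smoothed out in a wedge. -/
def jumpCoeff (γ α : ℝ) (b : Bool) (ξ : ℂ) : ℂ :=
  if b then (if 0 < ξ.im then expI (-(2 * α / 3 * π)) else expI (2 * α / 3 * π))
  else γ * (if 0 < ξ.im then expI (-(α / 3 * π)) else expI (α / 3 * π))

lemma jumpCoeff_eventually (γ α : ℝ) (b : Bool) {ξ : ℂ} (h : ξ.im ≠ 0) :
    ∀ᶠ z in 𝓝 ξ, jumpCoeff γ α b z = jumpCoeff γ α b ξ := by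
  rcases lt_or_gt_of_ne h with him | him
  · filter_upwards [(continuous_im.tendsto ξ).eventually (gt_mem_nhds him)] with z hz
    simp [jumpCoeff, not_lt.2 hz.le, not_lt.2 him.le]
  · filter_upwards [(continuous_im.tendsto ξ).eventually (lt_mem_nhds him)] with z hz
    simp [jumpCoeff, hz, him]

lemma norm_jumpCoeff_le (γ α : ℝ) (b : Bool) (ξ : ℂ) : ‖jumpCoeff γ α b ξ‖ ≤ 1 + |γ| := by
  unfold jumpCoeff
  have := abs_nonneg γ
  split_ifs <;> simp [norm_expI]

open Classical in
/-- The indicator of the sector next to the real half line. -/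
def side (b : Bool) (ξ : ℂ) : ℂ := if 1 < slope b ξ then 1 else 0

/-- The unipotent matrix which turns the solution into the continuation of its values in the
sectors adjacent to the imaginary axis. -/
def unip (c : Bool → ℂ) : Mat3 := 1 + (c true • nil true + c false • nil false)

lemma unip_mul (c d : Bool → ℂ) : unip c * unip d = unip (fun b => c b + d b) := by
  unfold unip
  simp only [mul_add, add_mul, mul_one, one_mul, Matrix.smul_mul, Matrix.mul_smul, nil_mul_nil,
    smul_zero, add_zero, add_smul]
  abel

lemma unip_zero : unip (fun _ => 0) = 1 := by simp [unip]

lemma unip_eq (c : Bool → ℂ) : unip c = !![1, c true, 0; 0, 1, 0; 0, c false, 1] := by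
  ext i j
  fin_cases i <;> fin_cases j <;> simp [unip, nil, sideRow]

lemma det_unip (c : Bool → ℂ) : (unip c).det = 1 := by rw [unip_eq, Matrix.det_fin_three]; simp

/-- The continuation of the values in the sectors adjacent to the imaginary axis, before extension
across the contour. -/
def hatPhi (γ α : ℝ) (Φ : ℂ → Mat3) (ξ : ℂ) : Mat3 :=
  Φ ξ * unip fun b => jumpCoeff γ α b ξ * side b ξ

lemma slope_cases {ξ : ℂ} (h : ξ ∈ contourᶜ) (b : Bool) : slope b ξ ≠ 1 := by
  intro h1
  rw [mem_compl_iff, mem_contour_iff] at h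
  push Not at h
  obtain ⟨h0, h2, h3⟩ := h
  unfold slope at h1
  rw [div_eq_one_iff_eq (abs_ne_zero.2 h0)] at h1
  rcases abs_cases ξ.im with ⟨e, -⟩ | ⟨e, -⟩ <;> cases b <;> simp [sideSign, e] at h1
  · exact h3 (by linarith)
  · exact h2 h1
  · exact h2 h1
  · exact h3 h1

lemma side_eventually {ξ : ℂ} (h : ξ ∈ contourᶜ) (b : Bool) : ∀ᶠ z in 𝓝 ξ, side b z = side b ξ := by
  have h0 : ξ.im ≠ 0 := fun h0 => h (mem_contour_iff.2 (Or.inl h0))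
  have hc := (contDiffAt_slope b h0).continuousAt
  rcases lt_or_gt_of_ne (slope_cases h b) with h1 | h1
  · filter_upwards [hc.eventually (gt_mem_nhds h1)] with z hz
    simp [side, not_lt.2 hz.le, not_lt.2 h1.le]
  · filter_upwards [hc.eventually (lt_mem_nhds h1)] with z hz
    simp [side, hz, h1]

section Smoothing
variable {γ α : ℝ} {p : Param} {Φ : ℂ → Mat3}

lemma differentiableOn_hatPhi (h : Solves γ α p Φ) :
    DifferentiableOn ℂ (hatPhi γ α Φ) contourᶜ := by
  intro z hz
  have h0 : z.im ≠ 0 := fun h0 => hz (mem_contour_iff.2 (Or.inl h0))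
  refine DifferentiableAt.differentiableWithinAt ?_
  have h1 : DifferentiableAt ℂ (fun w => Φ w * unip fun b => jumpCoeff γ α b z * side b z) z :=
    (h.differentiableOn.differentiableAt (isOpen_compl_contour.mem_nhds hz)).mul_const _
  refine h1.congr_of_eventuallyEq ?_
  filter_upwards [side_eventually hz true, side_eventually hz false,
    jumpCoeff_eventually γ α true h0, jumpCoeff_eventually γ α false h0] with w h1 h2 h3 h4
  simp only [hatPhi, unip, h1, h2, h3, h4]

lemma tendsto_hatPhi (h : Solves γ α p Φ) {z : ℂ} (hz : z.im ≠ 0)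
    (hzc : z ∈ contour) : ∃ l, Tendsto (hatPhi γ α Φ) (𝓝[contourᶜ] z) (𝓝 l) := by
  have hz0 : z ≠ 0 := by rintro rfl; simp at hz
  obtain ⟨θ, S, T, hadj⟩ := exists_adjacent hzc hz0
  obtain ⟨r, hr, hzr⟩ := hadj.eq_mul_expI
  have hle := hadj.nhdsWithin_le
  have hside0 : ∀ {w : ℂ} {b : Bool}, sideSign b * w.re ≤ |w.im| → side b w = 0 := fun h1 =>
    if_neg (not_lt.2 (div_le_one_of_le₀ h1 (abs_nonneg _)))
  have outer : ∀ {A : Set ℂ} {F : Mat3}, Tendsto Φ (𝓝[A] z) (𝓝 F) →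
      (∀ w ∈ A, |w.re| ≤ |w.im|) → Tendsto (hatPhi γ α Φ) (𝓝[A] z) (𝓝 F) := by
    intro A F hF hA
    refine hF.congr' ?_
    filter_upwards [self_mem_nhdsWithin] with w hw
    have hs : ∀ b, side b w = 0 := fun b => hside0 (le_trans (by
      cases b
      · simpa [sideSign] using neg_le_abs w.re
      · simpa [sideSign] using le_abs_self w.re) (hA w hw))
    simp [hatPhi, hs, unip_zero]
  have inner : ∀ {A : Set ℂ} {F : Mat3} (b : Bool), Tendsto Φ (𝓝[A] z) (𝓝 F) →
      (∀ w ∈ A, 0 < w.im * z.im ∧ |w.im| < sideSign b * w.re) → Tendsto (hatPhi γ α Φ) (𝓝[A] z)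
        (𝓝 (F * unip fun c => if c = b then jumpCoeff γ α b z else 0)) := by
    intro A F b hF hA
    refine (hF.mul_const _).congr' ?_
    filter_upwards [self_mem_nhdsWithin] with w hw
    obtain ⟨h1, h2⟩ := hA w hw
    rw [hatPhi]
    congr 2
    funext c
    split_ifs with hc
    · subst hc
      have hj : jumpCoeff γ α c w = jumpCoeff γ α c z := by
        unfold jumpCoeff
        rcases mul_pos_iff.1 h1 with ⟨a, a'⟩ | ⟨a, a'⟩
        · simp only [a, a']
        · simp only [not_lt.2 a.le, not_lt.2 a'.le]
      rw [hj, side, slope, if_pos ((one_lt_div (abs_pos.2 (left_ne_zero_of_mul h1.ne'))).2 h2),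
        mul_one]
    · rw [hside0, mul_zero]
      have := abs_nonneg w.im
      cases b <;> cases c <;> simp [sideSign] at hc h2 ⊢ <;> linarith
  cases hadj with
  | pos h1 h2 => exact absurd h2 hz
  | neg h1 h2 => exact absurd h2 hz
  | quarter h1 h2 =>
    obtain ⟨F, _, t1, t2, rfl⟩ := h.jump_quarter r hr
    rw [← hzr] at t1 t2
    refine ⟨_, (tendsto_sup.2 ⟨?_, outer t2 fun w hw => ?_⟩).mono_left hle⟩
    · convert inner true t1 fun w hw => ?_ using 3
      · simp [unip_eq, jumpCoeff, h1]
      · rw [mem_sector_0_quarter] at hw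
        exact ⟨mul_pos hw.1 h1, by simpa [sideSign, abs_of_pos hw.1] using hw.2⟩
    · rw [mem_sector_quarter_three] at hw
      exact abs_le_abs hw.1.le (by linarith [hw.2])
  | neg_quarter h1 h2 =>
    obtain ⟨F, _, t1, t2, rfl⟩ := h.jump_neg_quarter r hr
    rw [← hzr] at t1 t2
    refine ⟨_, (tendsto_sup.2 ⟨outer t1 fun w hw => ?_, ?_⟩).mono_left hle⟩
    · rw [mem_sector_neg_three_quarter] at hw
      rw [← abs_neg w.im]
      exact abs_le_abs (by linarith [hw.1, hw.2]) (by linarith [hw.1, hw.2])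
    · convert inner true t2 fun w hw => ?_ using 2
      · rw [mul_assoc]
        simp [unip_eq, jumpCoeff, h1.not_gt, ← Matrix.one_fin_three]
      · rw [mem_sector_neg_quarter_0] at hw
        exact ⟨mul_pos_of_neg_of_neg hw.1 h1, by simp [sideSign, abs_of_neg hw.1]; linarith [hw.2]⟩
  | three_quarter h1 h2 =>
    obtain ⟨F, _, t1, t2, rfl⟩ := h.jump_three_quarter r hr
    rw [← hzr] at t1 t2
    refine ⟨_, (tendsto_sup.2 ⟨outer t1 fun w hw => ?_, ?_⟩).mono_left hle⟩
    · rw [mem_sector_quarter_three] at hw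
      exact abs_le_abs hw.1.le (by linarith [hw.2])
    · convert inner false t2 fun w hw => ?_ using 2
      · rw [mul_assoc]
        simp [unip_eq, jumpCoeff, h1, ← Matrix.one_fin_three]
      · rw [mem_sector_three_pi] at hw
        exact ⟨mul_pos hw.1 h1, by simp [sideSign, abs_of_pos hw.1]; linarith [hw.2]⟩
  | neg_three_quarter h1 h2 =>
    obtain ⟨F, _, t1, t2, rfl⟩ := h.jump_neg_three_quarter r hr
    rw [← hzr] at t1 t2
    refine ⟨_, (tendsto_sup.2 ⟨?_, outer t2 fun w hw => ?_⟩).mono_left hle⟩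
    · convert inner false t1 fun w hw => ?_ using 3
      · simp [unip_eq, jumpCoeff, h1.not_gt]
      · rw [mem_sector_neg_pi_three] at hw
        exact ⟨mul_pos_of_neg_of_neg hw.1 h1, by simp [sideSign, abs_of_neg hw.1]; linarith [hw.2]⟩
    · rw [mem_sector_neg_three_quarter] at hw
      rw [← abs_neg w.im]
      exact abs_le_abs (by linarith [hw.1, hw.2]) (by linarith [hw.1, hw.2])

lemma differentiableAt_extend_hatPhi (h : Solves γ α p Φ) {z : ℂ}
    (hz : z.im ≠ 0) : DifferentiableAt ℂ (extendFrom contourᶜ (hatPhi γ α Φ)) z := by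
  have hV : IsOpen {z : ℂ | z.im ≠ 0} := isOpen_ne_fun continuous_im continuous_const
  exact (differentiableOn_extend_contour (differentiableOn_hatPhi h) hV (by simp)
    (fun w hw hwc => tendsto_hatPhi h hw hwc)).differentiableAt (hV.mem_nhds hz)

/-! ### Across the real line -/

lemma cbrt_neg_of_im_pos {ξ : ℂ} (h : 0 < ξ.im) : cbrt ξ = omega ^ 2 * -cbrt (-ξ) := by
  have h0 : ξ ≠ 0 := by rintro rfl; simp at h
  have hn : ‖cbrt (-ξ)‖ = ‖cbrt ξ‖ := by
    refine (pow_left_inj₀ (norm_nonneg _) (norm_nonneg _) (n := 3) (by norm_num)).1 ?_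
    rw [norm_cbrt_pow_three, norm_cbrt_pow_three, norm_neg]
  have hm : (-1 : ℂ) = expI π := by unfold expI; rw [exp_pi_mul_I]
  rw [cbrt_eq h0, cbrt_eq (neg_ne_zero.2 h0), hn, arg_neg_eq_arg_sub_pi_of_im_pos h,
    neg_eq_neg_one_mul, hm, omega, expI_pow,
    show expI (((2 : ℕ) : ℝ) * (2 * π / 3)) * (expI π *
      ((‖cbrt ξ‖ : ℂ) * expI ((ξ.arg - π) / 3))) = (‖cbrt ξ‖ : ℂ) *
      (expI (((2 : ℕ) : ℝ) * (2 * π / 3)) * expI π * expI ((ξ.arg - π) / 3)) by ring,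
    ← expI_add, ← expI_add]
  rw [show ((2 : ℕ) : ℝ) * (2 * π / 3) + π + (ξ.arg - π) / 3 =
    ξ.arg / 3 + ((1 : ℤ) : ℝ) * (2 * π) by push_cast; ring, expI_add, expI_two_pi_mul,
    mul_one]

lemma cbrt_neg_of_im_neg {ξ : ℂ} (h : ξ.im < 0) : cbrt ξ = omega * -cbrt (-ξ) := by
  have h1 := cbrt_neg_of_im_pos (ξ := -ξ) (by simpa using h)
  rw [neg_neg] at h1
  rw [h1]
  linear_combination (-cbrt ξ) * omega_pow_three

lemma modelOf_swap01 (p : Param) (a b c : ℂ) :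
    modelOf p ![a, b, c] * !![0, 1, 0; 1, 0, 0; 0, 0, 1] = modelOf p ![b, a, c] := by
  ext i j
  fin_cases i <;> fin_cases j <;>
    simp [modelOf, vander, Matrix.mul_apply, Fin.sum_univ_three, Matrix.vecMul_diagonal]

lemma modelOf_swap12 (p : Param) (a b c : ℂ) :
    modelOf p ![a, b, c] * !![1, 0, 0; 0, 0, 1; 0, 1, 0] = modelOf p ![a, c, b] := by
  ext i j
  fin_cases i <;> fin_cases j <;>
    simp [modelOf, vander, Matrix.mul_apply, Fin.sum_univ_three, Matrix.vecMul_diagonal]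

lemma continuous_modelOf (p : Param) : Continuous (modelOf p) := by
  unfold modelOf
  refine Continuous.mul ?_ ?_
  · refine continuous_matrix fun i j => ?_
    fin_cases i <;> fin_cases j <;> simp [vander] <;> fun_prop
  · refine Continuous.matrix_diagonal ?_
    unfold phasePoly
    fun_prop

lemma tendsto_relative (h : Solves γ α p Φ) {z : ℂ} (hz : z.im = 0) (hz0 : z ≠ 0) :
    ∃ l, Tendsto (fun ξ => Φ ξ * (model p ξ)⁻¹) (𝓝[contourᶜ] z) (𝓝 l) := by
  have hzc : z ∈ contour := mem_contour_iff.2 (Or.inl hz)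
  obtain ⟨θ, S, T, hadj⟩ := exists_adjacent hzc hz0
  obtain ⟨r, hr, hzr⟩ := hadj.eq_mul_expI
  have key : ∀ (k : ℂ → Fin 3 → ℂ) {Fm Fp J : Mat3} (_ : J * J = 1) (_ : ContinuousAt k z)
      (_ : (modelOf p (k z)).det ≠ 0)
      (_ : ∀ w ∈ S, model p w = modelOf p (k w)) (_ : ∀ w ∈ T, model p w = modelOf p (k w) * J)
      (_ : Tendsto Φ (𝓝[S] z) (𝓝 Fm)) (_ : Tendsto Φ (𝓝[T] z) (𝓝 Fp)) (_ : Fp = Fm * J),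
      ∃ l, Tendsto (fun ξ => Φ ξ * (model p ξ)⁻¹) (𝓝[contourᶜ] z) (𝓝 l) := by
    intro k Fm Fp J hJ2 hk hd hS hT t1 t2 hJ
    have hJi : J⁻¹ = J := Matrix.inv_eq_right_inv hJ2
    have tm : Tendsto (fun w => (modelOf p (k w))⁻¹) (𝓝 z) (𝓝 (modelOf p (k z))⁻¹) :=
      tendsto_mat_inv hd (((continuous_modelOf p).tendsto _).comp hk.tendsto)
    refine ⟨Fm * (modelOf p (k z))⁻¹, Tendsto.mono_left (tendsto_sup.2 ⟨?_, ?_⟩) hadj.nhdsWithin_le⟩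
    · refine (t1.mul (tm.mono_left nhdsWithin_le_nhds)).congr' ?_
      filter_upwards [self_mem_nhdsWithin] with w hw
      rw [hS w hw]
    · have := (t2.mul_const J).mul (tm.mono_left (nhdsWithin_le_nhds (s := T)))
      rw [hJ, mul_assoc Fm, hJ2, mul_one] at this
      refine this.congr' ?_
      filter_upwards [self_mem_nhdsWithin] with w hw
      rw [hT w hw, Matrix.mul_inv_rev, hJi, mul_assoc]
  have hcd : ∀ k : Fin 3 → ℂ, (modelOf p k).det ≠ 0 ↔ (vander k).det ≠ 0 := by
    simp [modelOf, Matrix.det_diagonal, Finset.prod_ne_zero_iff]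
  cases hadj with
  | pos h1 h2 =>
    obtain ⟨Fm, Fp, t1, t2, hJ⟩ := h.jump_pos r hr
    rw [← hzr] at t1 t2
    have hsp : z ∈ slitPlane := Or.inl h1
    refine key (fun w => ![omega ^ 2 * cbrt w, omega * cbrt w, cbrt w])
      (J := !![0, 1, 0; 1, 0, 0; 0, 0, 1]) ?_ ?_ ?_ ?_ ?_ t1 t2 hJ
    · simp [Matrix.one_fin_three]
    · have hc := (differentiableAt_cbrt hsp).continuousAt
      exact continuousAt_pi.2 fun j => by
        fin_cases j; exacts [hc.const_mul _, hc.const_mul _, hc]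
    · rw [hcd]
      simpa [kap, h2] using det_vander_kap_ne_zero hz0
    · intro w hw
      rw [mem_sector_neg_quarter_0] at hw
      rw [model_eq_modelOf]; congr 1
      simp [kap, not_lt.2 hw.1.le]
    · intro w hw
      rw [mem_sector_0_quarter] at hw
      rw [model_eq_modelOf, modelOf_swap01]; congr 1
      simp [kap, hw.1]
  | neg h1 h2 =>
    obtain ⟨Fm, Fp, t1, t2, hJ⟩ := h.jump_neg r hr
    rw [← hzr] at t1 t2
    have hsp : -z ∈ slitPlane := Or.inl (by simpa using h1)
    have h3 := omega_pow_three
    have h4 : omega ^ 4 = omega := by linear_combination omega * h3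
    refine key (fun w => ![-cbrt (-w), omega * -cbrt (-w), omega ^ 2 * -cbrt (-w)])
      (J := !![1, 0, 0; 0, 0, 1; 0, 1, 0]) ?_ ?_ ?_ ?_ ?_ t1 t2 hJ
    · simp [Matrix.one_fin_three]
    · have hc : ContinuousAt (fun w => cbrt (-w)) z :=
        ContinuousAt.comp (f := fun w : ℂ => -w) (g := cbrt)
          (differentiableAt_cbrt hsp).continuousAt continuous_neg.continuousAt
      exact continuousAt_pi.2 fun j => by
        fin_cases j; exacts [hc.neg, hc.neg.const_mul _, hc.neg.const_mul _]
    · rw [hcd, det_vander]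
      have hc := cbrt_ne_zero (neg_ne_zero.2 hz0)
      have hd := detOmega_ne_zero
      have e : (omega * -cbrt (-z) - -cbrt (-z)) * (omega ^ 2 * -cbrt (-z) - -cbrt (-z)) *
        (omega ^ 2 * -cbrt (-z) - omega * -cbrt (-z)) = detOmega * (-cbrt (-z)) ^ 3 := by
        unfold detOmega; ring
      simp only [Matrix.cons_val_zero, Matrix.cons_val_one, Matrix.cons_val]
      rw [e]
      exact mul_ne_zero hd (pow_ne_zero _ (neg_ne_zero.2 hc))
    · intro w hw
      rw [mem_sector_three_pi] at hw
      rw [model_eq_modelOf]; congr 1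
      unfold kap
      rw [if_pos hw.1, cbrt_neg_of_im_pos hw.1]
      congr 1
      · linear_combination (-cbrt (-w)) * h3
      · congr 1
        linear_combination (-cbrt (-w)) * h4
    · intro w hw
      rw [mem_sector_neg_pi_three] at hw
      rw [model_eq_modelOf, modelOf_swap12]; congr 1
      unfold kap
      rw [if_neg (not_lt.2 hw.1.le), cbrt_neg_of_im_neg hw.1]
      congr 1
      · linear_combination (-cbrt (-w)) * h3
      · congr 1
        ring
  | quarter h1 h2 => exact absurd hz h1.ne'
  | neg_quarter h1 h2 => exact absurd hz h1.ne
  | three_quarter h1 h2 => exact absurd hz h1.ne'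
  | neg_three_quarter h1 h2 => exact absurd hz h1.ne

lemma differentiableAt_model (p : Param) {ξ : ℂ} (h : ξ.im ≠ 0) :
    DifferentiableAt ℂ (model p) ξ := by
  have hk := differentiableAt_kap h
  have hp := differentiableAt_phasePoly_kap h p
  have e : model p = fun ξ => vander (kap ξ) *
      Matrix.diagonal fun j => exp (-phasePoly p (kap ξ j)) := funext fun ξ => model_eq _ _ _ _
  rw [e]
  refine DifferentiableAt.mul ?_ ?_
  · refine differentiableAt_mat fun i j => ?_
    fin_cases i <;> fin_cases j <;> simp [vander] <;> fun_prop (disch := exact hk _)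
  · refine differentiableAt_mat fun i j => ?_
    by_cases hij : i = j
    · subst hij
      simp only [Matrix.diagonal_apply_eq]
      exact (hp i).neg.cexp
    · simp only [Matrix.diagonal_apply_ne _ hij]
      exact differentiableAt_const _

lemma im_ne_zero_of_notMem_contour {ξ : ℂ} (h : ξ ∈ contourᶜ) : ξ.im ≠ 0 :=
  fun h0 => h (mem_contour_iff.2 (Or.inl h0))

lemma differentiableOn_relative (h : Solves γ α p Φ) :
    DifferentiableOn ℂ (fun ξ => Φ ξ * (model p ξ)⁻¹) contourᶜ := by
  intro z hz
  have him := im_ne_zero_of_notMem_contour hz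
  exact ((h.differentiableOn.differentiableAt (isOpen_compl_contour.mem_nhds hz)).mul
    (differentiableAt_mat_inv (det_model' p (ne_zero_of_notMem_contour hz))
      (differentiableAt_model p him))).differentiableWithinAt

lemma differentiableAt_extend_relative (h : Solves γ α p Φ) {z : ℂ} (hz : z.im = 0) (hz0 : z ≠ 0) :
    DifferentiableAt ℂ (extendFrom contourᶜ fun ξ => Φ ξ * (model p ξ)⁻¹) z := by
  have hV : IsOpen {w : ℂ | |w.im| < |w.re|} := isOpen_lt (by fun_prop) (by fun_prop)
  have hmem : z ∈ {w : ℂ | |w.im| < |w.re|} := by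
    have : z.re ≠ 0 := fun h => hz0 (Complex.ext h hz)
    simpa [hz] using this
  refine (differentiableOn_extend_contour (differentiableOn_relative h) hV (by simp)
    (fun w hw hwc => ?_)).differentiableAt (hV.mem_nhds hmem)
  have hw0 : w ≠ 0 := by rintro rfl; simp at hw
  refine tendsto_relative h ?_ hw0
  rw [mem_contour_iff] at hwc
  rw [mem_ofPred_eq] at hw
  rcases hwc with h1 | h1 | h1
  · exact h1
  · rw [h1] at hw; simp at hw
  · rw [h1, abs_neg] at hw; simp at hw

end Smoothing

/-! ## Polynomial bounds for the Vandermonde matrix -/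

lemma norm_inv_le_of_entries {A : Mat3} {c : ℝ} (hA : ∀ i j, ‖A i j‖ ≤ c) :
    ‖A⁻¹‖ ≤ ‖A.det‖⁻¹ * (18 * c ^ 2) := by
  have hc : 0 ≤ c := (norm_nonneg _).trans (hA 0 0)
  rw [Matrix.inv_def, Ring.inverse_eq_inv', norm_smul, norm_inv]
  have key : ∀ i j k l i' j' k' l', ‖A i j * A k l - A i' j' * A k' l'‖ ≤ 2 * c ^ 2 := by
    intro i j k l i' j' k' l'
    refine (norm_sub_le _ _).trans ?_
    rw [norm_mul, norm_mul]
    have h1 := mul_le_mul (hA i j) (hA k l) (norm_nonneg _) hc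
    have h2 := mul_le_mul (hA i' j') (hA k' l') (norm_nonneg _) hc
    linarith
  have key' : ∀ i j k l i' j' k' l', ‖-(A i j * A k l) + A i' j' * A k' l'‖ ≤ 2 * c ^ 2 := by
    intro i j k l i' j' k' l'
    rw [neg_add_eq_sub]; exact key _ _ _ _ _ _ _ _
  gcongr
  refine (norm_le_sum_entries _).trans ?_
  have h9 : ∀ i j, ‖A.adjugate i j‖ ≤ 2 * c ^ 2 := by
    intro i j
    rw [Matrix.adjugate_fin_three]
    fin_cases i <;> fin_cases j <;> simp only [Matrix.of_apply, Matrix.cons_val', Matrix.cons_val,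
      Fin.zero_eta, Fin.mk_one, Fin.reduceFinMk, Matrix.cons_val_zero, Matrix.cons_val_one] <;>
      first | apply key | apply key'
  calc ∑ i, ∑ j, ‖A.adjugate i j‖ ≤ ∑ _i : Fin 3, ∑ _j : Fin 3, 2 * c ^ 2 := by gcongr; exact h9 _ _
    _ = 18 * c ^ 2 := by simp; ring

lemma norm_cbrt_le (ξ : ℂ) : ‖cbrt ξ‖ ≤ 1 + ‖ξ‖ := by
  rw [← norm_cbrt_pow_three ξ]
  have := norm_nonneg (cbrt ξ)
  nlinarith [sq_nonneg (‖cbrt ξ‖ - 1), mul_nonneg this (sq_nonneg (‖cbrt ξ‖ - 1))]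

lemma norm_vander_kap_entry_le (ξ : ℂ) (i j : Fin 3) : ‖vander (kap ξ) i j‖ ≤ (1 + ‖ξ‖) ^ 2 := by
  have h1 : 1 ≤ 1 + ‖ξ‖ := by linarith [norm_nonneg ξ]
  have h2 := norm_cbrt_le ξ
  have h3 : ∀ j, ‖kap ξ j‖ ≤ (1 + ‖ξ‖) ^ 2 := fun j => by
    rw [norm_kap]; exact h2.trans (by nlinarith)
  have h4 : ∀ j, ‖kap ξ j ^ 2‖ ≤ (1 + ‖ξ‖) ^ 2 := fun j => by rw [norm_pow, norm_kap]; gcongr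
  have h5 : ‖(1:ℂ)‖ ≤ (1 + ‖ξ‖) ^ 2 := by rw [norm_one]; nlinarith
  fin_cases i <;> fin_cases j <;> simp only [vander, Matrix.of_apply, Matrix.cons_val',
    Matrix.cons_val, Fin.zero_eta, Fin.mk_one, Fin.reduceFinMk, Matrix.cons_val_zero,
    Matrix.cons_val_one] <;> first | exact h5 | apply h3 | apply h4

lemma norm_vander_kap_le (ξ : ℂ) : ‖vander (kap ξ)‖ ≤ 9 * (1 + ‖ξ‖) ^ 2 := by
  refine (norm_le_sum_entries _).trans ?_
  calc ∑ i, ∑ j, ‖vander (kap ξ) i j‖ ≤ ∑ _i : Fin 3, ∑ _j : Fin 3, (1 + ‖ξ‖) ^ 2 := by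
        gcongr; exact norm_vander_kap_entry_le _ _ _
    _ = _ := by simp; ring

lemma exists_norm_wedgeMat_le : ∃ C, 0 ≤ C ∧ ∀ b ξ, 1 / 4 ≤ ‖ξ‖ →
    ‖wedgeMat b ξ‖ ≤ C * (1 + ‖ξ‖) ^ 6 := by
  refine ⟨9 * (‖nil true‖ + ‖nil false‖) * ((‖detOmega‖ * (1 / 4))⁻¹ * 18), by positivity,
    fun b ξ hξ => ?_⟩
  have hd : 0 < ‖detOmega‖ := norm_pos_iff.2 detOmega_ne_zero
  have hinv : ‖(vander (kap ξ))⁻¹‖ ≤ (‖detOmega‖ * (1 / 4))⁻¹ * (18 * ((1 + ‖ξ‖) ^ 2) ^ 2) := by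
    refine (norm_inv_le_of_entries (norm_vander_kap_entry_le ξ)).trans ?_
    gcongr
    have hs : ‖halfSign ξ‖ = 1 := by unfold halfSign; split_ifs <;> simp
    rw [det_vander_kap, norm_mul, norm_mul, hs, one_mul]
    gcongr
  have hn : ‖nil b‖ ≤ ‖nil true‖ + ‖nil false‖ := by
    cases b
    · linarith [norm_nonneg (nil true)]
    · linarith [norm_nonneg (nil false)]
  unfold wedgeMat
  calc _ ≤ ‖vander (kap ξ)‖ * ‖nil b‖ * ‖(vander (kap ξ))⁻¹‖ :=
        (norm_mul_le _ _).trans (by gcongr; exact norm_mul_le _ _)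
    _ ≤ (9 * (1 + ‖ξ‖) ^ 2) * (‖nil true‖ + ‖nil false‖) *
        ((‖detOmega‖ * (1 / 4))⁻¹ * (18 * ((1 + ‖ξ‖) ^ 2) ^ 2)) := by
        gcongr; exact norm_vander_kap_le ξ
    _ = _ := by ring

lemma exists_wedge_decay {p : Param} (hp : Admissible p.1 p.2.1) (n : ℕ) :
    ∃ C, 0 ≤ C ∧ ∀ b, ∀ ξ ∈ wedge b, 1 / 4 ≤ ‖ξ‖ →
      (1 + ‖ξ‖) ^ n * ‖exp (-expo b p ξ) • wedgeMat b ξ‖ ≤ C := by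
  obtain ⟨ε, hε, c, hc, C, hC⟩ := exists_le_re_expo hp
  obtain ⟨C1, h0, hC1⟩ := exists_norm_wedgeMat_le
  obtain ⟨B, hB⟩ := exists_pow_mul_exp_le hc C (n + 6)
  have hB0 : 0 ≤ B := le_trans (by positivity) (hB 0 (C - c * ‖cbrt 0‖ ^ 2) le_rfl)
  refine ⟨C1 * B, by positivity, fun b ξ hξ h4 => ?_⟩
  have h1 := hC p hp (mem_ball_self hε) b ξ hξ
  have h2 := hB ξ (-expo b p ξ).re (by rw [neg_re]; linarith)
  rw [norm_smul, norm_exp]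
  calc _ ≤ (1 + ‖ξ‖) ^ n * (Real.exp (-expo b p ξ).re * (C1 * (1 + ‖ξ‖) ^ 6)) := by
        gcongr; exact hC1 b ξ h4
    _ = C1 * ((1 + ‖ξ‖) ^ (n + 6) * Real.exp (-expo b p ξ).re) := by ring
    _ ≤ C1 * B := by gcongr

/-! ## The smoothed relative solution -/

lemma contDiffAt_of_eventually {E : Type*} [NormedAddCommGroup E] [NormedSpace ℂ E]
    [CompleteSpace E] {f : ℂ → E} {z : ℂ} (h : ∀ᶠ w in 𝓝 z, DifferentiableAt ℂ f w) :
    ContDiffAt ℝ ∞ f z :=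
  (analyticAt_iff_eventually_differentiableAt.2 h).contDiffAt.restrict_scalars ℝ

def smoothF (γ α : ℝ) (p : Param) (Φ : ℂ → Mat3) (ξ : ℂ) : Mat3 :=
  if ξ.im = 0 then extendFrom contourᶜ (fun ξ => Φ ξ * (model p ξ)⁻¹) ξ
  else extendFrom contourᶜ (hatPhi γ α Φ) ξ *
    unip (fun b => -((cut b ξ : ℂ) * jumpCoeff γ α b ξ)) * (model p ξ)⁻¹

def leftover (γ α : ℝ) (b : Bool) (ξ : ℂ) : ℂ := jumpCoeff γ α b ξ * (side b ξ - cut b ξ)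

/-- `∂̄F = F ν` for the smoothed relative solution `F`. -/
def nu (γ α : ℝ) (p : Param) (ξ : ℂ) : Mat3 :=
  -((dbarCut true ξ * jumpCoeff γ α true ξ) • (exp (-expo true p ξ) • wedgeMat true ξ) +
    (dbarCut false ξ * jumpCoeff γ α false ξ) • (exp (-expo false p ξ) • wedgeMat false ξ))

lemma leftover_of_notMem (γ α : ℝ) {b : Bool} {ξ : ℂ} (h0 : ξ.im ≠ 0) (h : ξ ∉ wedge b) :
    leftover γ α b ξ = 0 := by
  have h1 : slope b ξ < 1 ∨ 2 < slope b ξ := by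
    by_contra hcon
    push Not at hcon
    exact h ⟨h0, hcon.1, hcon.2⟩
  unfold leftover side cut
  rcases h1 with h1 | h1
  · rw [if_neg (by linarith), Real.smoothTransition.zero_of_nonpos (by linarith)]; simp
  · rw [if_pos (by linarith), Real.smoothTransition.one_of_one_le (by linarith)]; simp

lemma norm_leftover_le (γ α : ℝ) (b : Bool) (ξ : ℂ) : ‖leftover γ α b ξ‖ ≤ 1 + |γ| := by
  unfold leftover
  rw [norm_mul]
  have h1 := norm_jumpCoeff_le γ α b ξ
  have h2 : ‖side b ξ - cut b ξ‖ ≤ 1 := by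
    have e : side b ξ - cut b ξ = (((if 1 < slope b ξ then 1 else 0) - cut b ξ : ℝ) : ℂ) := by
      unfold side; push_cast; split_ifs <;> simp
    rw [e, norm_real, Real.norm_eq_abs, abs_le]
    have h3 := Real.smoothTransition.nonneg (slope b ξ - 1)
    have h4 := Real.smoothTransition.le_one (slope b ξ - 1)
    unfold cut
    split_ifs <;> constructor <;> linarith
  have := abs_nonneg γ
  nlinarith [norm_nonneg (jumpCoeff γ α b ξ), norm_nonneg (side b ξ - cut b ξ)]

section Smoothed
variable {γ α : ℝ} {p : Param} {Φ : ℂ → Mat3}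

lemma smoothF_eq (h : Solves γ α p Φ) {ξ : ℂ} (hξ : ξ ∈ contourᶜ) :
    smoothF γ α p Φ ξ = Φ ξ * unip (fun b => leftover γ α b ξ) * (model p ξ)⁻¹ := by
  have hx : extendFrom contourᶜ (hatPhi γ α Φ) ξ = hatPhi γ α Φ ξ :=
    extendFrom_eq_of_mem (differentiableOn_hatPhi h) hξ
  unfold smoothF
  rw [if_neg (im_ne_zero_of_notMem_contour hξ), hx, hatPhi, mul_assoc (Φ ξ), unip_mul]
  congr 3
  funext b
  unfold leftover; ring

lemma smoothF_eventually_real (h : Solves γ α p Φ) {z : ℂ} (hz : z.im = 0) (hz0 : z ≠ 0) :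
    smoothF γ α p Φ =ᶠ[𝓝 z] extendFrom contourᶜ (fun ξ => Φ ξ * (model p ξ)⁻¹) := by
  have hre : z.re ≠ 0 := fun h => hz0 (Complex.ext h hz)
  have h1 : 2 * |z.im| < |z.re| := by simpa [hz] using hre
  have c1 : Continuous fun w : ℂ => 2 * |w.im| := by fun_prop
  have c2 : Continuous fun w : ℂ => |w.re| := by fun_prop
  filter_upwards [(c1.tendsto z).eventually_lt (c2.tendsto z) h1,
    eventually_notMem_wedge (b := true) hz0 (fun hw => hw.1 hz),
    eventually_notMem_wedge (b := false) hz0 (fun hw => hw.1 hz)] with w hw h2 h3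
  by_cases him : w.im = 0
  · unfold smoothF; rw [if_pos him]
  · have hwc : w ∈ contourᶜ := by
      rw [mem_compl_iff, mem_contour_iff]
      have hp := abs_pos.2 him
      push Not
      refine ⟨him, fun h => ?_, fun h => ?_⟩
      · rw [h] at hw; linarith
      · rw [h, abs_neg] at hw; linarith
    have hx : extendFrom contourᶜ (fun ξ => Φ ξ * (model p ξ)⁻¹) w = Φ w * (model p w)⁻¹ :=
      extendFrom_eq_of_mem (differentiableOn_relative h) hwc
    rw [smoothF_eq h hwc, hx]
    have : (fun b => leftover γ α b w) = fun _ => 0 := by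
      funext b
      cases b
      · exact leftover_of_notMem γ α him h3
      · exact leftover_of_notMem γ α him h2
    rw [this, unip_zero, mul_one]

lemma smoothF_eventually (γ α : ℝ) (p : Param) (Φ : ℂ → Mat3) {z : ℂ} (hz : z.im ≠ 0) :
    smoothF γ α p Φ =ᶠ[𝓝 z] fun ξ => extendFrom contourᶜ (hatPhi γ α Φ) ξ *
      unip (fun b => -((cut b ξ : ℂ) * jumpCoeff γ α b z)) * (model p ξ)⁻¹ := by
  filter_upwards [(continuous_im.tendsto z).eventually_ne hz, jumpCoeff_eventually γ α true hz,
    jumpCoeff_eventually γ α false hz] with w h0 h1 h2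
  unfold smoothF
  rw [if_neg h0]
  simp only [unip, h1, h2]

lemma eventually_im_ne {z : ℂ} (hz : z.im ≠ 0) : ∀ᶠ w in 𝓝 z, w.im ≠ 0 :=
  (continuous_im.tendsto z).eventually_ne hz

lemma differentiableAt_model_inv (p : Param) {z : ℂ} (hz : z.im ≠ 0) :
    DifferentiableAt ℂ (fun w => (model p w)⁻¹) z :=
  differentiableAt_mat_inv (det_model' p (by rintro rfl; simp at hz)) (differentiableAt_model p hz)

lemma contDiffAt_unip_cut (c : Bool → ℂ) {z : ℂ} (hz : z.im ≠ 0) :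
    ContDiffAt ℝ ∞ (fun ξ => unip fun b => -((cut b ξ : ℂ) * c b)) z := by
  unfold unip
  have h := fun b => ((contDiffAt_cut b hz).mul (contDiffAt_const (c := c b))).neg
  exact contDiffAt_const.add (((h true).smul contDiffAt_const).add
    ((h false).smul contDiffAt_const))

lemma contDiffAt_smoothF (h : Solves γ α p Φ) {z : ℂ} (hz : z ≠ 0) :
    ContDiffAt ℝ ∞ (smoothF γ α p Φ) z := by
  by_cases him : z.im = 0
  · refine ContDiffAt.congr_of_eventuallyEq ?_ (smoothF_eventually_real h him hz)
    refine contDiffAt_of_eventually ?_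
    have hV : IsOpen {w : ℂ | |w.im| < |w.re|} := isOpen_lt (by fun_prop) (by fun_prop)
    have hmem : z ∈ {w : ℂ | |w.im| < |w.re|} := by
      have : z.re ≠ 0 := fun h => hz (Complex.ext h him)
      simpa [him] using this
    filter_upwards [hV.mem_nhds hmem] with w hw
    by_cases hw0 : w.im = 0
    · exact differentiableAt_extend_relative h hw0 (by rintro rfl; simp at hw)
    · have hwc : w ∈ contourᶜ := by
        rw [mem_compl_iff, mem_contour_iff]
        push Not
        refine ⟨hw0, fun h => ?_, fun h => ?_⟩
        · rw [h] at hw; exact lt_irrefl _ hw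
        · rw [h, abs_neg] at hw; exact lt_irrefl _ hw
      have hd := (differentiableOn_relative h).differentiableAt (isOpen_compl_contour.mem_nhds hwc)
      refine hd.congr_of_eventuallyEq ?_
      filter_upwards [isOpen_compl_contour.mem_nhds hwc] with v hv
      exact extendFrom_eq_of_mem (differentiableOn_relative h) hv
  · refine ContDiffAt.congr_of_eventuallyEq ?_ (smoothF_eventually γ α p Φ him)
    refine ContDiffAt.mul (ContDiffAt.mul ?_ (contDiffAt_unip_cut _ him)) ?_
    · refine contDiffAt_of_eventually ?_
      filter_upwards [eventually_im_ne him] with w hw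
      exact differentiableAt_extend_hatPhi h hw
    · refine contDiffAt_of_eventually ?_
      filter_upwards [eventually_im_ne him] with w hw
      exact differentiableAt_model_inv p hw

lemma continuousAt_smoothF (h : Solves γ α p Φ) {z : ℂ} (hz : z ≠ 0) :
    ContinuousAt (smoothF γ α p Φ) z := (contDiffAt_smoothF h hz).continuousAt

lemma det_smoothF (h : Solves γ α p Φ) {z : ℂ} (hz : z ≠ 0) : (smoothF γ α p Φ z).det = 1 := by
  have hc : Tendsto (fun w => (smoothF γ α p Φ w).det) (𝓝[contourᶜ] z)
      (𝓝 (smoothF γ α p Φ z).det) :=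
    ((continuous_det.tendsto _).comp (continuousAt_smoothF h hz).tendsto).mono_left
      nhdsWithin_le_nhds
  have hne : (𝓝[contourᶜ] z).NeBot := mem_closure_iff_nhdsWithin_neBot.1 (dense_compl_contour z)
  refine tendsto_nhds_unique hc (tendsto_const_nhds.congr' ?_)
  filter_upwards [self_mem_nhdsWithin] with w hw
  rw [smoothF_eq h hw, Matrix.det_mul, Matrix.det_mul, det_unip, mul_one, Matrix.det_nonsing_inv,
    Ring.inverse_eq_inv', model, det_model, h.det_eq hw]
  rw [mul_inv_cancel₀]
  rw [← h.det_eq hw]; exact h.det_ne_zero hw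

lemma dbar_smoothF (h : Solves γ α p Φ) {z : ℂ} (hz : z ≠ 0) :
    dbar (smoothF γ α p Φ) z = smoothF γ α p Φ z * nu γ α p z := by
  by_cases him : z.im = 0
  · rw [dbar_congr (smoothF_eventually_real h him hz),
      dbar_eq_zero (differentiableAt_extend_relative h him hz)]
    simp [nu, dbarCut, him]
  · set H := extendFrom contourᶜ (hatPhi γ α Φ)
    have hHd : DifferentiableAt ℂ H z := differentiableAt_extend_hatPhi h him
    have hmd := differentiableAt_model_inv p him
    have hcd := fun b => (contDiffAt_cut b him).differentiableAt (by norm_num)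
    set c := fun b => jumpCoeff γ α b z
    set u : Mat3 := (dbarCut true z * c true) • nil true + (dbarCut false z * c false) • nil false
      with hu
    have hud : DifferentiableAt ℝ (fun ξ => unip fun b => -((cut b ξ : ℂ) * c b)) z :=
      (contDiffAt_unip_cut c him).differentiableAt (by norm_num)
    have hub : dbar (fun ξ => unip fun b => -((cut b ξ : ℂ) * c b)) z = -u := by
      have e : (fun ξ => unip fun b => -((cut b ξ : ℂ) * c b)) = fun ξ =>
          (1 : Mat3) + ((cut true ξ : ℂ) • (-(c true) • nil true) +
            (cut false ξ : ℂ) • (-(c false) • nil false)) := by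
        funext ξ; unfold unip; simp only [smul_smul]; congr 3 <;> ring
      rw [e]
      have d1 := (hcd true).smul (differentiableAt_const (x := z) (-(c true) • nil true))
      have d2 := (hcd false).smul (differentiableAt_const (x := z) (-(c false) • nil false))
      refine (dbar_add (differentiableAt_const _) (d1.add d2)).trans ?_
      rw [dbar_const, zero_add]
      refine (dbar_add d1 d2).trans ?_
      have e1 := fun b => dbar_smul (hcd b) (differentiableAt_const (x := z) (-(c b) • nil b))
      refine (congrArg₂ (· + ·) (e1 true) (e1 false)).trans ?_
      simp only [dbar_const, smul_zero, add_zero]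
      rw [hu]
      simp only [dbarCut, if_neg him, smul_smul]
      module
    rw [dbar_congr (smoothF_eventually γ α p Φ him)]
    have hHr : DifferentiableAt ℝ H z := hHd.restrictScalars ℝ
    have hmr : DifferentiableAt ℝ (fun w => (model p w)⁻¹) z := hmd.restrictScalars ℝ
    have e1 := dbar_mul (hHr.mul hud) hmr
    have e2 := dbar_mul hHr hud
    refine e1.trans ?_
    rw [dbar_eq_zero hmd, mul_zero, add_zero]
    refine (congrArg (· * (model p z)⁻¹) e2).trans ?_
    rw [dbar_eq_zero hHd, zero_mul, zero_add, hub]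
    have hm := (det_model' p hz).isUnit
    have hnu : nu γ α p z = -(model p z * u * (model p z)⁻¹) := by
      unfold nu
      rw [← model_conj_nil true p hz, ← model_conj_nil false p hz, hu]
      simp only [mul_add, add_mul, Matrix.mul_smul, Matrix.smul_mul]
      rfl
    have hS : smoothF γ α p Φ z = H z * unip (fun b => -((cut b z : ℂ) * c b)) * (model p z)⁻¹ :=
      (smoothF_eventually γ α p Φ him).self_of_nhds
    have hnil : unip (fun b => -((cut b z : ℂ) * c b)) * u = u := by
      rw [hu]
      simp only [unip, add_mul, mul_add, one_mul, Matrix.smul_mul, Matrix.mul_smul, nil_mul_nil,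
        smul_zero, add_zero]
    rw [hS, hnu]
    calc H z * -u * (model p z)⁻¹
        = -(H z * (unip (fun b => -((cut b z : ℂ) * c b)) * u) * (model p z)⁻¹) := by
          rw [hnil]; noncomm_ring
      _ = -(H z * unip (fun b => -((cut b z : ℂ) * c b)) * ((model p z)⁻¹ * model p z) * u *
          (model p z)⁻¹) := by rw [Matrix.nonsing_inv_mul _ hm]; noncomm_ring
      _ = _ := by noncomm_ring

lemma continuousAt_wedgeMat {b : Bool} {ξ : ℂ} (h : ξ.im ≠ 0) : ContinuousAt (wedgeMat b) ξ := by
  have hk := fun j => (differentiableAt_kap h j).continuousAt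
  have hξ : ξ ≠ 0 := by rintro rfl; simp at h
  have hv : ContinuousAt (fun z => vander (kap z)) ξ := by
    have : DifferentiableAt ℂ (fun z => vander (kap z)) ξ := by
      refine differentiableAt_mat fun i j => ?_
      have hk := differentiableAt_kap h
      fin_cases i <;> fin_cases j <;> simp [vander] <;> fun_prop (disch := exact hk _)
    exact this.continuousAt
  exact (hv.mul continuousAt_const).mul (tendsto_mat_inv (det_vander_kap_ne_zero hξ) hv)

lemma exists_norm_nu_le (γ α : ℝ) (hp : Admissible p.1 p.2.1) (n : ℕ) :
    ∃ C, 0 ≤ C ∧ ∀ ξ, 1 / 4 ≤ ‖ξ‖ → (1 + ‖ξ‖) ^ n * ‖nu γ α p ξ‖ ≤ C := by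
  obtain ⟨C, hC0, hC⟩ := exists_wedge_decay hp n
  obtain ⟨D, hD⟩ := exists_bound_dbarCut
  have hD0 : 0 ≤ D := le_trans (by positivity) (hD true 0)
  refine ⟨2 * (4 * D * (1 + |γ|) * C), by positivity, fun ξ hξ => ?_⟩
  have key : ∀ b, (1 + ‖ξ‖) ^ n * ‖(dbarCut b ξ * jumpCoeff γ α b ξ) •
      (exp (-expo b p ξ) • wedgeMat b ξ)‖ ≤ 4 * D * (1 + |γ|) * C := by
    intro b
    by_cases hw : ξ ∈ wedge b
    · rw [norm_smul, norm_mul]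
      have h1 : ‖dbarCut b ξ‖ ≤ 4 * D := by nlinarith [hD b ξ, norm_nonneg (dbarCut b ξ)]
      calc _ = ‖dbarCut b ξ‖ * ‖jumpCoeff γ α b ξ‖ *
            ((1 + ‖ξ‖) ^ n * ‖exp (-expo b p ξ) • wedgeMat b ξ‖) := by ring
        _ ≤ _ := by
          gcongr
          · exact norm_jumpCoeff_le γ α b ξ
          · exact hC b ξ hw hξ
    · rw [dbarCut_of_notMem hw]; simp; positivity
  unfold nu
  rw [norm_neg]
  calc _ ≤ (1 + ‖ξ‖) ^ n * (_ + _) := by gcongr; exact norm_add_le _ _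
    _ ≤ _ := by rw [mul_add]; linarith [key true, key false]

/-- The correction carried by the wedges decays rapidly. -/
lemma exists_norm_leftover_le (γ α : ℝ) (hp : Admissible p.1 p.2.1) (n : ℕ) :
    ∃ C, ∀ ξ ∈ contourᶜ, 1 / 4 ≤ ‖ξ‖ →
      (1 + ‖ξ‖) ^ n * ‖model p ξ * unip (fun b => leftover γ α b ξ) * (model p ξ)⁻¹ - 1‖ ≤ C := by
  obtain ⟨C, hC0, hC⟩ := exists_wedge_decay hp n
  refine ⟨2 * ((1 + |γ|) * C), fun ξ hξc hξ => ?_⟩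
  have him := im_ne_zero_of_notMem_contour hξc
  have h0 := ne_zero_of_notMem_contour hξc
  have e : model p ξ * unip (fun b => leftover γ α b ξ) * (model p ξ)⁻¹ - 1 =
      leftover γ α true ξ • (exp (-expo true p ξ) • wedgeMat true ξ) +
      leftover γ α false ξ • (exp (-expo false p ξ) • wedgeMat false ξ) := by
    rw [← model_conj_nil true p h0, ← model_conj_nil false p h0]
    unfold unip
    rw [mul_add, add_mul, mul_one, Matrix.mul_nonsing_inv _ (det_model' p h0).isUnit]
    simp only [mul_add, add_mul, Matrix.mul_smul, Matrix.smul_mul]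
    abel
  have key : ∀ b, (1 + ‖ξ‖) ^ n * ‖leftover γ α b ξ • (exp (-expo b p ξ) • wedgeMat b ξ)‖ ≤
      (1 + |γ|) * C := by
    intro b
    by_cases hw : ξ ∈ wedge b
    · rw [norm_smul]
      calc _ = ‖leftover γ α b ξ‖ * ((1 + ‖ξ‖) ^ n * ‖exp (-expo b p ξ) • wedgeMat b ξ‖) := by ring
        _ ≤ _ := by
          gcongr
          · exact norm_leftover_le γ α b ξ
          · exact hC b ξ hw hξ
    · rw [leftover_of_notMem γ α him hw]; simp; positivity
  rw [e]
  calc _ ≤ (1 + ‖ξ‖) ^ n * (_ + _) := by gcongr; exact norm_add_le _ _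
    _ ≤ _ := by rw [mul_add]; linarith [key true, key false]

lemma eventually_le_norm_cobounded (r : ℝ) : ∀ᶠ ξ in cobounded ℂ, r ≤ ‖ξ‖ := by
  rw [(Metric.hasBasis_cobounded_compl_closedBall (0:ℂ)).eventually_iff]
  exact ⟨r, trivial, fun z hz => by
    rw [mem_compl_iff, mem_closedBall_zero_iff, not_le] at hz; exact hz.le⟩

lemma leftover_isBigO (γ α : ℝ) (hp : Admissible p.1 p.2.1) (n : ℕ) :
    (fun ξ => model p ξ * unip (fun b => leftover γ α b ξ) * (model p ξ)⁻¹ - 1)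
      =O[cobounded ℂ ⊓ 𝓟 contourᶜ] fun ξ => (ξ ^ n)⁻¹ := by
  obtain ⟨C, hC⟩ := exists_norm_leftover_le γ α hp n
  refine IsBigO.of_bound C ?_
  filter_upwards [mem_inf_of_right (mem_principal_self _),
    mem_inf_of_left (eventually_le_norm_cobounded (1 / 4))] with ξ h1 h2
  have h3 := hC ξ h1 h2
  rw [norm_inv, norm_pow, ← div_eq_mul_inv C, le_div_iff₀ (by positivity)]
  refine le_trans ?_ h3
  rw [mul_comm]
  gcongr
  linarith

lemma tendsto_smoothF (h : Solves γ α p Φ) (hp : Admissible p.1 p.2.1) :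
    Tendsto (smoothF γ α p Φ) (cobounded ℂ) (𝓝 1) := by
  obtain ⟨R, hR, hO⟩ := h.at_infinity
  have t := expansion_tendsto_zero hO
  have h2 : Tendsto (fun ξ : ℂ => (ξ ^ 1)⁻¹) (cobounded ℂ ⊓ 𝓟 contourᶜ) (𝓝 0) := by
    simp only [pow_one]
    exact (tendsto_inv₀_cobounded (α := ℂ)).mono_left inf_le_left
  have t2 := (leftover_isBigO γ α hp 1).trans_tendsto h2
  have h3 : ContinuousOn (smoothF γ α p Φ) ({0} : Set ℂ)ᶜ := fun z hz =>
    (continuousAt_smoothF h hz).continuousWithinAt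
  refine tendsto_cobounded_of_dense dense_compl_contour (K := {0}) ?_ isClosed_singleton h3 ?_
  · exact eventually_ne_zero_cobounded
  · have := (t.const_add 1).mul (t2.const_add 1)
    rw [add_zero, mul_one] at this
    refine this.congr' ?_
    filter_upwards [mem_inf_of_right (mem_principal_self _)] with ξ hξ
    rw [add_sub_cancel, smoothF_eq h hξ, hR ξ hξ]
    simp only [model, mul_assoc]

end Smoothed

/-! ## Radial cutoffs and the expansion at infinity -/

/-- A smooth cutoff which is `0` for `|ξ| ≤ R` and `1` for `2R ≤ |ξ|`. -/
def radial (R : ℝ) (ξ : ℂ) : ℝ := Real.smoothTransition (‖ξ‖ ^ 2 / R ^ 2 - 1)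

lemma contDiff_radial (R : ℝ) : ContDiff ℝ ∞ fun ξ => (radial R ξ : ℂ) := by
  have h1 : ContDiff ℝ ∞ (radial R) := (Real.smoothTransition.contDiff (n := ⊤)).comp
      (((contDiff_norm_sq ℝ).div_const _).sub contDiff_const)
  exact ofRealCLM.contDiff.comp h1

lemma radial_of_le {R : ℝ} (hR : 0 < R) {ξ : ℂ} (h : ‖ξ‖ ≤ R) : radial R ξ = 0 := by
  apply Real.smoothTransition.zero_of_nonpos
  have : ‖ξ‖ ^ 2 / R ^ 2 ≤ 1 := by rw [div_le_one (by positivity)]; gcongr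
  linarith

lemma radial_of_ge {R : ℝ} (hR : 0 < R) {ξ : ℂ} (h : 2 * R ≤ ‖ξ‖) : radial R ξ = 1 := by
  apply Real.smoothTransition.one_of_one_le
  have : 2 ≤ ‖ξ‖ ^ 2 / R ^ 2 := by
    rw [le_div_iff₀ (by positivity)]
    nlinarith
  linarith

lemma radial_nonneg (R : ℝ) (ξ : ℂ) : 0 ≤ radial R ξ := Real.smoothTransition.nonneg _

lemma radial_le_one (R : ℝ) (ξ : ℂ) : radial R ξ ≤ 1 := Real.smoothTransition.le_one _

lemma eventually_radial_eq_zero {R : ℝ} (hR : 0 < R) {ξ : ℂ} (h : ‖ξ‖ < R) :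
    ∀ᶠ z in 𝓝 ξ, radial R z = 0 := by
  filter_upwards [(continuous_norm.tendsto ξ).eventually (gt_mem_nhds h)] with z hz
  exact radial_of_le hR hz.le

lemma eventually_radial_eq_one {R : ℝ} (hR : 0 < R) {ξ : ℂ} (h : 2 * R < ‖ξ‖) :
    ∀ᶠ z in 𝓝 ξ, radial R z = 1 := by
  filter_upwards [(continuous_norm.tendsto ξ).eventually (lt_mem_nhds h)] with z hz
  exact radial_of_ge hR hz.le

lemma inv_heavyWeight_le (s : ℂ) : (heavyWeight s)⁻¹ ≤ (1 + ‖s‖) ^ 6 := by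
  unfold heavyWeight
  rw [inv_inv, show (1 + ‖s‖) ^ 6 = ((1 + ‖s‖) ^ 2) ^ 3 by ring]
  gcongr
  nlinarith [norm_nonneg s]

lemma exists_le_heavyWeight {E : Type*} [NormedAddCommGroup E] {g : ℂ → E}
    (hg : Continuous g) {r C : ℝ}
    (h : ∀ ξ, r ≤ ‖ξ‖ → (1 + ‖ξ‖) ^ 6 * ‖g ξ‖ ≤ C) : ∃ C', ∀ s, ‖g s‖ ≤ C' * heavyWeight s := by
  have hc : Continuous fun ξ : ℂ => (1 + ‖ξ‖) ^ 6 * ‖g ξ‖ := by fun_prop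
  obtain ⟨D, hD⟩ := (isCompact_closedBall (0:ℂ) r).exists_bound_of_continuousOn hc.continuousOn
  refine ⟨max C D, fun s => ?_⟩
  have hw := heavyWeight_pos s
  have h1 : (1 + ‖s‖) ^ 6 * ‖g s‖ ≤ max C D := by
    rcases le_total r ‖s‖ with hs | hs
    · exact (h s hs).trans (le_max_left _ _)
    · have := hD s (by simpa using hs)
      exact ((le_abs_self _).trans this).trans (le_max_right _ _)
  rw [← div_le_iff₀ hw, div_eq_mul_inv, mul_comm]
  refine le_trans ?_ h1
  gcongr
  exact inv_heavyWeight_le s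

section Expansion
variable {γ α : ℝ} {p : Param} {Φ : ℂ → Mat3}

lemma exists_expandsTo_smoothF (h : Solves γ α p Φ)
    (hp : Admissible p.1 p.2.1) : ∃ M, ExpandsTo (smoothF γ α p Φ) 1 M := by
  set F := smoothF γ α p Φ
  set f : ℂ → Mat3 := fun ξ => 1 + (radial 1 ξ : ℂ) • (F ξ - 1) with hf
  have hfF : ∀ ξ, 2 < ‖ξ‖ → f =ᶠ[𝓝 ξ] F := fun ξ hξ => by
    filter_upwards [eventually_radial_eq_one one_pos (by linarith : 2 * 1 < ‖ξ‖)] with z hz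
    simp [hf, hz]
  have hfd : ContDiff ℝ 1 f := by
    rw [contDiff_iff_contDiffAt]
    intro ξ
    by_cases h0 : ξ = 0
    · have : f =ᶠ[𝓝 ξ] fun _ => 1 := by
        filter_upwards [eventually_radial_eq_zero one_pos (ξ := ξ) (by simp [h0])] with z hz
        simp [hf, hz]
      exact contDiffAt_const.congr_of_eventuallyEq this
    · exact contDiffAt_const.add (((contDiff_radial 1).contDiffAt.of_le (by norm_num)).smul
        (((contDiffAt_smoothF h h0).of_le (by norm_num)).sub contDiffAt_const))
  have hlim : Tendsto f (cobounded ℂ) (𝓝 1) := by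
    refine (tendsto_smoothF h hp).congr' ?_
    filter_upwards [eventually_le_norm_cobounded 3] with ξ hξ
    exact (hfF ξ (by linarith)).self_of_nhds.symm
  have hdc : Continuous (dbar f) :=
    continuous_iff_continuousAt.2 fun ξ => continuousAt_dbar hfd.contDiffAt
  obtain ⟨C, hC0, hC⟩ := exists_norm_nu_le γ α hp 6
  have hev := (tendsto_smoothF h hp).norm.eventually (gt_mem_nhds (lt_add_one ‖(1 : Mat3)‖))
  rw [(Metric.hasBasis_cobounded_compl_closedBall (0:ℂ)).eventually_iff] at hev
  obtain ⟨r, -, hr⟩ := hev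
  obtain ⟨C', hC'⟩ := exists_le_heavyWeight hdc (r := max (r + 1) 3) (C := (‖(1 : Mat3)‖ + 1) * C)
    (fun ξ hξ => by
      have h1 : r < ‖ξ‖ := by linarith [le_max_left (r + 1) 3]
      have h2 : 3 ≤ ‖ξ‖ := (le_max_right _ _).trans hξ
      have h0 : ξ ≠ 0 := by rintro rfl; simp at h2; linarith
      have e : dbar f ξ = F ξ * nu γ α p ξ :=
        (dbar_congr (hfF ξ (by linarith))).trans (dbar_smoothF h h0)
      rw [e]
      have h3 := hr (x := ξ) (by simpa using h1)
      calc (1 + ‖ξ‖) ^ 6 * ‖F ξ * nu γ α p ξ‖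
          ≤ (1 + ‖ξ‖) ^ 6 * (‖F ξ‖ * ‖nu γ α p ξ‖) := by gcongr; exact norm_mul_le _ _
        _ = ‖F ξ‖ * ((1 + ‖ξ‖) ^ 6 * ‖nu γ α p ξ‖) := by ring
        _ ≤ _ := by
          gcongr
          exact hC ξ (by linarith))
  have hcl : ∀ s, ‖dbar f s‖ ≤ C' * weight s := fun s =>
    (hC' s).trans (by
      have : 0 ≤ C' := nonneg_of_mul_nonneg_left ((norm_nonneg _).trans (hC' s)) (heavyWeight_pos s)
      gcongr; exact heavyWeight_le s)
  have hexp := expandsTo_of_eq_cauchyTransform hdc hC'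
    (fun ξ => eq_add_cauchyTransform_dbar hfd hlim hcl ξ)
  refine ⟨(π : ℂ)⁻¹ • ∫ s, dbar f s, hexp.congr' ?_ EventuallyEq.rfl⟩
  filter_upwards [eventually_le_norm_cobounded 3] with ξ hξ
  rw [(hfF ξ (by linarith)).self_of_nhds]

lemma relative_sub_smoothF_isBigO (h : Solves γ α p Φ) (hp : Admissible p.1 p.2.1) (n : ℕ) :
    (fun ξ => Φ ξ * (model p ξ)⁻¹ - smoothF γ α p Φ ξ)
      =O[cobounded ℂ ⊓ 𝓟 contourᶜ] fun ξ => (ξ ^ n)⁻¹ := by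
  obtain ⟨R, hR, hO⟩ := h.at_infinity
  have t := ((expansion_tendsto_zero hO).const_add 1).isBigO_one ℂ
  have h2 := (t.mul (leftover_isBigO γ α hp n)).neg_left
  refine h2.congr' ?_ (Eventually.of_forall fun ξ => one_mul _)
  filter_upwards [mem_inf_of_right (mem_principal_self _)] with ξ hξ
  have hm := (det_model' p (ne_zero_of_notMem_contour hξ)).isUnit
  have e : Φ ξ * (model p ξ)⁻¹ = 1 + R ξ := by
    rw [hR ξ hξ]
    change _ * model p ξ * (model p ξ)⁻¹ = _
    rw [mul_assoc, Matrix.mul_nonsing_inv _ hm, mul_one]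
  rw [smoothF_eq h hξ, ← e]
  have e2 : Φ ξ * unip (fun b => leftover γ α b ξ) * (model p ξ)⁻¹ = Φ ξ * (model p ξ)⁻¹ *
      (model p ξ * unip (fun b => leftover γ α b ξ) * (model p ξ)⁻¹) := by
    rw [mul_assoc (model p ξ), mul_assoc (Φ ξ) (model p ξ)⁻¹, ← mul_assoc (model p ξ)⁻¹,
      Matrix.nonsing_inv_mul _ hm, one_mul, mul_assoc]
  rw [e2]
  noncomm_ring

lemma hasExpansion_of_expandsTo (h : Solves γ α p Φ)
    (hp : Admissible p.1 p.2.1) {M : Mat3} (hM : ExpandsTo (smoothF γ α p Φ) 1 M) :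
    HasExpansion p.1 p.2.1 p.2.2 Φ M := by
  refine ⟨fun ξ => Φ ξ * (model p ξ)⁻¹ - 1 - ξ⁻¹ • M, fun ξ hξ => ?_, fun i j => ?_⟩
  · have hm := (det_model' p (ne_zero_of_notMem_contour hξ)).isUnit
    change _ = _ * model p ξ
    rw [show 1 + ξ⁻¹ • M + (Φ ξ * (model p ξ)⁻¹ - 1 - ξ⁻¹ • M) = Φ ξ * (model p ξ)⁻¹ by abel,
      mul_assoc, Matrix.nonsing_inv_mul _ hm, mul_one]
  · refine isBigO_entry (f := fun ξ => Φ ξ * (model p ξ)⁻¹ - 1 - ξ⁻¹ • M) ?_ i j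
    have h1 := (relative_sub_smoothF_isBigO h hp 2).add (hM.mono inf_le_left)
    refine h1.congr_left fun ξ => ?_
    abel

end Expansion

/-! ## The companion matrix and its exponentials -/

def Kmat (ξ : ℂ) : Mat3 := !![0, 1, 0; 0, 0, 1; ξ, 0, 0]

lemma Kmat_mul_vander {ξ : ℂ} {k : Fin 3 → ℂ} (hk : ∀ j, k j ^ 3 = ξ) :
    Kmat ξ * vander k = vander k * Matrix.diagonal k := by
  have h : ∀ j, ξ = k j ^ 2 * k j := fun j => by rw [← hk j]; ring
  ext i j
  fin_cases i <;> fin_cases j <;> simp [Kmat, vander, Matrix.mul_apply, Fin.sum_univ_three, sq]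
  · rw [h 0]; ring
  · rw [h 1]; ring
  · rw [h 2]; ring

/-- The phase as a matrix polynomial in the companion matrix. -/
def phaseMat (δ : Param) (ξ : ℂ) : Mat3 :=
  (δ.1 : ℂ) • (ξ • Kmat ξ) + ((δ.2.1 : ℂ) • Kmat ξ ^ 2 + (δ.2.2 : ℂ) • Kmat ξ)

lemma phaseMat_mul_vander (δ : Param) {ξ : ℂ} {k : Fin 3 → ℂ} (hk : ∀ j, k j ^ 3 = ξ) :
    phaseMat δ ξ * vander k = vander k * Matrix.diagonal fun j => phasePoly δ (k j) := by
  have h1 := Kmat_mul_vander hk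
  have h2 : Kmat ξ ^ 2 * vander k = vander k * Matrix.diagonal fun j => k j ^ 2 := by
    rw [sq, mul_assoc, h1, ← mul_assoc, h1, mul_assoc, Matrix.diagonal_mul_diagonal]
    simp only [sq]
  unfold phaseMat
  rw [add_mul, add_mul, Matrix.smul_mul, Matrix.smul_mul, Matrix.smul_mul, Matrix.smul_mul, h1, h2]
  simp only [← Matrix.mul_smul, ← mul_add, ← Matrix.diagonal_smul, Matrix.diagonal_add]
  congr 2
  funext j
  simp only [Pi.smul_apply, smul_eq_mul, phasePoly]
  rw [← hk j]; ring

lemma differentiable_Kmat : Differentiable ℂ Kmat := fun z => differentiableAt_mat fun i j => by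
  fin_cases i <;> fin_cases j <;> simp [Kmat]

lemma differentiable_phaseMat (δ : Param) : Differentiable ℂ (phaseMat δ) := by
  have := differentiable_Kmat
  unfold phaseMat
  exact ((differentiable_id.smul this).const_smul (δ.1 : ℂ)).add
    (((this.pow 2).const_smul (δ.2.1 : ℂ)).add (this.const_smul (δ.2.2 : ℂ)))

lemma exp_smul_phaseMat_mul_vander (c : ℂ) (δ : Param) {ξ : ℂ} {k : Fin 3 → ℂ}
    (hk : ∀ j, k j ^ 3 = ξ) (hd : (vander k).det ≠ 0) :
    NormedSpace.exp (c • phaseMat δ ξ) * vander k =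
      vander k * Matrix.diagonal fun j => exp (c * phasePoly δ (k j)) := by
  have hu := hd.isUnit
  have h : c • phaseMat δ ξ = vander k * Matrix.diagonal (fun j => c * phasePoly δ (k j)) *
      (vander k)⁻¹ := by
    have h1 := phaseMat_mul_vander δ hk
    have h2 : (Matrix.diagonal fun j => c * phasePoly δ (k j)) =
        c • Matrix.diagonal fun j => phasePoly δ (k j) := by
      rw [← Matrix.diagonal_smul]; rfl
    rw [h2, Matrix.mul_smul, Matrix.smul_mul, ← h1, mul_assoc, Matrix.mul_nonsing_inv _ hu, mul_one]
  rw [h, Matrix.exp_conj _ _ (isUnit_of_det_ne_zero hd), Matrix.exp_diagonal, mul_assoc,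
    Matrix.nonsing_inv_mul _ hu, mul_one]
  congr 2
  funext j
  rw [Pi.coe_exp, ← Complex.exp_eq_exp_ℂ]

lemma dbar_comp {E F : Type*} [NormedAddCommGroup E] [NormedSpace ℂ E] [NormedAddCommGroup F]
    [NormedSpace ℂ F] {f : E → F} {g : ℂ → E} {z : ℂ} (hf : DifferentiableAt ℂ f (g z))
    (hg : DifferentiableAt ℝ g z) : dbar (fun w => f (g w)) z = fderiv ℂ f (g z) (dbar g z) := by
  unfold dbar
  have h := (hf.hasFDerivAt.restrictScalars ℝ).comp z hg.hasFDerivAt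
  have h' : HasFDerivAt (fun w => f (g w)) (((fderiv ℂ f (g z)).restrictScalars ℝ).comp
    (fderiv ℝ g z)) z := h
  rw [h'.fderiv]
  simp

/-- The exponential wave which connects the solutions for nearby parameters away from the origin. -/
def wave (R : ℝ) (δ : Param) (ξ : ℂ) : Mat3 := NormedSpace.exp ((radial R ξ : ℂ) • phaseMat δ ξ)

lemma wave_of_le {R : ℝ} (hR : 0 < R) (δ : Param) {ξ : ℂ} (h : ‖ξ‖ ≤ R) : wave R δ ξ = 1 := by
  simp [wave, radial_of_le hR h]

lemma wave_mul_vander (R : ℝ) (δ : Param) {ξ : ℂ} (hξ : ξ ≠ 0) :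
    wave R δ ξ * vander (kap ξ) = vander (kap ξ) *
      Matrix.diagonal fun j => exp (radial R ξ * phasePoly δ (kap ξ j)) :=
  exp_smul_phaseMat_mul_vander _ _ (kap_pow_three ξ) (det_vander_kap_ne_zero hξ)

lemma isUnit_wave (R : ℝ) (δ : Param) (ξ : ℂ) : IsUnit (wave R δ ξ).det :=
  (Matrix.isUnit_iff_isUnit_det _).1 (Matrix.isUnit_exp _)

lemma differentiableAt_smul_phaseMat (R : ℝ) (δ : Param) (ξ : ℂ) :
    ContDiffAt ℝ ∞ (fun z => (radial R z : ℂ) • phaseMat δ z) ξ := by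
  have h : ContDiffAt ℝ ∞ (phaseMat δ) ξ :=
    contDiffAt_of_eventually (Eventually.of_forall fun w => differentiable_phaseMat δ w)
  exact (contDiff_radial R).contDiffAt.smul h

lemma exp_contDiffAt (A : Mat3) : ContDiffAt ℝ ∞ (NormedSpace.exp : Mat3 → Mat3) A :=
  (NormedSpace.exp_analytic (𝕂 := ℝ) A).contDiffAt

lemma contDiffAt_wave (R : ℝ) (δ : Param) (ξ : ℂ) : ContDiffAt ℝ ∞ (wave R δ) ξ :=
  (exp_contDiffAt _).comp ξ (differentiableAt_smul_phaseMat R δ ξ)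

lemma dbar_wave (R : ℝ) (δ : Param) (ξ : ℂ) :
    dbar (wave R δ) ξ = wave R δ ξ * (dbar (fun z => (radial R z : ℂ)) ξ • phaseMat δ ξ) := by
  set c : ℂ := (radial R ξ : ℂ)
  set P := phaseMat δ ξ
  have hexp : DifferentiableAt ℂ (NormedSpace.exp : Mat3 → Mat3) (c • P) :=
    (NormedSpace.exp_analytic (𝕂 := ℂ) (c • P)).differentiableAt
  have h1 := dbar_comp (f := (NormedSpace.exp : Mat3 → Mat3))
    (g := fun z => (radial R z : ℂ) • phaseMat δ z) (z := ξ) hexp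
    ((differentiableAt_smul_phaseMat R δ ξ).differentiableAt (by norm_num))
  have hrd : DifferentiableAt ℝ (fun z => (radial R z : ℂ)) ξ :=
    (contDiff_radial R).contDiffAt.differentiableAt (by norm_num)
  have h2 : dbar (fun z => (radial R z : ℂ) • phaseMat δ z) ξ =
      dbar (fun z => (radial R z : ℂ)) ξ • P := by
    refine (dbar_smul hrd ((differentiable_phaseMat δ ξ).restrictScalars ℝ)).trans ?_
    rw [dbar_eq_zero (differentiable_phaseMat δ ξ), smul_zero, add_zero]
  have h3 : fderiv ℂ (NormedSpace.exp : Mat3 → Mat3) (c • P) P = NormedSpace.exp (c • P) * P := by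
    have e1 := hasDerivAt_exp_smul_const (𝕂 := ℂ) P c
    have e2 : HasDerivAt (fun t : ℂ => t • P) P c :=
      ((hasDerivAt_id c).smul_const P).congr_deriv (one_smul ℂ P)
    have e3 := hexp.hasFDerivAt.comp_hasDerivAt c e2
    exact e3.unique e1
  refine h1.trans ?_
  rw [h2, map_smul]
  refine (congrArg _ h3).trans ?_
  rw [Matrix.mul_smul]
  rfl

/-- `θ_j - θ_2`, as a linear form in the parameters, scaled by a radial cutoff. -/
def ell (R : ℝ) (b : Bool) (ξ : ℂ) : Param →L[ℝ] ℂ :=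
  (ContinuousLinearMap.fst ℝ ℝ (ℝ × ℝ)).smulRight
    (-(radial R ξ : ℂ) * (kap ξ (sideRow b) ^ 4 - kap ξ 1 ^ 4)) +
  ((ContinuousLinearMap.fst ℝ ℝ ℝ).comp (ContinuousLinearMap.snd ℝ ℝ (ℝ × ℝ))).smulRight
    (-(radial R ξ : ℂ) * (kap ξ (sideRow b) ^ 2 - kap ξ 1 ^ 2)) +
  ((ContinuousLinearMap.snd ℝ ℝ ℝ).comp (ContinuousLinearMap.snd ℝ ℝ (ℝ × ℝ))).smulRight
    (-(radial R ξ : ℂ) * (kap ξ (sideRow b) - kap ξ 1))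

lemma ell_apply (R : ℝ) (b : Bool) (ξ : ℂ) (p : Param) :
    ell R b ξ p = -(radial R ξ : ℂ) * expo b p ξ := by
  simp only [ell, expo, phasePoly, _root_.add_apply, ContinuousLinearMap.smulRight_apply,
    ContinuousLinearMap.comp_apply, ContinuousLinearMap.coe_fst', ContinuousLinearMap.coe_snd',
    real_smul]
  ring

lemma continuousAt_ell (R : ℝ) (b : Bool) {ξ : ℂ} (h : ξ.im ≠ 0) : ContinuousAt (ell R b) ξ := by
  have hk := fun j => (differentiableAt_kap h j).continuousAt
  have hr : ContinuousAt (fun z => (radial R z : ℂ)) ξ := (contDiff_radial R).continuous.continuousAt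
  have key : ∀ (L : Param →L[ℝ] ℝ) {g : ℂ → ℂ}, ContinuousAt g ξ →
      ContinuousAt (fun z => L.smulRight (g z)) ξ := fun L g hg =>
    ((ContinuousLinearMap.smulRightL ℝ Param ℂ L).continuous.continuousAt).comp hg
  exact ((key _ (hr.neg.mul (((hk _).pow 4).sub ((hk _).pow 4)))).add
    (key _ (hr.neg.mul (((hk _).pow 2).sub ((hk _).pow 2))))).add
    (key _ (hr.neg.mul ((hk _).sub (hk _))))

lemma norm_ell_le (R : ℝ) (b : Bool) (ξ : ℂ) : ‖ell R b ξ‖ ≤ 6 * (1 + ‖ξ‖) ^ 4 := by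
  have hq : 1 ≤ 1 + ‖ξ‖ := by linarith [norm_nonneg ξ]
  have hk : ∀ j (n : ℕ), n ≤ 4 → ‖kap ξ j ^ n‖ ≤ (1 + ‖ξ‖) ^ 4 := fun j n hn => by
    rw [norm_pow, norm_kap]
    calc ‖cbrt ξ‖ ^ n ≤ (1 + ‖ξ‖) ^ n := by gcongr; exact norm_cbrt_le ξ
      _ ≤ _ := pow_le_pow_right₀ hq hn
  have hd : ∀ n : ℕ, n ≤ 4 → ‖kap ξ (sideRow b) ^ n - kap ξ 1 ^ n‖ ≤ 2 * (1 + ‖ξ‖) ^ 4 :=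
    fun n hn => (norm_sub_le _ _).trans (by linarith [hk (sideRow b) n hn, hk 1 n hn])
  refine ContinuousLinearMap.opNorm_le_bound _ (by positivity) fun p => ?_
  rw [ell_apply, norm_mul, norm_neg, norm_real, Real.norm_of_nonneg (radial_nonneg R ξ)]
  have h1 : ‖p.1‖ ≤ ‖p‖ := norm_fst_le p
  have h2 : ‖p.2.1‖ ≤ ‖p‖ := (norm_fst_le p.2).trans (norm_snd_le p)
  have h3 : ‖p.2.2‖ ≤ ‖p‖ := (norm_snd_le p.2).trans (norm_snd_le p)
  have e : expo b p ξ = p.1 * (kap ξ (sideRow b) ^ 4 - kap ξ 1 ^ 4) +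
      p.2.1 * (kap ξ (sideRow b) ^ 2 - kap ξ 1 ^ 2) +
      p.2.2 * (kap ξ (sideRow b) ^ 1 - kap ξ 1 ^ 1) := by unfold expo phasePoly; ring
  have h4 : ‖expo b p ξ‖ ≤ 6 * (1 + ‖ξ‖) ^ 4 * ‖p‖ := by
    rw [e]
    refine (norm_add₃_le).trans ?_
    rw [norm_mul, norm_mul, norm_mul, norm_real, norm_real, norm_real]
    have m1 := mul_le_mul h1 (hd 4 le_rfl) (norm_nonneg _) (norm_nonneg p)
    have m2 := mul_le_mul h2 (hd 2 (by norm_num)) (norm_nonneg _) (norm_nonneg p)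
    have m3 := mul_le_mul h3 (hd 1 (by norm_num)) (norm_nonneg _) (norm_nonneg p)
    linarith
  calc _ ≤ 1 * ‖expo b p ξ‖ := by gcongr; exact radial_le_one R ξ
    _ ≤ _ := by rw [one_mul]; exact h4

lemma expo_add (b : Bool) (p q : Param) (ξ : ℂ) : expo b (p + q) ξ = expo b p ξ + expo b q ξ := by
  unfold expo phasePoly
  simp only [Prod.fst_add, Prod.snd_add]
  push_cast; ring

/-- Conjugating the rank one matrices by the wave changes the exponents. -/
lemma wave_inv_conj (R : ℝ) (δ : Param) (b : Bool) {ξ : ℂ} (hξ : ξ ≠ 0) :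
    (wave R δ ξ)⁻¹ * wedgeMat b ξ * wave R δ ξ =
      exp (-(radial R ξ : ℂ) * expo b δ ξ) • wedgeMat b ξ := by
  have hV := (det_vander_kap_ne_zero hξ).isUnit
  have hw := isUnit_wave R δ ξ
  set V := vander (kap ξ)
  set Dg : Mat3 := Matrix.diagonal fun j => exp (radial R ξ * phasePoly δ (kap ξ j)) with hDg
  have h1 : wave R δ ξ * V = V * Dg := wave_mul_vander R δ hξ
  suffices h : wedgeMat b ξ * wave R δ ξ =
      exp (-(radial R ξ : ℂ) * expo b δ ξ) • (wave R δ ξ * wedgeMat b ξ) by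
    rw [mul_assoc, h, Matrix.mul_smul, ← mul_assoc, Matrix.nonsing_inv_mul _ hw, one_mul]
  have h2 : wave R δ ξ = V * Dg * V⁻¹ := by
    rw [← h1, mul_assoc, Matrix.mul_nonsing_inv _ hV, mul_one]
  have h3 : nil b * Dg = exp (-(radial R ξ : ℂ) * expo b δ ξ) • (Dg * nil b) := by
    rw [hDg, nil_mul_diagonal, diagonal_mul_nil, smul_smul, ← exp_add]
    congr 2
    unfold expo; ring
  unfold wedgeMat
  rw [h2]
  calc V * nil b * V⁻¹ * (V * Dg * V⁻¹) = V * nil b * (V⁻¹ * V) * Dg * V⁻¹ := by noncomm_ring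
    _ = V * (nil b * Dg) * V⁻¹ := by rw [Matrix.nonsing_inv_mul _ hV]; noncomm_ring
    _ = exp (-(radial R ξ : ℂ) * expo b δ ξ) • (V * Dg * nil b * V⁻¹) := by
      rw [h3, Matrix.mul_smul, Matrix.smul_mul, ← mul_assoc]
    _ = exp (-(radial R ξ : ℂ) * expo b δ ξ) • (V * Dg * (V⁻¹ * V) * nil b * V⁻¹) := by
      rw [Matrix.nonsing_inv_mul _ hV, mul_one]
    _ = _ := by congr 1; noncomm_ring

/-- Beyond the radial cutoff the wave relates the models. -/
lemma model_eq_wave_inv_mul {R : ℝ} (hR : 0 < R) (p₀ δ : Param) {ξ : ℂ} (hξ : 2 * R ≤ ‖ξ‖) :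
    (model (p₀ + δ) ξ)⁻¹ = (model p₀ ξ)⁻¹ * wave R δ ξ := by
  have h0 : ξ ≠ 0 := by rintro rfl; simp at hξ; linarith
  have h1 := wave_mul_vander R δ h0
  have hm0 := (det_model' p₀ h0).isUnit
  have e : wave R δ ξ * model (p₀ + δ) ξ = model p₀ ξ := by
    rw [model_eq_modelOf, model_eq_modelOf, modelOf, ← mul_assoc, h1, mul_assoc,
      Matrix.diagonal_mul_diagonal, modelOf]
    congr 2
    funext j
    rw [← exp_add, radial_of_ge hR hξ]
    congr 1
    unfold phasePoly
    simp only [Prod.fst_add, Prod.snd_add]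
    push_cast; ring
  refine Matrix.inv_eq_left_inv ?_
  rw [mul_assoc, e, Matrix.nonsing_inv_mul _ hm0]

/-! ## Perturbation of the parameters -/

/-- The admissible parameter triples. -/
def Adm : Set Param := {p | Admissible p.1 p.2.1}

/-- `Φ` solves the model problem for all admissible parameters. -/
abbrev Family (γ α : ℝ) (Φ : Param → ℂ → Mat3) : Prop := ∀ p ∈ Adm, Solves γ α p (Φ p)

/-- `M` collects the coefficients of `1/ξ` in the expansions at infinity of the solutions. -/
abbrev Moments (γ α : ℝ) (Φ : Param → ℂ → Mat3) (M : Param → Mat3) : Prop :=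
  ∀ p ∈ Adm, ExpandsTo (smoothF γ α p (Φ p)) 1 (M p)

section Perturbation
variable {γ α : ℝ} {q : Param} {Φ₀ : ℂ → Mat3}

lemma contDiffAt_mat_inv {f : ℂ → Mat3} {z : ℂ} (hf : ContDiffAt ℝ ∞ f z) (hd : (f z).det ≠ 0) :
    ContDiffAt ℝ ∞ (fun w => (f w)⁻¹) z := by
  obtain ⟨u, hu⟩ := isUnit_of_det_ne_zero hd
  have h1 : ContDiffAt ℝ ∞ (Ring.inverse : Mat3 → Mat3) (f z) := by
    rw [← hu]; exact contDiffAt_ringInverse ℝ u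
  have h2 := h1.comp z hf
  refine h2.congr_of_eventuallyEq (Eventually.of_forall fun w => ?_)
  exact Matrix.nonsing_inv_eq_ringInverse (f w)

lemma contDiffAt_smoothF_inv (h : Solves γ α q Φ₀) {z : ℂ}
    (hz : z ≠ 0) : ContDiffAt ℝ ∞ (fun w => (smoothF γ α q Φ₀ w)⁻¹) z :=
  contDiffAt_mat_inv (contDiffAt_smoothF h hz) (by rw [det_smoothF h hz]; exact one_ne_zero)

lemma smoothF_mul_inv (h : Solves γ α q Φ₀) {z : ℂ}
    (hz : z ≠ 0) : smoothF γ α q Φ₀ z * (smoothF γ α q Φ₀ z)⁻¹ = 1 :=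
  Matrix.mul_nonsing_inv _ (by rw [det_smoothF h hz]; exact isUnit_one)

lemma smoothF_inv_mul (h : Solves γ α q Φ₀) {z : ℂ}
    (hz : z ≠ 0) : (smoothF γ α q Φ₀ z)⁻¹ * smoothF γ α q Φ₀ z = 1 :=
  Matrix.nonsing_inv_mul _ (by rw [det_smoothF h hz]; exact isUnit_one)

lemma eventually_ne_nhds {z : ℂ} (hz : z ≠ 0) : ∀ᶠ w in 𝓝 z, w ≠ 0 := isOpen_ne.mem_nhds hz

lemma dbar_smoothF_inv (h : Solves γ α q Φ₀) {z : ℂ} (hz : z ≠ 0) :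
    dbar (fun w => (smoothF γ α q Φ₀ w)⁻¹) z = -(nu γ α q z * (smoothF γ α q Φ₀ z)⁻¹) := by
  have d1 := (contDiffAt_smoothF h hz).differentiableAt (by norm_num)
  have d2 := (contDiffAt_smoothF_inv h hz).differentiableAt (by norm_num)
  have e1 := dbar_mul d1 d2
  have e2 : dbar (fun w => smoothF γ α q Φ₀ w * (smoothF γ α q Φ₀ w)⁻¹) z = 0 := by
    rw [dbar_congr (g := fun _ => (1 : Mat3)) (by
      filter_upwards [eventually_ne_nhds hz] with w hw
      exact smoothF_mul_inv h hw), dbar_const]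
  have e3 := e1.symm.trans e2
  rw [dbar_smoothF h hz] at e3
  have e4 := congrArg ((smoothF γ α q Φ₀ z)⁻¹ * ·) e3
  simp only [mul_add, mul_zero, ← mul_assoc, smoothF_inv_mul h hz, one_mul] at e4
  exact eq_neg_of_add_eq_zero_right e4

lemma exists_bound_of_tendsto {E : Type*} [NormedAddCommGroup E] {f : ℂ → E} {l : E} {r : ℝ}
    (hf : ContinuousOn f {z | r ≤ ‖z‖}) (hl : Tendsto f (cobounded ℂ) (𝓝 l)) :
    ∃ C, 0 ≤ C ∧ ∀ z, r ≤ ‖z‖ → ‖f z‖ ≤ C := by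
  have hev := hl.norm.eventually (gt_mem_nhds (lt_add_one ‖l‖))
  rw [(Metric.hasBasis_cobounded_compl_closedBall (0:ℂ)).eventually_iff] at hev
  obtain ⟨s, -, hs⟩ := hev
  have hcl : IsClosed {z : ℂ | r ≤ ‖z‖} := isClosed_le continuous_const continuous_norm
  obtain ⟨D, hD⟩ := ((isCompact_closedBall (0:ℂ) s).inter_right hcl).exists_bound_of_continuousOn
    (hf.mono inter_subset_right)
  refine ⟨max (‖l‖ + 1) D, by positivity, fun z hz => ?_⟩
  by_cases hzs : z ∈ closedBall (0:ℂ) s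
  · exact (hD z ⟨hzs, hz⟩).trans (le_max_right _ _)
  · exact (hs hzs).le.trans (le_max_left _ _)

lemma exists_bound_smoothF (h : Solves γ α q Φ₀) (hp : q ∈ Adm) : ∃ C, 0 ≤ C ∧ ∀ z, 1 / 2 ≤ ‖z‖ →
      ‖smoothF γ α q Φ₀ z‖ ≤ C ∧ ‖(smoothF γ α q Φ₀ z)⁻¹‖ ≤ C := by
  have hne : ∀ z : ℂ, 1 / 2 ≤ ‖z‖ → z ≠ 0 := fun z hz => by rintro rfl; norm_num at hz
  have ht := tendsto_smoothF h hp
  obtain ⟨C1, h1, hC1⟩ := exists_bound_of_tendsto (r := 1 / 2)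
    (fun z hz => (continuousAt_smoothF h (hne z hz)).continuousWithinAt) ht
  have ht' := tendsto_mat_inv (by rw [Matrix.det_one]; exact one_ne_zero) ht
  obtain ⟨C2, h2, hC2⟩ := exists_bound_of_tendsto (r := 1 / 2)
    (fun z hz => (contDiffAt_smoothF_inv h (hne z hz)).continuousAt.continuousWithinAt) ht'
  exact ⟨max C1 C2, h1.trans (le_max_left _ _), fun z hz =>
    ⟨(hC1 z hz).trans (le_max_left _ _), (hC2 z hz).trans (le_max_right _ _)⟩⟩

/-- The amplitude of the exponential family which describes the perturbation in a wedge. -/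
def ampl (γ α : ℝ) (q : Param) (Φ₀ : ℂ → Mat3) (R : ℝ) (b : Bool) (ξ : ℂ) : Mat3 :=
  (-((radial (1 / 2) ξ : ℂ) * ((heavyWeight ξ)⁻¹ : ℝ) * (dbarCut b ξ * jumpCoeff γ α b ξ) *
    exp (-(1 - (radial R ξ : ℂ)) * expo b q ξ))) •
      (smoothF γ α q Φ₀ ξ * wedgeMat b ξ * (smoothF γ α q Φ₀ ξ)⁻¹)

lemma exists_isExpFamily (h : Solves γ α q Φ₀) (hp : q ∈ Adm)
    (R : ℝ) : ∃ ε > 0, ∀ b, IsExpFamily (Adm ∩ ball q ε) (ell R b) (ampl γ α q Φ₀ R b) := by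
  obtain ⟨ε, hε, c, hc, C, hC⟩ := exists_le_re_expo hp
  refine ⟨ε, hε, fun b => ⟨fun ξ => ?_, fun n => ?_⟩⟩
  · by_cases h0 : ‖ξ‖ < 1 / 2
    · left
      filter_upwards [eventually_radial_eq_zero (by norm_num : (0:ℝ) < 1 / 2) h0] with z hz
      simp only [ampl, hz]
      simp
    have hξ : ξ ≠ 0 := by rintro rfl; norm_num at h0
    by_cases him : ξ.im = 0
    · left
      filter_upwards [eventually_notMem_wedge (b := b) hξ (fun hw => hw.1 him)] with z hz
      simp [ampl, dbarCut_of_notMem hz]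
    · right
      refine ⟨?_, continuousAt_ell R b him⟩
      have hj : ContinuousAt (jumpCoeff γ α b) ξ :=
        continuousAt_const.congr ((jumpCoeff_eventually γ α b him).mono fun _ h => h.symm)
      have hr := fun R => ((contDiff_radial R).continuous.continuousAt (x := ξ))
      have hw : ContinuousAt (fun z => (((heavyWeight z)⁻¹ : ℝ) : ℂ)) ξ :=
        continuous_ofReal.continuousAt.comp
          (continuous_heavyWeight.continuousAt.inv₀ (heavyWeight_pos ξ).ne')
      exact (((((hr _).mul hw).mul ((continuousAt_dbarCut him).mul hj)).mul
        (((continuousAt_const.sub (hr _)).neg.mul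
          (differentiableAt_expo him b q).continuousAt).cexp)).neg).smul
        (((continuousAt_smoothF h hξ).mul (continuousAt_wedgeMat him)).mul
          (contDiffAt_smoothF_inv h hξ).continuousAt)
  · obtain ⟨C1, h10, hC1⟩ := exists_norm_wedgeMat_le
    obtain ⟨CF, hF0, hCF⟩ := exists_bound_smoothF h hp
    obtain ⟨D, hD⟩ := exists_bound_dbarCut
    have hD0 : 0 ≤ D := le_trans (by positivity) (hD true 0)
    obtain ⟨B, hB⟩ := exists_pow_mul_exp_le hc C (4 * n + 12)
    have hB0 : 0 ≤ B := le_trans (by positivity) (hB 0 (C - c * ‖cbrt 0‖ ^ 2) le_rfl)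
    set K := 6 ^ n * (2 * D * (1 + |γ|) * (CF * C1 * CF)) with hK
    refine ⟨K * B, fun ξ p hps => ?_⟩
    by_cases hs : ‖ξ‖ ≤ 1 / 2
    · simp only [ampl, radial_of_le (by norm_num : (0:ℝ) < 1 / 2) hs]
      simp; positivity
    by_cases hw : ξ ∈ wedge b
    swap
    · simp only [ampl, dbarCut_of_notMem hw]
      simp; positivity
    push Not at hs
    have hd : ‖dbarCut b ξ‖ ≤ 2 * D := by
      have := hD b ξ
      nlinarith [norm_nonneg (dbarCut b ξ)]
    have hχ0 := radial_nonneg R ξ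
    have hχ1 := radial_le_one R ξ
    have ea := hC p hps.1 hps.2 b ξ hw
    have ea0 := hC q hp (mem_ball_self hε) b ξ hw
    have hx := hB ξ (-(radial R ξ) * (expo b p ξ).re + -(1 - radial R ξ) * (expo b q ξ).re)
      (by nlinarith)
    have hre : (ell R b ξ p).re = -(radial R ξ) * (expo b p ξ).re := by
      rw [ell_apply, ← ofReal_neg, re_ofReal_mul]
    have hre0 : ‖exp (-(1 - (radial R ξ : ℂ)) * expo b q ξ)‖ =
        Real.exp (-(1 - radial R ξ) * (expo b q ξ).re) := by
      rw [norm_exp, show -(1 - (radial R ξ : ℂ)) = ((-(1 - radial R ξ) : ℝ) : ℂ) by push_cast; ring,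
        re_ofReal_mul]
    have ham : ‖ampl γ α q Φ₀ R b ξ‖ ≤ (1 * (1 + ‖ξ‖) ^ 6 * (2 * D * (1 + |γ|)) *
        Real.exp (-(1 - radial R ξ) * (expo b q ξ).re)) *
        (CF * (C1 * (1 + ‖ξ‖) ^ 6) * CF) := by
      unfold ampl
      rw [norm_smul, norm_neg, norm_mul, norm_mul, norm_mul, norm_mul, norm_real, norm_real, hre0,
        Real.norm_of_nonneg (radial_nonneg _ _),
        Real.norm_of_nonneg (inv_nonneg.2 (heavyWeight_pos ξ).le)]
      have hn : ‖smoothF γ α q Φ₀ ξ * wedgeMat b ξ * (smoothF γ α q Φ₀ ξ)⁻¹‖ ≤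
          CF * (C1 * (1 + ‖ξ‖) ^ 6) * CF := by
        refine (norm_mul_le _ _).trans ?_
        have := hCF ξ hs.le
        refine mul_le_mul ((norm_mul_le _ _).trans ?_) this.2 (norm_nonneg _) (by positivity)
        exact mul_le_mul this.1 (hC1 b ξ (by linarith)) (norm_nonneg _) (by positivity)
      have h1 := radial_le_one (1 / 2) ξ
      have h2 := inv_heavyWeight_le ξ
      have h3 := norm_jumpCoeff_le γ α b ξ
      have h4 := inv_nonneg.2 (heavyWeight_pos ξ).le
      gcongr
    calc ‖ell R b ξ‖ ^ n * (Real.exp (ell R b ξ p).re * ‖ampl γ α q Φ₀ R b ξ‖)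
        ≤ (6 * (1 + ‖ξ‖) ^ 4) ^ n * (Real.exp (-(radial R ξ) * (expo b p ξ).re) *
          ((1 * (1 + ‖ξ‖) ^ 6 * (2 * D * (1 + |γ|)) *
          Real.exp (-(1 - radial R ξ) * (expo b q ξ).re)) *
          (CF * (C1 * (1 + ‖ξ‖) ^ 6) * CF))) := by
          rw [hre]
          gcongr
          exact norm_ell_le R b ξ
      _ = K * ((1 + ‖ξ‖) ^ (4 * n + 12) * Real.exp (-(radial R ξ) * (expo b p ξ).re +
          -(1 - radial R ξ) * (expo b q ξ).re)) := by
          rw [hK, Real.exp_add, mul_pow, ← pow_mul, pow_add]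
          ring
      _ ≤ K * B := by gcongr

lemma exists_bcf_of_support {g : ℂ → Mat3} (hg : Continuous g) {r : ℝ}
    (h0 : ∀ ξ, r < ‖ξ‖ → g ξ = 0) : ∃ G : ℂ →ᵇ Mat3, ∀ ξ, G ξ = g ξ := by
  obtain ⟨D, hD⟩ := (isCompact_closedBall (0:ℂ) r).exists_bound_of_continuousOn hg.continuousOn
  refine ⟨BoundedContinuousFunction.ofNormedAddCommGroup g hg (max D 0) fun ξ => ?_, fun ξ => rfl⟩
  by_cases h : r < ‖ξ‖
  · rw [h0 ξ h, norm_zero]; exact le_max_right _ _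
  · exact (hD ξ (by simpa using h)).trans (le_max_left _ _)

/-- `∂̄` of the radial cutoff. -/
def dbarRadial (R : ℝ) (ξ : ℂ) : ℂ := dbar (fun z => (radial R z : ℂ)) ξ

lemma dbarRadial_of_lt {R : ℝ} (hR : 0 < R) {ξ : ℂ} (h : ‖ξ‖ < R) :
    ∀ᶠ z in 𝓝 ξ, dbarRadial R z = 0 := by
  filter_upwards [(eventually_radial_eq_zero hR h).eventually_nhds] with z hz
  unfold dbarRadial
  rw [dbar_congr (g := fun _ => 0) (by filter_upwards [hz] with w hw; simp [hw]), dbar_const]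

lemma dbarRadial_of_gt {R : ℝ} (hR : 0 < R) {ξ : ℂ} (h : 2 * R < ‖ξ‖) : dbarRadial R ξ = 0 := by
  unfold dbarRadial
  rw [dbar_congr (g := fun _ => 1) (by
    filter_upwards [eventually_radial_eq_one hR h] with w hw; simp [hw]), dbar_const]

lemma continuous_dbarRadial (R : ℝ) : Continuous (dbarRadial R) :=
  continuous_iff_continuousAt.2 fun _ =>
    continuousAt_dbar ((contDiff_radial R).contDiffAt.of_le (by norm_num))

lemma exists_radial_bcf (h : Solves γ α q Φ₀) {R : ℝ} (hR : 0 < R)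
    {P : ℂ → Mat3} (hP : Continuous P) : ∃ G : ℂ →ᵇ Mat3, ∀ ξ,
      G ξ = ((((heavyWeight ξ)⁻¹ : ℝ) : ℂ) * dbarRadial R ξ) •
        (smoothF γ α q Φ₀ ξ * P ξ * (smoothF γ α q Φ₀ ξ)⁻¹) := by
  refine exists_bcf_of_support (r := 2 * R) ?_ fun ξ hξ => by simp [dbarRadial_of_gt hR hξ]
  rw [continuous_iff_continuousAt]
  intro ξ
  by_cases h0 : ξ = 0
  · refine continuousAt_const.congr (f := fun _ => 0) ?_
    filter_upwards [dbarRadial_of_lt hR (ξ := ξ) (by simpa [h0] using hR)] with z hz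
    simp [hz]
  · have hw : ContinuousAt (fun z => (((heavyWeight z)⁻¹ : ℝ) : ℂ)) ξ :=
      continuous_ofReal.continuousAt.comp
        (continuous_heavyWeight.continuousAt.inv₀ (heavyWeight_pos ξ).ne')
    exact (hw.mul (continuous_dbarRadial R).continuousAt).smul
      (((continuousAt_smoothF h h0).mul hP.continuousAt).mul
        (contDiffAt_smoothF_inv h h0).continuousAt)

/-- The Beltrami-type coefficient of the perturbed problem. -/
def pert (γ α : ℝ) (q : Param) (Φ₀ : ℂ → Mat3) (R : ℝ) (δ : Param) (ξ : ℂ) : Mat3 :=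
  smoothF γ α q Φ₀ ξ * ((wave R δ ξ)⁻¹ * nu γ α q ξ * wave R δ ξ - nu γ α q ξ +
    dbarRadial R ξ • phaseMat δ ξ) * (smoothF γ α q Φ₀ ξ)⁻¹

lemma pert_eq {R : ℝ} (hR : 1 ≤ R) (p : Param) (ξ : ℂ) :
    pert γ α q Φ₀ R (p - q) ξ = ((heavyWeight ξ : ℝ) : ℂ) •
      ((exp (ell R true ξ p) • ampl γ α q Φ₀ R true ξ -
        exp (ell R true ξ q) • ampl γ α q Φ₀ R true ξ) +
       (exp (ell R false ξ p) • ampl γ α q Φ₀ R false ξ -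
        exp (ell R false ξ q) • ampl γ α q Φ₀ R false ξ) +
       ((((heavyWeight ξ)⁻¹ : ℝ) : ℂ) * dbarRadial R ξ) •
        (smoothF γ α q Φ₀ ξ * phaseMat (p - q) ξ * (smoothF γ α q Φ₀ ξ)⁻¹)) := by
  have hw0 : ((heavyWeight ξ : ℝ) : ℂ) ≠ 0 := ofReal_ne_zero.2 (heavyWeight_pos ξ).ne'
  have hR0 : 0 < R := by linarith
  set F := smoothF γ α q Φ₀ ξ
  by_cases hs : ‖ξ‖ ≤ R
  · have hr := radial_of_le hR0 hs
    have e1 : ∀ b p, ell R b ξ p = 0 := fun b p => by rw [ell_apply, hr]; simp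
    simp only [e1, sub_self, zero_add, smul_smul]
    unfold pert
    rw [wave_of_le hR0 _ hs]
    simp only [inv_one, one_mul, mul_one, sub_self, zero_add]
    rw [Matrix.mul_smul, Matrix.smul_mul, ofReal_inv, mul_inv_cancel_left₀ hw0]
  · push Not at hs
    have h0 : ξ ≠ 0 := by rintro rfl; rw [norm_zero] at hs; linarith
    have hr : radial (1 / 2) ξ = 1 := radial_of_ge (by norm_num) (by linarith)
    have key : ∀ b, ((heavyWeight ξ : ℝ) : ℂ) • (exp (ell R b ξ p) • ampl γ α q Φ₀ R b ξ -
        exp (ell R b ξ q) • ampl γ α q Φ₀ R b ξ) =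
        F * (-((dbarCut b ξ * jumpCoeff γ α b ξ) • (exp (-expo b q ξ) •
          ((wave R (p - q) ξ)⁻¹ * wedgeMat b ξ * wave R (p - q) ξ - wedgeMat b ξ)))) * F⁻¹ := by
      intro b
      rw [wave_inv_conj R _ b h0, ← sub_smul, ell_apply, ell_apply, ampl, hr]
      have hexp : expo b p ξ = expo b q ξ + expo b (p - q) ξ := by rw [← expo_add]; congr 1; abel
      have e2 : exp (-(radial R ξ : ℂ) * expo b (p - q) ξ) • wedgeMat b ξ - wedgeMat b ξ =
          (exp (-(radial R ξ : ℂ) * expo b (p - q) ξ) - 1) • wedgeMat b ξ := by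
        rw [sub_smul, one_smul]
      rw [e2]
      simp only [smul_smul, ← neg_smul, Matrix.mul_smul, Matrix.smul_mul]
      congr 1
      have e3 : exp (-(radial R ξ : ℂ) * expo b p ξ) = exp (-(radial R ξ : ℂ) * expo b q ξ) *
          exp (-(radial R ξ : ℂ) * expo b (p - q) ξ) := by
        rw [← exp_add, hexp]; congr 1; ring
      have e4 : exp (-expo b q ξ) = exp (-(radial R ξ : ℂ) * expo b q ξ) *
          exp (-(1 - (radial R ξ : ℂ)) * expo b q ξ) := by
        rw [← exp_add]; congr 1; ring
      rw [e3, e4, ofReal_inv]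
      field_simp
      push_cast
      ring
    rw [smul_add, smul_add, key true, key false]
    have e5 : ((heavyWeight ξ : ℝ) : ℂ) • ((((heavyWeight ξ)⁻¹ : ℝ) : ℂ) * dbarRadial R ξ) •
        (F * phaseMat (p - q) ξ * F⁻¹) = F * (dbarRadial R ξ • phaseMat (p - q) ξ) * F⁻¹ := by
      rw [smul_smul, Matrix.mul_smul, Matrix.smul_mul, ofReal_inv, mul_inv_cancel_left₀ hw0]
    rw [e5]
    unfold pert nu
    rw [← add_mul, ← mul_add, ← add_mul, ← mul_add]
    congr 2
    simp only [mul_neg, neg_mul, mul_add, add_mul, smul_sub, Matrix.mul_smul, Matrix.smul_mul]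
    abel

/-- The perturbation, relative to the weight, depends smoothly on the parameters. -/
lemma exists_pert_family (h : Solves γ α q Φ₀) (hp : q ∈ Adm)
    {R : ℝ} (hR : 1 ≤ R) : ∃ b : Param → (ℂ →ᵇ Mat3), ContDiffWithinAt ℝ ∞ b Adm q ∧ b q = 0 ∧
      ∀ᶠ p in 𝓝[Adm] q, ∀ ξ, pert γ α q Φ₀ R (p - q) ξ = ((heavyWeight ξ : ℝ) : ℂ) • b p ξ := by
  obtain ⟨ε, hε, hfam⟩ := exists_isExpFamily h hp R
  have hR0 : 0 < R := by linarith
  have hK := differentiable_Kmat.continuous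
  obtain ⟨G1, hG1⟩ := exists_radial_bcf h hR0 (P := fun ξ => ξ • Kmat ξ) (continuous_id.smul hK)
  obtain ⟨G2, hG2⟩ := exists_radial_bcf h hR0 (P := fun ξ => Kmat ξ ^ 2) (hK.pow 2)
  obtain ⟨G3, hG3⟩ := exists_radial_bcf h hR0 (P := Kmat) hK
  have hqs : q ∈ Adm ∩ ball q ε := ⟨hp, mem_ball_self hε⟩
  refine ⟨fun p => (expFamily (hfam true) p - expFamily (hfam true) q) +
    (expFamily (hfam false) p - expFamily (hfam false) q) +
    ((p.1 - q.1) • G1 + ((p.2.1 - q.2.1) • G2 + (p.2.2 - q.2.2) • G3)), ?_, ?_, ?_⟩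
  · have hc : ∀ b, ContDiffWithinAt ℝ ∞ (expFamily (hfam b)) Adm q := fun b => by
      have := contDiffOn_expFamily (hfam b) q hqs
      exact (contDiffWithinAt_inter (ball_mem_nhds q hε)).1 this
    have hl : ContDiff ℝ ∞ fun p : Param =>
        (p.1 - q.1) • G1 + ((p.2.1 - q.2.1) • G2 + (p.2.2 - q.2.2) • G3) := by
      fun_prop
    exact ((((hc true).sub contDiffWithinAt_const).add
      ((hc false).sub contDiffWithinAt_const))).add hl.contDiffWithinAt
  · simp
  · filter_upwards [self_mem_nhdsWithin, mem_nhdsWithin_of_mem_nhds (ball_mem_nhds q hε)]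
      with p hpA hpB ξ
    rw [pert_eq hR]
    congr 1
    simp only [BoundedContinuousFunction.coe_add, BoundedContinuousFunction.coe_sub, Pi.add_apply,
      Pi.sub_apply, BoundedContinuousFunction.coe_smul,
      expFamily_apply (hfam _) ⟨hpA, hpB⟩, expFamily_apply (hfam _) hqs, hG1, hG2, hG3]
    congr 1
    simp only [phaseMat, Prod.fst_sub, Prod.snd_sub, mul_add, add_mul, smul_add,
      Matrix.mul_smul, Matrix.smul_mul, ← Complex.coe_smul]
    simp only [smul_smul]
    congr 1
    · congr 1; ring
    · congr 1
      · congr 1; ring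
      · congr 1; ring

end Perturbation

/-! ## Solutions for nearby parameters -/

lemma eqOn_of_eqOn_compl_contour {E : Type*} [TopologicalSpace E] [T2Space E] {U : Set ℂ}
    (hU : IsOpen U) {f g : ℂ → E} (hf : ContinuousOn f U) (hg : ContinuousOn g U)
    (h : ∀ ξ ∈ U, ξ ∈ contourᶜ → f ξ = g ξ) : EqOn f g U := by
  intro ξ hξ
  have : EqOn f g (U ∩ contourᶜ) := fun z hz => h z hz.1 hz.2
  refine this.of_subset_closure (t := U) hf hg inter_subset_left ?_ hξ
  exact dense_compl_contour.open_subset_closure_inter hU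

section Nearby
variable {γ α : ℝ} {p q : Param} {Φ Φ₀ : ℂ → Mat3}

/-- The wave, conjugated by the regularized solution. -/
def conjWave (γ α : ℝ) (q : Param) (Φ₀ : ℂ → Mat3) (R : ℝ) (δ : Param) (ξ : ℂ) : Mat3 :=
  1 + smoothF γ α q Φ₀ ξ * (wave R δ ξ - 1) * (smoothF γ α q Φ₀ ξ)⁻¹

lemma conjWave_of_le {R : ℝ} (hR : 0 < R) (δ : Param) {ξ : ℂ} (hξ : ‖ξ‖ ≤ R) :
    conjWave γ α q Φ₀ R δ ξ = 1 := by
  simp [conjWave, wave_of_le hR δ hξ]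

lemma conjWave_of_ne (h : Solves γ α q Φ₀) (R : ℝ) (δ : Param) {ξ : ℂ}
    (hξ : ξ ≠ 0) : conjWave γ α q Φ₀ R δ ξ =
      smoothF γ α q Φ₀ ξ * wave R δ ξ * (smoothF γ α q Φ₀ ξ)⁻¹ := by
  rw [conjWave, mul_sub, mul_one, sub_mul, smoothF_mul_inv h hξ]
  abel

lemma contDiff_conjWave (h : Solves γ α q Φ₀) {R : ℝ} (hR : 0 < R)
    (δ : Param) : ContDiff ℝ ∞ (conjWave γ α q Φ₀ R δ) := by
  rw [contDiff_iff_contDiffAt]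
  intro ξ
  by_cases h0 : ξ = 0
  · refine contDiffAt_const.congr_of_eventuallyEq (f := fun _ => (1 : Mat3)) ?_
    have : ∀ᶠ z : ℂ in 𝓝 ξ, ‖z‖ < R := by
      rw [h0]; filter_upwards [ball_mem_nhds (0:ℂ) hR] with z hz; simpa using hz
    filter_upwards [this] with z hz using conjWave_of_le hR δ hz.le
  · exact contDiffAt_const.add (((contDiffAt_smoothF h h0).mul
      ((contDiffAt_wave R δ ξ).sub contDiffAt_const)).mul (contDiffAt_smoothF_inv h h0))

lemma dbar_conjWave (h : Solves γ α q Φ₀) {R : ℝ} (hR : 0 < R)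
    (δ : Param) (ξ : ℂ) : dbar (conjWave γ α q Φ₀ R δ) ξ =
      conjWave γ α q Φ₀ R δ ξ * pert γ α q Φ₀ R δ ξ := by
  by_cases h0 : ξ = 0
  · have hev : ∀ᶠ z : ℂ in 𝓝 ξ, conjWave γ α q Φ₀ R δ z = 1 := by
      rw [h0]; filter_upwards [ball_mem_nhds (0:ℂ) hR] with z hz
      exact conjWave_of_le hR δ (by simpa using (mem_ball_zero_iff.1 hz).le)
    have hd := (dbarRadial_of_lt hR (ξ := ξ) (by simpa [h0] using hR)).self_of_nhds
    rw [dbar_congr hev, dbar_const, pert, hd, wave_of_le hR δ (by simpa [h0] using hR.le)]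
    simp
  · have hF := (contDiffAt_smoothF h h0).differentiableAt (by norm_num)
    have hFi := (contDiffAt_smoothF_inv h h0).differentiableAt (by norm_num)
    have hE := (contDiffAt_wave R δ ξ).differentiableAt (by norm_num)
    have hev : ∀ᶠ z : ℂ in 𝓝 ξ, conjWave γ α q Φ₀ R δ z =
        smoothF γ α q Φ₀ z * wave R δ z * (smoothF γ α q Φ₀ z)⁻¹ := by
      filter_upwards [eventually_ne_nhds h0] with z hz using conjWave_of_ne h R δ hz
    have hw := isUnit_wave R δ ξ
    have e1 := dbar_mul (hF.mul hE) hFi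
    have e2 := dbar_mul hF hE
    have e3 := dbar_smoothF h h0
    have e4 := dbar_smoothF_inv h h0
    have e5 := dbar_wave R δ ξ
    refine (dbar_congr hev).trans (e1.trans ?_)
    refine (congrArg₂ (· + ·) (congrArg (· * _) e2) (congrArg _ e4)).trans ?_
    refine (congrArg₂ (· + ·) (congrArg (· * _) (congrArg₂ (· + ·) (congrArg (· * _) e3)
      (congrArg _ e5))) rfl).trans ?_
    rw [conjWave_of_ne h R δ h0, pert]
    have hFF := smoothF_inv_mul h h0
    set F := smoothF γ α q Φ₀ ξ
    set w := wave R δ ξ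
    set n := nu γ α q ξ
    change (F * n * w + F * (w * (dbarRadial R ξ • phaseMat δ ξ))) * F⁻¹ + F * w * -(n * F⁻¹) = _
    have e6 : F * w * F⁻¹ * (F * (w⁻¹ * n * w - n + dbarRadial R ξ • phaseMat δ ξ) * F⁻¹) =
        F * w * (F⁻¹ * F) * (w⁻¹ * n * w - n + dbarRadial R ξ • phaseMat δ ξ) * F⁻¹ := by
      noncomm_ring
    rw [e6, hFF, mul_one]
    have e7 : F * w * (w⁻¹ * n * w - n + dbarRadial R ξ • phaseMat δ ξ) =
        F * (w * w⁻¹) * n * w + F * w * (-n + dbarRadial R ξ • phaseMat δ ξ) := by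
      noncomm_ring
    rw [e7, Matrix.mul_nonsing_inv _ hw, mul_one]
    noncomm_ring

lemma conjWave_mul_inv (h : Solves γ α q Φ₀) (R : ℝ) (δ : Param) {ξ : ℂ}
    (hξ : ξ ≠ 0) : conjWave γ α q Φ₀ R δ ξ *
      (smoothF γ α q Φ₀ ξ * (wave R δ ξ)⁻¹ * (smoothF γ α q Φ₀ ξ)⁻¹) = 1 := by
  rw [conjWave_of_ne h R δ hξ]
  have h1 := smoothF_inv_mul h hξ
  have h2 := smoothF_mul_inv h hξ
  have hw := isUnit_wave R δ ξ
  set F := smoothF γ α q Φ₀ ξ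
  set w := wave R δ ξ
  calc F * w * F⁻¹ * (F * w⁻¹ * F⁻¹) = F * w * (F⁻¹ * F) * w⁻¹ * F⁻¹ := by noncomm_ring
    _ = F * (w * w⁻¹) * F⁻¹ := by rw [h1]; noncomm_ring
    _ = 1 := by rw [Matrix.mul_nonsing_inv _ hw, mul_one, h2]

/-- The solution for nearby parameters, relative to a given one, solves a singular integral
equation with a small kernel. -/
lemma exists_relative_bcf (h₀ : Solves γ α q Φ₀)
    (h : Solves γ α p Φ) (hq : q ∈ Adm) (hp : p ∈ Adm) {R : ℝ}
    (hR : 1 ≤ R) {b : ℂ →ᵇ Mat3}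
    (hb : ∀ ξ, pert γ α q Φ₀ R (p - q) ξ = ((heavyWeight ξ : ℝ) : ℂ) • b ξ) :
    ∃ W : ℂ →ᵇ Mat3, W = 1 + cauchyOp (W * b) ∧ DifferentiableOn ℂ W (ball 0 R) ∧
      (∀ ξ ∈ contourᶜ, ‖ξ‖ ≤ R → Φ ξ = W ξ * Φ₀ ξ) ∧
      (∀ ξ ∈ contourᶜ, Φ ξ = W ξ * (smoothF γ α q Φ₀ ξ * (wave R (p - q) ξ)⁻¹ *
        (smoothF γ α q Φ₀ ξ)⁻¹) * Φ₀ ξ) ∧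
      ∀ ξ, 2 * R < ‖ξ‖ → smoothF γ α p Φ ξ = W ξ * smoothF γ α q Φ₀ ξ := by
  have hR0 : 0 < R := by linarith
  obtain ⟨X, hX, hΦ, -⟩ := h₀.exists_ratio h
  set G := conjWave γ α q Φ₀ R (p - q) with hG
  have hXs : ContDiff ℝ ∞ X := contDiff_iff_contDiffAt.2 fun z =>
    contDiffAt_of_eventually (Eventually.of_forall fun w => hX w)
  have hGs := contDiff_conjWave h₀ hR0 (p - q)
  have hWs : ContDiff ℝ ∞ fun ξ => X ξ * G ξ := hXs.mul hGs
  have hWc := hWs.continuous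
  have hsm : ∀ ξ, 2 * R < ‖ξ‖ → smoothF γ α p Φ ξ = X ξ * G ξ * smoothF γ α q Φ₀ ξ := by
    have hne : ∀ ξ : ℂ, 2 * R < ‖ξ‖ → ξ ≠ 0 := fun ξ hξ => by
      rintro rfl; rw [norm_zero] at hξ; linarith
    refine eqOn_of_eqOn_compl_contour (isOpen_lt continuous_const continuous_norm)
      (fun ξ hξ => (continuousAt_smoothF h (hne ξ hξ)).continuousWithinAt)
      (fun ξ hξ => (hWc.continuousAt.mul
        (continuousAt_smoothF h₀ (hne ξ hξ))).continuousWithinAt) fun ξ hξ hc => ?_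
    have e1 := model_eq_wave_inv_mul hR0 q (p - q) (le_of_lt hξ)
    rw [add_sub_cancel] at e1
    have e2 := smoothF_inv_mul h₀ (hne ξ hξ)
    rw [hG, conjWave_of_ne h₀ _ _ (hne ξ hξ)]
    have e3 : X ξ * (smoothF γ α q Φ₀ ξ * wave R (p - q) ξ * (smoothF γ α q Φ₀ ξ)⁻¹) *
        smoothF γ α q Φ₀ ξ = X ξ * smoothF γ α q Φ₀ ξ * wave R (p - q) ξ *
          ((smoothF γ α q Φ₀ ξ)⁻¹ * smoothF γ α q Φ₀ ξ) := by noncomm_ring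
    rw [e3, e2, mul_one, smoothF_eq h hc, smoothF_eq h₀ hc, hΦ ξ hc, e1]
    noncomm_ring
  have hlim : Tendsto (fun ξ => X ξ * G ξ) (cobounded ℂ) (𝓝 1) := by
    have t1 := tendsto_smoothF h hp
    have t2 := tendsto_mat_inv (by rw [Matrix.det_one]; exact one_ne_zero) (tendsto_smoothF h₀ hq)
    have t3 : Tendsto (fun ξ => smoothF γ α p Φ ξ * (smoothF γ α q Φ₀ ξ)⁻¹)
      (cobounded ℂ) (𝓝 (1 * 1⁻¹)) := t1.mul t2
    rw [inv_one, one_mul] at t3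
    refine t3.congr' ?_
    filter_upwards [eventually_le_norm_cobounded (2 * R + 1)] with ξ hξ
    have h0 : ξ ≠ 0 := by rintro rfl; rw [norm_zero] at hξ; linarith
    rw [hsm ξ (by linarith), mul_assoc, smoothF_mul_inv h₀ h0, mul_one]
  obtain ⟨C, hC0, hC⟩ := exists_bound_of_tendsto (r := 0) hWc.continuousOn hlim
  set W : ℂ →ᵇ Mat3 := BoundedContinuousFunction.ofNormedAddCommGroup (fun ξ => X ξ * G ξ) hWc C
    fun ξ => hC ξ (norm_nonneg ξ) with hW
  have hWa : ∀ ξ, W ξ = X ξ * G ξ := fun ξ => rfl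
  have hdb : ∀ ξ, dbar (fun ξ => X ξ * G ξ) ξ = ((heavyWeight ξ : ℝ) : ℂ) • (W * b) ξ := fun ξ => by
    have e1 := dbar_mul (f := X) (g := G) (z := ξ) ((hX ξ).restrictScalars ℝ)
      (hGs.contDiffAt.differentiableAt (by norm_num))
    refine e1.trans ?_
    refine (congrArg₂ (· + ·) (congrArg (· * G ξ) (dbar_eq_zero (hX ξ)))
      (congrArg (X ξ * ·) (dbar_conjWave h₀ hR0 (p - q) ξ))).trans ?_
    rw [hb ξ]
    change 0 * G ξ + X ξ * (G ξ * _) = ((heavyWeight ξ : ℝ) : ℂ) • (X ξ * G ξ * b ξ)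
    rw [zero_mul, zero_add, Matrix.mul_smul, Matrix.mul_smul, mul_assoc]
  refine ⟨W, ?_, ?_, ?_, ?_, hsm⟩
  · ext1 ξ
    have := eq_add_cauchyTransform_dbar (hWs.of_le (by norm_num)) hlim (C := ‖W * b‖)
      (fun s => by rw [hdb s]; exact norm_weight_smul_le' (W * b) s) ξ
    rw [hWa, this, BoundedContinuousFunction.add_apply, cauchyOp_apply]
    congr 2
    funext s
    exact hdb s
  · refine hX.differentiableOn.congr fun ξ hξ => ?_
    rw [hWa, hG, conjWave_of_le hR0 _ (by simpa using (mem_ball_zero_iff.1 hξ).le), mul_one]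
  · intro ξ hξ hle
    rw [hWa, hG, conjWave_of_le hR0 _ hle, mul_one, hΦ ξ hξ]
  · intro ξ hξ
    rw [hWa, mul_assoc (X ξ), hG, conjWave_mul_inv h₀ R _ (ne_zero_of_notMem_contour hξ), mul_one,
      hΦ ξ hξ]

end Nearby

/-! ## Expansions at infinity -/

section Expansion
variable {A : Type*} [NormedRing A] [NormedAlgebra ℂ A]

lemma inv_isBigO_one_cobounded : (fun ξ : ℂ => ξ⁻¹) =O[cobounded ℂ] fun _ => (1:ℂ) := by
  refine IsBigO.of_bound 1 ?_
  filter_upwards [eventually_le_norm_cobounded 1] with ξ hξ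
  rw [norm_inv, norm_one, mul_one]
  exact inv_le_one_of_one_le₀ hξ

lemma inv_sq_isBigO_inv_cobounded : (fun ξ : ℂ => (ξ ^ 2)⁻¹) =O[cobounded ℂ] fun ξ => ξ⁻¹ := by
  have := inv_isBigO_one_cobounded.mul (isBigO_refl (fun ξ : ℂ => ξ⁻¹) (cobounded ℂ))
  refine this.congr (fun ξ => by rw [sq, mul_inv]) (fun ξ => by rw [one_mul])

lemma tendsto_inv_cobounded : Tendsto (fun ξ : ℂ => ξ⁻¹) (cobounded ℂ) (𝓝 0) :=
  tendsto_inv₀_cobounded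

lemma ExpandsTo.congr {E : Type*} [NormedAddCommGroup E] [NormedSpace ℂ E] {f g : ℂ → E} {l m : E}
    (h : ExpandsTo f l m) (hfg : f =ᶠ[cobounded ℂ] g) : ExpandsTo g l m := by
  refine IsBigO.congr' h ?_ EventuallyEq.rfl
  filter_upwards [hfg] with ξ hξ
  rw [hξ]

lemma ExpandsTo.add {E : Type*} [NormedAddCommGroup E] [NormedSpace ℂ E] {f g : ℂ → E}
    {l m l' m' : E} (h : ExpandsTo f l m) (h' : ExpandsTo g l' m') :
    ExpandsTo (fun ξ => f ξ + g ξ) (l + l') (m + m') := by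
  refine (IsBigO.add h h').congr_left fun ξ => ?_
  simp only [smul_add]
  abel

lemma ExpandsTo.const {E : Type*} [NormedAddCommGroup E] [NormedSpace ℂ E] (l : E) :
    ExpandsTo (fun _ => l) l 0 := by
  unfold ExpandsTo
  simp [isBigO_zero]

lemma ExpandsTo.isBigO {E : Type*} [NormedAddCommGroup E] [NormedSpace ℂ E] {f : ℂ → E}
    {l m : E} (h : ExpandsTo f l m) :
    (fun ξ => f ξ - l) =O[cobounded ℂ] fun ξ : ℂ => ξ⁻¹ := by
  have h1 : (fun ξ : ℂ => ξ⁻¹ • m) =O[cobounded ℂ] fun ξ : ℂ => ξ⁻¹ := by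
    refine IsBigO.of_bound ‖m‖ (Eventually.of_forall fun ξ => ?_)
    rw [norm_smul, mul_comm]
  refine ((IsBigO.trans h inv_sq_isBigO_inv_cobounded).add h1).congr_left fun ξ => ?_
  abel

lemma ExpandsTo.tendsto {E : Type*} [NormedAddCommGroup E] [NormedSpace ℂ E] {f : ℂ → E}
    {l m : E} (h : ExpandsTo f l m) : Tendsto f (cobounded ℂ) (𝓝 l) := by
  have := h.isBigO.trans_tendsto tendsto_inv_cobounded
  exact tendsto_sub_nhds_zero_iff.1 this

lemma ExpandsTo.unique {E : Type*} [NormedAddCommGroup E] [NormedSpace ℂ E] {f : ℂ → E}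
    {l m m' : E} (h : ExpandsTo f l m) (h' : ExpandsTo f l m') : m = m' := by
  have h1 : (fun ξ : ℂ => ξ • ((f ξ - l - ξ⁻¹ • m') - (f ξ - l - ξ⁻¹ • m)))
      =O[cobounded ℂ] fun ξ : ℂ => ξ • (ξ ^ 2)⁻¹ :=
    (isBigO_refl _ _).smul (IsBigO.sub h' h)
  have h2 : Tendsto (fun ξ : ℂ => ξ • (ξ ^ 2)⁻¹) (cobounded ℂ) (𝓝 0) := by
    refine tendsto_inv_cobounded.congr' ?_
    filter_upwards [eventually_ne_zero_cobounded] with ξ hξ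
    rw [smul_eq_mul]; field_simp
  have h3 := h1.trans_tendsto h2
  have h4 : Tendsto (fun _ : ℂ => m - m') (cobounded ℂ) (𝓝 0) := by
    refine h3.congr' ?_
    filter_upwards [eventually_ne_zero_cobounded] with ξ hξ
    rw [sub_sub_sub_cancel_left, ← smul_sub, smul_smul, mul_inv_cancel₀ hξ, one_smul]
  exact sub_eq_zero.1 (tendsto_nhds_unique tendsto_const_nhds h4)

lemma ExpandsTo.mul {f g : ℂ → A} {l m l' m' : A} (h : ExpandsTo f l m)
    (h' : ExpandsTo g l' m') : ExpandsTo (fun ξ => f ξ * g ξ) (l * l') (l * m' + m * l') := by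
  have hg : g =O[cobounded ℂ] fun _ => (1:ℂ) := h'.tendsto.isBigO_one ℂ
  have h1 : (fun ξ => (f ξ - l - ξ⁻¹ • m) * g ξ) =O[cobounded ℂ]
      fun ξ => (ξ ^ 2)⁻¹ * 1 := IsBigO.mul h hg
  have h2 : (fun ξ => l * (g ξ - l' - ξ⁻¹ • m')) =O[cobounded ℂ]
      fun ξ => (ξ ^ 2)⁻¹ := IsBigO.const_mul_left h' l
  have hm : (fun ξ : ℂ => ξ⁻¹ • m) =O[cobounded ℂ] fun ξ : ℂ => ξ⁻¹ := by
    refine IsBigO.of_bound ‖m‖ (Eventually.of_forall fun ξ => ?_)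
    rw [norm_smul, mul_comm]
  have h3 : (fun ξ => (ξ⁻¹ • m) * (g ξ - l')) =O[cobounded ℂ]
      fun ξ : ℂ => ξ⁻¹ * ξ⁻¹ := hm.mul h'.isBigO
  refine (((h1.congr_right fun ξ => mul_one _).add h2).add
    (h3.congr_right fun ξ => by rw [sq, mul_inv])).congr_left fun ξ => ?_
  simp only [mul_sub, sub_mul, smul_mul_assoc, mul_smul_comm, smul_add]
  abel

end Expansion

/-! ## Smooth dependence on the parameters -/

lemma contDiffWithinAt_mul_of_fixedPoint {E P : Type*} [NormedRing E] [NormedAlgebra ℂ E]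
    [CompleteSpace E] [NormedAddCommGroup P] [NormedSpace ℝ P] {s : Set P} {q : P}
    (hq : q ∈ s) {b W : P → (ℂ →ᵇ E)} (hb : ContDiffWithinAt ℝ ∞ b s q) (hb0 : b q = 0)
    (hW : ∀ᶠ p in 𝓝[s] q, W p = 1 + cauchyOp (W p * b p)) :
    ContDiffWithinAt ℝ ∞ (fun p => W p * b p) s q :=
  (contDiffWithinAt_of_fixedPoint cauchyOp hq hb hb0 hW).mul hb

section Family
variable {γ α : ℝ} {Φ : Param → ℂ → Mat3} {M : Param → Mat3}

/-- Near any admissible parameter, the solutions are controlled by a smooth family of bounded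
continuous functions. -/
lemma exists_local_family (hΦ : Family γ α Φ)
    {q : Param} (hq : q ∈ Adm) {R : ℝ} (hR : 1 ≤ R) : ∃ Z : Param → (ℂ →ᵇ Mat3),
      ContDiffWithinAt ℝ ∞ Z Adm q ∧ Z q = 0 ∧ ∀ᶠ p in 𝓝[Adm] q,
      DifferentiableOn ℂ (cauchyOp (Z p)) (ball 0 R) ∧
      (∀ ξ ∈ contourᶜ, ‖ξ‖ ≤ R → Φ p ξ = (1 + cauchyOp (Z p) ξ) * Φ q ξ) ∧
      (∀ ξ ∈ contourᶜ, Φ p ξ = (1 + cauchyOp (Z p) ξ) * (smoothF γ α q (Φ q) ξ *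
        (wave R (p - q) ξ)⁻¹ * (smoothF γ α q (Φ q) ξ)⁻¹) * Φ q ξ) ∧
      ∀ ξ, 2 * R < ‖ξ‖ →
        smoothF γ α p (Φ p) ξ = (1 + cauchyOp (Z p) ξ) * smoothF γ α q (Φ q) ξ := by
  obtain ⟨b, hb, hb0, hpert⟩ := exists_pert_family (hΦ q hq) hq hR
  have key : ∀ p, ∃ W : ℂ →ᵇ Mat3, p ∈ Adm →
      (∀ ξ, pert γ α q (Φ q) R (p - q) ξ = ((heavyWeight ξ : ℝ) : ℂ) • b p ξ) →
      W = 1 + cauchyOp (W * b p) ∧ DifferentiableOn ℂ W (ball 0 R) ∧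
      (∀ ξ ∈ contourᶜ, ‖ξ‖ ≤ R → Φ p ξ = W ξ * Φ q ξ) ∧
      (∀ ξ ∈ contourᶜ, Φ p ξ = W ξ * (smoothF γ α q (Φ q) ξ * (wave R (p - q) ξ)⁻¹ *
        (smoothF γ α q (Φ q) ξ)⁻¹) * Φ q ξ) ∧
      ∀ ξ, 2 * R < ‖ξ‖ → smoothF γ α p (Φ p) ξ = W ξ * smoothF γ α q (Φ q) ξ := by
    intro p
    by_cases hp : p ∈ Adm ∧ ∀ ξ, pert γ α q (Φ q) R (p - q) ξ = ((heavyWeight ξ : ℝ) : ℂ) • b p ξ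
    · obtain ⟨W, hW⟩ := exists_relative_bcf (hΦ q hq) (hΦ p hp.1) hq hp.1 hR hp.2
      exact ⟨W, fun _ _ => hW⟩
    · exact ⟨0, fun h1 h2 => absurd ⟨h1, h2⟩ hp⟩
  choose W hW using key
  have hW' : ∀ᶠ p in 𝓝[Adm] q, W p = 1 + cauchyOp (W p * b p) := by
    filter_upwards [self_mem_nhdsWithin, hpert] with p hp hpp using (hW p hp hpp).1
  refine ⟨fun p => W p * b p, contDiffWithinAt_mul_of_fixedPoint hq hb hb0 hW',
    by change W q * b q = 0; rw [hb0, mul_zero], ?_⟩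
  filter_upwards [self_mem_nhdsWithin, hpert] with p hp hpp
  obtain ⟨e, h1, h2, h3, h4⟩ := hW p hp hpp
  have e' : ∀ ξ, 1 + cauchyOp (W p * b p) ξ = W p ξ := fun ξ =>
    (congrArg (fun f : ℂ →ᵇ Mat3 => f ξ) e).symm
  refine ⟨(h1.sub_const 1).congr fun ξ _ => ?_, fun ξ hξ hl => ?_, fun ξ hξ => ?_, fun ξ hξ => ?_⟩
  · rw [← e' ξ, add_sub_cancel_left]
  · rw [e' ξ]; exact h2 ξ hξ hl
  · rw [e' ξ]; exact h3 ξ hξ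
  · rw [e' ξ]; exact h4 ξ hξ

lemma eventually_moment_eq (hM : Moments γ α Φ M)
    {q : Param} (hq : q ∈ Adm) {R : ℝ} {Z : Param → (ℂ →ᵇ Mat3)}
    (hZ : ∀ᶠ p in 𝓝[Adm] q, ∀ ξ, 2 * R < ‖ξ‖ →
      smoothF γ α p (Φ p) ξ = (1 + cauchyOp (Z p) ξ) * smoothF γ α q (Φ q) ξ) :
    ∀ᶠ p in 𝓝[Adm] q, M p = M q + momentOp (Z p) := by
  filter_upwards [self_mem_nhdsWithin, hZ] with p hp h
  have h1 := ((ExpandsTo.const (1 : Mat3)).add (expandsTo_cauchyOp (Z p))).mul (hM q hq)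
  rw [add_zero, mul_one, one_mul, mul_one, zero_add] at h1
  refine (hM p hp).unique (h1.congr ?_)
  filter_upwards [eventually_le_norm_cobounded (2 * R + 1)] with ξ hξ
  exact (h ξ (by linarith)).symm

lemma contDiffOn_moment (hΦ : Family γ α Φ) (hM : Moments γ α Φ M) : ContDiffOn ℝ ∞ M Adm := by
  intro q hq
  obtain ⟨Z, hZ, hZ0, hev⟩ := exists_local_family hΦ hq le_rfl
  have hm := eventually_moment_eq hM hq (hev.mono fun p h => h.2.2.2)
  have h1 : ContDiffWithinAt ℝ ∞ (fun p => M q + momentOp (Z p)) Adm q :=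
    contDiffWithinAt_const.add ((momentOp (E := Mat3)).contDiff.comp_contDiffWithinAt (g := fun z => momentOp z) hZ)
  exact h1.congr_of_eventuallyEq hm (by rw [hZ0, map_zero, add_zero])

lemma phaseMat_smul (t : ℝ) (e : Param) (ξ : ℂ) : phaseMat (t • e) ξ = t • phaseMat e ξ := by
  simp only [phaseMat, Prod.smul_fst, Prod.smul_snd, smul_eq_mul, smul_add, ofReal_mul,
    ← Complex.coe_smul, smul_smul, mul_assoc]

lemma hasDerivAt_wave_inv {R : ℝ} (hR : 0 < R) (e : Param) {ξ : ℂ} (hξ : 2 * R ≤ ‖ξ‖) :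
    HasDerivAt (fun t : ℝ => (wave R (t • e) ξ)⁻¹) (-phaseMat e ξ) 0 := by
  have h := hasDerivAt_exp_smul_const (𝕂 := ℝ) (-phaseMat e ξ) (0 : ℝ)
  rw [zero_smul, NormedSpace.exp_zero, one_mul] at h
  refine h.congr_of_eventuallyEq (Eventually.of_forall fun t => ?_)
  change (wave R (t • e) ξ)⁻¹ = NormedSpace.exp (t • -phaseMat e ξ)
  rw [wave, radial_of_ge hR hξ, ofReal_one, one_smul, ← Matrix.exp_neg, phaseMat_smul, smul_neg]

/-- The logarithmic derivative of the solution in a direction of the parameter space is entire, with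
a known expansion at infinity. -/
lemma exists_logDeriv (hΦ : Family γ α Φ) (hM : Moments γ α Φ M) {q : Param} (hq : q ∈ Adm)
    {e : Param} {T : Set ℝ} (hTA : ∀ t ∈ T, q + t • e ∈ Adm) (hT : UniqueDiffWithinAt ℝ T 0) :
    ∃ (Y : ℂ → Mat3) (M' : Mat3), Differentiable ℂ Y ∧
      HasDerivWithinAt (fun t : ℝ => M (q + t • e)) M' T 0 ∧
      (∀ ξ ∈ contourᶜ, HasDerivWithinAt (fun t : ℝ => Φ (q + t • e) ξ) (Y ξ * Φ q ξ) T 0) ∧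
      ExpandsTo (fun ξ => Y ξ + smoothF γ α q (Φ q) ξ * phaseMat e ξ *
        (smoothF γ α q (Φ q) ξ)⁻¹) 0 M' := by
  have hc : HasDerivWithinAt (fun t : ℝ => q + t • e) e T 0 :=
    (((hasDerivAt_id (0:ℝ)).smul_const e).const_add q |>.congr_deriv (one_smul ℝ e)).hasDerivWithinAt
  have hc0 : q + (0:ℝ) • e = q := by simp
  have hct : Tendsto (fun t : ℝ => q + t • e) (𝓝[T] 0) (𝓝[Adm] q) := by
    refine tendsto_nhdsWithin_iff.2 ⟨?_, ?_⟩
    · have := hc.continuousWithinAt; rw [ContinuousWithinAt, hc0] at this; exact this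
    · filter_upwards [self_mem_nhdsWithin] with t ht using hTA t ht
  have hne : (𝓝[T \ {0}] (0:ℝ)).NeBot := by
    have := uniqueDiffWithinAt_iff_accPt.1 hT
    rw [accPt_principal_iff_nhdsWithin] at this
    exact this
  -- local families for all radii
  have key : ∀ R : ℝ, 1 ≤ R → ∃ Z' : ℂ →ᵇ Mat3, DifferentiableOn ℂ (cauchyOp Z') (ball 0 R) ∧
      (∀ ξ ∈ contourᶜ, ‖ξ‖ ≤ R →
        HasDerivWithinAt (fun t : ℝ => Φ (q + t • e) ξ) (cauchyOp Z' ξ * Φ q ξ) T 0) ∧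
      (∀ ξ ∈ contourᶜ, 2 * R ≤ ‖ξ‖ →
        HasDerivWithinAt (fun t : ℝ => Φ (q + t • e) ξ) ((cauchyOp Z' ξ -
          smoothF γ α q (Φ q) ξ * phaseMat e ξ * (smoothF γ α q (Φ q) ξ)⁻¹) * Φ q ξ) T 0) ∧
      HasDerivWithinAt (fun t : ℝ => M (q + t • e)) (momentOp Z') T 0 := by
    intro R hR
    have hR0 : 0 < R := by linarith
    obtain ⟨Z, hZ, hZ0, hev⟩ := exists_local_family hΦ hq hR
    have hmom := eventually_moment_eq hM hq (hev.mono fun p h => h.2.2.2)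
    have hd : HasFDerivWithinAt Z (fderivWithin ℝ Z Adm q) Adm (q + (0:ℝ) • e) := by
      rw [hc0]; exact (hZ.differentiableWithinAt (by norm_num)).hasFDerivWithinAt
    have hd1 : HasDerivWithinAt (fun t : ℝ => Z (q + t • e)) (fderivWithin ℝ Z Adm q e) T 0 :=
      hd.comp_hasDerivWithinAt (0:ℝ) hc (fun t ht => hTA t ht)
    set Z' := fderivWithin ℝ Z Adm q e
    have hC : HasDerivWithinAt (fun t : ℝ => cauchyOp (Z (q + t • e))) (cauchyOp Z') T 0 :=
      (cauchyOp (E := Mat3)).hasFDerivAt.comp_hasDerivWithinAt (0:ℝ) hd1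
    have hCe : ∀ ξ, HasDerivWithinAt (fun t : ℝ => 1 + cauchyOp (Z (q + t • e)) ξ)
        (cauchyOp Z' ξ) T 0 := fun ξ =>
      ((BoundedContinuousFunction.evalCLM ℝ ξ).hasFDerivAt.comp_hasDerivWithinAt (0:ℝ) hC).const_add 1
    have hZc0 : cauchyOp (Z (q + (0:ℝ) • e)) = 0 := by rw [hc0, hZ0, map_zero]
    have hevt := hct.eventually hev
    refine ⟨Z', ?_, ?_, ?_, ?_⟩
    · have hs := hasDerivWithinAt_iff_tendsto_slope.1 hC
      have hu := (BoundedContinuousFunction.tendsto_iff_tendstoUniformly.1 hs).tendstoUniformlyOn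
        (s := ball (0:ℂ) R) |>.tendstoLocallyUniformlyOn
      refine hu.differentiableOn ?_ isOpen_ball
      filter_upwards [nhdsWithin_mono _ sdiff_subset hevt] with t ht
      have : (⇑(_root_.slope (fun t : ℝ => cauchyOp (Z (q + t • e))) 0 t) : ℂ → Mat3) =
          fun ξ => ((t⁻¹ : ℝ) : ℂ) • cauchyOp (Z (q + t • e)) ξ := by
        funext ξ
        simp only [_root_.slope, vsub_eq_sub, hZc0, sub_zero]
        rfl
      rw [this]
      exact ht.1.const_smul ((t⁻¹ : ℝ) : ℂ)
    · intro ξ hξ hle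
      refine ((hCe ξ).mul_const (Φ q ξ)).congr_of_eventuallyEq ?_ ?_
      · filter_upwards [hevt] with t ht using ht.2.1 ξ hξ hle
      · rw [hZc0, hc0]; simp
    · intro ξ hξ hle
      have h0 : ξ ≠ 0 := ne_zero_of_notMem_contour hξ
      set F := smoothF γ α q (Φ q) ξ
      have hw := (hasDerivAt_wave_inv hR0 e hle).hasDerivWithinAt (s := T)
      have hprod := ((hCe ξ).mul ((hw.const_mul F).mul_const F⁻¹)).mul_const (Φ q ξ)
      have hw0 : (wave R ((0:ℝ) • e) ξ)⁻¹ = 1 := by rw [zero_smul, wave, phaseMat]; simp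
      refine (hprod.congr_of_eventuallyEq ?_ ?_).congr_deriv ?_
      · filter_upwards [hevt] with t ht
        have := ht.2.2.1 ξ hξ
        rw [add_sub_cancel_left] at this
        exact this
      · have hFF := smoothF_mul_inv (hΦ q hq) h0
        change Φ (q + (0:ℝ) • e) ξ = (1 + cauchyOp (Z (q + (0:ℝ) • e)) ξ) *
          (F * (wave R ((0:ℝ) • e) ξ)⁻¹ * F⁻¹) * Φ q ξ
        rw [hw0, mul_one, hFF, hZc0, hc0]; simp
      · have hFF := smoothF_mul_inv (hΦ q hq) h0
        rw [hw0, mul_one, hFF, hZc0]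
        simp only [BoundedContinuousFunction.coe_zero, Pi.zero_apply, add_zero, one_mul, mul_one]
        congr 1
        noncomm_ring
    · refine (((momentOp (E := Mat3)).hasFDerivAt.comp_hasDerivWithinAt (0:ℝ) hd1).const_add
        (M q)).congr_of_eventuallyEq ?_ ?_
      · filter_upwards [hct.eventually hmom] with t ht using ht
      · simp [hZ0]
  choose! Z' hdiff hsmall hlarge hmom using key
  have hcancel : ∀ {ξ : ℂ} {A B : Mat3}, ξ ∈ contourᶜ → A * Φ q ξ = B * Φ q ξ → A = B := by
    intro ξ A B hξ hAB
    have := (hΦ q hq).mul_inv_self hξ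
    rw [← mul_one A, ← mul_one B, ← this, ← mul_assoc, ← mul_assoc, hAB]
  set Y : ℂ → Mat3 := fun ξ => cauchyOp (Z' (‖ξ‖ + 1)) ξ
  have hYoff : ∀ R : ℝ, 1 ≤ R → ∀ ξ ∈ contourᶜ, ‖ξ‖ ≤ R → Y ξ = cauchyOp (Z' R) ξ := by
    intro R hR ξ hξ hle
    have h1 := hsmall R hR ξ hξ hle
    have h2 := hsmall (‖ξ‖ + 1) (by linarith [norm_nonneg ξ]) ξ hξ (by linarith)
    exact hcancel hξ (hT.eq_deriv _ h2 h1)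
  have hYR : ∀ R : ℝ, 1 ≤ R → ∀ ξ, ‖ξ‖ < R → Y ξ = cauchyOp (Z' R) ξ := by
    intro R hR ξ hξ
    have hR' : 1 ≤ ‖ξ‖ + 1 := by linarith [norm_nonneg ξ]
    have := eqOn_of_eqOn_compl_contour (isOpen_ball (x := (0:ℂ)) (ε := min R (‖ξ‖ + 1)))
      (f := cauchyOp (Z' (‖ξ‖ + 1))) (g := cauchyOp (Z' R))
      (BoundedContinuousFunction.continuous _).continuousOn
      (BoundedContinuousFunction.continuous _).continuousOn
      (fun z hz hc => by
        have hz' := mem_ball_zero_iff.1 hz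
        rw [← hYoff R hR z hc (hz'.le.trans (min_le_left _ _)),
          ← hYoff _ hR' z hc (hz'.le.trans (min_le_right _ _))])
    exact this (mem_ball_zero_iff.2 (lt_min hξ (by linarith)))
  have hYd : Differentiable ℂ Y := fun ξ => by
    have hR' : 1 ≤ ‖ξ‖ + 1 := by linarith [norm_nonneg ξ]
    have hm : ball (0:ℂ) (‖ξ‖ + 1) ∈ 𝓝 ξ := isOpen_ball.mem_nhds (by simp)
    refine (((hdiff _ hR').differentiableAt hm)).congr_of_eventuallyEq ?_
    filter_upwards [hm] with z hz using hYR _ hR' z (by simpa using hz)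
  refine ⟨Y, momentOp (Z' 1), hYd, hmom 1 le_rfl, fun ξ hξ => ?_, ?_⟩
  · exact hsmall (‖ξ‖ + 1) (by linarith [norm_nonneg ξ]) ξ hξ (by linarith)
  · refine (expandsTo_cauchyOp (Z' 1)).congr ?_
    have hne : ∀ ξ : ℂ, 2 < ‖ξ‖ → ξ ≠ 0 := fun ξ hξ => by rintro rfl; rw [norm_zero] at hξ; linarith
    have := eqOn_of_eqOn_compl_contour (isOpen_lt continuous_const continuous_norm (f := fun _ => (2:ℝ)))
      (f := cauchyOp (Z' 1)) (g := fun ξ => Y ξ + smoothF γ α q (Φ q) ξ * phaseMat e ξ *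
        (smoothF γ α q (Φ q) ξ)⁻¹) (BoundedContinuousFunction.continuous _).continuousOn
      (fun ξ hξ => (hYd.continuous.continuousAt.add
        (((continuousAt_smoothF (hΦ q hq) (hne ξ hξ)).mul
          (differentiable_phaseMat e).continuous.continuousAt).mul
          (contDiffAt_smoothF_inv (hΦ q hq) (hne ξ hξ)).continuousAt)).continuousWithinAt)
      (fun ξ hξ hc => by
        have h1 := hlarge 1 le_rfl ξ hc (by rw [mul_one]; exact le_of_lt hξ)
        have h2 := hsmall (‖ξ‖ + 1) (by linarith [norm_nonneg ξ]) ξ hc (by linarith)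
        have := hcancel hc (hT.eq_deriv _ h1 h2)
        change _ = cauchyOp (Z' (‖ξ‖ + 1)) ξ + _
        rw [← this, sub_add_cancel])
    filter_upwards [eventually_le_norm_cobounded 3] with ξ hξ
    exact this (show (2:ℝ) < ‖ξ‖ by linarith)

end Family

/-! ## Calculus on the set of admissible parameters -/

lemma convex_Adm : Convex ℝ Adm := by
  intro p hp q hq a b ha hb hab
  have key : ∀ r : Param, r ∈ Adm ↔ r.1 < 0 ∨ (r.1 = 0 ∧ 0 < r.2.1) := fun r => Iff.rfl
  rw [key] at hp hq ⊢
  simp only [Prod.fst_add, Prod.smul_fst, Prod.snd_add, Prod.smul_snd, smul_eq_mul]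
  rcases eq_or_lt_of_le ha with rfl | ha
  · obtain rfl : b = 1 := by linarith
    simpa using hq
  rcases eq_or_lt_of_le hb with rfl | hb
  · obtain rfl : a = 1 := by linarith
    simpa using hp
  rcases hp with hp | ⟨hp, hp'⟩ <;> rcases hq with hq | ⟨hq, hq'⟩
  · left; nlinarith
  · left; rw [hq]; nlinarith
  · left; rw [hp]; nlinarith
  · right; rw [hp, hq]; exact ⟨by simp, by positivity⟩

lemma mem_interior_Adm {p : Param} (h : p.1 < 0) : p ∈ interior Adm := by
  refine mem_interior.2 ⟨{q | q.1 < 0}, fun q hq => Or.inl hq, isOpen_lt continuous_fst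
    continuous_const, h⟩

lemma uniqueDiffOn_Adm : UniqueDiffOn ℝ Adm :=
  uniqueDiffOn_convex convex_Adm ⟨(-1, 0, 0), mem_interior_Adm (by norm_num)⟩

lemma mem_closure_interior_Adm {p : Param} (hp : p ∈ Adm) : p ∈ closure (interior Adm) := by
  rw [convex_Adm.closure_interior_eq_closure_of_nonempty_interior
    ⟨(-1, 0, 0), mem_interior_Adm (by norm_num)⟩]
  exact subset_closure hp

abbrev dirRho : Param := (1, 0, 0)
abbrev dirSigma : Param := (0, 1, 0)
abbrev dirTau : Param := (0, 0, 1)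

/-- The parameters `t` for which `p + t • e` is admissible. -/
def segAt (p e : Param) : Set ℝ := {t | p + t • e ∈ Adm}

lemma segAt_rho {p : Param} (hp : p ∈ Adm) : Iic 0 ⊆ segAt p dirRho := by
  intro t ht
  have ht' : t ≤ 0 := ht
  change Admissible _ _
  rcases hp with h | ⟨h, h'⟩
  · left; simp; linarith
  · rcases eq_or_lt_of_le ht' with rfl | h2
    · right; simpa using ⟨h, h'⟩
    · left; simp; linarith

lemma segAt_sigma {p : Param} (hp : p ∈ Adm) : segAt p dirSigma ∈ 𝓝 (0:ℝ) := by
  rcases hp with h | ⟨h, h'⟩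
  · refine Filter.mem_of_superset univ_mem fun t _ => Or.inl ?_
    simpa using h
  · refine Filter.mem_of_superset (Ioi_mem_nhds (neg_lt_zero.2 h')) fun t ht => Or.inr ?_
    have : -p.2.1 < t := ht
    simp only [Prod.fst_add, Prod.smul_fst, Prod.snd_add, Prod.smul_snd, smul_eq_mul]
    exact ⟨by simp [h], by linarith⟩

lemma segAt_tau {p : Param} (hp : p ∈ Adm) : segAt p dirTau = univ := by
  refine eq_univ_of_forall fun t => ?_
  change Admissible _ _
  simpa [Admissible, Adm] using hp

/-- The directions which are tangent to the parameter set at each of its points. -/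
def IsDir (e : Param) : Prop := e = dirRho ∨ e = dirSigma ∨ e = dirTau

lemma uniqueDiffWithinAt_segAt {p e : Param} (hp : p ∈ Adm) (he : IsDir e) :
    UniqueDiffWithinAt ℝ (segAt p e) 0 := by
  rcases he with rfl | rfl | rfl
  · exact (uniqueDiffOn_Iic (0:ℝ) 0 (mem_Iic.2 le_rfl)).mono (segAt_rho hp)
  · exact uniqueDiffWithinAt_of_mem_nhds (segAt_sigma hp)
  · rw [segAt_tau hp]; exact uniqueDiffWithinAt_univ

section Pd
variable {E : Type*} [NormedAddCommGroup E] [NormedSpace ℝ E] {g h : Param → E} {e e' p : Param}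

/-- The derivative in the direction `e` of a function on the parameter set. -/
def pd (e : Param) (g : Param → E) (p : Param) : E := fderivWithin ℝ g Adm p e

abbrev Smooth (g : Param → E) : Prop := ContDiffOn ℝ ∞ g Adm

lemma Smooth.pd (hg : Smooth g) (e : Param) : Smooth (pd e g) :=
  (hg.fderivWithin uniqueDiffOn_Adm (m := ∞) (by norm_num)).clm_apply contDiffOn_const

lemma Smooth.iterate_pd (hg : Smooth g) (e : Param) (k : ℕ) :
    Smooth ((BoussinesqRHP.pd e)^[k] g) := by
  induction k with
  | zero => exact hg
  | succ k ih => rw [Function.iterate_succ_apply']; exact ih.pd e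

lemma Smooth.hasFDerivWithinAt (hg : Smooth g) (hp : p ∈ Adm) :
    HasFDerivWithinAt g (fderivWithin ℝ g Adm p) Adm p :=
  ((hg p hp).differentiableWithinAt (by norm_num)).hasFDerivWithinAt

lemma pd_comm (hg : Smooth g) (hp : p ∈ Adm) : pd e (pd e' g) p = pd e' (pd e g) p := by
  have hs := (hg p hp).isSymmSndFDerivWithinAt (by
    rw [minSmoothness_of_isRCLikeNormedField]; exact WithTop.coe_le_coe.2 le_top) uniqueDiffOn_Adm
    (mem_closure_interior_Adm hp) hp
  have key : ∀ a b : Param, pd a (pd b g) p = fderivWithin ℝ (fderivWithin ℝ g Adm) Adm p a b := by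
    intro a b
    have hd : DifferentiableWithinAt ℝ (fderivWithin ℝ g Adm) Adm p :=
      ((hg.fderivWithin uniqueDiffOn_Adm (m := ∞) (by norm_num)) p hp).differentiableWithinAt
        (by norm_num)
    have := (hd.hasFDerivWithinAt.clm_apply (hasFDerivWithinAt_const b p Adm))
    unfold pd
    rw [this.fderivWithin (uniqueDiffOn_Adm p hp)]
    simp
  rw [key, key]
  exact hs e e'

/-- `g` has the derivative `d` in the direction `e` at `p`. -/
def HasPd (e : Param) (g : Param → E) (d : E) (p : Param) : Prop :=
  HasDerivWithinAt (fun t : ℝ => g (p + t • e)) d (segAt p e) 0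

lemma hasDerivAt_line (p e : Param) : HasDerivAt (fun t : ℝ => p + t • e) e 0 :=
  ((hasDerivAt_id (0:ℝ)).smul_const e).const_add p |>.congr_deriv (one_smul ℝ e)

lemma line_zero (p e : Param) : p + (0:ℝ) • e = p := by simp

lemma Smooth.hasPd (hg : Smooth g) (hp : p ∈ Adm) : HasPd e g (BoussinesqRHP.pd e g p) p := by
  have h1 : HasFDerivWithinAt g (fderivWithin ℝ g Adm p) Adm (p + (0:ℝ) • e) := by
    rw [line_zero]; exact hg.hasFDerivWithinAt hp
  exact h1.comp_hasDerivWithinAt (0:ℝ) (hasDerivAt_line p e).hasDerivWithinAt fun t ht => ht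

lemma HasPd.unique {d d' : E} (hp : p ∈ Adm) (he : IsDir e) (h1 : HasPd e g d p)
    (h2 : HasPd e g d' p) : d = d' :=
  (uniqueDiffWithinAt_segAt hp he).eq_deriv _ h1 h2

lemma HasPd.pd_eq {d : E} (h1 : HasPd e g d p) (hg : Smooth g) (hp : p ∈ Adm) (he : IsDir e) :
    BoussinesqRHP.pd e g p = d := (hg.hasPd hp).unique hp he h1

lemma HasPd.congr {d : E} (h1 : HasPd e g d p) (hp : p ∈ Adm) (hgh : ∀ q ∈ Adm, h q = g q) :
    HasPd e h d p :=
  HasDerivWithinAt.congr h1 (fun _ ht => hgh _ ht) (by rw [line_zero]; exact hgh p hp)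

lemma HasPd.add {d d' : E} (h1 : HasPd e g d p) (h2 : HasPd e h d' p) :
    HasPd e (fun q => g q + h q) (d + d') p := HasDerivWithinAt.add h1 h2

lemma HasPd.sub {d d' : E} (h1 : HasPd e g d p) (h2 : HasPd e h d' p) :
    HasPd e (fun q => g q - h q) (d - d') p := HasDerivWithinAt.sub h1 h2

lemma HasPd.neg {d : E} (h1 : HasPd e g d p) : HasPd e (fun q => -g q) (-d) p :=
  HasDerivWithinAt.neg h1

lemma hasPd_const (c : E) : HasPd e (fun _ => c) 0 p := hasDerivWithinAt_const _ _ _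

lemma HasPd.mul {A : Type*} [NormedRing A] [NormedAlgebra ℝ A] {g h : Param → A} {d d' : A}
    (h1 : HasPd e g d p) (h2 : HasPd e h d' p) :
    HasPd e (fun q => g q * h q) (d * h p + g p * d') p := by
  have := HasDerivWithinAt.mul h1 h2
  simp only [line_zero] at this
  exact this

lemma HasPd.const_mul {A : Type*} [NormedRing A] [NormedAlgebra ℝ A] {g : Param → A} {d : A}
    (c : A) (h1 : HasPd e g d p) : HasPd e (fun q => c * g q) (c * d) p :=
  HasDerivWithinAt.const_mul c h1

lemma pd_congr (hgh : ∀ q ∈ Adm, h q = g q) (hp : p ∈ Adm) : pd e h p = pd e g p := by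
  unfold pd
  rw [fderivWithin_congr hgh (hgh p hp)]

/-- The chain rule along a curve in the parameter set. -/
lemma Smooth.hasDerivAt_comp (hg : Smooth g) {c : ℝ → Param} {t : ℝ} {c' : Param}
    (hc : HasDerivAt c c' t) (hA : ∀ᶠ s in 𝓝 t, c s ∈ Adm) :
    HasDerivAt (fun s => g (c s)) (fderivWithin ℝ g Adm (c t) c') t := by
  have hU : c ⁻¹' Adm ∈ 𝓝 t := hA
  have h1 := (hg.hasFDerivWithinAt hA.self_of_nhds).comp_hasDerivWithinAt t
    (hc.hasDerivWithinAt (s := c ⁻¹' Adm)) (fun s hs => hs)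
  exact h1.hasDerivAt hU

lemma Smooth.hasDerivAt_tau (hg : Smooth g) {ρ σ τ : ℝ} (hp : (ρ, σ, τ) ∈ Adm) :
    HasDerivAt (fun t => g (ρ, σ, t)) (BoussinesqRHP.pd dirTau g (ρ, σ, τ)) τ := by
  refine hg.hasDerivAt_comp (c := fun t => (ρ, σ, t)) ?_ (Eventually.of_forall fun s => hp)
  exact (hasDerivAt_const τ ρ).prodMk ((hasDerivAt_const τ σ).prodMk (hasDerivAt_id τ))

lemma eventually_sigma {ρ σ : ℝ} (hp : Admissible ρ σ) : ∀ᶠ s in 𝓝 σ, Admissible ρ s := by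
  rcases hp with h | ⟨h, h'⟩
  · exact Eventually.of_forall fun s => Or.inl h
  · filter_upwards [Ioi_mem_nhds h'] with s hs using Or.inr ⟨h, hs⟩

lemma Smooth.hasDerivAt_sigma (hg : Smooth g) {ρ σ τ : ℝ} (hp : (ρ, σ, τ) ∈ Adm) :
    HasDerivAt (fun s => g (ρ, s, τ)) (BoussinesqRHP.pd dirSigma g (ρ, σ, τ)) σ := by
  refine hg.hasDerivAt_comp (c := fun s => (ρ, s, τ)) ?_ ((eventually_sigma hp).mono fun s hs => hs)
  exact (hasDerivAt_const σ ρ).prodMk ((hasDerivAt_id σ).prodMk (hasDerivAt_const σ τ))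

lemma Smooth.hasDerivWithinAt_rho (hg : Smooth g) {ρ σ τ : ℝ} (hp : (ρ, σ, τ) ∈ Adm) :
    HasDerivWithinAt (fun r => g (r, σ, τ)) (BoussinesqRHP.pd dirRho g (ρ, σ, τ)) (Iic 0) ρ := by
  have hc : HasDerivAt (fun r : ℝ => ((r, σ, τ) : Param)) dirRho ρ :=
    (hasDerivAt_id ρ).prodMk ((hasDerivAt_const ρ σ).prodMk (hasDerivAt_const ρ τ))
  have h1 := (hg.hasFDerivWithinAt hp).comp_hasDerivWithinAt ρ
    (hc.hasDerivWithinAt (s := (fun r : ℝ => ((r, σ, τ) : Param)) ⁻¹' Adm)) (fun s hs => hs)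
  refine HasDerivWithinAt.mono_of_mem_nhdsWithin h1 ?_
  rcases hp with h | ⟨h, h'⟩
  · exact mem_nhdsWithin_of_mem_nhds (Filter.mem_of_superset (Iio_mem_nhds h) fun r hr => Or.inl hr)
  · filter_upwards [self_mem_nhdsWithin] with r hr
    rcases eq_or_lt_of_le (show r ≤ 0 from hr) with rfl | h2
    · exact Or.inr ⟨rfl, h'⟩
    · exact Or.inl h2

lemma Smooth.iteratedDeriv_tau (hg : Smooth g) (k : ℕ) : ∀ {ρ σ τ : ℝ}, (ρ, σ, τ) ∈ Adm →
    iteratedDeriv k (fun t => g (ρ, σ, t)) τ = (BoussinesqRHP.pd dirTau)^[k] g (ρ, σ, τ) := by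
  induction k with
  | zero => intro ρ σ τ _; simp
  | succ k ih =>
    intro ρ σ τ hp
    rw [iteratedDeriv_succ, Function.iterate_succ_apply']
    have : iteratedDeriv k (fun t => g (ρ, σ, t)) =
        fun t => (BoussinesqRHP.pd dirTau)^[k] g (ρ, σ, t) := funext fun t => ih hp
    rw [this]
    exact ((hg.iterate_pd dirTau k).hasDerivAt_tau hp).deriv

end Pd

/-! ## Zero curvature equations -/

section Calculus
variable {U V : ℝ → ℂ}

lemma hasDerivAt_D (hU : ContDiff ℝ ∞ U) (k : ℕ) (τ : ℝ) : HasDerivAt (D k U) (D (k + 1) U τ) τ := by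
  have h : Differentiable ℝ (iteratedDeriv k U) :=
    hU.differentiable_iteratedDeriv k (mod_cast WithTop.coe_lt_top k)
  have := (h τ).hasDerivAt
  rwa [← iteratedDeriv_succ] at this

lemma contDiff_D (hU : ContDiff ℝ ∞ U) (k : ℕ) : ContDiff ℝ ∞ (D k U) := by
  unfold D; rw [iteratedDeriv_eq_iterate]; exact hU.iterate_deriv k

lemma D_zero (U : ℝ → ℂ) : D 0 U = U := iteratedDeriv_zero

lemma D_zero_apply (U : ℝ → ℂ) (τ : ℝ) : D 0 U τ = U τ := congrFun iteratedDeriv_zero τ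

lemma D_succ (k : ℕ) (U : ℝ → ℂ) : D (k + 1) U = deriv (D k U) := iteratedDeriv_succ

lemma D_one_mul (hU : ContDiff ℝ ∞ U) (hV : ContDiff ℝ ∞ V) :
    D 1 (fun t => U t * V t) = fun τ => D 1 U τ * V τ + U τ * D 1 V τ := by
  funext τ
  have h1 := hasDerivAt_D hU 0 τ
  have h2 := hasDerivAt_D hV 0 τ
  have h := h1.mul h2
  rw [D_succ]
  have e : D 0 (fun t => U t * V t) = D 0 U * D 0 V := by funext t; simp [D_zero]
  rw [e, h.deriv, D_zero, D_zero]

lemma D_two_mul (hU : ContDiff ℝ ∞ U) (hV : ContDiff ℝ ∞ V) :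
    D 2 (fun t => U t * V t) = fun τ => D 2 U τ * V τ + 2 * D 1 U τ * D 1 V τ + U τ * D 2 V τ := by
  funext τ
  rw [D_succ, D_one_mul hU hV]
  have h := ((hasDerivAt_D hU 1 τ).mul (hasDerivAt_D hV 0 τ)).add
    ((hasDerivAt_D hU 0 τ).mul (hasDerivAt_D hV 1 τ))
  simp only [D_zero] at h
  have e : (fun τ => D 1 U τ * V τ + U τ * D 1 V τ) = D 1 U * V + U * D 1 V := rfl
  rw [e, h.deriv, D_zero_apply, D_zero_apply]; ring

lemma D_three_mul (hU : ContDiff ℝ ∞ U) (hV : ContDiff ℝ ∞ V) :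
    D 3 (fun t => U t * V t) = fun τ => D 3 U τ * V τ + 3 * D 2 U τ * D 1 V τ +
      3 * D 1 U τ * D 2 V τ + U τ * D 3 V τ := by
  funext τ
  rw [D_succ, D_two_mul hU hV]
  have h := (((hasDerivAt_D hU 2 τ).mul (hasDerivAt_D hV 0 τ)).add
    (((hasDerivAt_D hU 1 τ).const_mul 2).mul (hasDerivAt_D hV 1 τ))).add
    ((hasDerivAt_D hU 0 τ).mul (hasDerivAt_D hV 2 τ))
  simp only [D_zero] at h
  have e : (fun τ => D 2 U τ * V τ + 2 * D 1 U τ * D 1 V τ + U τ * D 2 V τ) =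
      D 2 U * V + (fun t => 2 * D 1 U t) * D 1 V + U * D 2 V := rfl
  rw [e, h.deriv, D_zero_apply, D_zero_apply]; ring

lemma D_one_mul_apply (hU : ContDiff ℝ ∞ U) (hV : ContDiff ℝ ∞ V) (τ : ℝ) :
    D 1 (fun t => U t * V t) τ = D 1 U τ * V τ + U τ * D 1 V τ := congrFun (D_one_mul hU hV) τ

lemma D_two_mul_apply (hU : ContDiff ℝ ∞ U) (hV : ContDiff ℝ ∞ V) (τ : ℝ) :
    D 2 (fun t => U t * V t) τ = D 2 U τ * V τ + 2 * D 1 U τ * D 1 V τ + U τ * D 2 V τ :=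
  congrFun (D_two_mul hU hV) τ

lemma D_three_mul_apply (hU : ContDiff ℝ ∞ U) (hV : ContDiff ℝ ∞ V) (τ : ℝ) :
    D 3 (fun t => U t * V t) τ = D 3 U τ * V τ + 3 * D 2 U τ * D 1 V τ +
      3 * D 1 U τ * D 2 V τ + U τ * D 3 V τ := congrFun (D_three_mul hU hV) τ

lemma D_one_D_one (U : ℝ → ℂ) (τ : ℝ) : D 1 (D 1 U) τ = D 2 U τ := by
  rw [D_succ 1, D_succ 0, D_zero]

lemma pow_two_eq (U : ℝ → ℂ) : U ^ 2 = fun t => U t * U t := by funext t; simp [sq]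
lemma mul_eq_fun (U V : ℝ → ℂ) : U * V = fun t => U t * V t := rfl

lemma deriv_Bhat (hU : ContDiff ℝ ∞ U) (hV : ContDiff ℝ ∞ V) (τ : ℝ) (ξ : ℂ) (i j : Fin 3) :
    HasDerivAt (fun t => Bhat U V t ξ i j) ((!![2 / 3 * D 1 U τ, 0, 0;
      D 1 V τ - 2 / 3 * D 2 U τ, -(1 / 3) * D 1 U τ, 0;
      -D 2 V τ + 2 / 3 * D 3 U τ, D 1 V τ - 1 / 3 * D 2 U τ, -(1 / 3) * D 1 U τ] : Mat3) i j) τ := by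
  have u := hasDerivAt_D hU
  have v := hasDerivAt_D hV
  have u0 := u 0 τ
  have v0 := v 0 τ
  rw [D_zero] at u0 v0
  have zero := hasDerivAt_const τ (0:ℂ)
  have one := hasDerivAt_const τ (1:ℂ)
  have xi := hasDerivAt_const τ ξ
  fin_cases i <;> fin_cases j
  · exact (zero.add (u0.const_mul _)).congr_deriv (zero_add _)
  · exact (zero.add zero).congr_deriv (zero_add _)
  · exact (one.add zero).congr_deriv (zero_add _)
  · exact (xi.add (v0.sub ((u 1 τ).const_mul _))).congr_deriv (zero_add _)
  · exact (zero.add (u0.const_mul _)).congr_deriv (zero_add _)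
  · exact (zero.add zero).congr_deriv (zero_add _)
  · exact (zero.add ((v 1 τ).neg.add ((u 2 τ).const_mul _))).congr_deriv (zero_add _)
  · exact (xi.add (v0.sub ((u 1 τ).const_mul _))).congr_deriv (zero_add _)
  · exact (zero.add (u0.const_mul _)).congr_deriv (zero_add _)

lemma deriv_Ahat (hU : ContDiff ℝ ∞ U) (hV : ContDiff ℝ ∞ V) (τ : ℝ) (ξ : ℂ) (i j : Fin 3) :
    HasDerivAt (fun t => Ahat U V t ξ i j)
      ((!![0, 0, 0; 0, 0, 0; D 1 V τ, -D 1 U τ, 0] : Mat3) i j) τ := by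
  have u0 := hasDerivAt_D hU 0 τ
  have v0 := hasDerivAt_D hV 0 τ
  rw [D_zero] at u0 v0
  have zero := hasDerivAt_const τ (0:ℂ)
  have one := hasDerivAt_const τ (1:ℂ)
  fin_cases i <;> fin_cases j
  exacts [zero, one, zero, zero, zero, one, v0.const_add ξ, u0.neg, zero]

/-- The `τ`-derivative of `Ĉ`. -/
def dChat (U V : ℝ → ℂ) (τ : ℝ) (ξ : ℂ) : Mat3 :=
  ξ • !![0, 0, 0; 1 / 3 * D 1 U τ, 0, 0; -(1 / 3) * D 2 U τ + 2 / 3 * D 1 V τ, -(2 / 3) * D 1 U τ, 0] +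
  !![1 / 9 * (2 * D 3 U τ - 3 * D 2 V τ + 2 * D 1 (U ^ 2) τ), -(1 / 3) * (D 1 V τ - D 2 U τ),
      1 / 3 * D 1 U τ;
    1 / 9 * (-2 * D 4 U τ + 3 * D 3 V τ - 2 * D 2 (U ^ 2) τ + 3 * D 1 (U * V) τ),
      1 / 9 * (-D 3 U τ - D 1 (U ^ 2) τ), -(1 / 3) * D 1 V τ;
    1 / 9 * (2 * D 5 U τ - 3 * D 4 V τ + 2 * D 3 (U ^ 2) τ - 3 * D 2 (U * V) τ - 3 * D 1 (V ^ 2) τ),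
      1 / 9 * (-D 4 U τ - D 2 (U ^ 2) τ + 3 * D 3 V τ + 6 * D 1 (U * V) τ),
      1 / 9 * (-D 3 U τ + 3 * D 2 V τ - D 1 (U ^ 2) τ)]

lemma deriv_Chat (hU : ContDiff ℝ ∞ U) (hV : ContDiff ℝ ∞ V) (τ : ℝ) (ξ : ℂ) (i j : Fin 3) :
    HasDerivAt (fun t => Chat U V t ξ i j) (dChat U V τ ξ i j) τ := by
  have u := hasDerivAt_D hU
  have v := hasDerivAt_D hV
  have q := hasDerivAt_D (hU.pow 2)
  have r := hasDerivAt_D (hU.mul hV)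
  have s := hasDerivAt_D (hV.pow 2) 0 τ
  have u0 := u 0 τ
  have v0 := v 0 τ
  have q0 := q 0 τ
  have r0 := r 0 τ
  rw [D_zero] at u0 v0 q0 r0 s
  have zero := hasDerivAt_const τ (0:ℂ)
  have one := hasDerivAt_const τ (1:ℂ)
  have comb : ∀ {c : ℂ} {f g : ℝ → ℂ} {f' g' : ℂ}, HasDerivAt f f' τ → HasDerivAt g g' τ →
      HasDerivAt (fun t => ξ ^ 2 • c + ξ • f t + g t) (ξ • f' + g') τ := by
    intro c f g f' g' hf hg
    exact (((hasDerivAt_const τ (ξ ^ 2 • c)).add (hf.const_mul ξ)).add hg).congr_deriv (by simp)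
  have comm : ∀ {f : ℝ → ℂ} {g : ℝ → ℂ} {f' : ℂ}, HasDerivAt f f' τ → (∀ t, g t = f t) →
      HasDerivAt g f' τ := fun hf hfg => hf.congr_of_eventuallyEq (Eventually.of_forall hfg)
  fin_cases i <;> fin_cases j
  · exact comb zero ((((u 2 τ).const_mul 2).sub ((v 1 τ).const_mul 3)).add (q0.const_mul 2)
      |>.const_mul (1 / 9))
  · exact comb one ((v0.sub (u 1 τ)).const_mul (-(1 / 3))) |>.congr_deriv (by simp [dChat])
  · exact comb zero (u0.const_mul (1 / 3))
  · refine comb (u0.const_mul (1 / 3)) (comm (((((u 3 τ).const_mul (-2)).add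
      ((v 2 τ).const_mul 3)).sub ((q 1 τ).const_mul 2)).add (r0.const_mul 3) |>.const_mul (1 / 9))
      fun t => ?_)
    simp [c21, mul_assoc]
    rfl
  · exact comb zero (((u 2 τ).neg.sub q0).const_mul (1 / 9))
  · exact comb one (v0.const_mul (-(1 / 3))) |>.congr_deriv (by simp [dChat])
  · exact comb (((u 1 τ).const_mul (-(1 / 3))).add (v0.const_mul (2 / 3)))
      ((((((u 4 τ).const_mul 2).sub ((v 3 τ).const_mul 3)).add ((q 2 τ).const_mul 2)).sub
        ((r 1 τ).const_mul 3)).sub (s.const_mul 3) |>.const_mul (1 / 9))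
  · refine comb (u0.const_mul (-(2 / 3))) (comm ((((u 3 τ).neg.sub (q 1 τ)).add
      ((v 2 τ).const_mul 3)).add (r0.const_mul 6) |>.const_mul (1 / 9)) fun t => ?_)
    simp [c32, mul_assoc]
    rfl
  · exact comb zero (((u 2 τ).neg.add ((v 1 τ).const_mul 3)).sub q0 |>.const_mul (1 / 9))

/-- The `τ`-derivative of `L̂`. -/
def dLhat (ρ σ : ℝ) (U V : ℝ → ℂ) (τ : ℝ) (ξ : ℂ) : Mat3 := ((1 / 3 : ℂ) • Ahat U V τ ξ +
    (τ / 3 : ℂ) • (!![0, 0, 0; 0, 0, 0; D 1 V τ, -D 1 U τ, 0] : Mat3)) +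
  (2 * σ / 3 : ℂ) • (!![2 / 3 * D 1 U τ, 0, 0; D 1 V τ - 2 / 3 * D 2 U τ, -(1 / 3) * D 1 U τ, 0;
      -D 2 V τ + 2 / 3 * D 3 U τ, D 1 V τ - 1 / 3 * D 2 U τ, -(1 / 3) * D 1 U τ] : Mat3) +
  (4 * ρ / 3 : ℂ) • dChat U V τ ξ

lemma deriv_Lhat (ρ σ : ℝ) (hU : ContDiff ℝ ∞ U) (hV : ContDiff ℝ ∞ V) (τ : ℝ) (ξ : ℂ)
    (i j : Fin 3) : HasDerivAt (fun t => Lhat ρ σ U V t ξ i j) (dLhat ρ σ U V τ ξ i j) τ := by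
  have h0 : HasDerivAt (fun t : ℝ => (t / 3 : ℂ)) (1 / 3) τ :=
    (hasDerivAt_id τ).ofReal_comp.div_const 3
  have h1 := h0.mul (deriv_Ahat hU hV τ ξ i j)
  have h2 := (deriv_Bhat hU hV τ ξ i j).const_mul (2 * σ / 3 : ℂ)
  have h3 := (deriv_Chat hU hV τ ξ i j).const_mul (4 * ρ / 3 : ℂ)
  exact ((h1.const_add (((-(1 / 3 : ℂ)) • (Matrix.diagonal ![0, 1, 2] : Mat3)) i j)).add h2).add h3

lemma dSigma_Ahat (u v : ℝ → ℝ → ℝ → ℂ) (ρ σ τ : ℝ) (ξ : ℂ) :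
    Matrix.of (fun i j => dSigma (fun r s t => Ahat (u r s) (v r s) t ξ i j) ρ σ τ) =
      (!![0, 0, 0; 0, 0, 0; dSigma v ρ σ τ, -dSigma u ρ σ τ, 0] : Mat3) := by
  ext i j
  fin_cases i <;> fin_cases j <;> simp [Ahat, dSigma]

lemma dRho_Ahat (u v : ℝ → ℝ → ℝ → ℂ) (ρ σ τ : ℝ) (ξ : ℂ) :
    Matrix.of (fun i j => dRho (fun r s t => Ahat (u r s) (v r s) t ξ i j) ρ σ τ) =
      (!![0, 0, 0; 0, 0, 0; dRho v ρ σ τ, -dRho u ρ σ τ, 0] : Mat3) := by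
  ext i j
  fin_cases i <;> fin_cases j <;> simp [Ahat, dRho, derivWithin.fun_neg]

lemma dXi_Ahat (U V : ℝ → ℂ) (τ : ℝ) (ξ : ℂ) :
    Matrix.of (fun i j => deriv (fun z => Ahat U V τ z i j) ξ) =
      (!![0, 0, 0; 0, 0, 0; 1, 0, 0] : Mat3) := by
  ext i j
  fin_cases i <;> fin_cases j <;> simp [Ahat]

lemma diagonal_zero_one_two :
    (Matrix.diagonal ![0, 1, 2] : Mat3) = !![0, 0, 0; 0, 1, 0; 0, 0, 2] := by
  ext i j
  fin_cases i <;> fin_cases j <;> simp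

end Calculus

section Compatibility
variable {u v : ℝ → ℝ → ℝ → ℂ} {ρ σ τ : ℝ}

lemma firstFlowAt_of_compatible (hu : ContDiff ℝ ∞ (u ρ σ)) (hv : ContDiff ℝ ∞ (v ρ σ)) {ξ : ℂ}
    (h : (!![0, 0, 0; 0, 0, 0; dSigma v ρ σ τ, -dSigma u ρ σ τ, 0] : Mat3) -
      Matrix.of (fun i j => deriv (fun t => Bhat (u ρ σ) (v ρ σ) t ξ i j) τ) =
      Ahat (u ρ σ) (v ρ σ) τ ξ * Bhat (u ρ σ) (v ρ σ) τ ξ -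
        Bhat (u ρ σ) (v ρ σ) τ ξ * Ahat (u ρ σ) (v ρ σ) τ ξ) : FirstFlowAt u v ρ σ τ := by
  simp only [fun ξ i j => (deriv_Bhat hu hv τ ξ i j).deriv] at h
  have h1 := congrFun (congrFun h 2) 1
  have h2 := congrFun (congrFun h 2) 0
  simp [Ahat, Bhat, -iteratedDeriv_one] at h1 h2
  constructor
  · linear_combination -h1
  · linear_combination h2

lemma compatibleTauSigma_iff (hu : ContDiff ℝ ∞ (u ρ σ)) (hv : ContDiff ℝ ∞ (v ρ σ)) :
    CompatibleTauSigma u v ρ σ τ ↔ FirstFlowAt u v ρ σ τ := by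
  unfold CompatibleTauSigma
  simp only [dSigma_Ahat]
  refine ⟨fun h => firstFlowAt_of_compatible hu hv (h 0), ?_⟩
  unfold FirstFlowAt
  simp only [fun ξ i j => (deriv_Bhat hu hv τ ξ i j).deriv]
  rintro ⟨h1, h2⟩ ξ
  ext i j
  fin_cases i <;> fin_cases j <;> simp [Ahat, Bhat, -iteratedDeriv_one]
  all_goals first | ring1 | linear_combination h2 | linear_combination -h1

lemma secondFlowAt_of_compatible (hu : ContDiff ℝ ∞ (u ρ σ)) (hv : ContDiff ℝ ∞ (v ρ σ)) {ξ : ℂ}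
    (h : (!![0, 0, 0; 0, 0, 0; dRho v ρ σ τ, -dRho u ρ σ τ, 0] : Mat3) -
      Matrix.of (fun i j => deriv (fun t => Chat (u ρ σ) (v ρ σ) t ξ i j) τ) =
      Ahat (u ρ σ) (v ρ σ) τ ξ * Chat (u ρ σ) (v ρ σ) τ ξ -
        Chat (u ρ σ) (v ρ σ) τ ξ * Ahat (u ρ σ) (v ρ σ) τ ξ) : SecondFlowAt u v ρ σ τ := by
  have hv1 := contDiff_D hv 1
  simp only [fun ξ i j => (deriv_Chat hu hv τ ξ i j).deriv] at h
  have h1 := congrFun (congrFun h 2) 1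
  have h2 := congrFun (congrFun h 2) 0
  unfold SecondFlowAt
  simp [Ahat, dChat, Chat, c11, c22, c33, c21, c31, c32, -iteratedDeriv_one] at h1 h2
  simp only [pow_two_eq, mul_eq_fun, D_one_mul_apply hu hu, D_two_mul_apply hu hu,
    D_three_mul_apply hu hu, D_one_mul_apply hu hv, D_two_mul_apply hu hv, D_one_mul_apply hv hv,
    D_one_mul_apply hu hv1, D_one_D_one] at h1 h2 ⊢
  constructor
  · linear_combination -h1
  · linear_combination h2

lemma compatibleTauRho_iff (hu : ContDiff ℝ ∞ (u ρ σ)) (hv : ContDiff ℝ ∞ (v ρ σ)) :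
    CompatibleTauRho u v ρ σ τ ↔ SecondFlowAt u v ρ σ τ := by
  unfold CompatibleTauRho
  simp only [dRho_Ahat]
  refine ⟨fun h => secondFlowAt_of_compatible hu hv (h 0), ?_⟩
  unfold SecondFlowAt
  have hv1 := contDiff_D hv 1
  simp only [fun ξ i j => (deriv_Chat hu hv τ ξ i j).deriv]
  rintro ⟨h1, h2⟩ ξ
  simp only [pow_two_eq, mul_eq_fun, D_two_mul_apply hu hu, D_three_mul_apply hu hu,
    D_one_mul_apply hu hv, D_one_mul_apply hv hv, D_one_mul_apply hu hv1, D_one_D_one] at h1 h2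
  ext i j
  fin_cases i <;> fin_cases j <;>
    simp [Ahat, dChat, Chat, c11, c22, c33, c21, c31, c32, -iteratedDeriv_one]
  all_goals try simp only [pow_two_eq, mul_eq_fun, D_one_mul_apply hu hu, D_two_mul_apply hu hu,
    D_three_mul_apply hu hu, D_one_mul_apply hu hv, D_two_mul_apply hu hv, D_one_mul_apply hv hv]
  all_goals first | ring1 | linear_combination h2 | linear_combination -h1

lemma compatibleXiTau_iff (hu : ContDiff ℝ ∞ (u ρ σ)) (hv : ContDiff ℝ ∞ (v ρ σ)) :
    CompatibleXiTau u v ρ σ τ ↔ SelfSimilarAt ρ σ (u ρ σ) (v ρ σ) τ := by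
  unfold CompatibleXiTau SelfSimilarAt
  have hv1 := contDiff_D hv 1
  simp only [dXi_Ahat, fun ξ i j => (deriv_Lhat ρ σ hu hv τ ξ i j).deriv, pow_two_eq, mul_eq_fun,
    D_one_mul_apply hu hu, D_two_mul_apply hu hu, D_three_mul_apply hu hu, D_one_mul_apply hu hv,
    D_one_mul_apply hv hv, D_one_mul_apply hu hv1, D_one_D_one]
  constructor
  · intro h
    have h1 := congrFun (congrFun (h 0) 2) 1
    have h2 := congrFun (congrFun (h 0) 2) 0
    simp [Ahat, Bhat, dLhat, Lhat, diagonal_zero_one_two, dChat, Chat, c11, c22, c33,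
      c21, c31, c32, -iteratedDeriv_one] at h1 h2
    simp only [pow_two_eq, mul_eq_fun, D_one_mul_apply hu hu, D_two_mul_apply hu hu,
      D_three_mul_apply hu hu, D_one_mul_apply hu hv, D_two_mul_apply hu hv, D_one_mul_apply hv hv] at h1 h2
    constructor
    · linear_combination 3 * h1
    · linear_combination -3 * h2
  · rintro ⟨h1, h2⟩ ξ
    ext i j
    fin_cases i <;> fin_cases j <;>
      simp [Ahat, Bhat, dLhat, Lhat, diagonal_zero_one_two, dChat, Chat, c11, c22,
        c33, c21, c31, c32, -iteratedDeriv_one]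
    all_goals try simp only [pow_two_eq, mul_eq_fun, D_one_mul_apply hu hu, D_two_mul_apply hu hu,
      D_three_mul_apply hu hu, D_one_mul_apply hu hv, D_two_mul_apply hu hv, D_one_mul_apply hv hv]
    all_goals first | ring1 | linear_combination (1 / 3) * h1 | linear_combination -(1 / 3) * h2

end Compatibility

/-! ## The reduction without the top flow -/

lemma hasDerivAt_ofReal_id (τ : ℝ) : HasDerivAt (fun t : ℝ => (t : ℂ)) 1 τ :=
  (hasDerivAt_id τ).ofReal_comp

lemma selfSimilar_iff_reduced {σ : ℝ} (hσ : 0 < σ) {U : ℝ → ℂ} (hU : ContDiff ℝ ∞ U) :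
    (∃ V : ℝ → ℂ, ContDiff ℝ ∞ V ∧ ∀ τ : ℝ, SelfSimilarAt 0 σ U V τ) ↔
      ∀ τ : ℝ, ReducedAt σ U τ := by
  have hσ' : (σ : ℂ) ≠ 0 := ofReal_ne_zero.2 hσ.ne'
  have u := hasDerivAt_D hU
  have q : ∀ k τ, HasDerivAt (D k (U ^ 2)) (D (k + 1) (U ^ 2) τ) τ := hasDerivAt_D (hU.pow 2)
  have u0 : ∀ τ, HasDerivAt U (D 1 U τ) τ := fun τ => by have := u 0 τ; rwa [D_zero] at this
  set P : ℝ → ℂ := fun τ => 1 / 2 * D 2 U τ + (τ * D 1 U τ + 2 * U τ) / (4 * σ) with hP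
  set P' : ℝ → ℂ := fun τ => 1 / 2 * D 3 U τ + (τ * D 2 U τ + 3 * D 1 U τ) / (4 * σ) with hP'
  set P'' : ℝ → ℂ := fun τ => 1 / 2 * D 4 U τ + (τ * D 3 U τ + 4 * D 2 U τ) / (4 * σ) with hP''
  have dP : ∀ τ, HasDerivAt P (P' τ) τ := fun τ => by
    refine (((u 2 τ).const_mul (1 / 2)).add ((((hasDerivAt_ofReal_id τ).mul (u 1 τ)).add
      ((u0 τ).const_mul 2)).div_const (4 * σ : ℂ))).congr_deriv ?_
    simp only [hP']; ring
  have dP' : ∀ τ, HasDerivAt P' (P'' τ) τ := fun τ => by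
    refine (((u 3 τ).const_mul (1 / 2)).add ((((hasDerivAt_ofReal_id τ).mul (u 2 τ)).add
      ((u 1 τ).const_mul 3)).div_const (4 * σ : ℂ))).congr_deriv ?_
    simp only [hP'']; ring
  constructor
  · rintro ⟨V, hV, h⟩ τ
    have v := hasDerivAt_D hV
    have v0 : ∀ τ, HasDerivAt V (D 1 V τ) τ := fun τ => by have := v 0 τ; rwa [D_zero] at this
    have e1 : D 1 V = P := by
      funext t
      have := (h t).1
      simp only [hP]
      push_cast at this
      field_simp
      linear_combination 2 * this
    have e2 : D 2 V = P' := by rw [D_succ 1, e1]; funext t; exact (dP t).deriv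
    have e3 : ∀ t, V t = (2 * σ * (P' t - 2 / 3 * D 3 U t - 1 / 3 * D 1 (U ^ 2) t) - t * P t) / 3 := by
      intro t
      have := (h t).2
      rw [e1, e2] at this
      push_cast at this
      linear_combination -(1 / 3) * this
    have d := (((((dP' τ).sub ((u 3 τ).const_mul (2 / 3))).sub ((q 1 τ).const_mul (1 / 3))).const_mul
      (2 * σ : ℂ)).sub ((hasDerivAt_ofReal_id τ).mul (dP τ))).div_const 3
    have d' := d.congr_of_eventuallyEq (Eventually.of_forall e3)
    have e4 := d'.unique (v0 τ)
    rw [e1] at e4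
    simp only [hP, hP', hP''] at e4
    rw [← sub_eq_zero] at e4
    unfold ReducedAt
    refine (Eq.trans ?_ (congrArg (fun z : ℂ => 36 * (σ : ℂ) * z) e4)).trans (mul_zero _)
    field_simp
    ring
  · intro h
    set V : ℝ → ℂ := fun t =>
      (2 * σ * (P' t - 2 / 3 * D 3 U t - 1 / 3 * D 1 (U ^ 2) t) - t * P t) / 3 with hV
    have dV : ∀ τ, HasDerivAt V (P τ) τ := fun τ => by
      refine ((((((dP' τ).sub ((u 3 τ).const_mul (2 / 3))).sub
        ((q 1 τ).const_mul (1 / 3))).const_mul (2 * σ : ℂ)).sub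
        ((hasDerivAt_ofReal_id τ).mul (dP τ))).div_const 3).congr_deriv ?_
      have e4 := h τ
      unfold ReducedAt at e4
      simp only [hP, hP', hP'']
      rw [← sub_eq_zero]
      refine (Eq.trans ?_ (congrArg (fun z : ℂ => (36 * (σ : ℂ))⁻¹ * z) e4)).trans (mul_zero _)
      field_simp
      ring
    have cid : ContDiff ℝ ∞ fun t : ℝ => (t : ℂ) := ofRealCLM.contDiff
    have cU := contDiff_D hU
    have cP : ContDiff ℝ ∞ P := by
      exact (contDiff_const.mul (cU 2)).add (((cid.mul (cU 1)).add (contDiff_const.mul hU)).div_const _)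
    have cP' : ContDiff ℝ ∞ P' := by
      exact (contDiff_const.mul (cU 3)).add
        (((cid.mul (cU 2)).add (contDiff_const.mul (cU 1))).div_const _)
    have e1 : D 1 V = P := by rw [D_succ 0, D_zero]; funext t; exact (dV t).deriv
    have e2 : D 2 V = P' := by rw [D_succ 1, e1]; funext t; exact (dP t).deriv
    refine ⟨V, ?_, fun τ => ⟨?_, ?_⟩⟩
    · exact ((contDiff_const.mul ((cP'.sub (contDiff_const.mul (cU 3))).sub
        (contDiff_const.mul (contDiff_D (hU.pow 2) 1)))).sub (cid.mul cP)).div_const _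
    · rw [e1]
      simp only [hP]
      push_cast
      field_simp
      ring
    · rw [e1, e2]
      simp only [hV]
      push_cast
      ring

/-! ## The second-order Chazy equation and the fourth Painlevé equation -/

lemma hasDerivAt_D_of_contDiffOn {S : Set ℝ} (hS : IsOpen S) {f : ℝ → ℂ} {n : ℕ}
    (hf : ContDiffOn ℝ n f S) {k : ℕ} (hk : k < n) {τ : ℝ} (hτ : τ ∈ S) :
    HasDerivAt (D k f) (D (k + 1) f τ) τ := by
  rw [D_succ]
  have h2 : DifferentiableAt ℝ (iteratedDeriv k f) τ := by
    have h3 := hf.differentiableOn_iteratedDerivWithin (m := k) (mod_cast hk) hS.uniqueDiffOn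
    exact (h3.congr fun t ht => (iteratedDerivWithin_of_isOpen hS ht).symm).differentiableAt
      (hS.mem_nhds hτ)
  exact h2.hasDerivAt

/-- A derivative that holds on an open set determines the iterated derivatives there. -/
lemma D_succ_eq_of_hasDerivAt {S : Set ℝ} (hS : IsOpen S) {f g h : ℝ → ℂ} {k : ℕ}
    (hg : ∀ τ ∈ S, D k f τ = g τ) (hd : ∀ τ ∈ S, HasDerivAt g (h τ) τ) {τ : ℝ} (hτ : τ ∈ S) :
    D (k + 1) f τ = h τ := by
  rw [D_succ]
  have : D k f =ᶠ[𝓝 τ] g := by filter_upwards [hS.mem_nhds hτ] with t ht using hg t ht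
  rw [this.deriv_eq, (hd τ hτ).deriv]

lemma contDiffOn_succ_of_hasDerivAt {S : Set ℝ} (hS : IsOpen S) {f g : ℝ → ℂ} {n : ℕ}
    (hd : ∀ τ ∈ S, HasDerivAt f (g τ) τ) (hg : ContDiffOn ℝ n g S) :
    ContDiffOn ℝ (n + 1 : ℕ) f S := by
  push_cast
  rw [contDiffOn_succ_iff_deriv_of_isOpen hS]
  refine ⟨fun τ hτ => (hd τ hτ).differentiableAt.differentiableWithinAt, by simp, ?_⟩
  exact hg.congr fun τ hτ => (hd τ hτ).deriv

lemma chazyPainleveEquivalence (α : ℝ) : ChazyPainleveEquivalence α := by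
  intro S hS
  have hid := hasDerivAt_ofReal_id
  have cid : ∀ n : ℕ, ContDiffOn ℝ n (fun t : ℝ => (t : ℂ)) S := fun n =>
    ofRealCLM.contDiff.contDiffOn
  constructor
  · rintro y ⟨hy, hE⟩ hne
    have y0 : ∀ τ ∈ S, HasDerivAt y (D 1 y τ) τ := fun τ hτ => by
      have := hasDerivAt_D_of_contDiffOn hS hy (k := 0) (by norm_num) hτ
      rwa [D_zero] at this
    have y1 : ∀ τ ∈ S, HasDerivAt (D 1 y) (D 2 y τ) τ := fun τ hτ =>
      hasDerivAt_D_of_contDiffOn hS hy (k := 1) (by norm_num) hτ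
    have y2 : ∀ τ ∈ S, HasDerivAt (D 2 y) (D 3 y τ) τ := fun τ hτ =>
      hasDerivAt_D_of_contDiffOn hS hy (k := 2) (by norm_num) hτ
    have y3 : ∀ τ ∈ S, D 3 y τ = -6 * D 1 y τ ^ 2 + 4 * τ * (τ * D 1 y τ - y τ) +
        2 / 3 * ((α : ℂ) ^ 2 - α + 1) := fun τ hτ => by
      have d := (((((y2 τ hτ).pow 2).add (((y1 τ hτ).pow 3).const_mul 4)).sub
        (((((hid τ).mul (y1 τ hτ)).sub (y0 τ hτ)).pow 2).const_mul 4)).sub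
        ((y1 τ hτ).const_mul (4 / 3 * ((α : ℂ) ^ 2 - α + 1)))).add_const
          (4 / 27 * ((α : ℂ) + 1) * (2 * α - 1) * (α - 2))
      have z : HasDerivAt (fun _ : ℝ => (0:ℂ)) 0 τ := hasDerivAt_const _ _
      have d' := z.congr_of_eventuallyEq (by
        filter_upwards [hS.mem_nhds hτ] with t ht using hE t ht)
      have e := d.unique d'
      have h0 := (hne τ hτ).1
      simp only [Pi.sub_apply, Pi.mul_apply] at e
      have e' : 2 * D 2 y τ * (D 3 y τ - (-6 * D 1 y τ ^ 2 + 4 * τ * (τ * D 1 y τ - y τ) +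
        2 / 3 * ((α : ℂ) ^ 2 - α + 1))) = 0 := by
        linear_combination e
      rcases mul_eq_zero.1 e' with h | h
      · exact absurd (mul_eq_zero.1 h) (by simpa using h0)
      · exact sub_eq_zero.1 h
    set w := chazyToPainleve α y
    have wdef : ∀ τ ∈ S, 2 * w τ * (D 1 y τ - ((α : ℂ) + 1) / 3) =
        D 2 y τ - 2 * τ * D 1 y τ + 2 * y τ := fun τ hτ => by
      have h0 := sub_ne_zero.2 (hne τ hτ).2.1
      have h1 : w τ = _ / (2 * (D 1 y τ - ((α : ℂ) + 1) / 3)) := rfl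
      rw [h1, mul_right_comm, mul_div_cancel₀ _ (mul_ne_zero two_ne_zero h0)]
    -- the factorization of the second-order equation
    have fact : ∀ τ ∈ S, (D 2 y τ + 2 * (τ * D 1 y τ - y τ)) * w τ =
        -2 * (D 1 y τ - (1 - 2 * (α : ℂ)) / 3) * (D 1 y τ - ((α : ℂ) - 2) / 3) := fun τ hτ => by
      have h0 := sub_ne_zero.2 (hne τ hτ).2.1
      refine mul_left_cancel₀ (mul_ne_zero two_ne_zero h0) ?_
      have e := hE τ hτ
      unfold ChazySecondAt at e
      linear_combination e + (D 2 y τ + 2 * (τ * D 1 y τ - y τ)) * wdef τ hτ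
    have w1 : ∀ τ ∈ S, HasDerivAt w (-w τ ^ 2 - 2 * τ * w τ - 2 * D 1 y τ - ((α : ℂ) + 1) / 3) τ := by
      intro τ hτ
      have h0 := sub_ne_zero.2 (hne τ hτ).2.1
      have d := (((y2 τ hτ).sub (((hid τ).const_mul 2).mul (y1 τ hτ))).add
        ((y0 τ hτ).const_mul 2)).div (((y1 τ hτ).sub_const (((α : ℂ) + 1) / 3)).const_mul 2)
        (mul_ne_zero two_ne_zero h0)
      refine HasDerivAt.congr_deriv (f' := _) d ?_
      rw [div_eq_iff (pow_ne_zero 2 (mul_ne_zero two_ne_zero h0)), y3 τ hτ]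
      have e1 := wdef τ hτ
      have e2 := fact τ hτ
      simp only [Pi.sub_apply, Pi.add_apply, Pi.mul_apply]
      linear_combination 2 * D 2 y τ * e1 +
        2 * (D 1 y τ - ((α : ℂ) + 1) / 3) * ((w τ + 2 * τ) * e1 - e2)
    have d1w : ∀ τ ∈ S, D 1 w τ = -w τ ^ 2 - 2 * τ * w τ - 2 * D 1 y τ - ((α : ℂ) + 1) / 3 :=
      fun τ hτ => D_succ_eq_of_hasDerivAt hS (fun t _ => D_zero_apply w t) w1 hτ
    have d2w : ∀ τ ∈ S, D 2 w τ = -2 * w τ * D 1 w τ - 2 * w τ - 2 * τ * D 1 w τ - 2 * D 2 y τ :=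
      fun τ hτ => D_succ_eq_of_hasDerivAt hS d1w (h := fun τ => -2 * w τ * D 1 w τ - 2 * w τ -
        2 * τ * D 1 w τ - 2 * D 2 y τ) (fun t ht => by
          have dw := w1 t ht
          rw [← d1w t ht] at dw
          refine (((((dw.pow 2).neg).sub (((hid t).const_mul 2).mul dw)).sub
            ((y1 t ht).const_mul 2)).sub_const _).congr_deriv ?_
          push_cast
          ring) hτ
    have cy : ContDiffOn ℝ (2:ℕ) (D 1 y) S := by
      refine contDiffOn_succ_of_hasDerivAt hS y1 (contDiffOn_succ_of_hasDerivAt hS (n := 0) y2 ?_)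
      refine ContDiffOn.congr (f := fun τ : ℝ => -6 * D 1 y τ ^ 2 + 4 * τ * (τ * D 1 y τ - y τ) +
        2 / 3 * ((α : ℂ) ^ 2 - α + 1)) ?_ y3
      have c0 : ContDiffOn ℝ (0:ℕ) y S := hy.of_le (by norm_num)
      have c1 : ContDiffOn ℝ (0:ℕ) (D 1 y) S := contDiffOn_zero.2 fun τ hτ =>
        (y1 τ hτ).continuousAt.continuousWithinAt
      exact ((contDiffOn_const.mul (c1.pow 2)).add ((contDiffOn_const.mul (cid 0)).mul
        (((cid 0).mul c1).sub c0))).add contDiffOn_const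
    have step : ∀ n : ℕ, n ≤ 2 → ContDiffOn ℝ n w S → ContDiffOn ℝ (n + 1 : ℕ) w S := by
      intro n hn cw
      refine contDiffOn_succ_of_hasDerivAt hS w1 ?_
      have c1 : ContDiffOn ℝ n (D 1 y) S := cy.of_le (mod_cast hn)
      exact (((cw.pow 2).neg.sub ((contDiffOn_const.mul (cid n)).mul cw)).sub
        (contDiffOn_const.mul c1)).sub contDiffOn_const
    have cw0 : ContDiffOn ℝ (0:ℕ) w S := contDiffOn_zero.2 fun τ hτ =>
      (w1 τ hτ).continuousAt.continuousWithinAt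
    refine ⟨⟨step 1 (by norm_num) (step 0 (by norm_num) cw0), fun τ hτ => ⟨(hne τ hτ).2.2, ?_⟩⟩,
      fun τ hτ => ?_⟩
    · have hw0 := (hne τ hτ).2.2
      have e1 := wdef τ hτ
      have e2 := fact τ hτ
      refine mul_left_cancel₀ (mul_ne_zero two_ne_zero hw0) ?_
      have hr : ∀ x A B t z : ℂ, z ≠ 0 → 2 * z * (x ^ 2 / (2 * z) + 3 / 2 * z ^ 3 + 4 * t * z ^ 2 +
          2 * (t ^ 2 - A) * z + B / z) =
          x ^ 2 + 3 * z ^ 4 + 8 * t * z ^ 3 + 4 * (t ^ 2 - A) * z ^ 2 + 2 * B := by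
        intro x A B t z hz
        field_simp
        ring
      rw [hr _ _ _ _ _ hw0, d2w τ hτ, d1w τ hτ]
      push_cast
      linear_combination -2 * (e2 - w τ * e1)
    · have hw0 := (hne τ hτ).2.2
      have e1 := wdef τ hτ
      have e2 := fact τ hτ
      refine mul_left_cancel₀ (mul_ne_zero (by norm_num : (8:ℂ) ≠ 0) hw0) ?_
      have hr : ∀ x y z : ℂ, z ≠ 0 → 8 * z * (x + y / (8 * z)) = 8 * z * x + y := by
        intro x y z hz
        field_simp
      unfold painleveToChazy
      rw [hr _ _ _ hw0, d1w τ hτ]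
      linear_combination 2 * (e2 + w τ * e1)
  · rintro w ⟨cw, hw⟩
    have w0 : ∀ τ ∈ S, HasDerivAt w (D 1 w τ) τ := fun τ hτ => by
      have := hasDerivAt_D_of_contDiffOn hS cw (k := 0) (by norm_num) hτ
      rwa [D_zero] at this
    have w1 : ∀ τ ∈ S, HasDerivAt (D 1 w) (D 2 w τ) τ := fun τ hτ =>
      hasDerivAt_D_of_contDiffOn hS cw (k := 1) (by norm_num) hτ
    set a : ℝ → ℂ := fun τ => -(D 1 w τ + w τ ^ 2 + 2 * τ * w τ + ((α : ℂ) + 1) / 3) / 2 with ha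
    set b : ℝ → ℂ := fun τ => w τ * (a τ - ((α : ℂ) + 1) / 3) -
      (a τ - (1 - 2 * (α : ℂ)) / 3) * (a τ - ((α : ℂ) - 2) / 3) * (w τ)⁻¹ with hb
    set y := painleveToChazy α w with hy
    have da : ∀ τ ∈ S, HasDerivAt a (b τ) τ := fun τ hτ => by
      obtain ⟨hw0, hP⟩ := hw τ hτ
      refine (((((w1 τ hτ).add ((w0 τ hτ).pow 2)).add (((hid τ).const_mul 2).mul
        (w0 τ hτ))).add_const _).neg.div_const 2).congr_deriv ?_
      rw [hP]
      simp only [hb, ha]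
      push_cast
      field_simp
      ring
    have dy : ∀ τ ∈ S, HasDerivAt y (a τ) τ := fun τ hτ => by
      obtain ⟨hw0, hP⟩ := hw τ hτ
      have dG := ((((w0 τ hτ).pow 2).add (((hid τ).const_mul 2).mul (w0 τ hτ))).add_const
        (1:ℂ)).sub_const (α : ℂ)
      refine ((((hid τ).const_mul ((1 - 2 * (α : ℂ)) / 3)).sub ((w0 τ hτ).const_mul
        ((α : ℂ) / 2))).add ((((w1 τ hτ).pow 2).sub (dG.pow 2)).div ((w0 τ hτ).const_mul 8)
        (mul_ne_zero (by norm_num) hw0))).congr_deriv ?_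
      rw [hP]
      simp only [ha, Pi.sub_apply, Pi.add_apply, Pi.mul_apply, Pi.pow_apply]
      push_cast
      field_simp
      ring
    have d1 : ∀ τ ∈ S, D 1 y τ = a τ := fun τ hτ =>
      D_succ_eq_of_hasDerivAt hS (fun t _ => D_zero_apply y t) dy hτ
    have d2 : ∀ τ ∈ S, D 2 y τ = b τ := fun τ hτ => D_succ_eq_of_hasDerivAt hS d1 da hτ
    have c0 : ContDiffOn ℝ (1:ℕ) w S := cw.of_le (by norm_num)
    have c1 : ContDiffOn ℝ (1:ℕ) (D 1 w) S := by
      have := (contDiffOn_succ_iff_deriv_of_isOpen (n := 1) hS).1 cw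
      have e : D 1 w = deriv w := by rw [D_succ 0, D_zero]
      rw [e]; exact this.2.2
    have ca : ContDiffOn ℝ (1:ℕ) a S :=
      (((c1.add (c0.pow 2)).add ((contDiffOn_const.mul (cid 1)).mul c0)).add
        contDiffOn_const).neg.div_const 2
    have cb : ContDiffOn ℝ (1:ℕ) b S :=
      (c0.mul (ca.sub contDiffOn_const)).sub (((ca.sub contDiffOn_const).mul
        (ca.sub contDiffOn_const)).mul (c0.inv fun τ hτ => (hw τ hτ).1))
    refine ⟨⟨contDiffOn_succ_of_hasDerivAt hS dy (contDiffOn_succ_of_hasDerivAt hS da cb),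
      fun τ hτ => ?_⟩, fun τ hτ hne => ?_⟩
    · obtain ⟨hw0, -⟩ := hw τ hτ
      unfold ChazySecondAt
      rw [d1 τ hτ, d2 τ hτ]
      simp only [hy, painleveToChazy, hb, ha]
      field_simp
      ring
    · obtain ⟨hw0, -⟩ := hw τ hτ
      rw [d1 τ hτ] at hne
      have h0 := sub_ne_zero.2 hne
      unfold chazyToPainleve
      rw [d1 τ hτ, d2 τ hτ, div_eq_iff (mul_ne_zero two_ne_zero h0)]
      simp only [hy, painleveToChazy, hb, ha]
      field_simp
      ring

/-! ## The Boussinesq equation -/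

section Curry
variable {u v : ℝ → ℝ → ℝ → ℂ} {e p : Param}

/-- A function of three parameters as a function of the parameter triple. -/
abbrev unc (u : ℝ → ℝ → ℝ → ℂ) (p : Param) : ℂ := u p.1 p.2.1 p.2.2

lemma pd_add {g h : Param → ℂ} (hg : Smooth g) (hh : Smooth h) (hp : p ∈ Adm) (he : IsDir e) :
    pd e (fun q => g q + h q) p = pd e g p + pd e h p :=
  ((hg.hasPd hp).add (hh.hasPd hp)).pd_eq (hg.add hh) hp he

lemma pd_sub {g h : Param → ℂ} (hg : Smooth g) (hh : Smooth h) (hp : p ∈ Adm) (he : IsDir e) :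
    pd e (fun q => g q - h q) p = pd e g p - pd e h p :=
  ((hg.hasPd hp).sub (hh.hasPd hp)).pd_eq (hg.sub hh) hp he

lemma pd_const_mul (c : ℂ) {g : Param → ℂ} (hg : Smooth g) (hp : p ∈ Adm) (he : IsDir e) :
    pd e (fun q => c * g q) p = c * pd e g p :=
  ((hg.hasPd hp).const_mul c).pd_eq (contDiffOn_const.mul hg) hp he

lemma D_eq_pd (hu : Smooth (unc u)) (k : ℕ) {ρ σ τ : ℝ} (hp : (ρ, σ, τ) ∈ Adm) :
    D k (u ρ σ) τ = (pd dirTau)^[k] (unc u) (ρ, σ, τ) :=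
  Smooth.iteratedDeriv_tau (g := unc u) hu k hp

lemma dSigma_eq_pd (hu : Smooth (unc u)) {ρ σ τ : ℝ} (hp : (ρ, σ, τ) ∈ Adm) :
    dSigma u ρ σ τ = pd dirSigma (unc u) (ρ, σ, τ) :=
  (Smooth.hasDerivAt_sigma (g := unc u) hu hp).deriv

lemma dRho_eq_pd (hu : Smooth (unc u)) {ρ σ τ : ℝ} (hp : (ρ, σ, τ) ∈ Adm) :
    dRho u ρ σ τ = pd dirRho (unc u) (ρ, σ, τ) := by
  have hρ : ρ ≤ 0 := by rcases hp with h | ⟨h, -⟩ <;> [exact le_of_lt h; exact le_of_eq h]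
  exact (Smooth.hasDerivWithinAt_rho (g := unc u) hu hp).derivWithin (uniqueDiffOn_Iic (0:ℝ) ρ hρ)

lemma contDiff_slice (hu : Smooth (unc u)) {ρ σ : ℝ} (h : Admissible ρ σ) :
    ContDiff ℝ ∞ (u ρ σ) := by
  have h1 : ContDiff ℝ ∞ fun t : ℝ => ((ρ, σ, t) : Param) :=
    contDiff_const.prodMk (contDiff_const.prodMk contDiff_id)
  have h2 : ContDiff ℝ ∞ (unc u ∘ fun t : ℝ => ((ρ, σ, t) : Param)) :=
    ContDiffOn.comp_contDiff (𝕜 := ℝ) (g := unc u) hu h1 fun t => h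
  exact h2

lemma isDir_tau : IsDir dirTau := .inr (.inr rfl)
lemma isDir_sigma : IsDir dirSigma := Or.inr (Or.inl rfl)
lemma isDir_rho : IsDir dirRho := Or.inl rfl

lemma boussinesqAt_of_firstFlow (hu : Smooth (unc u)) (hv : Smooth (unc v))
    (h : ∀ ρ σ τ : ℝ, Admissible ρ σ → FirstFlowAt u v ρ σ τ) {ρ σ τ : ℝ} (ha : Admissible ρ σ) :
    BoussinesqAt u ρ σ τ := by
  have hp : ((ρ, σ, τ) : Param) ∈ Adm := ha
  set t : (Param → ℂ) → Param → ℂ := pd dirTau with ht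
  set s : (Param → ℂ) → Param → ℂ := pd dirSigma with hs
  set U := unc u
  set W := unc v
  have f1 : ∀ q ∈ Adm, s U q = t (t U) q - 2 * t W q := by
    rintro ⟨ρ, σ, τ⟩ hq
    have := (h ρ σ τ hq).1
    rw [dSigma_eq_pd hu hq, D_eq_pd hu 2 hq, D_eq_pd hv 1 hq] at this
    exact this
  have f2 : ∀ q ∈ Adm, s W q = -t (t W) q + 2 / 3 * t (t (t U)) q + 2 / 3 * (U q * t U q) := by
    rintro ⟨ρ, σ, τ⟩ hq
    have := (h ρ σ τ hq).2
    rw [dSigma_eq_pd hv hq, D_eq_pd hv 2 hq, D_eq_pd hu 3 hq, D_eq_pd hu 1 hq] at this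
    rw [← mul_assoc]
    exact this
  have tU := hu.pd dirTau
  have ttU := tU.pd dirTau
  have tttU := ttU.pd dirTau
  have tW := hv.pd dirTau
  have ttW := tW.pd dirTau
  have sU := hu.pd dirSigma
  have hUU : Smooth fun q => U q * t U q := hu.mul tU
  -- the `τ`-derivatives of the flows
  have g1 : ∀ q ∈ Adm, t (s U) q = t (t (t U)) q - 2 * t (t W) q := fun q hq => by
    rw [ht, pd_congr (e := dirTau) f1 hq, pd_sub ttU (contDiffOn_const.mul tW) hq isDir_tau,
      pd_const_mul 2 tW hq isDir_tau]
  have g2 : ∀ q ∈ Adm, t (t (s U)) q = t (t (t (t U))) q - 2 * t (t (t W)) q := fun q hq => by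
    rw [ht, pd_congr (e := dirTau) g1 hq, pd_sub tttU (contDiffOn_const.mul ttW) hq isDir_tau,
      pd_const_mul 2 ttW hq isDir_tau]
  have g3 : ∀ q ∈ Adm, t (s W) q = -t (t (t W)) q + 2 / 3 * t (t (t (t U))) q +
      2 / 3 * t (fun q => U q * t U q) q := fun q hq => by
    rw [ht, pd_congr (e := dirTau) f2 hq, pd_add ((ttW.neg).add (contDiffOn_const.mul tttU))
      (contDiffOn_const.mul hUU) hq isDir_tau, pd_add ttW.neg (contDiffOn_const.mul tttU) hq isDir_tau,
      pd_const_mul _ tttU hq isDir_tau, pd_const_mul _ hUU hq isDir_tau]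
    congr 2
    exact ((ttW.hasPd hq).neg).pd_eq ttW.neg hq isDir_tau
  have g4 : s (s U) (ρ, σ, τ) = t (t (s U)) (ρ, σ, τ) - 2 * t (s W) (ρ, σ, τ) := by
    rw [hs, pd_congr (e := dirSigma) f1 hp, pd_sub ttU (contDiffOn_const.mul tW) hp isDir_sigma,
      pd_const_mul 2 tW hp isDir_sigma]
    congr 1
    · rw [ht, pd_comm tU hp]
      exact pd_congr (fun q hq => pd_comm hu hq) hp
    · rw [ht, pd_comm hv hp]
  have e1 : dSigma (dSigma u) ρ σ τ = s (s U) (ρ, σ, τ) := by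
    have h1 := (Smooth.hasDerivAt_sigma sU hp).deriv
    rw [hs, ← h1]
    refine Filter.EventuallyEq.deriv_eq ?_
    filter_upwards [eventually_sigma ha] with x hx using dSigma_eq_pd hu hx
  have e2 : D 1 (fun x => u ρ σ x * D 1 (u ρ σ) x) τ = t (fun q => U q * t U q) (ρ, σ, τ) := by
    have : (fun x => u ρ σ x * D 1 (u ρ σ) x) = fun x => (fun q => U q * t U q) (ρ, σ, x) := by
      funext x
      rw [D_eq_pd hu 1 (show ((ρ, σ, x) : Param) ∈ Adm from ha)]
      rfl
    rw [this]
    exact Smooth.iteratedDeriv_tau hUU 1 hp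
  unfold BoussinesqAt
  rw [e1, e2, D_eq_pd hu 4 hp, g4, g2 _ hp, g3 _ hp]
  change _ = -(1 / 3) * t (t (t (t U))) (ρ, σ, τ) - _
  ring

end Curry

/-! ## Conjugation of linear pencils -/

section Conjugation
variable {A : Type*} [NormedRing A] [NormedAlgebra ℂ A]

lemma ExpandsTo.tendsto_smul {f : ℂ → A} {m : A} (h : ExpandsTo f 0 m) :
    Tendsto (fun ξ => ξ • f ξ) (cobounded ℂ) (𝓝 m) := by
  have h1 : (fun ξ : ℂ => ξ • (f ξ - 0 - ξ⁻¹ • m)) =O[cobounded ℂ]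
      fun ξ : ℂ => ξ • (ξ ^ 2)⁻¹ := (isBigO_refl _ _).smul h
  have h2 : Tendsto (fun ξ : ℂ => ξ • (ξ ^ 2)⁻¹) (cobounded ℂ) (𝓝 0) := by
    refine tendsto_inv_cobounded.congr' ?_
    filter_upwards [eventually_ne_zero_cobounded] with ξ hξ
    rw [smul_eq_mul]; field_simp
  have h3 := (h1.trans_tendsto h2).add_const m
  rw [zero_add] at h3
  refine h3.congr' ?_
  filter_upwards [eventually_ne_zero_cobounded] with ξ hξ
  rw [sub_zero, smul_sub, smul_smul, mul_inv_cancel₀ hξ, one_smul, sub_add_cancel]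

lemma ExpandsTo.tendsto_pencil_mul {f : ℂ → A} {m : A} (h : ExpandsTo f 0 m) (N N₀ : A) :
    Tendsto (fun ξ => (ξ • N + N₀) * f ξ) (cobounded ℂ) (𝓝 (N * m)) := by
  have h1 := (h.tendsto_smul.const_mul N).add (h.tendsto.const_mul N₀)
  rw [mul_zero, add_zero] at h1
  refine h1.congr fun ξ => ?_
  rw [add_mul, smul_mul_assoc, mul_smul_comm]

lemma ExpandsTo.tendsto_mul_pencil {f : ℂ → A} {m : A} (h : ExpandsTo f 0 m) (N N₀ : A) :
    Tendsto (fun ξ => f ξ * (ξ • N + N₀)) (cobounded ℂ) (𝓝 (m * N)) := by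
  have h1 := (h.tendsto_smul.mul_const N).add (h.tendsto.mul_const N₀)
  rw [zero_mul, add_zero] at h1
  refine h1.congr fun ξ => ?_
  rw [mul_add, smul_mul_assoc, mul_smul_comm]

/-- The polynomial part of a conjugated linear pencil. -/
lemma ExpandsTo.tendsto_conj {F G : ℂ → A} {M : A} (hF : ExpandsTo F 1 M)
    (hFG : ∀ᶠ ξ in cobounded ℂ, F ξ * G ξ = 1)
    (hG : Tendsto G (cobounded ℂ) (𝓝 1)) (N N₀ : A) :
    Tendsto (fun ξ => F ξ * (ξ • N + N₀) * G ξ - (ξ • N + N₀ + (M * N - N * M)))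
      (cobounded ℂ) (𝓝 0) := by
  have hR : ExpandsTo (fun ξ => F ξ - 1 - ξ⁻¹ • M) 0 0 := by
    refine IsBigO.congr_left hF fun ξ => ?_
    simp
  set R : ℂ → A := fun ξ => F ξ - 1 - ξ⁻¹ • M with hRdef
  set c := M * N - N * M with hc
  have t1 := (hR.tendsto_mul_pencil N N₀).sub (hR.tendsto_pencil_mul N (N₀ + c))
  have t2 : Tendsto (fun ξ : ℂ => ξ⁻¹ • (M * N₀ - N₀ * M - c * M)) (cobounded ℂ) (𝓝 0) := by
    have := tendsto_inv_cobounded.smul_const (M * N₀ - N₀ * M - c * M)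
    rwa [zero_smul] at this
  have t3 := (t1.add t2).mul hG
  simp only [zero_mul, mul_zero, sub_zero, add_zero] at t3
  refine t3.congr' ?_
  filter_upwards [hFG, eventually_ne_zero_cobounded] with ξ h1 hξ
  have hFe : F ξ = 1 + ξ⁻¹ • M + R ξ := by simp only [hRdef]; abel
  have h2 : R ξ * (ξ • N + N₀) - (ξ • N + (N₀ + c)) * R ξ + ξ⁻¹ • (M * N₀ - N₀ * M - c * M) =
      F ξ * (ξ • N + N₀) - (ξ • N + N₀ + c) * F ξ := by
    rw [hFe]
    simp only [add_mul, mul_add, one_mul, mul_one, smul_mul_assoc, mul_smul_comm, smul_add,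
      smul_sub, smul_inv_smul₀ hξ, inv_smul_smul₀ hξ, hc]
    abel
  rw [h2, sub_mul, mul_assoc (ξ • N + N₀ + c), h1, mul_one]

end Conjugation

/-! ## The linear system for the solution of the Riemann-Hilbert problem -/

def unit31 : Mat3 := !![0, 0, 0; 0, 0, 0; 1, 0, 0]
def shift2 : Mat3 := !![0, 0, 0; 1, 0, 0; 0, 1, 0]

lemma Kmat_eq (ξ : ℂ) : Kmat ξ = ξ • unit31 + Kmat 0 := by
  ext i j; fin_cases i <;> fin_cases j <;> simp [Kmat, unit31]

lemma Kmat_sq_eq (ξ : ℂ) : Kmat ξ ^ 2 = ξ • shift2 + Kmat 0 ^ 2 := by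
  rw [sq, sq]
  ext i j; fin_cases i <;> fin_cases j <;> simp [Kmat, shift2]

lemma Kmat_cube (ξ : ℂ) : Kmat ξ * Kmat ξ ^ 2 = ξ • (1 : Mat3) := by
  rw [sq]
  ext i j; fin_cases i <;> fin_cases j <;> simp [Kmat]

lemma phaseMat_tau (ξ : ℂ) : phaseMat dirTau ξ = Kmat ξ := by simp [phaseMat]
lemma phaseMat_sigma (ξ : ℂ) : phaseMat dirSigma ξ = Kmat ξ ^ 2 := by simp [phaseMat]
lemma phaseMat_rho (ξ : ℂ) : phaseMat dirRho ξ = ξ • Kmat ξ := by simp [phaseMat]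

def laxA (M : Mat3) (ξ : ℂ) : Mat3 := ξ • unit31 + (Kmat 0 + (M * unit31 - unit31 * M))
def laxB (M : Mat3) (ξ : ℂ) : Mat3 := ξ • shift2 + (Kmat 0 ^ 2 + (M * shift2 - shift2 * M))

lemma differentiable_pencil (N N₀ : Mat3) : Differentiable ℂ fun ξ : ℂ => ξ • N + N₀ :=
  (differentiable_id.smul_const N).add_const N₀

section Lax
variable {γ α : ℝ} {Φ : Param → ℂ → Mat3} {M : Param → Mat3} {p : Param}

lemma smooth_solution (hΦ : Family γ α Φ) {ξ : ℂ} (hξ : ξ ∈ contourᶜ) : Smooth fun p => Φ p ξ := by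
  intro p₀ hp₀
  obtain ⟨Z, hZ, hZ0, hev⟩ := exists_local_family hΦ hp₀
    (show 1 ≤ ‖ξ‖ + 1 by linarith [norm_nonneg ξ])
  have h1 : ContDiffWithinAt ℝ ∞ (fun p => cauchyOp (Z p)) Adm p₀ :=
    (cauchyOp (E := Mat3)).contDiff.comp_contDiffWithinAt hZ
  have h2 : ContDiffWithinAt ℝ ∞ (fun p => cauchyOp (Z p) ξ) Adm p₀ :=
    (BoundedContinuousFunction.evalCLM (β := Mat3) ℝ ξ).contDiff.comp_contDiffWithinAt h1
  have h3 : ContDiffWithinAt ℝ ∞ (fun p => (1 + cauchyOp (Z p) ξ) * Φ p₀ ξ) Adm p₀ :=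
    (contDiffWithinAt_const.add h2).mul contDiffWithinAt_const
  refine h3.congr_of_eventuallyEq (hev.mono fun p h => h.2.1 ξ hξ (by linarith)) ?_
  simp [hZ0]

lemma exists_logDeriv_pd (hΦ : Family γ α Φ) (hM : Moments γ α Φ M) (hp : p ∈ Adm) {e : Param}
    (he : IsDir e) : ∃ Y : ℂ → Mat3, Differentiable ℂ Y ∧
      (∀ ξ ∈ contourᶜ, pd e (fun q => Φ q ξ) p = Y ξ * Φ p ξ) ∧
      ExpandsTo (fun ξ => Y ξ + smoothF γ α p (Φ p) ξ * phaseMat e ξ *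
        (smoothF γ α p (Φ p) ξ)⁻¹) 0 (pd e M p) := by
  obtain ⟨Y, M', hY, h1, h2, h3⟩ := exists_logDeriv hΦ hM hp (e := e) (T := segAt p e)
    (fun t ht => ht) (uniqueDiffWithinAt_segAt hp he)
  refine ⟨Y, hY, fun ξ hξ => ?_, ?_⟩
  · exact HasPd.pd_eq (h2 ξ hξ) (smooth_solution hΦ hξ) hp he
  · rw [HasPd.pd_eq h1 (contDiffOn_moment hΦ hM) hp he]; exact h3

lemma tendsto_smoothF_inv (h : Solves γ α p (Φ p)) (hp : p ∈ Adm) :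
    Tendsto (fun ξ => (smoothF γ α p (Φ p) ξ)⁻¹) (cobounded ℂ) (𝓝 1) := by
  have := tendsto_mat_inv (by rw [Matrix.det_one]; exact one_ne_zero) (tendsto_smoothF h hp)
  rw [inv_one] at this
  exact this

lemma eventually_smoothF_mul_inv (h : Solves γ α p (Φ p)) :
    ∀ᶠ ξ in cobounded ℂ, smoothF γ α p (Φ p) ξ * (smoothF γ α p (Φ p) ξ)⁻¹ = 1 :=
  eventually_ne_zero_cobounded.mono fun _ hξ => smoothF_mul_inv h hξ

/-- The conjugate of `K` by the regularized solution. -/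
def conjK (γ α : ℝ) (p : Param) (Φ₀ : ℂ → Mat3) (n : ℕ) (ξ : ℂ) : Mat3 :=
  smoothF γ α p Φ₀ ξ * Kmat ξ ^ n * (smoothF γ α p Φ₀ ξ)⁻¹

lemma lax_tau (hΦ : Family γ α Φ) (hM : Moments γ α Φ M) (hp : p ∈ Adm) :
    (∀ ξ ∈ contourᶜ, pd dirTau (fun q => Φ q ξ) p = -(laxA (M p) ξ * Φ p ξ)) ∧
      ExpandsTo (fun ξ => conjK γ α p (Φ p) 1 ξ - laxA (M p) ξ) 0 (pd dirTau M p) := by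
  obtain ⟨Y, hY, h1, h2⟩ := exists_logDeriv_pd hΦ hM hp isDir_tau
  have hc := (hM p hp).tendsto_conj (eventually_smoothF_mul_inv (hΦ p hp))
    (tendsto_smoothF_inv (hΦ p hp) hp) unit31 (Kmat 0)
  have hz : ∀ ξ, Y ξ + laxA (M p) ξ = 0 := by
    refine eq_zero_of_entire_of_tendsto (hY.add (differentiable_pencil _ _)) ?_
    have := h2.tendsto.sub hc
    rw [sub_zero] at this
    refine this.congr fun ξ => ?_
    rw [phaseMat_tau, ← Kmat_eq, laxA, Kmat_eq ξ]
    abel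
  have hY' : ∀ ξ, Y ξ = -laxA (M p) ξ := fun ξ => eq_neg_of_add_eq_zero_left (hz ξ)
  refine ⟨fun ξ hξ => by rw [h1 ξ hξ, hY', neg_mul], h2.congr (Eventually.of_forall fun ξ => ?_)⟩
  simp only [hY', phaseMat_tau, conjK, pow_one]
  abel

lemma lax_sigma (hΦ : Family γ α Φ) (hM : Moments γ α Φ M) (hp : p ∈ Adm) :
    (∀ ξ ∈ contourᶜ, pd dirSigma (fun q => Φ q ξ) p = -(laxB (M p) ξ * Φ p ξ)) ∧
      ExpandsTo (fun ξ => conjK γ α p (Φ p) 2 ξ - laxB (M p) ξ) 0 (pd dirSigma M p) := by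
  obtain ⟨Y, hY, h1, h2⟩ := exists_logDeriv_pd hΦ hM hp isDir_sigma
  have hc := (hM p hp).tendsto_conj (eventually_smoothF_mul_inv (hΦ p hp))
    (tendsto_smoothF_inv (hΦ p hp) hp) shift2 (Kmat 0 ^ 2)
  have hz : ∀ ξ, Y ξ + laxB (M p) ξ = 0 := by
    refine eq_zero_of_entire_of_tendsto (hY.add (differentiable_pencil _ _)) ?_
    have := h2.tendsto.sub hc
    rw [sub_zero] at this
    refine this.congr fun ξ => ?_
    rw [phaseMat_sigma, ← Kmat_sq_eq, laxB, Kmat_sq_eq ξ]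
    abel
  have hY' : ∀ ξ, Y ξ = -laxB (M p) ξ := fun ξ => eq_neg_of_add_eq_zero_left (hz ξ)
  refine ⟨fun ξ hξ => by rw [h1 ξ hξ, hY', neg_mul], h2.congr (Eventually.of_forall fun ξ => ?_)⟩
  simp only [hY', phaseMat_sigma, conjK]
  abel

lemma lax_rho (hΦ : Family γ α Φ) (hM : Moments γ α Φ M) (hp : p ∈ Adm) {ξ : ℂ}
    (hξ : ξ ∈ contourᶜ) : pd dirRho (fun q => Φ q ξ) p =
      -((ξ • laxA (M p) ξ + pd dirTau M p) * Φ p ξ) := by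
  obtain ⟨Y, hY, h1, h2⟩ := exists_logDeriv_pd hΦ hM hp isDir_rho
  have ha := (lax_tau hΦ hM hp).2.tendsto_smul
  have hz : ∀ ξ, Y ξ + (ξ • laxA (M p) ξ + pd dirTau M p) = 0 := by
    refine eq_zero_of_entire_of_tendsto (hY.add ((differentiable_id.smul
      (differentiable_pencil _ _)).add_const _)) ?_
    have := h2.tendsto.sub (ha.sub_const (pd dirTau M p))
    rw [sub_self, sub_zero] at this
    refine this.congr fun ξ => ?_
    simp only [phaseMat_rho, conjK, pow_one, smul_sub, Matrix.mul_smul, Matrix.smul_mul]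
    abel
  rw [h1 ξ hξ, eq_neg_of_add_eq_zero_left (hz ξ), neg_mul]

lemma conjK_mul (h : Solves γ α p (Φ p)) (m n : ℕ) {ξ : ℂ} (hξ : ξ ≠ 0) :
    conjK γ α p (Φ p) m ξ * conjK γ α p (Φ p) n ξ = conjK γ α p (Φ p) (m + n) ξ := by
  have hF := smoothF_inv_mul h hξ
  unfold conjK
  rw [pow_add]
  set F := smoothF γ α p (Φ p) ξ
  calc F * Kmat ξ ^ m * F⁻¹ * (F * Kmat ξ ^ n * F⁻¹) =
      F * Kmat ξ ^ m * (F⁻¹ * F) * Kmat ξ ^ n * F⁻¹ := by noncomm_ring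
    _ = _ := by rw [hF]; noncomm_ring

lemma moment_relation_sq (hΦ : Family γ α Φ) (hM : Moments γ α Φ M) (hp : p ∈ Adm) (ξ : ℂ) :
    laxA (M p) ξ * laxA (M p) ξ + (unit31 * pd dirTau M p + pd dirTau M p * unit31) =
      laxB (M p) ξ := by
  have ha := (lax_tau hΦ hM hp).2
  have hb := (lax_sigma hΦ hM hp).2
  have hA : Differentiable ℂ (laxA (M p)) := differentiable_pencil _ _
  have hB : Differentiable ℂ (laxB (M p)) := differentiable_pencil _ _
  refine sub_eq_zero.1 (eq_zero_of_entire_of_tendsto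
    (f := fun ξ => laxA (M p) ξ * laxA (M p) ξ + (unit31 * pd dirTau M p + pd dirTau M p * unit31) -
      laxB (M p) ξ) (((hA.mul hA).add_const _).sub hB) ?_ ξ)
  have t1 := ha.tendsto_pencil_mul unit31 (Kmat 0 + (M p * unit31 - unit31 * M p))
  have t2 := ha.tendsto_mul_pencil unit31 (Kmat 0 + (M p * unit31 - unit31 * M p))
  have t3 := ha.tendsto.mul ha.tendsto
  have t := (hb.tendsto.sub ((t1.add t2).sub_const
    (unit31 * pd dirTau M p + pd dirTau M p * unit31))).sub t3
  rw [sub_self, mul_zero, sub_zero, sub_zero] at t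
  refine t.congr' ?_
  filter_upwards [eventually_ne_zero_cobounded] with ξ hξ
  have e := conjK_mul (hΦ p hp) 1 1 hξ
  rw [← e]
  change _ - (laxA (M p) ξ * _ + _ * laxA (M p) ξ - _) - _ = _
  noncomm_ring

lemma moment_relation_cube (hΦ : Family γ α Φ) (hM : Moments γ α Φ M) (hp : p ∈ Adm) (ξ : ℂ) :
    laxA (M p) ξ * laxB (M p) ξ + (unit31 * pd dirSigma M p + pd dirTau M p * shift2) =
      ξ • (1 : Mat3) := by
  have ha := (lax_tau hΦ hM hp).2
  have hb := (lax_sigma hΦ hM hp).2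
  have hA : Differentiable ℂ (laxA (M p)) := differentiable_pencil _ _
  have hB : Differentiable ℂ (laxB (M p)) := differentiable_pencil _ _
  refine sub_eq_zero.1 (eq_zero_of_entire_of_tendsto
    (f := fun ξ => laxA (M p) ξ * laxB (M p) ξ + (unit31 * pd dirSigma M p + pd dirTau M p * shift2) -
      ξ • (1 : Mat3)) (((hA.mul hB).add_const _).sub (differentiable_id.smul_const _)) ?_ ξ)
  have t1 := hb.tendsto_pencil_mul unit31 (Kmat 0 + (M p * unit31 - unit31 * M p))
  have t2 := ha.tendsto_mul_pencil shift2 (Kmat 0 ^ 2 + (M p * shift2 - shift2 * M p))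
  have t3 := ha.tendsto.mul hb.tendsto
  have t := (((t1.add t2).sub_const (unit31 * pd dirSigma M p + pd dirTau M p * shift2)).neg).sub t3
  rw [sub_self, mul_zero, sub_zero, neg_zero] at t
  refine t.congr' ?_
  filter_upwards [eventually_ne_zero_cobounded] with ξ hξ
  have e := conjK_mul (hΦ p hp) 1 2 hξ
  have e' : conjK γ α p (Φ p) (1 + 2) ξ = ξ • (1 : Mat3) := by
    rw [conjK, pow_add, pow_one, Kmat_cube, Matrix.mul_smul, mul_one, Matrix.smul_mul,
      smoothF_mul_inv (hΦ p hp) hξ]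
  rw [← e', ← e]
  change -(laxA (M p) ξ * _ + _ * laxB (M p) ξ - _) - _ = _
  noncomm_ring

lemma trace_pd_moment (hΦ : Family γ α Φ) (hM : Moments γ α Φ M) (hp : p ∈ Adm) :
    (pd dirTau M p).trace = 0 := by
  have ha := (lax_tau hΦ hM hp).2.tendsto_smul
  have hc : Continuous fun X : Mat3 => X.trace := continuous_id.matrix_trace
  have h1 := (hc.tendsto _).comp ha
  refine tendsto_nhds_unique h1 (tendsto_const_nhds.congr' ?_)
  filter_upwards [eventually_ne_zero_cobounded] with ξ hξ
  have e1 : (conjK γ α p (Φ p) 1 ξ).trace = 0 := by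
    rw [conjK, Matrix.trace_mul_comm, ← mul_assoc, smoothF_inv_mul (hΦ p hp) hξ, one_mul, pow_one]
    simp [Kmat, Matrix.trace, Fin.sum_univ_three]
  have e2 : (laxA (M p) ξ).trace = 0 := by
    rw [laxA, Matrix.trace_add, Matrix.trace_add, Matrix.trace_sub, Matrix.trace_mul_comm, sub_self]
    simp [Kmat, unit31, Matrix.trace, Fin.sum_univ_three]
  simp [Matrix.trace_smul, Matrix.trace_sub, e1, e2]

end Lax

/-! ## The Lax matrices are determined by their first rows -/

section Rows
variable {U V : ℝ → ℂ} {ξ : ℂ} {y : ℝ → Mat3}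

lemma mul_Ahat_sub (Y : Mat3) (U V : ℝ → ℂ) (t : ℝ) (ξ : ℂ) (j : Fin 3) :
    (Y * Ahat U V t ξ - Ahat U V t ξ * Y) 0 j =
        ![Y 0 2 * (ξ + V t), Y 0 0 - Y 0 2 * U t, Y 0 1] j - Y 1 j ∧
      (Y * Ahat U V t ξ - Ahat U V t ξ * Y) 1 j =
        ![Y 1 2 * (ξ + V t), Y 1 0 - Y 1 2 * U t, Y 1 1] j - Y 2 j := by
  constructor <;> fin_cases j <;>
    simp [Ahat, Matrix.vecMul, dotProduct, Fin.sum_univ_three, Matrix.mul_apply, sub_eq_add_neg]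

lemma eq_Bhat_of_row (hU : ContDiff ℝ ∞ U) (hV : ContDiff ℝ ∞ V)
    (hy : ∀ t i j, i ≠ 2 → HasDerivAt (fun s => y s i j)
      ((y t * Ahat U V t ξ - Ahat U V t ξ * y t) i j) t)
    (h0 : ∀ t j, y t 0 j = Bhat U V t ξ 0 j) (t : ℝ) : y t = Bhat U V t ξ := by
  have h1 : ∀ t j, y t 1 j = Bhat U V t ξ 1 j := fun t j => by
    have e := hy t 0 j (by decide)
    rw [show (fun s => y s 0 j) = _ from funext fun s => h0 s j] at e
    have := e.unique (deriv_Bhat hU hV t ξ 0 j)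
    rw [(mul_Ahat_sub _ U V t ξ j).1, h0, h0, h0] at this
    rw [eq_sub_of_add_eq' (eq_add_of_sub_eq this).symm]
    fin_cases j <;> simp [Bhat, -iteratedDeriv_one] <;> ring
  have h2 : ∀ t j, y t 2 j = Bhat U V t ξ 2 j := fun t j => by
    have e := hy t 1 j (by decide)
    rw [show (fun s => y s 1 j) = _ from funext fun s => h1 s j] at e
    have := e.unique (deriv_Bhat hU hV t ξ 1 j)
    rw [(mul_Ahat_sub _ U V t ξ j).2, h1, h1, h1] at this
    rw [eq_sub_of_add_eq' (eq_add_of_sub_eq this).symm]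
    fin_cases j <;> simp [Bhat, -iteratedDeriv_one] <;> ring
  ext i j
  fin_cases i
  exacts [h0 t j, h1 t j, h2 t j]

lemma eq_Chat_of_row (hU : ContDiff ℝ ∞ U) (hV : ContDiff ℝ ∞ V)
    (hy : ∀ t i j, i ≠ 2 → HasDerivAt (fun s => y s i j)
      ((y t * Ahat U V t ξ - Ahat U V t ξ * y t) i j) t)
    (h01 : ∀ t, y t 0 1 = Chat U V t ξ 0 1) (h02 : ∀ t, y t 0 2 = Chat U V t ξ 0 2)
    (htr : ∀ t, (y t).trace = 0) (t : ℝ) : y t = Chat U V t ξ := by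
  have e12 : ∀ t, y t 1 2 = Chat U V t ξ 1 2 := fun t => by
    have e := hy t 0 2 (by decide)
    rw [show (fun s => y s 0 2) = _ from funext h02] at e
    have := e.unique (deriv_Chat hU hV t ξ 0 2)
    rw [(mul_Ahat_sub _ U V t ξ 2).1] at this
    simp [h01, h02, Chat, dChat, -iteratedDeriv_one] at this ⊢
    linear_combination -this
  have h00 : ∀ t, y t 0 0 = Chat U V t ξ 0 0 := fun t => by
    have e := hy t 0 1 (by decide)
    rw [show (fun s => y s 0 1) = _ from funext h01] at e
    have a := e.unique (deriv_Chat hU hV t ξ 0 1)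
    rw [(mul_Ahat_sub _ U V t ξ 1).1] at a
    have e' := hy t 1 2 (by decide)
    rw [show (fun s => y s 1 2) = _ from funext e12] at e'
    have b := e'.unique (deriv_Chat hU hV t ξ 1 2)
    rw [(mul_Ahat_sub _ U V t ξ 2).2] at b
    have c := htr t
    rw [Matrix.trace, Fin.sum_univ_three] at c
    simp [h02, Chat, dChat, c11, -iteratedDeriv_one] at a b c ⊢
    linear_combination (1 / 3) * (c + b + 2 * a)
  have h0 : ∀ t j, y t 0 j = Chat U V t ξ 0 j := fun t j => by
    fin_cases j
    exacts [h00 t, h01 t, h02 t]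
  have h1 : ∀ t j, y t 1 j = Chat U V t ξ 1 j := fun t j => by
    have e := hy t 0 j (by decide)
    rw [show (fun s => y s 0 j) = _ from funext fun s => h0 s j] at e
    have := e.unique (deriv_Chat hU hV t ξ 0 j)
    rw [(mul_Ahat_sub _ U V t ξ j).1, h0, h0, h0] at this
    rw [eq_sub_of_add_eq' (eq_add_of_sub_eq this).symm]
    fin_cases j <;> simp [Chat, dChat, c11, c21, c22, -iteratedDeriv_one] <;> ring
  have h2 : ∀ t j, y t 2 j = Chat U V t ξ 2 j := fun t j => by
    have e := hy t 1 j (by decide)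
    rw [show (fun s => y s 1 j) = _ from funext fun s => h1 s j] at e
    have := e.unique (deriv_Chat hU hV t ξ 1 j)
    rw [(mul_Ahat_sub _ U V t ξ j).2, h1, h1, h1] at this
    rw [eq_sub_of_add_eq' (eq_add_of_sub_eq this).symm]
    fin_cases j <;> simp [Chat, dChat, c21, c22, c31, c32, c33, -iteratedDeriv_one]
    all_goals ring1
  ext i j
  fin_cases i
  exacts [h0 t j, h1 t j, h2 t j]

end Rows

/-! ## The gauge transformation -/

def gaugeInv (M : Mat3) : Mat3 :=
  !![1, 0, 0; -M 0 2, 1, 0; -M 0 2 ^ 2 - 2 * M 1 2 + M 0 1, -M 0 2, 1]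

/-- The derivative of the gauge matrix along a curve with velocity `m`. -/
def gaugeDeriv (M m : Mat3) : Mat3 :=
  m 0 2 • shift2 + (4 * M 0 2 * m 0 2 + 2 * m 1 2 - m 0 1) • unit31

lemma gaugeInv_mul (M : Mat3) : gaugeInv M * gaugeMatrix M = 1 := by
  ext i j
  fin_cases i <;> fin_cases j <;> simp [gaugeInv, gaugeMatrix]
  ring

lemma gaugeMatrix_eq (M : Mat3) : gaugeMatrix M =
    1 + (M 0 2 • shift2 + (2 * M 0 2 * M 0 2 + 2 * M 1 2 - M 0 1) • unit31) := by
  ext i j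
  fin_cases i <;> fin_cases j <;> simp [shift2, unit31, gaugeMatrix]
  ring

lemma det_gaugeMatrix (M : Mat3) : (gaugeMatrix M).det = 1 := by
  rw [Matrix.det_fin_three]; simp [gaugeMatrix]

def gaugeLax (M m X : Mat3) : Mat3 := (gaugeMatrix M * X - gaugeDeriv M m) * gaugeInv M

lemma gaugeLax_mul (M m X : Mat3) :
    gaugeLax M m X * gaugeMatrix M = gaugeMatrix M * X - gaugeDeriv M m := by
  rw [gaugeLax, mul_assoc, gaugeInv_mul, mul_one]

section Smoothness
variable {M G : Param → Mat3} {e p : Param}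

lemma HasPd.entry {d : Mat3} (h : HasPd e G d p) (i j : Fin 3) :
    HasPd e (fun q => G q i j) (d i j) p :=
  ((entryCLM i j).restrictScalars ℝ).hasFDerivAt.comp_hasDerivWithinAt (0:ℝ) h

lemma Smooth.entry (h : Smooth G) (i j : Fin 3) : Smooth fun q => G q i j :=
  ((entryCLM i j).restrictScalars ℝ).contDiff.comp_contDiffOn h

lemma pd_entry (h : Smooth G) (hp : p ∈ Adm) (he : IsDir e) (i j : Fin 3) :
    pd e (fun q => G q i j) p = pd e G p i j :=
  ((h.hasPd hp).entry i j).pd_eq (h.entry i j) hp he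

lemma HasPd.smul_const {g : Param → ℂ} {d : ℂ} (h : HasPd e g d p) (X : Mat3) :
    HasPd e (fun q => g q • X) (d • X) p := HasDerivWithinAt.smul_const h X

lemma HasPd.gaugeMatrix {m : Mat3} (h : HasPd e M m p) :
    HasPd e (fun q => gaugeMatrix (M q)) (gaugeDeriv (M p) m) p := by
  have a := h.entry 0 2
  have b := ((((a.const_mul 2).mul a).add ((h.entry 1 2).const_mul 2)).sub (h.entry 0 1))
  have := (hasPd_const (e := e) (p := p) (1 : Mat3)).add ((a.smul_const shift2).add (b.smul_const unit31))
  simp only [gaugeMatrix_eq]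
  refine HasDerivWithinAt.congr_deriv this ?_
  rw [gaugeDeriv, zero_add]
  congr 2; ring

lemma Smooth.gaugeMatrix (h : Smooth M) : Smooth fun q => gaugeMatrix (M q) := by
  simp only [gaugeMatrix_eq]
  have a := h.entry 0 2
  exact contDiffOn_const.add ((a.smul contDiffOn_const).add
    (((((contDiffOn_const.mul a).mul a).add (contDiffOn_const.mul (h.entry 1 2))).sub
      (h.entry 0 1)).smul contDiffOn_const))

lemma Smooth.gaugeInv (h : Smooth M) : Smooth fun q => gaugeInv (M q) := by
  have e : ∀ X : Mat3, BoussinesqRHP.gaugeInv X =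
      1 + (-X 0 2 • shift2 + (-(X 0 2 * X 0 2) - 2 * X 1 2 + X 0 1) • unit31) := fun X => by
    ext i j
    fin_cases i <;> fin_cases j <;> simp [shift2, unit31, BoussinesqRHP.gaugeInv]
    ring
  simp only [e]
  have a := h.entry 0 2
  exact contDiffOn_const.add ((a.neg.smul contDiffOn_const).add
    ((((a.mul a).neg.sub (contDiffOn_const.mul (h.entry 1 2))).add
      (h.entry 0 1)).smul contDiffOn_const))

lemma Smooth.gaugeLax (h : Smooth M) (hX : Smooth G) :
    Smooth fun q => gaugeLax (M q) (BoussinesqRHP.pd e M q) (G q) := by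
  have h' := h.pd e
  have d : Smooth fun q => gaugeDeriv (M q) (BoussinesqRHP.pd e M q) :=
    ((h'.entry 0 2).smul contDiffOn_const).add
      (((((contDiffOn_const.mul (h.entry 0 2)).mul (h'.entry 0 2)).add
        (contDiffOn_const.mul (h'.entry 1 2))).sub (h'.entry 0 1)).smul contDiffOn_const)
  exact ((h.gaugeMatrix.mul hX).sub d).mul h.gaugeInv

lemma pd_gauge {Ψ X : Param → Mat3} (h : Smooth M) (hΨ : Smooth Ψ) (he : IsDir e) (hp : p ∈ Adm)
    (hX : pd e Ψ p = -(X p * Ψ p)) : pd e (fun q => gaugeMatrix (M q) * Ψ q) p =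
      -(gaugeLax (M p) (pd e M p) (X p) * (gaugeMatrix (M p) * Ψ p)) := by
  have h1 := ((h.hasPd (e := e) hp).gaugeMatrix.mul (hΨ.hasPd hp)).pd_eq
    (h.gaugeMatrix.mul hΨ) hp he
  rw [h1, hX, ← mul_assoc, gaugeLax_mul]
  noncomm_ring

lemma zero_curvature {e' : Param} {Ψ X Y : Param → Mat3} (hΨ : Smooth Ψ) (hX : Smooth X)
    (hY : Smooth Y) (he : IsDir e) (he' : IsDir e')
    (h1 : ∀ q ∈ Adm, pd e Ψ q = -(X q * Ψ q)) (h2 : ∀ q ∈ Adm, pd e' Ψ q = -(Y q * Ψ q))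
    (hp : p ∈ Adm) (hdet : (Ψ p).det ≠ 0) : pd e' X p - pd e Y p = X p * Y p - Y p * X p := by
  have a := ((hX.hasPd (e := e') hp).mul (hΨ.hasPd hp)).neg.pd_eq (hX.mul hΨ).neg hp he'
  have b := ((hY.hasPd (e := e) hp).mul (hΨ.hasPd hp)).neg.pd_eq (hY.mul hΨ).neg hp he
  have c := pd_comm (e := e') (e' := e) hΨ hp
  rw [pd_congr h1 hp, pd_congr h2 hp, a, b, h1 p hp, h2 p hp] at c
  have d : (pd e' X p - pd e Y p - (X p * Y p - Y p * X p)) * Ψ p = 0 := by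
    rw [← sub_eq_zero] at c
    rw [← neg_eq_zero, ← c]; noncomm_ring
  have u : Ψ p * (Ψ p)⁻¹ = 1 := Matrix.mul_nonsing_inv _ (isUnit_iff_ne_zero.2 hdet)
  refine sub_eq_zero.1 ?_
  have := congrArg (· * (Ψ p)⁻¹) d
  simpa only [mul_assoc, u, mul_one, zero_mul] using this

end Smoothness

/-! ## The gauge-transformed Lax system -/

section Flows
variable {γ α : ℝ} {Φ : Param → ℂ → Mat3} {M : Param → Mat3} {p : Param} {ξ : ℂ}

abbrev uFun (M : Param → Mat3) (ρ σ τ : ℝ) : ℂ := uOf (M (ρ, σ, τ))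
abbrev vFun (M : Param → Mat3) (ρ σ τ : ℝ) : ℂ := vOf (M (ρ, σ, τ))

lemma smooth_uFun (h : Smooth M) : Smooth (unc (uFun M)) :=
  contDiffOn_const.mul ((((h.entry 0 2).pow 2).add (h.entry 1 2)).sub (h.entry 0 1))

lemma smooth_vFun (h : Smooth M) : Smooth (unc (vFun M)) :=
  contDiffOn_const.mul ((((((h.entry 0 2).pow 3).sub ((h.entry 0 1).mul (h.entry 0 2))).add
    ((contDiffOn_const.mul (h.entry 0 2)).mul (h.entry 1 2))).sub (h.entry 1 1)).add (h.entry 2 2))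

lemma pd_uFun (h : Smooth M) (hp : p ∈ Adm) {e : Param} (he : IsDir e) : pd e (unc (uFun M)) p =
      -3 * (2 * M p 0 2 * pd e M p 0 2 + pd e M p 1 2 - pd e M p 0 1) := by
  have h0 := h.hasPd (e := e) hp
  have := ((((h0.entry 0 2).mul (h0.entry 0 2)).add (h0.entry 1 2)).sub (h0.entry 0 1)).const_mul (-3)
  have e1 : unc (uFun M) = fun q => -3 * (M q 0 2 * M q 0 2 + M q 1 2 - M q 0 1) := by
    funext q; simp [unc, uOf, sq]
  rw [e1, this.pd_eq (by rw [← e1]; exact smooth_uFun h) hp he]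
  ring

/-- `Â` as a function of the parameters. -/
def companion (M : Mat3) (ξ : ℂ) : Mat3 := !![0, 1, 0; 0, 0, 1; ξ + vOf M, -uOf M, 0]

lemma smooth_companion (h : Smooth M) (ξ : ℂ) : Smooth fun q => companion (M q) ξ := by
  have e : ∀ X : Mat3, companion X ξ = Kmat ξ + (vOf X • unit31 + uOf X • !![0, 0, 0; 0, 0, 0; 0, -1, 0]) :=
    fun X => by ext i j; fin_cases i <;> fin_cases j <;> simp [companion, unit31, Kmat]
  simp only [e]
  exact contDiffOn_const.add (((smooth_vFun h).smul contDiffOn_const).add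
    ((smooth_uFun h).smul contDiffOn_const))

lemma pd_companion (h : Smooth M) (hp : p ∈ Adm) {e : Param} (he : IsDir e) (ξ : ℂ) :
    pd e (fun q => companion (M q) ξ) p = !![0, 0, 0; 0, 0, 0;
      pd e (unc (vFun M)) p, -pd e (unc (uFun M)) p, 0] := by
  have hv := smooth_vFun h
  have hu := smooth_uFun h
  have key : ∀ (i j : Fin 3) {g : Param → ℂ} {d : ℂ}, (fun q => companion (M q) ξ i j) = g →
      HasPd e g d p → pd e (fun q => companion (M q) ξ) p i j = d := fun i j g d hg hd => by
    rw [← pd_entry (smooth_companion h ξ) hp he, hg]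
    exact hd.pd_eq (hg ▸ (smooth_companion h ξ).entry i j) hp he
  ext i j
  fin_cases i <;> fin_cases j
  · exact key 0 0 rfl (hasPd_const _)
  · exact key 0 1 rfl (hasPd_const _)
  · exact key 0 2 rfl (hasPd_const _)
  · exact key 1 0 rfl (hasPd_const _)
  · exact key 1 1 rfl (hasPd_const _)
  · exact key 1 2 rfl (hasPd_const _)
  · exact key 2 0 rfl (((hasPd_const _).add (hv.hasPd hp)).congr_deriv (zero_add _))
  · exact key 2 1 rfl (hu.hasPd hp).neg
  · exact key 2 2 rfl (hasPd_const _)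

variable (hΦ : Family γ α Φ) (hM : Moments γ α Φ M)
include hΦ hM

lemma moment_relations (hp : p ∈ Adm) : pd dirTau M p 0 2 = M p 0 1 - M p 1 2 - M p 0 2 ^ 2 ∧
    pd dirTau M p 1 2 = M p 1 1 - M p 2 2 - M p 0 2 * M p 1 2 ∧
    pd dirTau M p 0 1 = M p 0 0 - M p 1 1 - M p 0 1 * M p 0 2 ∧
    pd dirSigma M p 0 2 = M p 0 0 - M p 2 2 - M p 0 1 * M p 0 2 - M p 0 2 * M p 1 2 := by
  have h1 := moment_relation_sq hΦ hM hp 0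
  have h2 := moment_relation_cube hΦ hM hp 0
  have a := congrFun (congrFun h1 0) 0
  have b := congrFun (congrFun h1 1) 0
  have c := congrFun (congrFun h1 2) 1
  have d := congrFun (congrFun h2 2) 2
  simp [laxA, laxB, unit31, shift2, Kmat, Matrix.vecMul, dotProduct, Matrix.mul_apply,
    Fin.sum_univ_three, sq] at a b c d
  refine ⟨?_, ?_, ?_, ?_⟩
  · linear_combination a
  · linear_combination b
  · linear_combination c
  · linear_combination d

lemma gaugeLax_tau (hp : p ∈ Adm) (ξ : ℂ) :
    gaugeLax (M p) (pd dirTau M p) (laxA (M p) ξ) = companion (M p) ξ := by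
  obtain ⟨r1, r2, r3, -⟩ := moment_relations hΦ hM hp
  have key : gaugeMatrix (M p) * laxA (M p) ξ - gaugeDeriv (M p) (pd dirTau M p) =
      companion (M p) ξ * gaugeMatrix (M p) := by
    ext i j
    fin_cases i <;> fin_cases j <;>
      simp [gaugeMatrix, laxA, gaugeDeriv, companion, unit31, shift2, Kmat, uOf, vOf,
        Matrix.vecMul, dotProduct, Matrix.mul_apply, Fin.sum_univ_three, sub_eq_add_neg]
    · linear_combination -r1
    · linear_combination (-4 * M p 0 2) * r1 - 2 * r2 + r3
    · linear_combination -r1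
  have inv : gaugeMatrix (M p) * gaugeInv (M p) = 1 := mul_eq_one_comm.1 (gaugeInv_mul _)
  rw [gaugeLax, key, mul_assoc, inv, mul_one]

end Flows

/-! ## The flows -/

lemma smooth_laxA {M : Param → Mat3} (h : Smooth M) (ξ : ℂ) : Smooth fun q => laxA (M q) ξ :=
  contDiffOn_const.add (contDiffOn_const.add ((h.mul contDiffOn_const).sub (contDiffOn_const.mul h)))

lemma smooth_laxB {M : Param → Mat3} (h : Smooth M) (ξ : ℂ) : Smooth fun q => laxB (M q) ξ :=
  contDiffOn_const.add (contDiffOn_const.add ((h.mul contDiffOn_const).sub (contDiffOn_const.mul h)))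

lemma I_mem_compl_contour : I ∈ contourᶜ := by
  have := Real.pi_pos
  simp only [contour, mem_compl_iff, mem_ofPred_eq, arg_I, not_or]
  refine ⟨?_, ?_, ?_, ?_, ?_, ?_⟩ <;> intro h <;> linarith

section Flows
variable {γ α : ℝ} {Φ : Param → ℂ → Mat3} {M : Param → Mat3} {p : Param} {ξ : ℂ}

def laxC (M : Param → Mat3) (ξ : ℂ) (q : Param) : Mat3 := ξ • laxA (M q) ξ + pd dirTau M q

lemma trace_gaugeLax (M m X : Mat3) : (gaugeLax M m X).trace = X.trace := by
  rw [gaugeLax, sub_mul, Matrix.trace_sub, Matrix.trace_mul_comm, ← mul_assoc, gaugeInv_mul, one_mul]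
  simp [gaugeDeriv, gaugeInv, Matrix.trace, Fin.sum_univ_three, shift2, unit31]

lemma gaugeLax_row (M m X : Mat3) (j : Fin 3) : gaugeLax M m X 0 j =
    ![X 0 0 - X 0 1 * M 0 2 + X 0 2 * (-M 0 2 ^ 2 - 2 * M 1 2 + M 0 1), X 0 1 - X 0 2 * M 0 2,
      X 0 2] j := by
  fin_cases j <;>
    simp [gaugeLax, gaugeMatrix, gaugeDeriv, gaugeInv, shift2, unit31, Matrix.vecMul, dotProduct,
      Matrix.vecHead, Matrix.vecTail, Matrix.mul_apply, Fin.sum_univ_three, sub_eq_add_neg]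

lemma gaugeLax_laxB_row (M m : Mat3) (j : Fin 3) :
    gaugeLax M m (laxB M ξ) 0 j = ![2 / 3 * uOf M, 0, 1] j := by
  rw [gaugeLax_row]
  fin_cases j <;> simp [laxB, shift2, Kmat, uOf, Matrix.vecMul, dotProduct, Matrix.mul_apply,
    Fin.sum_univ_three, sq]
  ring

lemma smooth_laxC (h : Smooth M) (ξ : ℂ) : Smooth (laxC M ξ) :=
  ((contDiffOn_const (c := ξ)).smul (smooth_laxA h ξ)).add (h.pd dirTau)

variable (hΦ : Family γ α Φ) (hM : Moments γ α Φ M)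
include hΦ hM

lemma pd_tau_gauge (hp : p ∈ Adm) (hξ : ξ ∈ contourᶜ) :
    pd dirTau (fun q => gaugeMatrix (M q) * Φ q ξ) p =
      -(companion (M p) ξ * (gaugeMatrix (M p) * Φ p ξ)) := by
  rw [← gaugeLax_tau hΦ hM hp]
  exact pd_gauge (X := fun q => laxA (M q) ξ) (contDiffOn_moment hΦ hM) (smooth_solution hΦ hξ)
    isDir_tau hp ((lax_tau hΦ hM hp).1 ξ hξ)

/-- A direction `e` in which the gauged solution satisfies a linear equation. -/
lemma hasDerivAt_gaugeLax {e : Param} (he : IsDir e) (hξ : ξ ∈ contourᶜ) {X : Param → Mat3}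
    (hX : Smooth X) (h : ∀ q ∈ Adm, pd e (fun q => Φ q ξ) q = -(X q * Φ q ξ)) {ρ σ : ℝ}
    (ha : Admissible ρ σ) (t : ℝ) (i j : Fin 3) :
    HasDerivAt (fun s => gaugeLax (M (ρ, σ, s)) (pd e M (ρ, σ, s)) (X (ρ, σ, s)) i j)
      (((!![0, 0, 0; 0, 0, 0; pd e (unc (vFun M)) (ρ, σ, t), -pd e (unc (uFun M)) (ρ, σ, t), 0] :
        Mat3) - (companion (M (ρ, σ, t)) ξ * gaugeLax (M (ρ, σ, t)) (pd e M (ρ, σ, t)) (X (ρ, σ, t)) -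
          gaugeLax (M (ρ, σ, t)) (pd e M (ρ, σ, t)) (X (ρ, σ, t)) * companion (M (ρ, σ, t)) ξ)) i j) t := by
  have hp : ((ρ, σ, t) : Param) ∈ Adm := ha
  have hS : Smooth M := contDiffOn_moment hΦ hM
  have hY : Smooth fun q => gaugeLax (M q) (pd e M q) (X q) := hS.gaugeLax hX
  have hΨ : Smooth fun q => gaugeMatrix (M q) * Φ q ξ := hS.gaugeMatrix.mul (smooth_solution hΦ hξ)
  have hdet : (gaugeMatrix (M (ρ, σ, t)) * Φ (ρ, σ, t) ξ).det ≠ 0 := by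
    rw [Matrix.det_mul, det_gaugeMatrix, one_mul]
    exact (hΦ _ hp).det_ne_zero hξ
  have z := zero_curvature hΨ (smooth_companion hS ξ) hY isDir_tau he
    (fun q hq => pd_tau_gauge hΦ hM hq hξ)
    (fun q hq => pd_gauge hS (smooth_solution hΦ hξ) he hq (h q hq)) hp hdet
  rw [pd_companion hS hp he] at z
  refine (Smooth.hasDerivAt_tau (hY.entry i j) hp).congr_deriv ?_
  rw [pd_entry hY hp isDir_tau, ← z, sub_sub_cancel]

lemma gaugeLax_sigma {ρ σ : ℝ} (ha : Admissible ρ σ) (τ : ℝ) (hξ : ξ ∈ contourᶜ) :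
    gaugeLax (M (ρ, σ, τ)) (pd dirSigma M (ρ, σ, τ)) (laxB (M (ρ, σ, τ)) ξ) =
      Bhat (uFun M ρ σ) (vFun M ρ σ) τ ξ := by
  have hS : Smooth M := contDiffOn_moment hΦ hM
  refine eq_Bhat_of_row (y := fun t => gaugeLax (M (ρ, σ, t)) (pd dirSigma M (ρ, σ, t))
    (laxB (M (ρ, σ, t)) ξ)) (contDiff_slice (smooth_uFun hS) ha) (contDiff_slice (smooth_vFun hS) ha)
    (fun t i j hi => ?_) (fun t j => ?_) τ
  · refine (hasDerivAt_gaugeLax hΦ hM isDir_sigma hξ (smooth_laxB hS ξ)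
      (fun q hq => (lax_sigma hΦ hM hq).1 ξ hξ) ha t i j).congr_deriv ?_
    rw [Matrix.sub_apply, show (!![0, 0, 0; 0, 0, 0; pd dirSigma (unc (vFun M)) (ρ, σ, t),
      -pd dirSigma (unc (uFun M)) (ρ, σ, t), 0] : Mat3) i j = 0 by
        fin_cases i <;> fin_cases j <;> first | rfl | exact absurd rfl hi, zero_sub,
      ← Matrix.neg_apply, neg_sub]
    rfl
  · rw [gaugeLax_laxB_row]
    fin_cases j <;> simp [Bhat]

lemma gaugeLax_rho {ρ σ : ℝ} (ha : Admissible ρ σ) (τ : ℝ) (hξ : ξ ∈ contourᶜ) :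
    gaugeLax (M (ρ, σ, τ)) (pd dirRho M (ρ, σ, τ)) (laxC M ξ (ρ, σ, τ)) =
      Chat (uFun M ρ σ) (vFun M ρ σ) τ ξ := by
  have hS : Smooth M := contDiffOn_moment hΦ hM
  have hu := contDiff_slice (smooth_uFun hS) ha
  have hv := contDiff_slice (smooth_vFun hS) ha
  refine eq_Chat_of_row (y := fun t => gaugeLax (M (ρ, σ, t)) (pd dirRho M (ρ, σ, t))
    (laxC M ξ (ρ, σ, t))) hu hv (fun t i j hi => ?_) (fun t => ?_) (fun t => ?_) (fun t => ?_) τ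
  · refine (hasDerivAt_gaugeLax hΦ hM isDir_rho hξ (smooth_laxC hS ξ) (fun q hq => lax_rho hΦ hM hq hξ) ha t i j).congr_deriv ?_
    rw [Matrix.sub_apply, show (!![0, 0, 0; 0, 0, 0; pd dirRho (unc (vFun M)) (ρ, σ, t),
      -pd dirRho (unc (uFun M)) (ρ, σ, t), 0] : Mat3) i j = 0 by
        fin_cases i <;> fin_cases j <;> first | rfl | exact absurd rfl hi, zero_sub,
      ← Matrix.neg_apply, neg_sub]
    rfl
  · have hp : ((ρ, σ, t) : Param) ∈ Adm := ha
    obtain ⟨r1, r2, r3, -⟩ := moment_relations hΦ hM hp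
    have e : D 1 (uFun M ρ σ) t = _ := (D_eq_pd (smooth_uFun hS) 1 hp).trans (pd_uFun hS hp isDir_tau)
    simp only [gaugeLax_row]
    simp [Chat, e, -iteratedDeriv_one]
    simp [laxC, laxA, unit31, Kmat, vOf, Matrix.vecMul, dotProduct, Matrix.mul_apply,
      Fin.sum_univ_three]
    linear_combination M (ρ, σ, t) 0 2 * r1 + r2
  · have hp : ((ρ, σ, t) : Param) ∈ Adm := ha
    obtain ⟨r1, -⟩ := moment_relations hΦ hM hp
    simp only [gaugeLax_row]
    simp [Chat, laxC, laxA, unit31, Kmat, uOf, Matrix.vecMul, dotProduct, Matrix.mul_apply,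
      Fin.sum_univ_three, -iteratedDeriv_one]
    linear_combination r1
  · have h0 : (laxA (M (ρ, σ, t)) ξ).trace = 0 := by
      rw [laxA, Matrix.trace_add, Matrix.trace_add, Matrix.trace_sub, Matrix.trace_mul_comm, sub_self]
      simp [Kmat, unit31, Matrix.trace, Fin.sum_univ_three]
    rw [trace_gaugeLax, laxC, Matrix.trace_add, Matrix.trace_smul, h0, smul_zero, zero_add]
    exact trace_pd_moment hΦ hM (p := (ρ, σ, t)) ha

lemma firstFlowAt {ρ σ : ℝ} (ha : Admissible ρ σ) (τ : ℝ) :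
    FirstFlowAt (uFun M) (vFun M) ρ σ τ := by
  have hS : Smooth M := contDiffOn_moment hΦ hM
  have hu := smooth_uFun hS
  have hv := smooth_vFun hS
  have hp : ((ρ, σ, τ) : Param) ∈ Adm := ha
  refine firstFlowAt_of_compatible (ξ := I) (contDiff_slice hu ha) (contDiff_slice hv ha) ?_
  ext i j
  have h := hasDerivAt_gaugeLax hΦ hM isDir_sigma I_mem_compl_contour (smooth_laxB hS I)
    (fun q hq => (lax_sigma hΦ hM hq).1 I I_mem_compl_contour) ha τ i j
  simp only [gaugeLax_sigma hΦ hM ha _ I_mem_compl_contour] at h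
  rw [Matrix.sub_apply, dSigma_eq_pd hu hp, dSigma_eq_pd hv hp]
  refine (congrArg (_ - ·) h.deriv).trans ?_
  rw [← Matrix.sub_apply, sub_sub_cancel]
  rfl

lemma secondFlowAt {ρ σ : ℝ} (ha : Admissible ρ σ) (τ : ℝ) :
    SecondFlowAt (uFun M) (vFun M) ρ σ τ := by
  have hS : Smooth M := contDiffOn_moment hΦ hM
  have hu := smooth_uFun hS
  have hv := smooth_vFun hS
  have hp : ((ρ, σ, τ) : Param) ∈ Adm := ha
  refine secondFlowAt_of_compatible (ξ := I) (contDiff_slice hu ha) (contDiff_slice hv ha) ?_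
  ext i j
  have h := hasDerivAt_gaugeLax (X := laxC M I) hΦ hM isDir_rho I_mem_compl_contour
    (smooth_laxC hS I)
    (fun q hq => lax_rho hΦ hM hq I_mem_compl_contour) ha τ i j
  simp only [gaugeLax_rho hΦ hM ha _ I_mem_compl_contour] at h
  rw [Matrix.sub_apply, dRho_eq_pd hu hp, dRho_eq_pd hv hp]
  refine (congrArg (_ - ·) h.deriv).trans ?_
  rw [← Matrix.sub_apply, sub_sub_cancel]
  rfl

end Flows

/-! ## Scaling -/

lemma log_exp_mul (x : ℝ) {ξ : ℂ} (hξ : ξ ≠ 0) : log (exp x * ξ) = x + log ξ := by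
  rw [← ofReal_exp, log_ofReal_mul (Real.exp_pos x) hξ, Real.log_exp]

lemma arg_exp_mul (x : ℝ) (ξ : ℂ) : (exp x * ξ).arg = ξ.arg := by
  rw [← ofReal_exp, arg_real_mul _ (Real.exp_pos x)]

lemma cpow_exp_mul (x : ℝ) {ξ : ℂ} (hξ : ξ ≠ 0) (s : ℂ) :
    (exp x * ξ) ^ s = exp (x * s) * ξ ^ s := by
  rw [cpow_def_of_ne_zero (mul_ne_zero (exp_ne_zero _) hξ), cpow_def_of_ne_zero hξ,
    log_exp_mul x hξ, add_mul, exp_add]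

def originExponents (α : ℝ) : Fin 3 → ℂ :=
  ![((1 / 2 - α / 3 : ℝ) : ℂ), ((1 / 2 + α / 6 : ℝ) : ℂ), ((α / 6 : ℝ) : ℂ)]

lemma originPowers_eq (α : ℝ) (ξ : ℂ) :
    originPowers α ξ = Matrix.diagonal fun i => ξ ^ originExponents α i := by
  unfold originPowers
  congr 1; ext i; fin_cases i <;> rfl

def lowerCol (a b : ℂ) : Mat3 := !![0, 0, 0; a, 0, 0; b, 0, 0]

lemma lowerCol_mul_self (a b : ℂ) : lowerCol a b * lowerCol a b = 0 := by
  ext i j; fin_cases i <;> fin_cases j <;> simp [lowerCol]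

/-- The logarithm in the connection matrix. -/
lemma exists_connectionMatrix_eq (γ : ℝ) {α : ℝ} (hα : -1 < α) : ∃ (k : ℕ) (a b : ℂ) (E₀ : Mat3),
    (∀ ξ, connectionMatrix γ α ξ = (1 + log ξ • lowerCol a b) * E₀) ∧
    ∀ ξ ≠ 0, originPowers α ξ * lowerCol a b = ξ ^ k • (lowerCol a b * originPowers α ξ) := by
  have key : ∀ (a b z e₁₀ e₁₁ e₁₂ e₂₀ e₂₁ e₂₂ : ℂ), !![1, 0, 0; e₁₀ + a * z, e₁₁, e₁₂;
      e₂₀ + b * z, e₂₁, e₂₂] = (1 + z • lowerCol a b) * !![1, 0, 0; e₁₀, e₁₁, e₁₂; e₂₀, e₂₁, e₂₂] := by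
    intros
    rw [add_mul, one_mul, smul_mul_assoc]
    ext i j; fin_cases i <;> fin_cases j <;> simp [lowerCol] <;> ring
  have comm : ∀ (d : Fin 3 → ℂ) (a b c : ℂ), d 1 * a = c * (a * d 0) → d 2 * b = c * (b * d 0) →
      Matrix.diagonal d * lowerCol a b = c • (lowerCol a b * Matrix.diagonal d) := by
    intro d a b c h1 h2
    ext i j
    rw [Matrix.diagonal_mul, Matrix.smul_apply, Matrix.mul_diagonal, smul_eq_mul]
    fin_cases i <;> fin_cases j <;> simp [lowerCol]
    exacts [h1, h2]
  have nat : ∀ k : ℤ, -1 < k → ∃ n : ℕ, k = n := fun k hk => Int.eq_ofNat_of_zero_le (by omega)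
  unfold connectionMatrix
  split_ifs with h1 h2
  · obtain ⟨k, hk⟩ := h1
    obtain ⟨n, rfl⟩ := nat k (by rify; linarith)
    refine ⟨n, 0, -(expI (2 * α / 3 * π) / (2 * π * I)) * (1 + γ),
      _, fun ξ => by rw [← key, zero_mul, add_zero, zero_add], fun ξ hξ => ?_⟩
    · have e : ξ ^ ((α / 6 : ℝ) : ℂ) = ξ ^ n * ξ ^ ((1 / 2 - α / 3 : ℝ) : ℂ) := by
        rw [← cpow_natCast, ← cpow_add _ _ hξ, hk]; push_cast; ring_nf
      exact comm _ _ _ _ (by simp) (by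
        change ξ ^ ((α / 6 : ℝ) : ℂ) * _ = _ * (_ * ξ ^ ((1 / 2 - α / 3 : ℝ) : ℂ))
        rw [e]; ring)
  · obtain ⟨k, hk⟩ := h2
    obtain ⟨n, rfl⟩ := nat k (by
      have : (-1:ℤ) < 2 * k := by rify; linarith
      omega)
    refine ⟨n, -(expI (2 * α / 3 * π) / (2 * π * I)) * (1 - γ), 0,
      _, fun ξ => by rw [← key, zero_mul, add_zero, zero_add], fun ξ hξ => ?_⟩
    · have e : ξ ^ ((1 / 2 + α / 6 : ℝ) : ℂ) = ξ ^ n * ξ ^ ((1 / 2 - α / 3 : ℝ) : ℂ) := by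
        rw [← cpow_natCast, ← cpow_add _ _ hξ, hk]; push_cast; ring_nf
      exact comm _ _ _ _ (by
        change ξ ^ ((1 / 2 + α / 6 : ℝ) : ℂ) * _ = _ * (_ * ξ ^ ((1 / 2 - α / 3 : ℝ) : ℂ))
        rw [e]; ring) (by simp)
  · have e : lowerCol 0 0 = 0 := by ext i j; fin_cases i <;> fin_cases j <;> rfl
    exact ⟨0, 0, 0, _, fun ξ => by rw [e, smul_zero, add_zero, one_mul], fun ξ _ => by simp [e]⟩

/-- The behaviour of the singular factor at the origin under dilations. -/
lemma exists_origin_scale (γ : ℝ) {α : ℝ} (hα : -1 < α) : ∃ (k : ℕ) (a b : ℂ), ∀ (μ : ℝ), ∀ ξ ≠ 0,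
    originPowers α (exp μ * ξ) * connectionMatrix γ α (exp μ * ξ) =
      Matrix.diagonal (fun i => exp (μ * originExponents α i)) *
        (1 + ξ ^ k • ((μ : ℂ) • lowerCol a b)) * (originPowers α ξ * connectionMatrix γ α ξ) := by
  obtain ⟨k, a, b, E₀, hE, hO⟩ := exists_connectionMatrix_eq γ hα
  refine ⟨k, a, b, fun μ ξ hξ => ?_⟩
  have e1 : originPowers α (exp μ * ξ) =
      Matrix.diagonal (fun i => exp (μ * originExponents α i)) * originPowers α ξ := by
    rw [originPowers_eq, originPowers_eq, Matrix.diagonal_mul_diagonal]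
    simp only [cpow_exp_mul _ hξ]
  have e2 : connectionMatrix γ α (exp μ * ξ) =
      (1 + (μ : ℂ) • lowerCol a b) * connectionMatrix γ α ξ := by
    rw [hE, hE, log_exp_mul μ hξ, ← mul_assoc]
    congr 1
    simp only [add_mul, mul_add, one_mul, mul_one, smul_mul_assoc, mul_smul_comm,
      lowerCol_mul_self, smul_zero, add_zero, add_smul]
    abel
  have e3 : originPowers α ξ * (1 + (μ : ℂ) • lowerCol a b) =
      (1 + ξ ^ k • ((μ : ℂ) • lowerCol a b)) * originPowers α ξ := by
    simp only [add_mul, mul_add, one_mul, mul_one, smul_mul_assoc, mul_smul_comm, hO ξ hξ]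
    rw [smul_comm]
  rw [e1, e2, mul_assoc, ← mul_assoc (originPowers α ξ), e3]
  simp only [mul_assoc]

def scaleMat (x : ℂ) : Mat3 := Matrix.diagonal ![1, exp x, exp (2 * x)]

lemma scaleMat_neg_mul (x : ℂ) : scaleMat (-x) * scaleMat x = 1 := by
  rw [scaleMat, scaleMat, Matrix.diagonal_mul_diagonal, ← Matrix.diagonal_one]
  congr 1; ext i
  fin_cases i <;> simp [← exp_add]

def scaleParam (x : ℝ) (p : Param) : Param :=
  (Real.exp (4 * x) * p.1, Real.exp (2 * x) * p.2.1, Real.exp x * p.2.2)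

lemma scaleParam_mem_Adm {p : Param} (hp : p ∈ Adm) (x : ℝ) : scaleParam x p ∈ Adm := by
  rcases hp with h | ⟨h, h'⟩
  · exact Or.inl (mul_neg_of_pos_of_neg (Real.exp_pos _) h)
  · exact Or.inr ⟨by simp [scaleParam, h], mul_pos (Real.exp_pos _) h'⟩

lemma model_scale (x : ℝ) (p : Param) {ξ : ℂ} (hξ : ξ ≠ 0) :
    model p (exp (3 * x : ℝ) * ξ) = scaleMat x * model (scaleParam x p) ξ := by
  have him : (0 < (exp (3 * x : ℝ) * ξ).im) = (0 < ξ.im) := by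
    rw [← ofReal_exp, im_ofReal_mul, mul_pos_iff_of_pos_left (Real.exp_pos _)]
  have hU : Upsilon (exp (3 * x : ℝ) * ξ) = scaleMat x * Upsilon ξ := by
    rw [Upsilon, Upsilon, scaleMat, Matrix.diagonal_mul_diagonal]
    congr 1; ext i
    fin_cases i <;> simp only [cpow_exp_mul _ hξ] <;> simp <;> ring_nf
  have hph : ∀ a, phase a p.1 p.2.1 p.2.2 (exp (3 * x : ℝ) * ξ) =
      phase a (scaleParam x p).1 (scaleParam x p).2.1 (scaleParam x p).2.2 ξ := fun a => by
    simp only [phase, cpow_exp_mul _ hξ, scaleParam]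
    push_cast; ring_nf
  have hT : Theta p.1 p.2.1 p.2.2 (exp (3 * x : ℝ) * ξ) =
      Theta (scaleParam x p).1 (scaleParam x p).2.1 (scaleParam x p).2.2 ξ := by
    unfold Theta; simp only [hph, him]
  unfold model modelAtInfinity
  simp only [hU, him, hT, mul_assoc]

lemma hasJump_scale {Φ : ℂ → Mat3} {θ a b c d : ℝ} {J : Mat3} (x : ℝ) (S : Mat3)
    (h : HasJump Φ θ (sector a b) (sector c d) J) :
    HasJump (fun ξ => S * Φ (exp x * ξ)) θ (sector a b) (sector c d) J := by
  intro r hr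
  obtain ⟨Fm, Fp, h1, h2, h3⟩ := h (Real.exp x * r) (mul_pos (Real.exp_pos x) hr)
  have key : ∀ {a b : ℝ}, Tendsto (fun ξ : ℂ => exp x * ξ) (𝓝[sector a b] ((r : ℂ) * expI θ))
      (𝓝[sector a b] (((Real.exp x * r : ℝ) : ℂ) * expI θ)) := by
    intro a b
    refine tendsto_nhdsWithin_of_tendsto_nhds_of_eventually_within _ ?_ ?_
    · have : Tendsto (fun ξ : ℂ => exp x * ξ) (𝓝 ((r : ℂ) * expI θ)) (𝓝 (exp x * ((r : ℂ) * expI θ))) :=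
        (continuous_const.mul continuous_id).tendsto _
      rw [ofReal_mul, ofReal_exp, mul_assoc]
      exact this.mono_left nhdsWithin_le_nhds
    · filter_upwards [self_mem_nhdsWithin] with ξ hξ
      change _ < _ ∧ _ < _
      rw [arg_exp_mul]; exact hξ
  exact ⟨S * Fm, S * Fp, (h1.comp key).const_mul S, (h2.comp key).const_mul S, by rw [h3, mul_assoc]⟩

lemma exp_mul_mem_contour (x : ℝ) {ξ : ℂ} (hξ : ξ ∈ contourᶜ) : exp x * ξ ∈ contourᶜ := by
  simpa only [contour, mem_compl_iff, mem_ofPred_eq, arg_exp_mul] using hξ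

section Scaling
variable {γ α : ℝ} {p : Param} {Φ : ℂ → Mat3}

lemma IsModelSolution.scale (h : Solves γ α p Φ) (hα : -1 < α) (x : ℝ) :
    IsModelSolution γ α (scaleParam x p).1 (scaleParam x p).2.1 (scaleParam x p).2.2
      (fun ξ => scaleMat (-x) * Φ (exp (3 * x : ℝ) * ξ)) where
  analytic i j := by
    simp only [scaleMat, Matrix.diagonal_mul]
    exact ((h.analytic i j).comp (differentiable_id.const_mul _).differentiableOn
      fun ξ hξ => exp_mul_mem_contour _ hξ).const_mul _
  jump_pos := hasJump_scale _ _ h.jump_pos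
  jump_neg := hasJump_scale _ _ h.jump_neg
  jump_quarter := hasJump_scale _ _ h.jump_quarter
  jump_neg_quarter := hasJump_scale _ _ h.jump_neg_quarter
  jump_three_quarter := hasJump_scale _ _ h.jump_three_quarter
  jump_neg_three_quarter := hasJump_scale _ _ h.jump_neg_three_quarter
  at_infinity := by
    obtain ⟨R, hR, hO⟩ := h.at_infinity
    refine ⟨fun ξ => scaleMat (-x) * R (exp (3 * x : ℝ) * ξ) * scaleMat x, fun ξ hξ => ?_, ?_⟩
    · have hm := model_scale x p (ne_zero_of_notMem_contour hξ)
      rw [hR _ (exp_mul_mem_contour _ hξ)]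
      change _ * (_ * model p _) = _ * model _ _
      rw [hm, add_mul, add_mul, one_mul, mul_add, ← mul_assoc, scaleMat_neg_mul]
      noncomm_ring
    · have hc : Tendsto (fun ξ : ℂ => exp (3 * x : ℝ) * ξ) (cobounded ℂ ⊓ 𝓟 contourᶜ)
          (cobounded ℂ ⊓ 𝓟 contourᶜ) :=
        ((tendsto_mul_left_cobounded (exp_ne_zero _)).mono_left inf_le_left).inf
          (tendsto_principal_principal.2 fun ξ hξ => exp_mul_mem_contour _ hξ) |>.mono_left
          (le_inf le_rfl inf_le_right)
      refine isBigO_entry ?_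
      have h1 := (isBigO_mat hO).comp_tendsto hc
      have h2 : (fun ξ : ℂ => (exp (3 * x : ℝ) * ξ)⁻¹) =O[cobounded ℂ ⊓ 𝓟 contourᶜ]
          fun ξ : ℂ => ξ⁻¹ := by
        simp only [mul_inv]
        exact (isBigO_refl _ _).const_mul_left _
      have h3 := h1.trans h2
      have h4 : (fun ξ => scaleMat (-x) * R (exp (3 * x : ℝ) * ξ) * scaleMat x)
          =O[cobounded ℂ ⊓ 𝓟 contourᶜ] fun ξ => (1 : ℂ) * ξ⁻¹ * 1 :=
        ((isBigO_const_const _ one_ne_zero _).mul h3).mul (isBigO_const_const _ one_ne_zero _)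
      simpa using h4
  at_zero := by
    obtain ⟨N, hN, hNe⟩ := h.at_zero
    obtain ⟨k, a, b, hO⟩ := exists_origin_scale γ hα
    set μ : ℝ := 3 * x
    have hlin : AnalyticAt ℂ (fun ξ : ℂ => exp μ * ξ) 0 := analyticAt_const.mul analyticAt_id
    have hN' : AnalyticAt ℂ (fun ξ : ℂ => N (exp μ * ξ)) 0 :=
      AnalyticAt.fun_comp (by simpa using analyticAt_mat hN) hlin
    refine ⟨fun ξ => scaleMat (-x) * N (exp μ * ξ) *
      Matrix.diagonal (fun i => exp (μ * originExponents α i)) *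
      (1 + ξ ^ k • ((μ : ℂ) • lowerCol a b)), fun i j => ?_, ?_⟩
    · exact (entryCLM i j).analyticAt _ |>.comp (((analyticAt_const.mul hN').mul analyticAt_const).mul
        (analyticAt_const.add ((analyticAt_id.pow k).smul analyticAt_const)))
    · have hc : Tendsto (fun ξ : ℂ => exp μ * ξ) (𝓝[sector (π / 4) (3 * π / 4)] 0)
          (𝓝[sector (π / 4) (3 * π / 4)] 0) := by
        refine tendsto_nhdsWithin_of_tendsto_nhds_of_eventually_within _ ?_ ?_
        · have := hlin.continuousAt.tendsto
          rw [mul_zero] at this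
          exact this.mono_left nhdsWithin_le_nhds
        · filter_upwards [self_mem_nhdsWithin] with ξ hξ
          change _ < _ ∧ _ < _
          rw [arg_exp_mul]; exact hξ
      filter_upwards [hc.eventually hNe, self_mem_nhdsWithin] with ξ h1 hs
      have hξ := ne_zero_of_notMem_contour (sector_subset_compl_contour hs)
      rw [h1, mul_assoc (N _), hO μ ξ hξ]
      simp only [mul_assoc]

end Scaling

/-! ## Self-similarity -/

section Euler
variable {E : Type*} [NormedAddCommGroup E] [NormedSpace ℝ E] {p : Param}

lemma hasDerivAt_scaleParam {g : Param → E} (hg : Smooth g) (hp : p ∈ Adm) :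
    HasDerivAt (fun x => g (scaleParam x p)) ((4 * p.1) • pd dirRho g p +
      (2 * p.2.1) • pd dirSigma g p + p.2.2 • pd dirTau g p) 0 := by
  have hexp : ∀ c d : ℝ, HasDerivAt (fun x : ℝ => Real.exp (c * x) * d) (c * d) 0 := fun c d => by
    have := (((hasDerivAt_id (0:ℝ)).const_mul c).exp).mul_const d
    simpa using this
  have hc : HasDerivAt (fun x => scaleParam x p) (4 * p.1, 2 * p.2.1, p.2.2) 0 := by
    refine (hexp 4 p.1).prodMk ((hexp 2 p.2.1).prodMk ?_)
    simpa using hexp 1 p.2.2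
  have := hg.hasDerivAt_comp hc (Eventually.of_forall fun x => scaleParam_mem_Adm hp x)
  refine this.congr_deriv ?_
  have e : ((4 * p.1, 2 * p.2.1, p.2.2) : Param) =
      (4 * p.1) • dirRho + (2 * p.2.1) • dirSigma + p.2.2 • dirTau := by
    simp
  rw [e, map_add, map_add, map_smul, map_smul, map_smul,
    show scaleParam 0 p = p by simp [scaleParam] ]
  rfl

lemma pd_euler {g : Param → ℂ} (hg : Smooth g) (hp : p ∈ Adm) {w : ℕ}
    (h : ∀ x : ℝ, g (scaleParam x p) = exp (-x) ^ w * g p) :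
    4 * p.1 * pd dirRho g p + 2 * p.2.1 * pd dirSigma g p + p.2.2 * pd dirTau g p = -w * g p := by
  have h1 := hasDerivAt_scaleParam hg hp
  simp only [h] at h1
  have h2 : HasDerivAt (fun x : ℝ => exp (-x) ^ w * g p) (-w * g p) 0 := by
    have := (((hasDerivAt_id (0:ℝ)).ofReal_comp.neg.cexp).pow w).mul_const (g p)
    simpa using this
  rw [← h1.unique h2]
  simp only [real_smul]
  push_cast; ring

end Euler

lemma mul_I_mem_compl_contour {t : ℝ} (ht : 0 < t) : (t * I : ℂ) ∈ contourᶜ := by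
  rw [mem_compl_iff, mem_contour_iff]
  simp [ht.ne', ht.ne]

lemma moment_tendsto {γ α : ℝ} {p : Param} {Φ : ℂ → Mat3} {M : Mat3}
    (h : Solves γ α p Φ) (hM : ExpandsTo (smoothF γ α p Φ) 1 M) :
    Tendsto (fun t : ℝ => (t * I : ℂ) • (Φ (t * I) * (model p (t * I))⁻¹ - 1)) atTop (𝓝 M) := by
  have h0 : ExpandsTo (fun ξ => smoothF γ α p Φ ξ - 1) 0 M :=
    IsBigO.congr_left hM fun ξ => by rw [sub_zero]
  have hI : Tendsto (fun t : ℝ => (t * I : ℂ)) atTop (cobounded ℂ) := by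
    rw [← tendsto_norm_atTop_iff_cobounded]
    simpa using tendsto_abs_atTop_atTop
  refine (h0.tendsto_smul.comp hI).congr' ?_
  filter_upwards [eventually_gt_atTop 0] with t ht
  have hξ := mul_I_mem_compl_contour ht
  have hw : ∀ b, leftover γ α b (t * I) = 0 := fun b =>
    leftover_of_notMem γ α (im_ne_zero_of_notMem_contour hξ) fun hb => by
      have := hb.2.1
      simp [slope] at this
      linarith
  simp only [Function.comp_apply]
  rw [smoothF_eq h hξ]
  simp only [hw, unip_zero, mul_one]

lemma lax_parameters {γ α : ℝ} {Φ : Param → ℂ → Mat3} {M : Param → Mat3} {ξ : ℂ} (hΦ : Family γ α Φ)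
    (hM : Moments γ α Φ M) {ρ σ : ℝ} (ha : Admissible ρ σ) (τ : ℝ)
    (hξ : ξ ∈ contourᶜ) :
    pd dirTau (fun q => gaugeMatrix (M q) * Φ q ξ) (ρ, σ, τ) =
      -(Ahat (uFun M ρ σ) (vFun M ρ σ) τ ξ * (gaugeMatrix (M (ρ, σ, τ)) * Φ (ρ, σ, τ) ξ)) ∧
    pd dirSigma (fun q => gaugeMatrix (M q) * Φ q ξ) (ρ, σ, τ) =
      -(Bhat (uFun M ρ σ) (vFun M ρ σ) τ ξ * (gaugeMatrix (M (ρ, σ, τ)) * Φ (ρ, σ, τ) ξ)) ∧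
    pd dirRho (fun q => gaugeMatrix (M q) * Φ q ξ) (ρ, σ, τ) =
      -(Chat (uFun M ρ σ) (vFun M ρ σ) τ ξ * (gaugeMatrix (M (ρ, σ, τ)) * Φ (ρ, σ, τ) ξ)) := by
  have hS : Smooth M := contDiffOn_moment hΦ hM
  have hp : ((ρ, σ, τ) : Param) ∈ Adm := ha
  have hF := smooth_solution hΦ hξ
  refine ⟨pd_tau_gauge hΦ hM hp hξ, ?_, ?_⟩
  · rw [← gaugeLax_sigma hΦ hM ha τ hξ]
    exact pd_gauge (X := fun q => laxB (M q) ξ) hS hF isDir_sigma hp ((lax_sigma hΦ hM hp).1 ξ hξ)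
  · rw [← gaugeLax_rho hΦ hM ha τ hξ]
    exact pd_gauge (X := laxC M ξ) hS hF isDir_rho hp (lax_rho hΦ hM hp hξ)

section SelfSimilar
variable {γ α : ℝ} {Φ : Param → ℂ → Mat3} {M : Param → Mat3} {p : Param} {ξ : ℂ} (hα : -1 < α)
  (hΦ : Family γ α Φ)
  (hM : Moments γ α Φ M)
include hα hΦ

lemma solution_scale (hp : p ∈ Adm) (x : ℝ) (hξ : ξ ∈ contourᶜ) :
    Φ (scaleParam x p) ξ = scaleMat (-x) * Φ p (exp (3 * x : ℝ) * ξ) :=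
  ((hΦ p hp).scale hα x).eqOn (hΦ _ (scaleParam_mem_Adm hp x)) hξ

include hM

lemma moment_scale (hp : p ∈ Adm) (x : ℝ) :
    M (scaleParam x p) = exp (-(3 * x : ℝ)) • (scaleMat (-x) * M p * scaleMat x) := by
  have hp' := scaleParam_mem_Adm hp x
  refine tendsto_nhds_unique (moment_tendsto (hΦ _ hp') (hM _ hp')) ?_
  have hl : Tendsto (fun t : ℝ => Real.exp (3 * x) * t) atTop atTop :=
    tendsto_id.const_mul_atTop (Real.exp_pos _)
  have h1 := (moment_tendsto (hΦ p hp) (hM p hp)).comp hl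
  refine ((((h1.const_mul (scaleMat (-x))).mul_const (scaleMat x))).const_smul
    (exp (-(3 * x : ℝ)))).congr' ?_
  filter_upwards [eventually_gt_atTop 0] with t ht
  have hξ := mul_I_mem_compl_contour ht
  have e : ((Real.exp (3 * x) * t : ℝ) * I : ℂ) = exp (3 * x : ℝ) * (t * I) := by push_cast; ring
  have em : (model (scaleParam x p) (t * I))⁻¹ = (model p (exp (3 * x : ℝ) * (t * I)))⁻¹ * scaleMat x := by
    rw [model_scale x p (ne_zero_of_notMem_contour hξ), Matrix.mul_inv_rev, mul_assoc,
      Matrix.inv_eq_left_inv (scaleMat_neg_mul (x : ℂ)), scaleMat_neg_mul, mul_one]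
  simp only [Function.comp_apply]
  rw [e, solution_scale hα hΦ hp x hξ, em]
  simp only [mul_smul_comm, smul_mul_assoc, mul_sub, sub_mul, mul_one, scaleMat_neg_mul, smul_smul]
  rw [← mul_assoc (exp (-(3 * x : ℝ))), ← exp_add, neg_add_cancel, exp_zero, one_mul]
  simp only [mul_assoc]

lemma moment_scale_apply (hp : p ∈ Adm) (x : ℝ) (i j : Fin 3) : M (scaleParam x p) i j =
    exp (-x) ^ (3 + (i : ℕ) - (j : ℕ)) * M p i j := by
  rw [moment_scale hα hΦ hM hp, Matrix.smul_apply, scaleMat, scaleMat, Matrix.mul_diagonal,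
    Matrix.diagonal_mul, smul_eq_mul]
  have hv : ∀ (y : ℂ) (i : Fin 3), ![1, exp y, exp (2 * y)] i = exp ((i : ℕ) * y) := fun y i => by
    fin_cases i <;> simp
  have he : exp (-x) ^ (3 + (i : ℕ) - (j : ℕ)) =
      exp (-(3 * x : ℝ)) * (exp ((i : ℕ) * -(x : ℂ)) * exp ((j : ℕ) * (x : ℂ))) := by
    rw [← exp_add, ← exp_add, ← exp_nat_mul, Nat.cast_sub (by omega)]
    congr 1; push_cast; ring
  rw [hv, hv, he]
  ring

lemma uFun_scale (hp : p ∈ Adm) (x : ℝ) :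
    unc (uFun M) (scaleParam x p) = exp (-x) ^ 2 * unc (uFun M) p := by
  change uOf (M (scaleParam x p)) = _ * uOf (M p)
  simp only [uOf, moment_scale_apply hα hΦ hM hp, Fin.coe_ofNat_eq_mod]
  norm_num; ring

lemma vFun_scale (hp : p ∈ Adm) (x : ℝ) :
    unc (vFun M) (scaleParam x p) = exp (-x) ^ 3 * unc (vFun M) p := by
  change vOf (M (scaleParam x p)) = _ * vOf (M p)
  simp only [vOf, moment_scale_apply hα hΦ hM hp, Fin.coe_ofNat_eq_mod]
  norm_num; ring

lemma gaugeMatrix_scale (hp : p ∈ Adm) (x : ℝ) :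
    gaugeMatrix (M (scaleParam x p)) * scaleMat (-x) = scaleMat (-x) * gaugeMatrix (M p) := by
  have e : exp (2 * -(x : ℂ)) = exp (-x) ^ 2 := (exp_nat_mul _ 2)
  have w := moment_scale_apply hα hΦ hM hp x
  have w1 := w 0 1
  have w2 := w 0 2
  have w3 := w 1 2
  simp only [Fin.coe_ofNat_eq_mod, Nat.reduceMod, Nat.reduceAdd, Nat.reduceSub, pow_one] at w1 w2 w3
  ext i j
  rw [scaleMat, Matrix.mul_diagonal, Matrix.diagonal_mul, e]
  fin_cases i <;> fin_cases j <;> simp [gaugeMatrix, w1, w2, w3] <;> ring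

lemma selfSimilarAt {ρ σ : ℝ} (ha : Admissible ρ σ) (τ : ℝ) :
    SelfSimilarAt ρ σ (uFun M ρ σ) (vFun M ρ σ) τ := by
  have hS : Smooth M := contDiffOn_moment hΦ hM
  have hp : ((ρ, σ, τ) : Param) ∈ Adm := ha
  have hu := smooth_uFun hS
  have hv := smooth_vFun hS
  have hU := contDiff_slice hu ha
  have eu := pd_euler hu hp (uFun_scale hα hΦ hM hp)
  have ev := pd_euler hv hp (vFun_scale hα hΦ hM hp)
  have f := firstFlowAt hΦ hM ha τ
  have g := secondFlowAt hΦ hM ha τ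
  unfold FirstFlowAt at f
  unfold SecondFlowAt at g
  rw [← dRho_eq_pd hu hp, ← dSigma_eq_pd hu hp, g.1, f.1,
    ← show D 1 (uFun M ρ σ) τ = pd dirTau _ _ from D_eq_pd hu 1 hp] at eu
  rw [← dRho_eq_pd hv hp, ← dSigma_eq_pd hv hp, g.2, f.2,
    ← show D 1 (vFun M ρ σ) τ = pd dirTau _ _ from D_eq_pd hv 1 hp] at ev
  unfold SelfSimilarAt
  rw [show D 1 (uFun M ρ σ ^ 2) τ = 2 * (uFun M ρ σ τ * D 1 (uFun M ρ σ) τ) by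
    rw [pow_two_eq, D_one_mul_apply hU hU]; ring]
  simp only [unc] at eu ev
  push_cast at eu ev
  constructor
  · linear_combination -eu
  · linear_combination -ev

lemma lax_xi {ρ σ : ℝ} (ha : Admissible ρ σ) (τ : ℝ) (hξ : ξ ∈ contourᶜ) : ∃ X : Mat3,
    HasDerivAt (fun z => gaugeMatrix (M (ρ, σ, τ)) * Φ (ρ, σ, τ) z) X ξ ∧
    -ξ • X = Lhat ρ σ (uFun M ρ σ) (vFun M ρ σ) τ ξ *
      (gaugeMatrix (M (ρ, σ, τ)) * Φ (ρ, σ, τ) ξ) := by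
  have hS : Smooth M := contDiffOn_moment hΦ hM
  have hp : ((ρ, σ, τ) : Param) ∈ Adm := ha
  set Ψ : Param → Mat3 := fun q => gaugeMatrix (M q) * Φ q ξ with hΨ
  have hΨs : Smooth Ψ := hS.gaugeMatrix.mul (smooth_solution hΦ hξ)
  obtain ⟨h1, h2, h3⟩ := lax_parameters hΦ hM ha τ hξ
  obtain ⟨F', hF'⟩ : ∃ F', HasDerivAt (Φ (ρ, σ, τ)) F' ξ :=
    ⟨_, ((hΦ _ hp).differentiableOn.differentiableAt (isOpen_compl_contour.mem_nhds hξ)).hasDerivAt⟩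
  set X := gaugeMatrix (M (ρ, σ, τ)) * F'
  have hd : HasDerivAt (fun z => gaugeMatrix (M (ρ, σ, τ)) * Φ (ρ, σ, τ) z) X ξ := hF'.const_mul _
  refine ⟨X, hd, ?_⟩
  ext i j
  have e1 := (hasDerivAt_scaleParam (hΨs.entry i j) hp)
  have e2 : ∀ x : ℝ, Ψ (scaleParam x (ρ, σ, τ)) i j = exp ((i : ℕ) * -(x : ℂ)) *
      (gaugeMatrix (M (ρ, σ, τ)) * Φ (ρ, σ, τ) (exp (3 * x : ℝ) * ξ)) i j := fun x => by
    simp only [hΨ]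
    rw [solution_scale hα hΦ hp x hξ, ← mul_assoc, gaugeMatrix_scale hα hΦ hM hp, mul_assoc, scaleMat,
      Matrix.diagonal_mul]
    congr 1
    fin_cases i <;> simp
  simp only [e2] at e1
  have hx : HasDerivAt (fun x : ℝ => exp (3 * x : ℝ) * ξ) (3 * ξ) 0 := by
    have := ((((hasDerivAt_id (0:ℝ)).const_mul 3).ofReal_comp).cexp).mul_const ξ
    simpa using this
  have hi : HasDerivAt (fun x : ℝ => exp ((i : ℕ) * -(x : ℂ))) (-(i : ℕ)) 0 := by
    have := ((((hasDerivAt_id (0:ℝ)).ofReal_comp).neg.const_mul ((i : ℕ) : ℂ))).cexp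
    simpa using this
  have hd' : HasDerivAt (fun z => (gaugeMatrix (M (ρ, σ, τ)) * Φ (ρ, σ, τ) z) i j) (X i j)
      (exp (3 * (0:ℝ) : ℝ) * ξ) := by
    simp only [mul_zero, ofReal_zero, exp_zero, one_mul]
    exact (entryCLM i j).hasFDerivAt.comp_hasDerivAt ξ hd
  have e3 := hi.mul (hd'.comp_of_eq 0 hx rfl)
  have e4 := e1.unique e3
  rw [pd_entry hΨs hp isDir_rho, pd_entry hΨs hp isDir_sigma, pd_entry hΨs hp isDir_tau, h1, h2, h3] at e4
  simp only [real_smul, Matrix.neg_apply] at e4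
  rw [Lhat, add_mul, add_mul, add_mul]
  simp only [Matrix.add_apply, Matrix.smul_mul, Matrix.smul_apply, smul_eq_mul, Matrix.diagonal_mul]
  have e5 : (![0, 1, 2] : Fin 3 → ℂ) i = (i : ℕ) := by fin_cases i <;> simp
  rw [e5]
  simp at e4
  linear_combination (1 / 3) * e4

lemma laxSystemAt {ρ σ : ℝ} (ha : Admissible ρ σ) (τ : ℝ) (hξ : ξ ∈ contourᶜ) :
    LaxSystemAt (uFun M) (vFun M) (fun r s t z => gaugeMatrix (M (r, s, t)) * Φ (r, s, t) z)
      ρ σ τ ξ := by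
  have hS : Smooth M := contDiffOn_moment hΦ hM
  have hp : ((ρ, σ, τ) : Param) ∈ Adm := ha
  set Ψ : Param → Mat3 := fun q => gaugeMatrix (M q) * Φ q ξ
  have hΨs : Smooth Ψ := hS.gaugeMatrix.mul (smooth_solution hΦ hξ)
  obtain ⟨h1, h2, h3⟩ := lax_parameters hΦ hM ha τ hξ
  refine ⟨?_, ⟨_, fun i j => Smooth.hasDerivAt_tau (hΨs.entry i j) hp, ?_⟩,
    ⟨_, fun i j => Smooth.hasDerivAt_sigma (hΨs.entry i j) hp, ?_⟩,
    ⟨_, fun i j => Smooth.hasDerivWithinAt_rho (hΨs.entry i j) hp, ?_⟩⟩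
  · obtain ⟨X, hd, hX⟩ := lax_xi hα hΦ hM ha τ hξ
    exact ⟨X, fun i j => (entryCLM i j).hasFDerivAt.comp_hasDerivAt ξ hd, hX⟩
  · rw [← neg_neg (Ahat _ _ _ _ * _)]
    exact congrArg _ ((Matrix.ext fun i j => pd_entry hΨs hp isDir_tau i j).trans h1)
  · rw [← neg_neg (Bhat _ _ _ _ * _)]
    exact congrArg _ ((Matrix.ext fun i j => pd_entry hΨs hp isDir_sigma i j).trans h2)
  · rw [← neg_neg (Chat _ _ _ _ * _)]
    exact congrArg _ ((Matrix.ext fun i j => pd_entry hΨs hp isDir_rho i j).trans h3)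

end SelfSimilar

/-! ## The exponents at the origin -/

lemma continuous_Lhat (ρ σ : ℝ) (U V : ℝ → ℂ) (τ : ℝ) : Continuous (Lhat ρ σ U V τ) := by
  refine continuous_matrix fun i j => ?_
  fin_cases i <;> fin_cases j <;> simp [Lhat, Ahat, Bhat, Chat] <;> fun_prop

lemma D_scale_add_cube {f : ℝ → ℂ} (hf : ContDiff ℝ ∞ f) (c : ℝ) (b : ℂ) (τ : ℝ) :
    D 1 (fun t : ℝ => (c : ℂ) * f (c * t) + b * (t : ℂ) ^ 3) τ =
      (c : ℂ) ^ 2 * D 1 f (c * τ) + 3 * b * (τ : ℂ) ^ 2 ∧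
    D 2 (fun t : ℝ => (c : ℂ) * f (c * t) + b * (t : ℂ) ^ 3) τ =
      (c : ℂ) ^ 3 * D 2 f (c * τ) + 6 * b * τ ∧
    D 3 (fun t : ℝ => (c : ℂ) * f (c * t) + b * (t : ℂ) ^ 3) τ =
      (c : ℂ) ^ 4 * D 3 f (c * τ) + 6 * b := by
  have d : ∀ (k : ℕ) (t : ℝ), HasDerivAt (fun t : ℝ => D k f (c * t)) (c * D (k + 1) f (c * t)) t :=
    fun k t => by
      have h := (hasDerivAt_D hf k (c * t)).scomp t ((hasDerivAt_id t).const_mul c)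
      rwa [mul_one, real_smul] at h
  have p : ∀ (n : ℕ) (t : ℝ), HasDerivAt (fun t : ℝ => (t : ℂ) ^ (n + 1)) ((n + 1) * t ^ n) t :=
    fun n t => by simpa using (hasDerivAt_ofReal_id t).fun_pow (n + 1)
  have d0 : ∀ t ∈ univ, D 0 (fun t : ℝ => (c : ℂ) * f (c * t) + b * (t : ℂ) ^ 3) t =
      c * D 0 f (c * t) + b * (t : ℂ) ^ 3 := fun t _ => by rw [D_zero, D_zero]
  have d1 : ∀ t ∈ univ, D 1 _ t = (c : ℂ) ^ 2 * D 1 f (c * t) + 3 * b * (t : ℂ) ^ 2 := fun t =>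
    D_succ_eq_of_hasDerivAt (h := fun t => (c : ℂ) ^ 2 * D 1 f (c * t) + 3 * b * (t : ℂ) ^ 2)
      isOpen_univ d0 fun t _ => (((d 0 t).const_mul (c : ℂ)).add ((p 2 t).const_mul b)).congr_deriv (by
        push_cast; ring)
  have d2 : ∀ t ∈ univ, D 2 _ t = (c : ℂ) ^ 3 * D 2 f (c * t) + 6 * b * t := fun t =>
    D_succ_eq_of_hasDerivAt (h := fun t => (c : ℂ) ^ 3 * D 2 f (c * t) + 6 * b * t)
      isOpen_univ d1 fun t _ => (((d 1 t).const_mul ((c : ℂ) ^ 2)).add ((p 1 t).const_mul (3 * b))).congr_deriv (by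
        push_cast; ring)
  exact ⟨d1 τ (mem_univ τ), d2 τ (mem_univ τ), D_succ_eq_of_hasDerivAt
    (h := fun t => (c : ℂ) ^ 4 * D 3 f (c * t) + 6 * b) isOpen_univ d2 (fun t _ =>
    (((d 2 t).const_mul ((c : ℂ) ^ 3)).add ((hasDerivAt_ofReal_id t).const_mul (6 * b))).congr_deriv
      (by ring)) (mem_univ τ)⟩

section Origin
variable {γ α : ℝ} {Φ : Param → ℂ → Mat3} {M : Param → Mat3} (hα : -1 < α) (hΦ : Family γ α Φ)
  (hM : Moments γ α Φ M)
include hα hΦ hM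

/-- At the origin `-L̂` is conjugate to the matrix of the exponents, up to a nilpotent part. -/
lemma exists_conj_Lhat_zero {ρ σ : ℝ} (ha : Admissible ρ σ) (τ : ℝ) :
    ∃ (N : Mat3) (a b : ℂ), N.det ≠ 0 ∧ -Lhat ρ σ (uFun M ρ σ) (vFun M ρ σ) τ 0 * N =
      N * (Matrix.diagonal (originExponents α) + lowerCol a b) := by
  have hp : ((ρ, σ, τ) : Param) ∈ Adm := ha
  obtain ⟨N, hN, hNe⟩ := (hΦ _ hp).at_zero
  obtain ⟨k, a, b, hO⟩ := exists_origin_scale γ hα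
  have hdet := (hΦ _ hp).det_N_ne_zero hN hNe
  have hne := neBot_sector
  set P := gaugeMatrix (M (ρ, σ, τ)) with hP
  set N' : ℂ → Mat3 := fun ξ => P * N ξ with hN'
  set Δ : Mat3 := Matrix.diagonal (originExponents α)
  set L := Lhat ρ σ (uFun M ρ σ) (vFun M ρ σ) τ
  have hNa : AnalyticAt ℂ N' 0 := analyticAt_const.mul (analyticAt_mat hN)
  have key : ∀ᶠ ξ in 𝓝[sector (π / 4) (3 * π / 4)] (0:ℂ),
      -L ξ * N' ξ = ξ • deriv N' ξ + N' ξ * (Δ + ξ ^ k • lowerCol a b) := by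
    filter_upwards [eventually_eventually_nhdsWithin.2 hNe, self_mem_nhdsWithin,
      mem_nhdsWithin_of_mem_nhds hNa.eventually_analyticAt] with ξ h1 hs hξa
    have hξc := sector_subset_compl_contour hs
    have hξ := ne_zero_of_notMem_contour hξc
    have hopen : IsOpen (sector (π / 4) (3 * π / 4)) := by
      have : sector (π / 4) (3 * π / 4) = {z : ℂ | z.re < z.im} ∩ {z | -z.im < z.re} :=
        Set.ext fun z => mem_sector_quarter_three
      rw [this]
      exact (isOpen_lt continuous_re continuous_im).inter (isOpen_lt continuous_im.neg continuous_re)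
    rw [hopen.nhdsWithin_eq hs] at h1
    obtain ⟨X, hX, hXe⟩ := lax_xi hα hΦ hM ha τ hξc
    set Z := originPowers α ξ * connectionMatrix γ α ξ with hZ
    have hc : HasDerivAt (fun s : ℝ => exp s * ξ) ξ 0 := by
      have := ((hasDerivAt_id (0:ℝ)).ofReal_comp.cexp).mul_const ξ
      simpa using this
    have hc0 : exp (0:ℝ) * ξ = ξ := by simp
    have g1 : HasDerivAt (fun s : ℝ => P * Φ (ρ, σ, τ) (exp s * ξ)) (ξ • X) 0 :=
      (HasDerivAt.scomp_of_eq (0:ℝ) hX hc hc0.symm)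
    have d1 : HasDerivAt (fun s : ℝ => N' (exp s * ξ)) (ξ • deriv N' ξ) 0 :=
      (HasDerivAt.scomp_of_eq (0:ℝ) hξa.differentiableAt.hasDerivAt hc hc0.symm)
    have d2 : HasDerivAt (fun s : ℝ => (Matrix.diagonal fun i => exp (s * originExponents α i) : Mat3))
        Δ 0 := by
      have hpi : HasDerivAt (fun s : ℝ => fun i => exp (s * originExponents α i)) (originExponents α) 0 := by
        refine hasDerivAt_pi.2 fun i => ?_
        have := ((hasDerivAt_id (0:ℝ)).ofReal_comp.mul_const (originExponents α i)).cexp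
        simpa using this
      exact (LinearMap.toContinuousLinearMap
        (Matrix.diagonalLinearMap (Fin 3) ℝ ℂ)).hasFDerivAt.comp_hasDerivAt (0:ℝ) hpi
    have d3 : HasDerivAt (fun s : ℝ => 1 + ξ ^ k • ((s : ℂ) • lowerCol a b))
        (ξ ^ k • lowerCol a b) 0 := by
      have := (((hasDerivAt_id (0:ℝ)).ofReal_comp.smul_const (lowerCol a b)).const_smul
        (ξ ^ k)).const_add (1 : Mat3)
      rwa [ofReal_one, one_smul] at this
    have g2 := ((d1.mul (d2.mul d3)).mul_const Z)
    have heq : (fun s : ℝ => P * Φ (ρ, σ, τ) (exp s * ξ)) =ᶠ[𝓝 0] fun s : ℝ => N' (exp s * ξ) *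
        ((Matrix.diagonal fun i => exp (s * originExponents α i)) *
          (1 + ξ ^ k • ((s : ℂ) • lowerCol a b))) * Z := by
      have ht : Tendsto (fun s : ℝ => exp s * ξ) (𝓝 0) (𝓝 ξ) := by
        have := hc.continuousAt.tendsto
        rwa [hc0] at this
      filter_upwards [ht.eventually h1] with s hs
      rw [hs, mul_assoc (N _), hO s ξ hξ]
      simp only [hN', hZ, mul_assoc]
    have e := (g1.congr_of_eventuallyEq heq.symm).unique g2
    simp only [Pi.mul_apply, ofReal_zero, zero_mul, exp_zero, Matrix.diagonal_one, zero_smul,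
      smul_zero, add_zero, mul_one, one_mul] at e
    have e2 : -L ξ * (N' ξ * Z) = ξ • X := by
      have : P * Φ (ρ, σ, τ) ξ = N' ξ * Z := by rw [h1.self_of_nhds]; simp only [hN', hZ, mul_assoc]
      rw [← this, neg_mul, ← hXe, neg_smul, neg_neg]
    have hZd : IsUnit Z.det := by
      rw [hZ, Matrix.det_mul, det_originPowers α hξ, det_connectionMatrix]
      exact (mul_ne_zero hξ (mul_ne_zero two_ne_zero (expI_ne_zero _))).isUnit
    have e3 := congrArg (· * Z⁻¹) (e2.trans e)
    simpa only [mul_assoc, Matrix.mul_nonsing_inv _ hZd, mul_one, add_mul] using e3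
  have hkt : Tendsto (fun ξ : ℂ => ξ ^ k) (𝓝 0) (𝓝 (0 ^ k)) := (continuous_pow k).tendsto 0
  have t1 := ((continuous_Lhat ρ σ (uFun M ρ σ) (vFun M ρ σ) τ).tendsto 0).neg.mul
    hNa.continuousAt.tendsto
  have t2 := (tendsto_id.smul hNa.deriv.continuousAt.tendsto).add (hNa.continuousAt.tendsto.mul
    ((hkt.smul_const (lowerCol a b)).const_add Δ))
  have lim := tendsto_nhds_unique ((t1.mono_left nhdsWithin_le_nhds).congr' key)
    (t2.mono_left nhdsWithin_le_nhds)
  refine ⟨N' 0, 0 ^ k * a, 0 ^ k * b, ?_, ?_⟩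
  · rw [hN', Matrix.det_mul, hP, det_gaugeMatrix, one_mul]; exact hdet
  · rw [lim, zero_smul, zero_add]
    congr 2
    ext i j; fin_cases i <;> fin_cases j <;> simp [lowerCol]

lemma trace_det_Lhat_zero {ρ σ : ℝ} (ha : Admissible ρ σ) (τ : ℝ) :
    (Lhat ρ σ (uFun M ρ σ) (vFun M ρ σ) τ 0 * Lhat ρ σ (uFun M ρ σ) (vFun M ρ σ) τ 0).trace =
      (1 / 2 - α / 3) ^ 2 + (1 / 2 + α / 6) ^ 2 + (α / 6) ^ 2 ∧
    (-Lhat ρ σ (uFun M ρ σ) (vFun M ρ σ) τ 0).det =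
      (1 / 2 - α / 3) * (1 / 2 + α / 6) * (α / 6) := by
  obtain ⟨N, a, b, hN, h⟩ := exists_conj_Lhat_zero hα hΦ hM ha τ
  set L := Lhat ρ σ (uFun M ρ σ) (vFun M ρ σ) τ 0
  set T := Matrix.diagonal (originExponents α) + lowerCol a b with hT
  have hi : N * N⁻¹ = 1 := Matrix.mul_nonsing_inv _ hN.isUnit
  have hi' : N⁻¹ * N = 1 := Matrix.nonsing_inv_mul _ hN.isUnit
  have e : -L = N * T * N⁻¹ := by rw [← h, mul_assoc, hi, mul_one]
  constructor
  · rw [← neg_mul_neg, e, show N * T * N⁻¹ * (N * T * N⁻¹) = N * (T * (N⁻¹ * N) * T) * N⁻¹ by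
      noncomm_ring, hi', mul_one, Matrix.trace_mul_comm, ← mul_assoc, hi', one_mul]
    simp [hT, Matrix.trace, Fin.sum_univ_three, Matrix.mul_apply, lowerCol, originExponents]
    ring
  · rw [e, Matrix.det_mul, Matrix.det_mul, mul_right_comm, ← Matrix.det_mul, hi, Matrix.det_one,
      one_mul, Matrix.det_fin_three]
    simp [hT, lowerCol, originExponents]

/-! ## The equations of Chazy type -/

/-- At `ρ = 0`, `σ = 3/2` the functions `u` and `v` are expressed through `f = m₁₃`. -/
lemma u_v_eq_of_first_moment (τ : ℝ) : let f := fun t : ℝ => M (0, 3 / 2, t) 0 2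
    uFun M 0 (3 / 2) τ = 3 * D 1 f τ ∧
      vFun M 0 (3 / 2) τ = 3 / 2 * D 2 f τ + 1 / 2 * (f τ + τ * D 1 f τ) := by
  intro f
  have hS : Smooth M := contDiffOn_moment hΦ hM
  have ha : Admissible 0 (3 / 2) := Or.inr ⟨rfl, by norm_num⟩
  have hp : ∀ t : ℝ, ((0, 3 / 2, t) : Param) ∈ Adm := fun t => ha
  have hf : Smooth (unc fun ρ σ τ => M (ρ, σ, τ) 0 2) := hS.entry 0 2
  have h1 : ∀ t, D 1 f t = pd dirTau M (0, 3 / 2, t) 0 2 := fun t => by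
    rw [← pd_entry hS (hp t) isDir_tau]
    exact D_eq_pd hf 1 (hp t)
  have hu : ∀ t, uFun M 0 (3 / 2) t = 3 * D 1 f t := fun t => by
    rw [h1, (moment_relations hΦ hM (hp t)).1, uFun, uOf]; ring
  refine ⟨hu τ, ?_⟩
  have h2 : pd dirTau (unc (uFun M)) (0, 3 / 2, τ) = 3 * D 2 f τ := by
    rw [← show D 1 (uFun M 0 (3 / 2)) τ = pd dirTau _ _ from D_eq_pd (smooth_uFun hS) 1 (hp τ), funext hu,
      D_succ_eq_of_hasDerivAt isOpen_univ (g := fun t => 3 * D 1 f t)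
        (fun t _ => D_zero_apply _ t) (fun t _ => (hasDerivAt_D (contDiff_slice hf ha) 1 t).const_mul 3) (mem_univ τ)]
  rw [pd_uFun hS (hp τ) isDir_tau] at h2
  obtain ⟨r1, r2, r3, r4⟩ := moment_relations hΦ hM (hp τ)
  have he := pd_euler hf (hp τ) (w := 1) fun x => by
    simpa using moment_scale_apply hα hΦ hM (hp τ) x 0 2
  have e1 : pd dirSigma (unc fun ρ σ τ => M (ρ, σ, τ) 0 2) (0, 3 / 2, τ) = _ :=
    pd_entry hS (hp τ) isDir_sigma 0 2
  have e2 : pd dirTau (unc fun ρ σ τ => M (ρ, σ, τ) 0 2) (0, 3 / 2, τ) = _ :=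
    pd_entry hS (hp τ) isDir_tau 0 2
  rw [e1, e2, r4] at he
  simp only [unc] at he
  push_cast at he
  rw [h1, vFun, vOf]
  rw [r1] at h2 he ⊢
  rw [r2, r3] at h2
  simp only [f]
  linear_combination (1 / 2 : ℂ) * h2 - (1 / 2 : ℂ) * he

/-- The two invariants of `L̂` at the origin, in terms of `f = m₁₃`. -/
lemma chazy_invariants (τ : ℝ) : let f := fun t : ℝ => M (0, 3 / 2, t) 0 2
    D 3 f τ + 6 * D 1 f τ ^ 2 + (τ : ℂ) ^ 2 / 3 * D 1 f τ + τ * f τ + 1 / 18 + α / 6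
        - (α : ℂ) ^ 2 / 6 = 0 ∧
    8 * D 2 f τ ^ 2 + 32 / 9 * τ * D 2 f τ + 32 / 81 * (τ : ℂ) ^ 2
      + 4 * (2 * D 1 f τ + 2 / 9 * (τ : ℂ) ^ 2) ^ 3
      - 8 * (τ * D 1 f τ - f τ + 2 / 27 * (τ : ℂ) ^ 3) ^ 2
      - 4 / 3 * ((α : ℂ) ^ 2 - α + 1) * (2 * D 1 f τ + 2 / 9 * (τ : ℂ) ^ 2)
      + 4 / 27 * ((α : ℂ) + 1) * (2 * α - 1) * (α - 2) = 0 := by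
  intro f
  have hS : Smooth M := contDiffOn_moment hΦ hM
  have ha : Admissible 0 (3 / 2) := Or.inr ⟨rfl, by norm_num⟩
  have hf : ContDiff ℝ ∞ f := contDiff_slice (u := fun ρ σ τ => M (ρ, σ, τ) 0 2) (hS.entry 0 2) ha
  have d := hasDerivAt_D hf
  have hu : ∀ t ∈ univ, D 0 (uFun M 0 (3 / 2)) t = 3 * D 1 f t := fun t _ =>
    (D_zero_apply _ t).trans (u_v_eq_of_first_moment hα hΦ hM t).1
  have hu1 : ∀ t ∈ univ, D 1 (uFun M 0 (3 / 2)) t = 3 * D 2 f t := fun t =>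
    D_succ_eq_of_hasDerivAt isOpen_univ hu fun t _ => (d 1 t).const_mul 3
  have hu2 : D 2 (uFun M 0 (3 / 2)) τ = 3 * D 3 f τ :=
    D_succ_eq_of_hasDerivAt isOpen_univ hu1 (fun t _ => (d 2 t).const_mul 3) (mem_univ τ)
  have hv : ∀ t ∈ univ, D 0 (vFun M 0 (3 / 2)) t = 3 / 2 * D 2 f t + 1 / 2 * (D 0 f t + t * D 1 f t) :=
    fun t _ => by rw [D_zero, D_zero]; exact (u_v_eq_of_first_moment hα hΦ hM t).2
  have hv1 : D 1 (vFun M 0 (3 / 2)) τ = 3 / 2 * D 3 f τ + 1 / 2 * (D 1 f τ + (1 * D 1 f τ + τ * D 2 f τ)) :=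
    D_succ_eq_of_hasDerivAt isOpen_univ hv (fun t _ => ((d 2 t).const_mul _).add
      (((d 0 t).add ((hasDerivAt_ofReal_id t).mul (d 1 t))).const_mul _)) (mem_univ τ)
  have hu0 := hu τ (mem_univ τ)
  have hv0 := hv τ (mem_univ τ)
  rw [D_zero_apply] at hu0
  rw [D_zero_apply, D_zero_apply] at hv0
  obtain ⟨e1, e2⟩ := trace_det_Lhat_zero hα hΦ hM ha τ
  simp [Lhat, Ahat, Bhat, Matrix.det_fin_three, Matrix.trace, Matrix.mul_apply, Fin.sum_univ_three,
    hu0, hv0, hu1, hu2, hv1] at e1 e2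
  have T : D 3 f τ + 6 * D 1 f τ ^ 2 + (τ : ℂ) ^ 2 / 3 * D 1 f τ + τ * f τ + 1 / 18 + α / 6
      - (α : ℂ) ^ 2 / 6 = 0 := by linear_combination e1
  exact ⟨T, by linear_combination 32 * e2 + 16 * ((τ : ℂ) ^ 2 / 9 + 1 / 3 + D 1 f τ) * T⟩

lemma chazyThirdAt_first_moment (τ : ℝ) :
    ChazyThirdAt α (fun t => M (0, 3 / 2, t) 0 2 + (t : ℂ) ^ 3 / 108) τ := by
  have hf := contDiff_slice (u := fun ρ σ τ => M (ρ, σ, τ) 0 2)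
    (Smooth.entry (contDiffOn_moment hΦ hM) 0 2) (Or.inr ⟨rfl, by norm_num⟩ : Admissible 0 (3 / 2))
  obtain ⟨h, -⟩ := chazy_invariants hα hΦ hM τ
  obtain ⟨h1, -, h3⟩ := D_scale_add_cube hf 1 (1 / 108) τ
  simp only [ofReal_one, one_mul, one_pow, one_div_mul_eq_div] at h1 h3
  rw [ChazyThirdAt, h1, h3]
  linear_combination h

lemma chazySecondAt_first_moment (τ : ℝ) : ChazySecondAt α
    (fun t => (√2 : ℝ) * M (0, 3 / 2, √2 * t) 0 2 + 4 / 27 * (t : ℂ) ^ 3) τ := by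
  have hf := contDiff_slice (u := fun ρ σ τ => M (ρ, σ, τ) 0 2)
    (Smooth.entry (contDiffOn_moment hΦ hM) 0 2) (Or.inr ⟨rfl, by norm_num⟩ : Admissible 0 (3 / 2))
  obtain ⟨-, h⟩ := chazy_invariants hα hΦ hM (√2 * τ)
  obtain ⟨h1, h2, -⟩ := D_scale_add_cube hf √2 (4 / 27) τ
  have s : ((√2 : ℝ) : ℂ) ^ 2 = 2 := by rw [← ofReal_pow]; simp
  rw [ChazySecondAt, h1, h2]
  push_cast at h
  generalize ((√2 : ℝ) : ℂ) = c at s h ⊢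
  have s3 : c ^ 3 = 2 * c := by rw [pow_succ, s]
  rw [s3, s]
  simp only [mul_pow, s, s3] at h
  linear_combination h + (4 * D 2 (fun t => M (0, 3 / 2, t) 0 2) (√2 * τ) ^ 2
    + 8 * (τ : ℂ) ^ 2 * D 1 (fun t => M (0, 3 / 2, t) 0 2) (√2 * τ) ^ 2
    + 64 / 27 * (τ : ℂ) ^ 4 * D 1 (fun t => M (0, 3 / 2, t) 0 2) (√2 * τ)
    + 128 / 729 * (τ : ℂ) ^ 6 - 4 * M (0, 3 / 2, √2 * τ) 0 2 ^ 2) * s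
end Origin

lemma exists_smooth_moments {γ α : ℝ} {Φ : Param → ℂ → Mat3}
    (hΦ : Family γ α Φ) : ∃ M : Param → Mat3,
    (Moments γ α Φ M) ∧ (∀ i j, Smooth fun p => M p i j) ∧
    Smooth (unc (uFun M)) ∧ Smooth (unc (vFun M)) := by
  have hex : ∀ p : Param, ∃ M, p ∈ Adm → ExpandsTo (smoothF γ α p (Φ p)) 1 M := fun p => by
    by_cases hp : p ∈ Adm
    · obtain ⟨M, hM⟩ := exists_expandsTo_smoothF (hΦ p hp) hp
      exact ⟨M, fun _ => hM⟩
    · exact ⟨0, fun h => absurd h hp⟩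
  choose M hM using hex
  have hS : Smooth M := contDiffOn_moment hΦ hM
  exact ⟨M, hM, hS.entry, smooth_uFun hS, smooth_vFun hS⟩

end BoussinesqRHP

end

theorem theorem1p3 (γ α : ℝ) (hα : -1 < α) (hγ : γ ∈ Set.Icc (-1 : ℝ) 1)
    (Φ : ℝ → ℝ → ℝ → ℂ → Mat3)
    (hΦ : ∀ ρ σ τ : ℝ, Admissible ρ σ → IsModelSolution γ α ρ σ τ (Φ ρ σ τ)) :
    -- the expansion at infinity, with smooth coefficients
    (∃ M : ℝ → ℝ → ℝ → Mat3,
      (∀ ρ σ τ : ℝ, Admissible ρ σ → HasExpansion ρ σ τ (Φ ρ σ τ) (M ρ σ τ)) ∧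
      (∀ i j, SmoothOnParams fun ρ σ τ => M ρ σ τ i j) ∧
      ∃ u v : ℝ → ℝ → ℝ → ℂ,
        (u = fun ρ σ τ => uOf (M ρ σ τ)) ∧ (v = fun ρ σ τ => vOf (M ρ σ τ)) ∧
        -- the Lax system for `PΦ`
        (∀ ρ σ τ : ℝ, Admissible ρ σ → ∀ ξ ∈ contourᶜ,
          LaxSystemAt u v (fun r s t z => gaugeMatrix (M r s t) * Φ r s t z) ρ σ τ ξ) ∧
        -- the flows and the self-similar reduction
        (∀ ρ σ τ : ℝ, Admissible ρ σ →
          FirstFlowAt u v ρ σ τ ∧ BoussinesqAt u ρ σ τ ∧ SecondFlowAt u v ρ σ τ ∧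
          SelfSimilarAt ρ σ (u ρ σ) (v ρ σ) τ) ∧
        (∀ σ τ : ℝ, 0 < σ → ReducedAt σ (u 0 σ) τ) ∧
        -- the ordinary differential equations for `f = m₁₃` at `ρ = 0`, `σ = 3/2`
        ∃ f : ℝ → ℂ, (f = fun τ => M 0 (3 / 2) τ 0 2) ∧
          (∀ τ : ℝ, ChazyThirdAt α (fun t => f t + (t : ℂ) ^ 3 / 108) τ) ∧
          (∀ τ : ℝ, ChazySecondAt α
            (fun t => (√2 : ℝ) * f (√2 * t) + 4 / 27 * (t : ℂ) ^ 3) τ)) ∧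
    -- the compatibility conditions of the Lax system are these equations
    (∀ u v : ℝ → ℝ → ℝ → ℂ, SmoothOnParams u → SmoothOnParams v →
      (∀ ρ σ τ : ℝ, Admissible ρ σ →
        (CompatibleTauSigma u v ρ σ τ ↔ FirstFlowAt u v ρ σ τ) ∧
        (CompatibleTauRho u v ρ σ τ ↔ SecondFlowAt u v ρ σ τ) ∧
        (CompatibleXiTau u v ρ σ τ ↔ SelfSimilarAt ρ σ (u ρ σ) (v ρ σ) τ)) ∧
      ((∀ ρ σ τ : ℝ, Admissible ρ σ → FirstFlowAt u v ρ σ τ) →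
        ∀ ρ σ τ : ℝ, Admissible ρ σ → BoussinesqAt u ρ σ τ)) ∧
    -- for `ρ = 0` the self-similar reduction is a single equation
    (∀ σ : ℝ, 0 < σ → ∀ U : ℝ → ℂ, ContDiff ℝ ∞ U →
      ((∃ V : ℝ → ℂ, ContDiff ℝ ∞ V ∧ ∀ τ : ℝ, SelfSimilarAt 0 σ U V τ) ↔
        ∀ τ : ℝ, ReducedAt σ U τ)) ∧
    -- the second-order equation is equivalent to Painlevé IV
    ChazyPainleveEquivalence α := by
  have hΦ' : Family γ α fun p => Φ p.1 p.2.1 p.2.2 := fun p hp => hΦ _ _ _ hp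
  obtain ⟨M, hM, hS, hu, hv⟩ := exists_smooth_moments hΦ'
  refine ⟨⟨fun ρ σ τ => M (ρ, σ, τ), fun ρ σ τ ha =>
      hasExpansion_of_expandsTo (p := (ρ, σ, τ)) (hΦ _ _ _ ha) ha (hM _ ha),
      hS, uFun M, vFun M, rfl, rfl,
      fun ρ σ τ ha ξ hξ => laxSystemAt hα hΦ' hM ha τ hξ, fun ρ σ τ ha => ?_, fun σ τ hσ => ?_,
      _, rfl, chazyThirdAt_first_moment hα hΦ' hM, chazySecondAt_first_moment hα hΦ' hM⟩,
    fun u v hu hv => ⟨fun ρ σ τ ha => ?_, fun h ρ σ τ => boussinesqAt_of_firstFlow hu hv h⟩,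
    fun σ hσ U hU => selfSimilar_iff_reduced hσ hU, chazyPainleveEquivalence α⟩
  · exact ⟨firstFlowAt hΦ' hM ha τ, boussinesqAt_of_firstFlow hu hv
      (fun _ _ τ ha => firstFlowAt hΦ' hM ha τ) ha, secondFlowAt hΦ' hM ha τ,
      selfSimilarAt hα hΦ' hM ha τ⟩
  · have ha : Admissible 0 σ := Or.inr ⟨rfl, hσ⟩
    exact (selfSimilar_iff_reduced hσ (contDiff_slice hu ha)).1
      ⟨_, contDiff_slice hv ha, selfSimilarAt hα hΦ' hM ha⟩ τ
  · have hu' := contDiff_slice hu ha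
    have hv' := contDiff_slice hv ha
    exact ⟨compatibleTauSigma_iff hu' hv', compatibleTauRho_iff hu' hv', compatibleXiTau_iff hu' hv'⟩
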